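/- For an $n\times m$ matrix $M$ over a field $\mathbb F$, let $G_M$ be the bipartite graph whose vertices are the rows and the columns of $M$, with row $i$ adjacent to column $j$ iff $M[i,j]\ne 0$. A matrix is in row-echelon form if all its zero rows are below all its non-zero rows and the leftmost non-zero entry of each non-zero row is strictly to the right of those of the rows above it; column-echelon form is defined symmetrically. A generalized $LU$-factorization of $M$ is a finite sequence of matrices with product $M$, each of which is a permutation matrix or a matrix in row-echelon or column-echelon form. The model of computation is a random access machine with registers of $\Omega(\log \ell)$ bits, where $\ell$ is the length of the input, and with a second kind of registers that hold elements of $\mathbb F$; each machine instruction (access to registers, arithmetic and comparison of words, arithmetic operation, comparison or assignment in $\mathbb F$) takes one unit of time. Matrices are given by lists of their non-zero entries. A tree decomposition is given by lists of the edges of its tree and of the members of its bags; it is assumed to have $O(n+m)$ nodes. **Theorem.** There is an algorithm, the same for all fields, that, given an $n\times m$ matrix $M$ over a field $\mathbb F$ with $n+m\ge 1$ and a tree decomposition of $G_M$ of width at most $k$ (where $k\ge 1$), computes the rank of $M$, the determinant of $M$ (if $n=m$), and a generalized $LU$-factorization of $M$ using $O(k^3\cdot(n+m))$ field operations and time. Furthermore,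 after this computation, for every $r\in\mathbb F^n$ the system of linear equations $Mx=r$ can be solved (that is, a solution $x\in\mathbb F^m$ is output, or it is reported that none exists) using $O(k^2\cdot(n+m))$ additional field operations and time. The constants hidden in the $O$-bounds depend neither on $\mathbb F$ nor on the input; they depend only on the constant in the assumed bound on the number of nodes. -/

import Mathlib

universe u

/-! ### Tree decompositions and the bipartite graph of a matrix -/

/-- The bipartite graph of an `n × m` matrix: its vertices are the rows `Sum.inl i` and the columns
`Sum.inr j`, and row `i` is adjacent to column `j` iff the entry `M i j` is non-zero. -/
def matrixGraph {F : Type u} [Zero F] {n m : ℕ} (M : Matrix (Fin n) (Fin m) F) :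
    SimpleGraph (Fin n ⊕ Fin m) where
  Adj u v :=
    match u, v with
    | Sum.inl i, Sum.inr j => M i j ≠ 0
    | Sum.inr j, Sum.inl i => M i j ≠ 0
    | _, _ => False
  symm := ⟨by rintro (i | i) (j | j) h <;> exact h⟩
  loopless := ⟨by rintro (i | i) h <;> exact h⟩

/-- `(T, B)` is a tree decomposition of the graph `G`: `T` is a tree, every edge of `G` lies inside
some bag, and the nodes whose bags contain a given vertex induce a non-empty connected subtree
(`SimpleGraph.Connected` includes non-emptiness). -/
structure IsTreeDecomposition {V : Type*} {ι : Type*} (G : SimpleGraph V) (T : SimpleGraph ι)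
    (B : ι → Finset V) : Prop where
  isTree : T.IsTree
  edge_covered : ∀ u v, G.Adj u v → ∃ x, u ∈ B x ∧ v ∈ B x
  connected : ∀ v, (T.induce {x | v ∈ B x}).Connected

/-! ### Generalized LU-factorizations -/

/-- A permutation matrix (it is square, since `e` is a bijection). -/
def IsPermutationMatrix {F : Type u} [Zero F] [One F] {n m : ℕ} (A : Matrix (Fin n) (Fin m) F) :
    Prop :=
  ∃ e : Fin n ≃ Fin m, ∀ i j, A i j = if e i = j then 1 else 0

/-- Each factor allowed in a generalized LU-factorization is a permutation matrix, or a matrix in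
row-echelon form, or a matrix in column-echelon form. -/
def IsLUFactor {F : Type u} [Zero F] [One F] {n m : ℕ} (A : Matrix (Fin n) (Fin m) F) : Prop :=
  IsPermutationMatrix A ∨ A.IsRowEchelon ∨ A.transpose.IsRowEchelon

/-- A finite sequence of matrices of sizes `d₀ × d₁, d₁ × d₂, …, d_{s-1} × d_s`, where `d₀` and `d_s`
are the two indices of the type. -/
inductive MatrixChain (F : Type u) : ℕ → ℕ → Type u
  | nil (n : ℕ) : MatrixChain F n n
  | cons {n p m : ℕ} (A : Matrix (Fin n) (Fin p) F) (rest : MatrixChain F p m) : MatrixChain F n m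

/-- The product of the sequence, in order. -/
def MatrixChain.prod {F : Type u} [Semiring F] :
    {n m : ℕ} → MatrixChain F n m → Matrix (Fin n) (Fin m) F
  | _, _, .nil _ => 1
  | _, _, .cons A rest => A * rest.prod

/-- Every member of the sequence is an allowed factor. -/
def MatrixChain.AllLUFactors {F : Type u} [Zero F] [One F] :
    {n m : ℕ} → MatrixChain F n m → Prop
  | _, _, .nil _ => True
  | _, _, .cons A rest => IsLUFactor A ∧ rest.AllLUFactors

/-- `c` is a generalized LU-factorization of `M`. -/
def MatrixChain.IsGeneralizedLU {F : Type u} [Semiring F] {n m : ℕ} (c : MatrixChain F n m)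
    (M : Matrix (Fin n) (Fin m) F) : Prop :=
  c.AllLUFactors ∧ c.prod = M

/-! ### The machine

A random access machine with `w`-bit word registers and with a second kind of registers that hold
elements of a field. The registers are arranged in segments: the register `(a, i)` has offset `i`
in segment `a`. A program mentions only finitely many segments, fixed in its text, so the segments
can be interleaved in one linear memory with a constant overhead. An offset may be read from a word
register (indirect addressing). Each instruction and each evaluation of a test takes one unit of
time; since field operations are such instructions too, the number of time units bounds both the
running time and the number of field operations. Programs are structured (sequence, branching,
loop); such a program is in particular a program with jumps. -/

/-- The contents of the registers. -/
structure RamState (F : Type u) where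
  word : ℕ → ℕ → ℕ
  fld : ℕ → ℕ → F

/-- The address of a register: `dir a i` is the register `(a, i)`, and `ind a b j` is the register
in segment `a` whose offset is the content of the word register `(b, j)`. -/
inductive Addr
  | dir (a i : ℕ)
  | ind (a b j : ℕ)

/-- Word arithmetic; `sub` is truncated at `0`. -/
inductive WordOp
  | add
  | sub
  | mul

inductive FieldOp
  | add
  | sub
  | mul
  | div

/-- Instructions; the first address is the destination. -/
inductive Instr
  | wordConst (d : Addr) (c : ℕ)
  | wordMove (d x : Addr)
  | wordOp (o : WordOp) (d x y : Addr)
  | fieldZero (d : Addr)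
  | fieldOne (d : Addr)
  | fieldMove (d x : Addr)
  | fieldOp (o : FieldOp) (d x y : Addr)

inductive RamTest
  | wordLt (x y : Addr)
  | wordEq (x y : Addr)
  | fieldEq (x y : Addr)

inductive RamProgram
  | skip
  | instr (c : Instr)
  | seq (p q : RamProgram)
  | branch (t : RamTest) (p q : RamProgram)
  | loop (t : RamTest) (p : RamProgram)

def WordOp.eval : WordOp → ℕ → ℕ → ℕ
  | .add, x, y => x + y
  | .sub, x, y => x - y
  | .mul, x, y => x * y

/-- Division by zero has no result. -/
noncomputable def FieldOp.eval {F : Type u} [Field F] : FieldOp → F → F → Option F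
  | .add, x, y => some (x + y)
  | .sub, x, y => some (x - y)
  | .mul, x, y => some (x * y)
  | .div, x, y => by classical exact if y = 0 then none else some (x / y)

namespace RamState

variable {F : Type u}

/-- The segment and the offset of the register that is addressed. -/
def loc (σ : RamState F) : Addr → ℕ × ℕ
  | .dir a i => (a, i)
  | .ind a b j => (a, σ.word b j)

def getWord (σ : RamState F) (x : Addr) : ℕ := σ.word (σ.loc x).1 (σ.loc x).2

def getField (σ : RamState F) (x : Addr) : F := σ.fld (σ.loc x).1 (σ.loc x).2

/-- Write a word; a value that does not fit into `w` bits cannot be written. -/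
def setWord (w : ℕ) (σ : RamState F) (d : Addr) (v : ℕ) : Option (RamState F) :=
  if v < 2 ^ w then
    some { σ with
      word := fun a i => if a = (σ.loc d).1 ∧ i = (σ.loc d).2 then v else σ.word a i }
  else none

def setField (σ : RamState F) (d : Addr) (v : F) : RamState F :=
  { σ with fld := fun a i => if a = (σ.loc d).1 ∧ i = (σ.loc d).2 then v else σ.fld a i }

end RamState

/-- The effect of one instruction on a machine with `w`-bit words; `none` means that the machine is
stuck (overflow of a word, or division by zero). -/
noncomputable def Instr.exec {F : Type u} [Field F] (w : ℕ) (σ : RamState F) :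
    Instr → Option (RamState F)
  | .wordConst d c => σ.setWord w d c
  | .wordMove d x => σ.setWord w d (σ.getWord x)
  | .wordOp o d x y => σ.setWord w d (o.eval (σ.getWord x) (σ.getWord y))
  | .fieldZero d => some (σ.setField d 0)
  | .fieldOne d => some (σ.setField d 1)
  | .fieldMove d x => some (σ.setField d (σ.getField x))
  | .fieldOp o d x y => (o.eval (σ.getField x) (σ.getField y)).map (σ.setField d)

def RamTest.Holds {F : Type u} (σ : RamState F) : RamTest → Prop
  | .wordLt x y => σ.getWord x < σ.getWord y
  | .wordEq x y => σ.getWord x = σ.getWord y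
  | .fieldEq x y => σ.getField x = σ.getField y

/-- `Runs w p σ τ t`: started in the state `σ`, the program `p` halts on the machine with `w`-bit
words after exactly `t` time units, in the state `τ`. -/
inductive Runs {F : Type u} [Field F] (w : ℕ) :
    RamProgram → RamState F → RamState F → ℕ → Prop
  | skip (σ : RamState F) : Runs w .skip σ σ 0
  | instr {c : Instr} {σ τ : RamState F} (h : c.exec w σ = some τ) : Runs w (.instr c) σ τ 1
  | seq {p q : RamProgram} {σ τ ρ : RamState F} {t t' : ℕ}
      (h : Runs w p σ τ t) (h' : Runs w q τ ρ t') : Runs w (.seq p q) σ ρ (t + t')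
  | branch_true {b : RamTest} {p q : RamProgram} {σ τ : RamState F} {t : ℕ}
      (hb : b.Holds σ) (h : Runs w p σ τ t) : Runs w (.branch b p q) σ τ (t + 1)
  | branch_false {b : RamTest} {p q : RamProgram} {σ τ : RamState F} {t : ℕ}
      (hb : ¬ b.Holds σ) (h : Runs w q σ τ t) : Runs w (.branch b p q) σ τ (t + 1)
  | loop_true {b : RamTest} {p : RamProgram} {σ τ ρ : RamState F} {t t' : ℕ}
      (hb : b.Holds σ) (h : Runs w p σ τ t) (h' : Runs w (.loop b p) τ ρ t') :
      Runs w (.loop b p) σ ρ (t + t' + 1)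
  | loop_false {b : RamTest} {p : RamProgram} {σ : RamState F}
      (hb : ¬ b.Holds σ) : Runs w (.loop b p) σ σ 1

/-! ### Input and output formats

Word segments:
* `0`: the numbers `n`, `m`, the number of non-zero entries, the number `q` of nodes (offsets 0–3);
* `1`, `2`: the row and the column of each non-zero entry;
* `3`, `4`: the two endpoints of each edge of the tree;
* `5`, `6`: the bag at node `x` occupies the offsets `i` of segment `6` between the values at the
  offsets `x` (inclusive) and `x + 1` (exclusive) of segment `5`; row `i` is written as `i`, and
  column `j` as `n + j`;
* `7`: output: the rank, the number `s` of factors, the solvability bit (offsets 0–2);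
* `8`: output: the sizes `d₀, …, d_s` of the factors (the factor number `t` is `d_t × d_{t+1}`);
* `9`, `10`, `11`: output: the non-zero entries of the factor number `t` have the positions from the
  value at offset `t` (inclusive) to the value at offset `t + 1` (exclusive) of segment `9`; at each
  position, segments `10` and `11` hold the row and the column, and field segment `3` the value.

Field segments: `0`: the values of the non-zero entries of the input; `1`: the right-hand side of the
linear system; `2`: output: the determinant (offset 0); `3`: see above; `4`: output: a solution.

All the other registers are zero at the beginning. -/

/-- Lists through which a matrix and a tree decomposition are handed to the machine, in any order. -/
structure InputLists (n m q : ℕ) where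
  entries : List (Fin n × Fin m)
  edges : List (Fin q × Fin q)
  bags : Fin q → List (Fin n ⊕ Fin m)

/-- The lists enumerate, without repetition, the non-zero entries of `M`, the edges of `T`, and the
members of every bag. -/
structure InputLists.Describes {F : Type u} [Zero F] {n m q : ℕ} (I : InputLists n m q)
    (M : Matrix (Fin n) (Fin m) F) (T : SimpleGraph (Fin q))
    (B : Fin q → Finset (Fin n ⊕ Fin m)) : Prop where
  entries_nodup : I.entries.Nodup
  mem_entries : ∀ i j, (i, j) ∈ I.entries ↔ M i j ≠ 0
  edges_nodup : (I.edges.map fun e => s(e.1, e.2)).Nodup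
  mem_edges : ∀ x y, s(x, y) ∈ (I.edges.map fun e => s(e.1, e.2)) ↔ T.Adj x y
  bags_nodup : ∀ x, (I.bags x).Nodup
  mem_bags : ∀ x v, v ∈ I.bags x ↔ v ∈ B x

/-- The number that stands for a vertex of the bipartite graph. -/
def vertexCode {n m : ℕ} : Fin n ⊕ Fin m → ℕ
  | .inl i => i
  | .inr j => n + j

/-- The contents of the bags, one bag after another. -/
def InputLists.bagContents {n m q : ℕ} (I : InputLists n m q) : List ℕ :=
  (List.finRange q).flatMap fun x => (I.bags x).map vertexCode

/-- The `q + 1` numbers that delimit the bags in `bagContents`. -/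
def InputLists.bagStarts {n m q : ℕ} (I : InputLists n m q) : List ℕ :=
  (List.range (q + 1)).map fun x =>
    (((List.finRange q).take x).map fun y => (I.bags y).length).sum

/-- The initial state of the machine. -/
def InputLists.initialState {F : Type u} [Zero F] {n m q : ℕ} (I : InputLists n m q)
    (M : Matrix (Fin n) (Fin m) F) : RamState F where
  word a i :=
    match a with
    | 0 => [n, m, I.entries.length, q].getD i 0
    | 1 => (I.entries.map fun e => (e.1 : ℕ)).getD i 0
    | 2 => (I.entries.map fun e => (e.2 : ℕ)).getD i 0
    | 3 => (I.edges.map fun e => (e.1 : ℕ)).getD i 0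
    | 4 => (I.edges.map fun e => (e.2 : ℕ)).getD i 0
    | 5 => I.bagStarts.getD i 0
    | 6 => I.bagContents.getD i 0
    | _ => 0
  fld a i :=
    match a with
    | 0 => (I.entries.map fun e => M e.1 e.2).getD i 0
    | _ => 0

namespace RamState

variable {F : Type u}

/-- Hand the right-hand side `r` of a linear system to the machine; nothing else changes. -/
def withRhs {n : ℕ} (σ : RamState F) (r : Fin n → F) : RamState F :=
  { σ with fld := fun a i => if h : a = 1 ∧ i < n then r ⟨i, h.2⟩ else σ.fld a i }

/-- The positions `lo ≤ p < hi` of the output list exactly the non-zero entries of `A`, each once,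
in any order. -/
def HoldsMatrix [Zero F] (σ : RamState F) (lo hi : ℕ) {n m : ℕ}
    (A : Matrix (Fin n) (Fin m) F) : Prop :=
  Set.InjOn (fun p => (σ.word 10 p, σ.word 11 p)) (Set.Ico lo hi) ∧
  (∀ p ∈ Set.Ico lo hi, ∃ (i : Fin n) (j : Fin m), σ.word 10 p = i ∧ σ.word 11 p = j ∧
    σ.fld 3 p = A i j ∧ A i j ≠ 0) ∧
  (∀ i j, A i j ≠ 0 → ∃ p ∈ Set.Ico lo hi, σ.word 10 p = i ∧ σ.word 11 p = j)

/-- The sequence `c`, numbered from `t` on, is what the output describes. -/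
def HoldsChainFrom [Zero F] (σ : RamState F) :
    {n m : ℕ} → MatrixChain F n m → ℕ → Prop
  | _, _, .nil n, t => σ.word 7 1 = t ∧ σ.word 8 t = n
  | n, _, .cons A rest, t =>
      σ.word 8 t = n ∧ σ.HoldsMatrix (σ.word 9 t) (σ.word 9 (t + 1)) A ∧
        σ.HoldsChainFrom rest (t + 1)

/-- The state contains the rank of `M`, its determinant if `M` is square, and a generalized
LU-factorization of `M`. -/
def HoldsElimination [Field F] (σ : RamState F) {n m : ℕ} (M : Matrix (Fin n) (Fin m) F) : Prop :=
  σ.word 7 0 = M.rank ∧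
  (∀ h : n = m, σ.fld 2 0 = (M.submatrix id (Fin.cast h)).det) ∧
  ∃ c : MatrixChain F n m, c.IsGeneralizedLU M ∧ σ.HoldsChainFrom c 0

/-- The state contains the answer to the linear system `M x = r`: either the solvability bit is `1`
and a solution is given, or the bit is `0` and there is no solution. -/
def HoldsSolution [Field F] (σ : RamState F) {n m : ℕ} (M : Matrix (Fin n) (Fin m) F)
    (r : Fin n → F) : Prop :=
  (σ.word 7 2 = 1 ∧ M.mulVec (fun j : Fin m => σ.fld 4 j) = r) ∨
  (σ.word 7 2 = 0 ∧ ¬ ∃ x : Fin m → F, M.mulVec x = r)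

end RamState

/-!
# Gaussian elimination along a tree decomposition

The elimination is not carried out on `M`, where it could fill in many entries, but on a larger matrix
whose non-zero pattern follows a forest.

Root the given tree, and refine it to a binary forest whose nodes are copies of bags: the vertices of
the tree are attached to their parents one by one, children first, and each attachment creates a new
copy of the bag of the parent (`IsLayout.merge`). This gives fewer than `2 * q` nodes. Number the members
of the bags of all the nodes consecutively, children before parents; these `N ≤ 2 * q * (k + 1)` slots
index both the rows and the columns of the *split matrix*. Every entry of `M` is placed at one pair of
slots of a common node, and entries `1` and `-1` on the diagonal and at pairs (slot, copy of the slot in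
the parent node) force the copies of a column to be equal and add up the copies of a row
(`IsSplit`, `splitEntry`). Unimodular factors turn the split matrix into the direct sum of `M` and an
identity matrix (`IsSplitting.exists_factorization`). So its rank exceeds that of `M` by `N - (n + m)`
(`IsSplit.rank_eq`), and the solutions of the two systems correspond to each other
(`IsSplit.mulVec_eq`, `IsSplit.exists_solution`). For `n = m`, tying the topmost row slot of the row
`i` to the topmost column slot of the column `i` gives a matrix with the determinant `(-1) ^ n * M.det`
(`IsSplit.det_add`), hence a formula for `M.det` in terms of the pivots and one permutation
(`IsSplit.exists_perm_det`).

Non-zero entries of the split matrix occur only at slots of equal or adjacent nodes (`Near`). Process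
the columns in the order of the slots, and choose as pivot row the first unused row that has a non-zero
entry in the column. Since children precede parents in a binary forest, the row operations preserve the
pattern (`near_of_near`, the field `fill` of `IsElim`). Hence a column concerns only the `O(k)` slots of
the children, the node, its sibling, its parent and its grandparent (`nearList`, `IsCover`) and costs
`O(k ^ 2)`, which makes `O(k ^ 3 * q)` for all columns; a right-hand side is treated with `O(k)` steps
for each of the `O(k * q)` slots. No row is changed after its use as a pivot row, so the row operations
are undone by the unit lower triangular matrix of their coefficients (`applyOps_inverse`). With the
summation of all the copies of a row or of a column as outer factors (`allRow_mul_split_mul_allCol`),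
and with permutations that sort them into echelon form, this is the generalized LU-factorization
`luChain` (`isGeneralizedLU_luChain`).

The programs are verified with the predicate `WP`, which bounds the running time along with the
result; each of them has a specification `…_spec`, which also names the segments of registers that it
may change (`RamState.Frame`). The matrices are kept as dense tables, with about `N ^ 2` and `n * m`
cells. This costs no time, because all registers that are not part of the input hold `0` at the
beginning, and only cells that matter are accessed; the addresses fit into words by `word_bounds`.
-/

/-! ### A program logic for the machine -/

open Finset

namespace RamState

variable {F : Type u}

/-- Overwrite one word register. -/
def sw (σ : RamState F) (a i v : ℕ) : RamState F :=
  { σ with word := Function.update σ.word a (Function.update (σ.word a) i v) }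

/-- Overwrite one field register. -/
def sf (σ : RamState F) (a i : ℕ) (v : F) : RamState F :=
  { σ with fld := Function.update σ.fld a (Function.update (σ.fld a) i v) }

@[simp] theorem word_sw (σ : RamState F) (a i v b : ℕ) :
    (σ.sw a i v).word b = if b = a then Function.update (σ.word a) i v else σ.word b := by
  simp [sw, Function.update_apply]

@[simp] theorem fld_sw (σ : RamState F) (a i v : ℕ) : (σ.sw a i v).fld = σ.fld := rfl

@[simp] theorem word_sf (σ : RamState F) (a i : ℕ) (v : F) : (σ.sf a i v).word = σ.word := rfl

@[simp] theorem fld_sf (σ : RamState F) (a i : ℕ) (v : F) (b : ℕ) :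
    (σ.sf a i v).fld b = if b = a then Function.update (σ.fld a) i v else σ.fld b := by
  simp [sf, Function.update_apply]

theorem setWord_eq {w : ℕ} (σ : RamState F) (d : Addr) {v : ℕ} (h : v < 2 ^ w) :
    σ.setWord w d v = some (σ.sw (σ.loc d).1 (σ.loc d).2 v) := by
  rw [setWord, if_pos h]
  congr 2
  funext a i
  by_cases ha : a = (σ.loc d).1
  · subst ha; by_cases hi : i = (σ.loc d).2 <;> simp [hi]
  · simp [ha]

theorem setField_eq (σ : RamState F) (d : Addr) (v : F) :
    σ.setField d v = σ.sf (σ.loc d).1 (σ.loc d).2 v := by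
  rw [setField, sf]
  congr 1
  funext a i
  by_cases ha : a = (σ.loc d).1
  · subst ha; by_cases hi : i = (σ.loc d).2 <;> simp [hi]
  · simp [ha]

/-- `τ` agrees with `σ` outside the word segments `ws` and the field segments `fs`. -/
structure Frame (ws fs : List ℕ) (σ τ : RamState F) : Prop where
  word_eq : ∀ a, a ∉ ws → τ.word a = σ.word a
  fld_eq : ∀ a, a ∉ fs → τ.fld a = σ.fld a

@[simp] theorem Frame.refl (ws fs : List ℕ) (σ : RamState F) : Frame ws fs σ σ :=
  ⟨fun _ _ => rfl, fun _ _ => rfl⟩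

theorem Frame.word {ws fs : List ℕ} {σ τ : RamState F} (h : Frame ws fs σ τ) {a : ℕ} (ha : a ∉ ws) :
    τ.word a = σ.word a := h.1 a ha

theorem Frame.fld {ws fs : List ℕ} {σ τ : RamState F} (h : Frame ws fs σ τ) {a : ℕ} (ha : a ∉ fs) :
    τ.fld a = σ.fld a := h.2 a ha

@[simp] theorem frame_sw {ws fs : List ℕ} {σ τ : RamState F} {a i v : ℕ} (ha : a ∈ ws) :
    Frame ws fs σ (τ.sw a i v) ↔ Frame ws fs σ τ := by
  have key : ∀ b, b ∉ ws → (τ.sw a i v).word b = τ.word b := fun b hb => by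
    have : b ≠ a := by rintro rfl; exact hb ha
    simp [this]
  exact ⟨fun h => ⟨fun b hb => by rw [← h.1 b hb, key b hb], h.2⟩,
    fun h => ⟨fun b hb => by rw [← h.1 b hb, key b hb], h.2⟩⟩

@[simp] theorem frame_sf {ws fs : List ℕ} {σ τ : RamState F} {a i : ℕ} {v : F} (ha : a ∈ fs) :
    Frame ws fs σ (τ.sf a i v) ↔ Frame ws fs σ τ := by
  have key : ∀ b, b ∉ fs → (τ.sf a i v).fld b = τ.fld b := fun b hb => by
    have : b ≠ a := by rintro rfl; exact hb ha
    simp [this]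
  exact ⟨fun h => ⟨h.1, fun b hb => by rw [← h.2 b hb, key b hb]⟩,
    fun h => ⟨h.1, fun b hb => by rw [← h.2 b hb, key b hb]⟩⟩

theorem Frame.trans {ws fs ws' fs' : List ℕ} {σ τ ρ : RamState F} (h : Frame ws fs σ τ)
    (h' : Frame ws' fs' τ ρ) (hw : ws' ⊆ ws := by decide) (hf : fs' ⊆ fs := by decide) : Frame ws fs
    σ ρ :=
  ⟨fun a ha => (h'.1 a fun h => ha (hw h)).trans (h.1 a ha),
    fun a ha => (h'.2 a fun h => ha (hf h)).trans (h.2 a ha)⟩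

theorem Frame.mono {ws fs ws' fs' : List ℕ} {σ τ : RamState F} (h : Frame ws' fs' σ τ)
    (hw : ws' ⊆ ws := by decide) (hf : fs' ⊆ fs := by decide) : Frame ws fs σ τ :=
  (Frame.refl ws fs σ).trans h hw hf

end RamState

/-- The scalar variable kept at offset `0` of segment `a`. -/
def reg (a : ℕ) : Addr := .dir a 0

/-- The array element of segment `a` whose index is the scalar variable `i`. -/
def arr (a i : ℕ) : Addr := .ind a i 0

section

variable {F : Type u}

@[simp] theorem loc_reg (σ : RamState F) (a : ℕ) : σ.loc (reg a) = (a, 0) := rfl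
@[simp] theorem loc_dir (σ : RamState F) (a i : ℕ) : σ.loc (.dir a i) = (a, i) := rfl
@[simp] theorem loc_arr (σ : RamState F) (a i : ℕ) : σ.loc (arr a i) = (a, σ.word i 0) := rfl

@[simp] theorem getWord_reg (σ : RamState F) (a : ℕ) : σ.getWord (reg a) = σ.word a 0 := rfl
@[simp] theorem getWord_dir (σ : RamState F) (a i : ℕ) : σ.getWord (.dir a i) = σ.word a i := rfl
@[simp] theorem getWord_arr (σ : RamState F) (a i : ℕ) :
    σ.getWord (arr a i) = σ.word a (σ.word i 0) := rfl
@[simp] theorem getWord_ind (σ : RamState F) (a b j : ℕ) :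
    σ.getWord (.ind a b j) = σ.word a (σ.word b j) := rfl
@[simp] theorem getField_reg (σ : RamState F) (a : ℕ) : σ.getField (reg a) = σ.fld a 0 := rfl
@[simp] theorem getField_dir (σ : RamState F) (a i : ℕ) : σ.getField (.dir a i) = σ.fld a i := rfl
@[simp] theorem getField_arr (σ : RamState F) (a i : ℕ) :
    σ.getField (arr a i) = σ.fld a (σ.word i 0) := rfl

@[simp] theorem holds_wordLt (σ : RamState F) (x y : Addr) :
    (RamTest.wordLt x y).Holds σ ↔ σ.getWord x < σ.getWord y := Iff.rfl
@[simp] theorem holds_wordEq (σ : RamState F) (x y : Addr) :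
    (RamTest.wordEq x y).Holds σ ↔ σ.getWord x = σ.getWord y := Iff.rfl
@[simp] theorem holds_fieldEq (σ : RamState F) (x y : Addr) :
    (RamTest.fieldEq x y).Holds σ ↔ σ.getField x = σ.getField y := Iff.rfl

end

namespace RamProgram

/-- Straight-line code. -/
def block : List Instr → RamProgram
  | [] => .skip
  | c :: L => .seq (.instr c) (block L)

/-- `while (v < hi) { p; v++ }`; the scalar `12` holds the constant `1`. -/
def forLoop (v : ℕ) (hi : Addr) (p : RamProgram) : RamProgram :=
  .loop (.wordLt (reg v) hi) (.seq p (.instr (.wordOp .add (reg v) (reg v) (reg 12))))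

/-- `for (v = lo; v < hi; v++) p`. -/
def forRange (v : ℕ) (lo hi : Addr) (p : RamProgram) : RamProgram :=
  .seq (.instr (.wordMove (reg v) lo)) (forLoop v hi p)

/-- The address of a register that always holds the number `0`. -/
@[simp] def zeroAddr : Addr := .dir 12 1

end RamProgram

infixr:60 " ;; " => RamProgram.seq

open RamProgram

variable {F : Type u} [Field F]

/-- The weakest precondition of an instruction. -/
def Instr.post (w : ℕ) : Instr → RamState F → (RamState F → Prop) → Prop
  | .wordConst d c, σ, Q => c < 2 ^ w ∧ Q (σ.sw (σ.loc d).1 (σ.loc d).2 c)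
  | .wordMove d x, σ, Q => σ.getWord x < 2 ^ w ∧ Q (σ.sw (σ.loc d).1 (σ.loc d).2 (σ.getWord x))
  | .wordOp o d x y, σ, Q => o.eval (σ.getWord x) (σ.getWord y) < 2 ^ w ∧
      Q (σ.sw (σ.loc d).1 (σ.loc d).2 (o.eval (σ.getWord x) (σ.getWord y)))
  | .fieldZero d, σ, Q => Q (σ.sf (σ.loc d).1 (σ.loc d).2 0)
  | .fieldOne d, σ, Q => Q (σ.sf (σ.loc d).1 (σ.loc d).2 1)
  | .fieldMove d x, σ, Q => Q (σ.sf (σ.loc d).1 (σ.loc d).2 (σ.getField x))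
  | .fieldOp .add d x y, σ, Q => Q (σ.sf (σ.loc d).1 (σ.loc d).2 (σ.getField x + σ.getField y))
  | .fieldOp .sub d x y, σ, Q => Q (σ.sf (σ.loc d).1 (σ.loc d).2 (σ.getField x - σ.getField y))
  | .fieldOp .mul d x y, σ, Q => Q (σ.sf (σ.loc d).1 (σ.loc d).2 (σ.getField x * σ.getField y))
  | .fieldOp .div d x y, σ, Q => σ.getField y ≠ 0 ∧
      Q (σ.sf (σ.loc d).1 (σ.loc d).2 (σ.getField x / σ.getField y))

/-- The weakest precondition of straight-line code. -/
def blockPost (w : ℕ) : List Instr → RamState F → (RamState F → Prop) → Prop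
  | [], σ, Q => Q σ
  | c :: L, σ, Q => c.post w σ fun τ => blockPost w L τ Q

attribute [simp] blockPost Instr.post WordOp.eval

theorem Instr.exec_of_post {w : ℕ} {c : Instr} {σ : RamState F} {Q : RamState F → Prop}
    (h : c.post w σ Q) : ∃ τ, c.exec w σ = some τ ∧ Q τ := by
  cases c with
  | wordConst d c => exact ⟨_, σ.setWord_eq d h.1, h.2⟩
  | wordMove d x => exact ⟨_, σ.setWord_eq d h.1, h.2⟩
  | wordOp o d x y => exact ⟨_, σ.setWord_eq d h.1, h.2⟩
  | fieldZero d => exact ⟨_, rfl, by rw [σ.setField_eq]; exact h⟩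
  | fieldOne d => exact ⟨_, rfl, by rw [σ.setField_eq]; exact h⟩
  | fieldMove d x => exact ⟨_, rfl, by rw [σ.setField_eq]; exact h⟩
  | fieldOp o d x y =>
    cases o with
    | add => exact ⟨_, rfl, by rw [σ.setField_eq]; exact h⟩
    | sub => exact ⟨_, rfl, by rw [σ.setField_eq]; exact h⟩
    | mul => exact ⟨_, rfl, by rw [σ.setField_eq]; exact h⟩
    | div =>
      refine ⟨σ.setField d (σ.getField x / σ.getField y), ?_, by rw [σ.setField_eq]; exact h.2⟩
      simp [Instr.exec, FieldOp.eval, h.1]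

/-- `WP w p σ T Q`: started in `σ`, the program `p` halts within `T` time units in a state that
satisfies `Q`. -/
def WP (w : ℕ) (p : RamProgram) (σ : RamState F) (T : ℕ) (Q : RamState F → Prop) : Prop :=
  ∃ τ t, Runs w p σ τ t ∧ t ≤ T ∧ Q τ

namespace WP

variable {w : ℕ} {p q : RamProgram} {σ : RamState F} {T T' : ℕ} {Q Q' : RamState F → Prop}

theorem mono (h : WP w p σ T Q) (hT : T ≤ T') (hQ : ∀ τ, Q τ → Q' τ) : WP w p σ T' Q' := by
  obtain ⟨τ, t, hr, ht, hq⟩ := h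
  exact ⟨τ, t, hr, ht.trans hT, hQ τ hq⟩

theorem post (h : WP w p σ T Q) (hQ : ∀ τ, Q τ → Q' τ) : WP w p σ T Q' := h.mono le_rfl hQ

theorem time (h : WP w p σ T Q) (hT : T ≤ T') : WP w p σ T' Q := h.mono hT fun _ => id

theorem skip (h : Q σ) : WP w .skip σ T Q := ⟨σ, 0, .skip σ, Nat.zero_le _, h⟩

theorem seq {T₁ : ℕ} (T' : ℕ) (h : WP w p σ T₁ fun τ => WP w q τ T' Q)
    (hT : T₁ + T' ≤ T := by omega) :
    WP w (p ;; q) σ T Q := by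
  obtain ⟨τ, t, hr, ht, ρ, t', hr', ht', hq⟩ := h
  exact ⟨ρ, t + t', .seq hr hr', by omega, hq⟩

theorem comp {T₁ T₂ : ℕ} {R : RamState F → Prop} (h : WP w p σ T₁ R)
    (h' : ∀ τ, R τ → WP w q τ T₂ Q) : WP w (p ;; q) σ (T₁ + T₂) Q :=
  seq T₂ (h.post h') le_rfl

theorem branch {b : RamTest} (h : b.Holds σ → WP w p σ T Q) (h' : ¬ b.Holds σ → WP w q σ T Q) :
    WP w (.branch b p q) σ (T + 1) Q := by
  by_cases hb : b.Holds σ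
  · obtain ⟨τ, t, hr, ht, hq⟩ := h hb
    exact ⟨τ, t + 1, .branch_true hb hr, by omega, hq⟩
  · obtain ⟨τ, t, hr, ht, hq⟩ := h' hb
    exact ⟨τ, t + 1, .branch_false hb hr, by omega, hq⟩

theorem block {L : List Instr} (h : blockPost w L σ Q) (hT : L.length ≤ T := by simp) :
    WP w (block L) σ T Q := by
  suffices WP w (RamProgram.block L) σ L.length Q from this.time hT
  clear hT
  induction L generalizing σ with
  | nil => exact skip h
  | cons c L ih =>
    obtain ⟨τ, hτ, hq⟩ := Instr.exec_of_post h
    obtain ⟨ρ, t, hr, ht, hq⟩ := ih hq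
    exact ⟨ρ, 1 + t, .seq (.instr hτ) hr, by simp; omega, hq⟩

theorem block_seq {L : List Instr} (T' : ℕ) (h : blockPost w L σ fun τ => WP w q τ T' Q)
    (hT : L.length + T' ≤ T := by simp <;> omega) :
    WP w (RamProgram.block L ;; q) σ T Q :=
  seq T' (block h le_rfl) hT

/-- A counting loop with an invariant; every pass of the body takes at most `c` time units. -/
theorem forLoop {v : ℕ} {hi : Addr} (lo h c : ℕ) (I : ℕ → RamState F → Prop) (hlo : lo ≤ h)
    (h0 : I lo σ)
    (hI : ∀ i τ, I i τ → τ.word v 0 = i ∧ τ.getWord hi = h)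
    (hw : h < 2 ^ w)
    (hstep : ∀ i τ, lo ≤ i → i < h → I i τ → WP w p τ c fun ρ =>
      ρ.word v 0 = i ∧ ρ.word 12 0 = 1 ∧ I (i + 1) (ρ.sw v 0 (i + 1))) :
    WP w (forLoop v hi p) σ ((h - lo) * (c + 2) + 1) (I h) := by
  obtain ⟨d, rfl⟩ := Nat.exists_eq_add_of_le hlo
  induction d generalizing lo σ with
  | zero =>
    refine ⟨σ, 1, .loop_false ?_, by omega, h0⟩
    obtain ⟨h1, h2⟩ := hI _ _ h0
    simp [h1, h2]
  | succ d ih =>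
    obtain ⟨h1, h2⟩ := hI _ _ h0
    obtain ⟨ρ, t, hr, ht, hv, h12, hq⟩ := hstep lo σ le_rfl (by omega) h0
    obtain ⟨τ', t', hr', ht', hq'⟩ := ih (σ := ρ.sw v 0 (lo + 1)) (lo + 1) hq
      (by omega) (by intro i τ hi; have := hI i τ hi; rw [this.1, this.2]; omega) (by omega)
      (by intro i τ h1 h2 hi
          exact hstep i τ (by omega) (by omega) hi)
    refine ⟨τ', (t + 1) + t' + 1, .loop_true (by simp [h1, h2]) (.seq hr (.instr ?_)) hr', ?_, ?_⟩
    · simp only [Instr.exec, WordOp.eval, getWord_reg, hv, h12]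
      rw [RamState.setWord_eq _ _ (by omega)]
      simp
    · have : (lo + (d + 1) - lo) = d + 1 := by omega
      have h3 : (lo + 1 + d - (lo + 1)) = d := by omega
      rw [h3] at ht'
      rw [this, Nat.succ_mul]
      omega
    · have : lo + 1 + d = lo + (d + 1) := by omega
      rwa [this] at hq'

/-- The rule for `forRange`: `I i` is the invariant before pass `i`. -/
theorem forRange {v : ℕ} {loA hi : Addr} (lo h c : ℕ) (I : ℕ → RamState F → Prop)
    (hloA : σ.getWord loA = lo) (h0 : I lo (σ.sw v 0 lo))
    (hI : ∀ i τ, I i τ → τ.word v 0 = i ∧ τ.getWord hi = h)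
    (hstep : ∀ i τ, lo ≤ i → i < h → I i τ → WP w p τ c fun ρ =>
      ρ.word v 0 = i ∧ ρ.word 12 0 = 1 ∧ I (i + 1) (ρ.sw v 0 (i + 1)))
    (hQ : ∀ τ, I h τ → Q τ) (hlo : lo ≤ h := by omega) (hw : h < 2 ^ w := by omega)
    (hT : (h - lo) * (c + 2) + 2 ≤ T := by omega) :
    WP w (forRange v loA hi p) σ T Q := by
  obtain ⟨τ, t, hr, ht, hq⟩ := forLoop lo h c I hlo h0 hI hw hstep
  refine ⟨τ, 1 + t, .seq (.instr ?_) hr, by omega, hQ τ hq⟩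
  simp only [Instr.exec, hloA]
  rw [RamState.setWord_eq _ _ (by omega)]
  simp

end WP

theorem addr_inj {N i j i' j' : ℕ} (hj : j < N) (hj' : j' < N) :
    i * N + j = i' * N + j' ↔ i = i' ∧ j = j' := by
  constructor
  · intro h
    have h1 : (i * N + j) / N = i := by
      rw [Nat.mul_comm, Nat.mul_add_div (by omega), Nat.div_eq_of_lt hj]; omega
    have h2 : (i' * N + j') / N = i' := by
      rw [Nat.mul_comm, Nat.mul_add_div (by omega), Nat.div_eq_of_lt hj']; omega
    have : i = i' := by rw [← h1, ← h2, h]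
    subst this
    exact ⟨rfl, by omega⟩
  · rintro ⟨rfl, rfl⟩; rfl

theorem addr_lt {N K i j : ℕ} (hi : i < K) (hj : j < N) : i * N + j < K * N := by
  have : (i + 1) * N ≤ K * N := Nat.mul_le_mul_right _ hi
  rw [Nat.succ_mul] at this
  omega

set_option linter.unusedSimpArgs false

/-! ### Splitting a matrix along a forest -/

section

namespace Matrix

variable {F : Type u} [Field F] {n m N : ℕ}

/-- Data for splitting the rows and columns of `M` into copies. Each index (slot) in `Fin N` is a
copy of the row or column `lab a`; the copies of one row or column form a rooted tree with parent
pointer `up`, whose root is the only copy with `up a = none`. The entries of `M` are distributed by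
`E` over the pairs of copies of their row and their column. -/
structure IsSplitting (M : Matrix (Fin n) (Fin m) F) (lab : Fin N → Fin n ⊕ Fin m)
    (up : Fin N → Option (Fin N)) (E : Matrix (Fin N) (Fin N) F) : Prop where
  lab_up : ∀ a b, up a = some b → lab b = lab a
  lt_up : ∀ a b, up a = some b → a < b
  top : ∀ v, ∃! a, lab a = v ∧ up a = none
  supp : ∀ a b, E a b ≠ 0 → (lab a).isLeft ∧ (lab b).isRight
  sum : ∀ r c, ∑ a, ∑ b, (if lab a = .inl r ∧ lab b = .inr c then E a b else 0) = M r c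

variable (lab : Fin N → Fin n ⊕ Fin m) (up : Fin N → Option (Fin N)) (E : Matrix (Fin N) (Fin N) F)

variable (F) in
/-- The parent relation among the copies of rows. -/
def rowUp : Matrix (Fin N) (Fin N) F :=
  of fun a b => if up b = some a ∧ (lab b).isLeft then 1 else 0

variable (F) in
/-- The parent relation among the copies of columns, transposed. -/
def colUp : Matrix (Fin N) (Fin N) F :=
  of fun a b => if up a = some b ∧ (lab a).isRight then 1 else 0

variable (F) in
/-- The projection to the copies that are not roots. -/
def nontop : Matrix (Fin N) (Fin N) F := diagonal fun a => if up a = none then 0 else 1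

/-- The split matrix. In the row of a copy `a` of a row, the column of a non-root copy `b` of a row
stands for the contribution that `b` passes to its parent; the row of a non-root copy of a column
says that this copy equals its parent. -/
def split : Matrix (Fin N) (Fin N) F := nontop F up + E - rowUp F lab up - colUp F lab up

variable (F) in
/-- The roots of the trees of copies of rows. -/
def topRow : Matrix (Fin n) (Fin N) F :=
  of fun r a => if lab a = .inl r ∧ up a = none then 1 else 0

variable (F) in
/-- The roots of the trees of copies of columns. -/
def topCol : Matrix (Fin N) (Fin m) F :=
  of fun a c => if lab a = .inr c ∧ up a = none then 1 else 0

variable (F) in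
/-- Row `r` sums over all the copies of row `r`. -/
def allRow : Matrix (Fin n) (Fin N) F := of fun r a => if lab a = .inl r then 1 else 0

variable (F) in
/-- Column `c` is the indicator of all the copies of column `c`. -/
def allCol : Matrix (Fin N) (Fin m) F := of fun a c => if lab a = .inr c then 1 else 0

variable (F) in
/-- The projection to the copies of rows. -/
def leftPart : Matrix (Fin N) (Fin N) F := diagonal fun a => if (lab a).isLeft then 1 else 0

variable (F) in
/-- The projection to the copies of columns. -/
def rightPart : Matrix (Fin N) (Fin N) F := diagonal fun a => if (lab a).isRight then 1 else 0

namespace IsSplitting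

variable {lab up E} {M : Matrix (Fin n) (Fin m) F} (h : IsSplitting M lab up E)
include h

omit h in
theorem rowUp_mul_nontop : rowUp F lab up * nontop F up = rowUp F lab up := by
  ext a b; by_cases hb : up b = none <;> simp [rowUp, nontop, hb]

omit h in
theorem nontop_mul_colUp : nontop F up * colUp F lab up = colUp F lab up := by
  ext a b; by_cases hb : up a = none <;> simp [colUp, nontop, hb]

omit h in
theorem rowUp_mul_colUp : rowUp F lab up * colUp F lab up = 0 := by
  ext a b
  rw [mul_apply]
  refine Finset.sum_eq_zero fun x _ => ?_
  rcases hx : lab x with r | c <;> simp [rowUp, colUp, hx]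

theorem det_one_sub_rowUp : (1 - rowUp F lab up).det = 1 := by
  rw [det_of_isLowerTriangular]
  · refine Finset.prod_eq_one fun a _ => ?_
    have : up a ≠ some a := fun ha => (h.lt_up a a ha).false
    simp [rowUp, this]
  · intro a b hab
    have hab' : a < b := hab
    have : up b ≠ some a := fun ha => (h.lt_up b a ha).asymm hab'
    simp [rowUp, this, hab'.ne]

theorem det_one_sub_colUp : (1 - colUp F lab up).det = 1 := by
  rw [det_of_isUpperTriangular]
  · refine Finset.prod_eq_one fun a _ => ?_
    have : up a ≠ some a := fun ha => (h.lt_up a a ha).false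
    simp [colUp, this]
  · intro a b hab
    have hab' : b < a := hab
    have : up a ≠ some b := fun ha => (h.lt_up a b ha).asymm hab'
    simp [colUp, this, hab'.ne']

theorem left_mul_rowUp : leftPart F lab * rowUp F lab up = rowUp F lab up := by
  ext a b
  by_cases hb : up b = some a
  · have := h.lab_up b a hb
    simp [leftPart, rowUp, hb, this]
  · simp [leftPart, rowUp, hb]

omit h in
theorem rowUp_mul_left : rowUp F lab up * leftPart F lab = rowUp F lab up := by
  ext a b
  by_cases hb : (lab b).isLeft <;> simp [leftPart, rowUp, hb]

theorem colUp_mul_right : colUp F lab up * rightPart F lab = colUp F lab up := by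
  ext a b
  by_cases hb : up a = some b
  · have := h.lab_up a b hb
    simp [rightPart, colUp, hb, this]
  · simp [rightPart, colUp, hb]

omit h in
theorem right_mul_colUp : rightPart F lab * colUp F lab up = colUp F lab up := by
  ext a b
  by_cases hb : (lab a).isRight <;> simp [rightPart, colUp, hb]

theorem left_mul_mul_right : leftPart F lab * E * rightPart F lab = E := by
  ext a b
  by_cases hE : E a b = 0
  · simp [leftPart, rightPart, hE]
  · have := h.supp a b hE
    simp [leftPart, rightPart, this]

omit h in
theorem right_mul_left : rightPart F lab * leftPart F lab = 0 := by
  ext a b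
  rcases hx : lab a with r | c <;> simp [leftPart, rightPart, hx, diagonal_apply]
  rintro h rfl
  simp [hx] at h

theorem allRow_mul_rowUp : allRow F lab * rowUp F lab up = allRow F lab * nontop F up := by
  ext r b
  rw [mul_apply]
  rcases hb : up b with _ | a
  · simp [rowUp, nontop, hb]
  · have hl := h.lab_up b a hb
    rw [Finset.sum_eq_single a]
    · rcases hx : lab b with r' | c <;> simp [rowUp, nontop, allRow, hb, hl, hx]
    · intro a' _ ha'
      simp [rowUp, hb, ha'.symm]
    · simp

theorem colUp_mul_allCol : colUp F lab up * allCol F lab = nontop F up * allCol F lab := by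
  ext b c
  rw [mul_apply]
  rcases hb : up b with _ | a
  · simp [colUp, nontop, hb]
  · have hl := h.lab_up b a hb
    rw [Finset.sum_eq_single a]
    · rcases hx : lab b with r' | c' <;> simp [colUp, nontop, allCol, hb, hl, hx]
    · intro a' _ ha'
      simp [colUp, hb, ha'.symm]
    · simp

omit h in
theorem allRow_mul_top : allRow F lab * (1 - nontop F up) = topRow F lab up := by
  rw [Matrix.mul_sub, Matrix.mul_one]
  ext r b
  by_cases hb : up b = none <;> simp [allRow, nontop, topRow, hb]

omit h in
theorem top_mul_allCol : (1 - nontop F up) * allCol F lab = topCol F lab up := by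
  rw [Matrix.sub_mul, Matrix.one_mul]
  ext b c
  by_cases hb : up b = none <;> simp [allCol, nontop, topCol, hb]

theorem allRow_mul_mul_allCol : allRow F lab * E * allCol F lab = M := by
  ext r c
  rw [← h.sum r c, mul_apply]
  simp only [mul_apply, Finset.sum_mul]
  rw [Finset.sum_comm]
  refine Finset.sum_congr rfl fun a _ => Finset.sum_congr rfl fun b _ => ?_
  by_cases h1 : lab a = .inl r <;> by_cases h2 : lab b = .inr c <;>
    simp [allRow, allCol, h1, h2]

theorem topRow_mul_transpose : topRow F lab up * (topRow F lab up)ᵀ = 1 := by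
  ext r r'
  obtain ⟨a, ha, hu⟩ := h.top (.inl r)
  rw [mul_apply, Finset.sum_eq_single a]
  · by_cases hr : r = r' <;> simp [topRow, ha, hr, one_apply]
  · intro b _ hb
    have : ¬ (lab b = .inl r ∧ up b = none) := fun h => hb (hu b h)
    simp [topRow, this]
  · simp

theorem transpose_mul_topCol : (topCol F lab up)ᵀ * topCol F lab up = 1 := by
  ext r r'
  obtain ⟨a, ha, hu⟩ := h.top (.inr r)
  rw [mul_apply, Finset.sum_eq_single a]
  · by_cases hr : r = r' <;> simp [topCol, ha, hr, one_apply]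
  · intro b _ hb
    have : ¬ (lab b = .inr r ∧ up b = none) := fun h => hb (hu b h)
    simp [topCol, this]
  · simp

theorem transpose_mul_topRow :
    (topRow F lab up)ᵀ * topRow F lab up = (1 - nontop F up) * leftPart F lab := by
  rw [sub_mul, one_mul]
  ext a b
  rw [mul_apply]
  rcases hx : lab a with r | c
  · rw [Finset.sum_eq_single r]
    · obtain ⟨t, -, ht⟩ := h.top (.inl r)
      by_cases hu : up a = none <;> by_cases hab : a = b
      · subst hab; simp [topRow, nontop, leftPart, hx, hu]
      · have : ¬ (lab b = .inl r ∧ up b = none) := fun h' =>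
          hab ((ht a ⟨hx, hu⟩).trans (ht b h').symm)
        simp [topRow, nontop, leftPart, hx, hu, this, hab]
      · subst hab; simp [topRow, nontop, leftPart, hx, hu]
      · simp [topRow, nontop, leftPart, hu, hab]
    · intro r' _ hr
      simp [topRow, hx, hr.symm]
    · simp
  · by_cases hab : a = b
    · subst hab; simp [topRow, nontop, leftPart, hx]
    · simp [topRow, nontop, leftPart, hx, hab]

theorem topCol_mul_transpose :
    topCol F lab up * (topCol F lab up)ᵀ = (1 - nontop F up) * rightPart F lab := by
  rw [sub_mul, one_mul]
  ext a b
  rw [mul_apply]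
  rcases hx : lab a with c | r
  · by_cases hab : a = b
    · subst hab; simp [topCol, nontop, rightPart, hx]
    · simp [topCol, nontop, rightPart, hx, hab]
  · rw [Finset.sum_eq_single r]
    · obtain ⟨t, -, ht⟩ := h.top (.inr r)
      by_cases hu : up a = none <;> by_cases hab : a = b
      · subst hab; simp [topCol, nontop, rightPart, hx, hu]
      · have : ¬ (lab b = .inr r ∧ up b = none) := fun h' =>
          hab ((ht a ⟨hx, hu⟩).trans (ht b h').symm)
        simp [topCol, nontop, rightPart, hx, hu, this, hab]
      · subst hab; simp [topCol, nontop, rightPart, hx, hu]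
      · simp [topCol, nontop, rightPart, hu, hab]
    · intro r' _ hr
      simp [topCol, hx, hr.symm]
    · simp

omit h in
theorem topRow_mul_topCol : topRow F lab up * topCol F lab up = 0 := by
  ext r c
  rw [mul_apply]
  refine Finset.sum_eq_zero fun x _ => ?_
  rcases hx : lab x with r | c <;> simp [topRow, topCol, hx]

omit h in
theorem topRow_mul_nontop : topRow F lab up * nontop F up = 0 := by
  ext r a
  by_cases hu : up a = none <;> simp [topRow, nontop, hu]

omit h in
theorem nontop_mul_topCol : nontop F up * topCol F lab up = 0 := by
  ext a c
  by_cases hu : up a = none <;> simp [topCol, nontop, hu]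

omit h in
theorem rowUp_mul_transpose : rowUp F lab up * (topRow F lab up)ᵀ = 0 := by
  ext a r
  rw [mul_apply]
  refine Finset.sum_eq_zero fun x _ => ?_
  rcases hx : up x with _ | b <;> simp [topRow, rowUp, hx]

omit h in
theorem transpose_mul_colUp : (topCol F lab up)ᵀ * colUp F lab up = 0 := by
  ext c a
  rw [mul_apply]
  refine Finset.sum_eq_zero fun x _ => ?_
  rcases hx : up x with _ | b <;> simp [topCol, colUp, hx]

omit h in
theorem rowUp_mul_topCol : rowUp F lab up * topCol F lab up = 0 := by
  ext a r
  rw [mul_apply]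
  refine Finset.sum_eq_zero fun x _ => ?_
  rcases hx : lab x with _ | b <;> simp [topCol, rowUp, hx]

omit h in
theorem topRow_mul_colUp : topRow F lab up * colUp F lab up = 0 := by
  ext c a
  rw [mul_apply]
  refine Finset.sum_eq_zero fun x _ => ?_
  rcases hx : lab x with _ | b <;> simp [topRow, colUp, hx]


omit h in
theorem split_eq :
    split lab up E = (1 - rowUp F lab up) * nontop F up * (1 - colUp F lab up) + E := by
  have h1 : (1 - rowUp F lab up) * nontop F up = nontop F up - rowUp F lab up := by
    rw [sub_mul, one_mul, rowUp_mul_nontop]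
  rw [h1, mul_sub, mul_one, sub_mul, nontop_mul_colUp, rowUp_mul_colUp, split]
  abel

/-- Summing over the copies recovers `M`: the links between the copies cancel. -/
theorem allRow_mul_split_mul_allCol : allRow F lab * split lab up E * allCol F lab = M := by
  have h1 : allRow F lab * (1 - rowUp F lab up) = topRow F lab up := by
    rw [← allRow_mul_top, Matrix.mul_sub, Matrix.mul_sub, h.allRow_mul_rowUp]
  rw [split_eq, Matrix.mul_add, Matrix.add_mul, h.allRow_mul_mul_allCol]
  simp only [← Matrix.mul_assoc]
  rw [h1, topRow_mul_nontop]
  simp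

/-- Up to unimodular factors that fix the roots, the split matrix is the direct sum of `M`, placed
at the roots, and an identity matrix at the other copies. -/
theorem exists_factorization :
    ∃ L R : Matrix (Fin N) (Fin N) F, L.det = 1 ∧ R.det = 1 ∧
      split lab up E =
        L * (nontop F up + (topRow F lab up)ᵀ * M * (topCol F lab up)ᵀ) * R ∧
      L * (topRow F lab up)ᵀ = (topRow F lab up)ᵀ ∧ L * topCol F lab up = topCol F lab up ∧
      (topCol F lab up)ᵀ * R = (topCol F lab up)ᵀ ∧ topRow F lab up * R = topRow F lab up := by
  set P := nontop F up with hP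
  set U := rowUp F lab up with hU
  set V := colUp F lab up with hV
  set S := topRow F lab up with hS
  set T := topCol F lab up with hT
  set e := leftPart F lab with he
  set f := rightPart F lab with hf
  have uA : IsUnit (1 - U).det := by rw [h.det_one_sub_rowUp]; exact isUnit_one
  have uB : IsUnit (1 - V).det := by rw [h.det_one_sub_colUp]; exact isUnit_one
  set A := (1 - U)⁻¹ with hA
  set B := (1 - V)⁻¹ with hB
  have A1 : A * (1 - U) = 1 := nonsing_inv_mul _ uA
  have A2 : (1 - U) * A = 1 := mul_nonsing_inv _ uA
  have B1 : B * (1 - V) = 1 := nonsing_inv_mul _ uB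
  have B2 : (1 - V) * B = 1 := mul_nonsing_inv _ uB
  have fe : f * e = 0 := right_mul_left
  have eA : A * e = e * A := by
    have h1 : (1 - U) * e = e * (1 - U) := by
      rw [sub_mul, mul_sub, one_mul, mul_one, h.left_mul_rowUp, rowUp_mul_left]
    calc A * e = A * e * ((1 - U) * A) := by rw [A2, mul_one]
      _ = A * (e * (1 - U)) * A := by simp only [Matrix.mul_assoc]
      _ = (A * (1 - U)) * e * A := by rw [← h1]; simp only [Matrix.mul_assoc]
      _ = e * A := by rw [A1, one_mul]
  have fB : f * B = B * f := by
    have h1 : (1 - V) * f = f * (1 - V) := by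
      rw [sub_mul, mul_sub, one_mul, mul_one, h.colUp_mul_right, right_mul_colUp]
    calc f * B = (B * (1 - V)) * f * B := by rw [B1, one_mul]
      _ = B * ((1 - V) * f) * B := by simp only [Matrix.mul_assoc]
      _ = B * f * ((1 - V) * B) := by rw [h1]; simp only [Matrix.mul_assoc]
      _ = B * f := by rw [B2, mul_one]
  set G := A * E * B with hG
  have eGf : e * G * f = G := by
    calc e * G * f = e * A * E * (B * f) := by rw [hG]; simp only [Matrix.mul_assoc]
      _ = A * (e * E * f) * B := by rw [← eA, ← fB]; simp only [Matrix.mul_assoc]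
      _ = G := by rw [h.left_mul_mul_right]
  have eP : P * e = e * P := by
    rw [hP, he, nontop, leftPart, diagonal_mul_diagonal, diagonal_mul_diagonal]
    congr 1; funext a; ring
  clear_value G
  have ee : e * e = e := by
    rw [he, leftPart, diagonal_mul_diagonal]
    congr 1; funext a; split_ifs <;> simp
  have ff : f * f = f := by
    rw [hf, rightPart, diagonal_mul_diagonal]
    congr 1; funext a; split_ifs <;> simp
  have eG : e * G = G := by
    rw [← eGf, ← Matrix.mul_assoc, ← Matrix.mul_assoc, ee]
  have Gf : G * f = G := by
    rw [← eGf, Matrix.mul_assoc, ff]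
  have PP : P * P = P := by
    rw [hP, nontop, diagonal_mul_diagonal]
    congr 1; funext a; split_ifs <;> simp
  have PT : P * T = 0 := nontop_mul_topCol
  have SP : S * P = 0 := topRow_mul_nontop
  have tP : Pᵀ = P := by rw [hP, nontop, diagonal_transpose]
  have PSt : P * Sᵀ = 0 := by rw [← tP, ← transpose_mul, SP, transpose_zero]
  have TtP : Tᵀ * P = 0 := by rw [← tP, ← transpose_mul, PT, transpose_zero]
  have GPe : G * P * e = 0 := by
    rw [Matrix.mul_assoc, eP, ← Gf, Matrix.mul_assoc, ← Matrix.mul_assoc f, fe]; simp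
  have GPG : G * P * G = 0 := by
    rw [← eG, ← Matrix.mul_assoc, eG, GPe, zero_mul]
  have SGT : S * G * T = M := by
    have h1 : S * A = allRow F lab := by
      have : S = allRow F lab * (1 - U) := by
        rw [hS, ← allRow_mul_top, Matrix.mul_sub, Matrix.mul_sub, h.allRow_mul_rowUp]
      rw [this, Matrix.mul_assoc, A2, Matrix.mul_one]
    have h2 : B * T = allCol F lab := by
      have : T = (1 - V) * allCol F lab := by
        rw [hT, ← top_mul_allCol, Matrix.sub_mul, Matrix.sub_mul, h.colUp_mul_allCol]
      rw [this, ← Matrix.mul_assoc, B1, Matrix.one_mul]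
    rw [hG, ← Matrix.mul_assoc, ← Matrix.mul_assoc, h1, Matrix.mul_assoc, h2,
      h.allRow_mul_mul_allCol]
  have fP : P * f = f * P := by
    rw [hP, hf, nontop, rightPart, diagonal_mul_diagonal, diagonal_mul_diagonal]
    congr 1; funext a; ring
  obtain ⟨Q, hQ⟩ : ∃ Q, Q = 1 - P := ⟨_, rfl⟩
  have QP : Q * P = 0 := by rw [hQ, sub_mul, one_mul, PP, sub_self]
  have PQ : P * Q = 0 := by rw [hQ, mul_sub, mul_one, PP, sub_self]
  have hC : Sᵀ * M * Tᵀ = Q * G * Q := by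
    have h1 : Q * f = f * Q := by rw [hQ, sub_mul, mul_sub, one_mul, mul_one, fP]
    calc Sᵀ * M * Tᵀ = (Sᵀ * S) * G * (T * Tᵀ) := by
            rw [← SGT]; simp only [Matrix.mul_assoc]
      _ = (Q * e) * G * (Q * f) := by
            rw [hS, hT, h.transpose_mul_topRow, h.topCol_mul_transpose, hQ]
      _ = Q * (e * G * f) * Q := by rw [h1]; simp only [Matrix.mul_assoc]
      _ = Q * G * Q := by rw [eGf]
  have core : (1 + G * P) * (P + Q * G * Q) * (1 + P * G * Q) = P + G := by
    have h1 : (1 + G * P) * (P + Q * G * Q) = P + Q * G * Q + G * P := by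
      have h2 : G * P * P = G * P := by rw [mul_assoc, PP]
      have h3 : G * P * (Q * G * Q) = 0 := by
        calc G * P * (Q * G * Q) = G * (P * Q) * (G * Q) := by simp only [mul_assoc]
          _ = 0 := by rw [PQ]; simp
      rw [add_mul, one_mul, mul_add, h2, h3, add_zero]
    have h2 : P * (P * G * Q) = P * G * Q := by rw [← mul_assoc, ← mul_assoc, PP]
    have h3 : Q * G * Q * (P * G * Q) = 0 := by
      calc Q * G * Q * (P * G * Q) = Q * G * (Q * P) * (G * Q) := by simp only [mul_assoc]
        _ = 0 := by rw [QP]; simp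
    have h4 : G * P * (P * G * Q) = 0 := by
      rw [mul_assoc G P, h2, ← mul_assoc, ← mul_assoc, GPG, zero_mul]
    rw [h1, mul_add, mul_one, add_mul, add_mul, h2, h3, h4, hQ]
    noncomm_ring
  refine ⟨(1 - U) * (1 + G * P), (1 + P * G * Q) * (1 - V), ?_, ?_, ?_, ?_, ?_, ?_, ?_⟩
  · rw [det_mul, h.det_one_sub_rowUp, one_mul, ← eG, mul_assoc, det_one_add_mul_comm, GPe,
      add_zero, det_one]
  · rw [det_mul, h.det_one_sub_colUp, mul_one, det_one_add_mul_comm, ← mul_assoc, QP, zero_mul,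
      add_zero, det_one]
  · rw [hC, split_eq]
    calc (1 - U) * P * (1 - V) + E = (1 - U) * (P + G) * (1 - V) := by
          have : (1 - U) * G * (1 - V) = E := by
            rw [hG, ← mul_assoc, ← mul_assoc, A2, one_mul, mul_assoc, B1, mul_one]
          rw [mul_add, add_mul, this]
      _ = _ := by rw [← core]; simp only [mul_assoc]
  · rw [Matrix.mul_assoc, Matrix.add_mul, Matrix.one_mul, Matrix.mul_assoc, PSt, Matrix.mul_zero,
      add_zero, Matrix.sub_mul, Matrix.one_mul, hU, hS, rowUp_mul_transpose, sub_zero]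
  · rw [Matrix.mul_assoc, Matrix.add_mul, Matrix.one_mul, Matrix.mul_assoc, PT, Matrix.mul_zero,
      add_zero, Matrix.sub_mul, Matrix.one_mul, hU, hT, rowUp_mul_topCol, sub_zero]
  · rw [← Matrix.mul_assoc, Matrix.mul_add, Matrix.mul_one, ← Matrix.mul_assoc, ← Matrix.mul_assoc,
      TtP, Matrix.zero_mul, Matrix.zero_mul, add_zero, Matrix.mul_sub, Matrix.mul_one, hT, hV,
      transpose_mul_colUp, sub_zero]
  · rw [← Matrix.mul_assoc, Matrix.mul_add, Matrix.mul_one, ← Matrix.mul_assoc, ← Matrix.mul_assoc,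
      SP, Matrix.zero_mul, Matrix.zero_mul, add_zero, Matrix.mul_sub, Matrix.mul_one, hS, hV,
      topRow_mul_colUp, sub_zero]

/-- A solution of the split system with the right-hand side placed at the roots, read off at the
roots, solves the original system. -/
theorem mulVec_of_split {r : Fin n → F} {X : Fin N → F}
    (hX : split lab up E *ᵥ X = (topRow F lab up)ᵀ *ᵥ r) :
    M *ᵥ ((topCol F lab up)ᵀ *ᵥ X) = r := by
  obtain ⟨L, R, hL, hR, hs, h1, h2, h3, h4⟩ := h.exists_factorization
  have uL : IsUnit L.det := by rw [hL]; exact isUnit_one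
  have e1 : (nontop F up + (topRow F lab up)ᵀ * M * (topCol F lab up)ᵀ) *ᵥ (R *ᵥ X) =
      (topRow F lab up)ᵀ *ᵥ r := by
    have : L *ᵥ ((nontop F up + (topRow F lab up)ᵀ * M * (topCol F lab up)ᵀ) *ᵥ (R *ᵥ X)) =
        L *ᵥ ((topRow F lab up)ᵀ *ᵥ r) := by
      rw [mulVec_mulVec, mulVec_mulVec, mulVec_mulVec, h1, ← hs, hX]
    have h5 := congrArg (fun v => L⁻¹ *ᵥ v) this
    simpa only [mulVec_mulVec, ← Matrix.mul_assoc, nonsing_inv_mul _ uL, Matrix.one_mul] using h5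
  have k : topRow F lab up * (nontop F up + (topRow F lab up)ᵀ * M * (topCol F lab up)ᵀ) =
      M * (topCol F lab up)ᵀ := by
    rw [Matrix.mul_add, topRow_mul_nontop, zero_add, ← Matrix.mul_assoc, ← Matrix.mul_assoc,
      h.topRow_mul_transpose, Matrix.one_mul]
  have e2 := congrArg (fun v => topRow F lab up *ᵥ v) e1
  rwa [mulVec_mulVec, k, mulVec_mulVec, Matrix.mul_assoc, h3,
    mulVec_mulVec _ (topRow F lab up), h.topRow_mul_transpose, one_mulVec, ← mulVec_mulVec] at e2

theorem exists_split_mulVec (x : Fin m → F) :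
    ∃ X, split lab up E *ᵥ X = (topRow F lab up)ᵀ *ᵥ (M *ᵥ x) := by
  obtain ⟨L, R, hL, hR, hs, h1, h2, h3, h4⟩ := h.exists_factorization
  have uR : IsUnit R.det := by rw [hR]; exact isUnit_one
  refine ⟨R⁻¹ *ᵥ (topCol F lab up *ᵥ x), ?_⟩
  have h5 : (nontop F up + (topRow F lab up)ᵀ * M * (topCol F lab up)ᵀ) * topCol F lab up =
      (topRow F lab up)ᵀ * M := by
    rw [Matrix.add_mul, nontop_mul_topCol, zero_add, Matrix.mul_assoc, h.transpose_mul_topCol,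
      Matrix.mul_one]
  rw [hs, mulVec_mulVec, mulVec_mulVec, mulVec_mulVec]
  congr 1
  rw [Matrix.mul_assoc _ R, mul_nonsing_inv _ uR, Matrix.mul_one,
    Matrix.mul_assoc, h5, ← Matrix.mul_assoc, h1]

theorem rank_split : (split lab up E).rank + (n + m) = M.rank + N := by
  classical
  obtain ⟨L, R, hL, hR, hs, h1, h2, h3, h4⟩ := h.exists_factorization
  have uR : IsUnit R.det := by rw [hR]; exact isUnit_one
  have uL : IsUnit L.det := by rw [hL]; exact isUnit_one
  set Z := (topRow F lab up)ᵀ * M * (topCol F lab up)ᵀ with hZ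
  have hPZ : nontop F up * Z = 0 := by
    have : nontop F up * (topRow F lab up)ᵀ = 0 := by
      have tP : (nontop F up)ᵀ = nontop F up := by rw [nontop, diagonal_transpose]
      rw [← tP, ← transpose_mul, topRow_mul_nontop, transpose_zero]
    rw [hZ, ← Matrix.mul_assoc, ← Matrix.mul_assoc, this]; simp
  have hZP : Z * nontop F up = 0 := by
    have : (topCol F lab up)ᵀ * nontop F up = 0 := by
      have tP : (nontop F up)ᵀ = nontop F up := by rw [nontop, diagonal_transpose]
      rw [← tP, ← transpose_mul, nontop_mul_topCol, transpose_zero]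
    rw [hZ, Matrix.mul_assoc, this]; simp
  have PP : nontop F up * nontop F up = nontop F up := by
    rw [nontop, diagonal_mul_diagonal]
    congr 1; funext a; split_ifs <;> simp
  have rZ : Z.rank = M.rank := by
    apply le_antisymm
    · exact (rank_mul_le_left _ _).trans (rank_mul_le_right _ _)
    · have : M = topRow F lab up * Z * topCol F lab up := by
        rw [hZ, Matrix.mul_assoc, Matrix.mul_assoc, h.transpose_mul_topCol, Matrix.mul_one,
          ← Matrix.mul_assoc, h.topRow_mul_transpose, Matrix.one_mul]
      calc M.rank = (topRow F lab up * Z * topCol F lab up).rank := by rw [← this]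
        _ ≤ Z.rank := (rank_mul_le_left _ _).trans (rank_mul_le_right _ _)
  have rsum : (nontop F up + Z).rank = (nontop F up).rank + Z.rank := by
    have hdis : LinearMap.range (nontop F up).mulVecLin ⊓ LinearMap.range Z.mulVecLin = ⊥ := by
      rw [eq_bot_iff]
      rintro v ⟨⟨x, hx⟩, ⟨y, hy⟩⟩
      simp only [mulVecLin_apply] at hx hy
      have : nontop F up *ᵥ v = v := by rw [← hx, mulVec_mulVec, PP]
      have h0 : nontop F up *ᵥ v = 0 := by rw [← hy, mulVec_mulVec, hPZ, zero_mulVec]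
      exact this.symm.trans h0
    have := Submodule.finrank_sup_add_finrank_inf_eq (LinearMap.range (nontop F up).mulVecLin)
      (LinearMap.range Z.mulVecLin)
    rw [hdis, finrank_bot, add_zero] at this
    rw [rank, rank, rank, ← this]
    have hrange : LinearMap.range (nontop F up + Z).mulVecLin =
        LinearMap.range (nontop F up).mulVecLin ⊔ LinearMap.range Z.mulVecLin := ?_
    · rw [hrange]
    apply le_antisymm
    · rintro _ ⟨x, rfl⟩
      rw [mulVecLin_apply, Matrix.add_mulVec]
      exact Submodule.add_mem_sup ⟨x, rfl⟩ ⟨x, rfl⟩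
    rw [sup_le_iff]
    constructor
    · rintro _ ⟨x, rfl⟩
      refine ⟨nontop F up *ᵥ x, ?_⟩
      simp only [mulVecLin_apply, mulVec_mulVec, Matrix.add_mul, PP, hZP, add_zero]
    · rintro _ ⟨x, rfl⟩
      refine ⟨(1 - nontop F up) *ᵥ x, ?_⟩
      simp only [mulVecLin_apply, mulVec_mulVec, Matrix.add_mul, Matrix.mul_sub, PP, hZP,
        Matrix.mul_one, add_zero, add_sub_cancel_left]
  have rP : (nontop F up).rank + (n + m) = N := by
    choose top htop htop' using h.top
    have e : (Fin n ⊕ Fin m) ≃ {a // up a = none} :=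
      { toFun := fun v => ⟨top v, (htop v).2⟩
        invFun := fun a => lab a
        left_inv := fun v => (htop v).1
        right_inv := fun a => Subtype.ext (htop' (lab a) a ⟨rfl, a.2⟩).symm }
    have c1 : Fintype.card {a // up a = none} = n + m := by
      rw [← Fintype.card_congr e]; simp
    have c2 : Fintype.card {a // ¬ up a = none} = N - (n + m) := by
      rw [Fintype.card_subtype_compl, c1, Fintype.card_fin]
    have c3 : Fintype.card {a // up a = none} ≤ N := by
      simpa using Fintype.card_subtype_le fun a => up a = none
    rw [nontop, Matrix.rank_diagonal]
    simp only [ne_eq, ite_eq_left_iff, one_ne_zero, imp_false, not_not]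
    rw [c2]
    omega
  rw [hs, rank_mul_eq_left_of_isUnit_det _ _ uR, rank_mul_eq_right_of_isUnit_det _ _ uL, rsum, rZ]
  omega

end IsSplitting

/-- For square `M`, linking the roots of row `i` and of column `i` turns the split matrix into one
whose determinant is that of `M` up to sign. -/
theorem IsSplitting.det_split_add {M : Matrix (Fin n) (Fin n) F} {lab : Fin N → Fin n ⊕ Fin n}
    {up : Fin N → Option (Fin N)} {E : Matrix (Fin N) (Fin N) F} (h : IsSplitting M lab up E) :
    (split lab up E + topCol F lab up * topRow F lab up).det = (-1) ^ n * M.det := by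
  obtain ⟨L, R, hL, hR, hs, h1, h2, h3, h4⟩ := h.exists_factorization
  set S := topRow F lab up with hS
  set T := topCol F lab up with hT
  set P := nontop F up with hP
  have e1 : split lab up E + T * S = L * (P + Sᵀ * M * Tᵀ + T * S) * R := by
    rw [Matrix.mul_add L, Matrix.add_mul _ _ R, ← hs, ← Matrix.mul_assoc, h2, Matrix.mul_assoc, h4]
  have SP : S * P = 0 := IsSplitting.topRow_mul_nontop
  have PT : P * T = 0 := IsSplitting.nontop_mul_topCol
  have ST : S * T = 0 := IsSplitting.topRow_mul_topCol
  have SS : S * Sᵀ = 1 := h.topRow_mul_transpose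
  have TT : Tᵀ * T = 1 := h.transpose_mul_topCol
  have TS : Tᵀ * Sᵀ = 0 := by rw [← transpose_mul, ST, transpose_zero]
  have tP : Pᵀ = P := by rw [hP, nontop, diagonal_transpose]
  have PSt : P * Sᵀ = 0 := by rw [← tP, ← transpose_mul, SP, transpose_zero]
  have TtP : Tᵀ * P = 0 := by rw [← tP, ← transpose_mul, PT, transpose_zero]
  have hsum : P + Sᵀ * S + T * Tᵀ = 1 := by
    rw [hS, hT, h.transpose_mul_topRow, h.topCol_mul_transpose, add_assoc, ← mul_add]
    have : leftPart F lab + rightPart F lab = 1 := by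
      ext a b
      rcases hx : lab a <;> by_cases hab : a = b <;> simp [leftPart, rightPart, hx, hab, one_apply]
      all_goals subst hab; simp [hx]
    rw [this, mul_one, hP]; abel
  have e2 : P + Sᵀ * M * Tᵀ + T * S =
      (1 + Sᵀ * ((M - 1) * S)) * (1 - (Sᵀ - T) * (S - Tᵀ)) := by
    have e3 : (1 : Matrix (Fin N) (Fin N) F) - (Sᵀ - T) * (S - Tᵀ) = P + Sᵀ * Tᵀ + T * S := by
      rw [← hsum]
      simp only [Matrix.sub_mul, Matrix.mul_sub]
      abel
    have e4 : S * (P + Sᵀ * Tᵀ + T * S) = Tᵀ := by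
      rw [Matrix.mul_add, Matrix.mul_add, SP, ← Matrix.mul_assoc, ← Matrix.mul_assoc, SS, ST]
      simp
    rw [e3, add_mul, one_mul, Matrix.mul_assoc Sᵀ ((M - 1) * S), Matrix.mul_assoc (M - 1) S, e4,
      Matrix.sub_mul, Matrix.mul_sub, Matrix.one_mul, ← Matrix.mul_assoc Sᵀ M]
    abel
  have e5 : (1 + Sᵀ * ((M - 1) * S)).det = M.det := by
    rw [det_one_add_mul_comm, Matrix.mul_assoc, SS, Matrix.mul_one, add_sub_cancel]
  have e6 : ((1 : Matrix (Fin N) (Fin N) F) - (Sᵀ - T) * (S - Tᵀ)).det = (-1) ^ n := by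
    have : (S - Tᵀ) * (Sᵀ - T) = 1 + 1 := by
      rw [Matrix.sub_mul, Matrix.mul_sub, Matrix.mul_sub, SS, ST, TS, TT]; abel
    rw [sub_eq_add_neg, ← Matrix.neg_mul, det_one_add_mul_comm, Matrix.mul_neg, this]
    have : (1 : Matrix (Fin n) (Fin n) F) + -(1 + 1) = -1 := by abel
    rw [this, det_neg]; simp
  rw [e1, det_mul, det_mul, hL, hR, e2, det_mul, e5, e6]
  ring

end Matrix

end

/-! ### Rooted trees -/

section

/-- `par` is the parent function of the tree `T` rooted at the vertex `0`, and `dep` decreases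
towards the root. Vertices are written as natural numbers. -/
structure IsRooting {q : ℕ} (T : SimpleGraph (Fin q)) (par dep : ℕ → ℕ) : Prop where
  par_lt : ∀ x, 0 < x → x < q → par x < q
  dep_par : ∀ x, 0 < x → x < q → dep (par x) < dep x
  adj : ∀ x y : Fin q, T.Adj x y ↔ (0 < x.val ∧ y.val = par x) ∨ (0 < y.val ∧ x.val = par y)

theorem SimpleGraph.IsTree.exists_isRooting {q : ℕ} {T : SimpleGraph (Fin q)} (hT : T.IsTree) :
    ∃ par dep, IsRooting T par dep := by
  classical
  obtain ⟨z⟩ := hT.connected.nonempty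
  have hq : 0 < q := z.pos
  let o : Fin q := ⟨0, hq⟩
  have key : ∀ x : Fin q, x ≠ o → ∃ y, T.Adj x y ∧ T.dist o y < T.dist o x := by
    intro x hx
    obtain ⟨p, hp⟩ := (hT.connected x o).exists_walk_length_eq_dist
    cases p with
    | nil => exact absurd rfl hx
    | @cons _ y _ h p =>
      refine ⟨y, h, ?_⟩
      have h1 : T.dist y o ≤ p.length := SimpleGraph.dist_le p
      rw [SimpleGraph.dist_comm, SimpleGraph.dist_comm (u := o), ← hp]
      simp only [SimpleGraph.Walk.length_cons]
      omega
  choose! par hpar hdist using key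
  have hedge : T.edgeFinset = (univ.filter fun x : Fin q => x ≠ o).image fun x => s(x, par x) := by
    symm
    apply Finset.eq_of_subset_of_card_le
    · intro e he
      simp only [mem_image, mem_filter, mem_univ, true_and] at he
      obtain ⟨x, hx, rfl⟩ := he
      simpa using hpar x hx
    · rw [Finset.card_image_of_injOn]
      · have h1 := hT.card_edgeFinset
        rw [Fintype.card_fin] at h1
        rw [Finset.filter_ne' univ o, Finset.card_erase_of_mem (mem_univ _), Finset.card_fin]
        omega
      · intro x hx y hy hxy
        simp only [coe_filter, mem_univ, true_and, Set.mem_ofPred_eq] at hx hy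
        simp only [Sym2.eq_iff] at hxy
        rcases hxy with h | ⟨h1, h2⟩
        · exact h.1
        · have d1 := hdist x hx
          have d2 := hdist y hy
          rw [h2] at d1; rw [← h1] at d2
          omega
  refine ⟨fun x => if h : x < q then (par ⟨x, h⟩ : ℕ) else 0,
    fun x => if h : x < q then T.dist o ⟨x, h⟩ else 0, ?_, ?_, ?_⟩
  · intro x _ hx
    simp [hx]
  · intro x h0 hx
    have := hdist ⟨x, hx⟩ (by simp [o, Fin.ext_iff]; omega)
    simpa [hx] using this
  · intro x y
    have : T.Adj x y ↔ s(x, y) ∈ T.edgeFinset := by simp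
    rw [this, hedge]
    simp only [mem_image, mem_filter, mem_univ, true_and, Sym2.eq_iff, x.2, y.2, dif_pos,
      Fin.eta]
    have hne : ∀ z : Fin q, z ≠ o ↔ 0 < z.val := by
      intro z; simp [o, Fin.ext_iff, Nat.pos_iff_ne_zero]
    constructor
    · rintro ⟨z, hz, ⟨rfl, rfl⟩ | ⟨rfl, rfl⟩⟩
      · exact Or.inl ⟨(hne _).1 hz, rfl⟩
      · exact Or.inr ⟨(hne _).1 hz, rfl⟩
    · rintro (⟨h1, h2⟩ | ⟨h1, h2⟩)
      · exact ⟨x, (hne _).2 h1, Or.inl ⟨rfl, Fin.ext h2.symm⟩⟩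
      · exact ⟨y, (hne _).2 h1, Or.inr ⟨rfl, Fin.ext h2.symm⟩⟩

namespace IsRooting

variable {q : ℕ} {T : SimpleGraph (Fin q)} {par dep : ℕ → ℕ} (h : IsRooting T par dep)
include h

/-- A symmetric sum over the edges is a sum over the non-root vertices. -/
theorem sum_edges {L : List (Fin q × Fin q)} (hL : (L.map fun e => s(e.1, e.2)).Nodup)
    (hm : ∀ x y, s(x, y) ∈ (L.map fun e => s(e.1, e.2)) ↔ T.Adj x y) (g : ℕ → ℕ → ℕ)
    (hg : ∀ a b, g a b = g b a) :
    (L.map fun e => g e.1 e.2).sum = ∑ y ∈ Finset.Ico 1 q, g y (par y) := by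
  classical
  let H : Sym2 (Fin q) → ℕ := Sym2.lift ⟨fun a b => g a b, fun a b => hg a b⟩
  have h1 : (L.map fun e => g e.1 e.2) = (L.map fun e => s(e.1, e.2)).map H := by
    rw [List.map_map]; rfl
  rw [h1, ← List.sum_toFinset _ hL]
  symm
  refine Finset.sum_bij (fun y hy => s(⟨y, (Finset.mem_Ico.1 hy).2⟩,
    ⟨par y, h.par_lt y (Finset.mem_Ico.1 hy).1 (Finset.mem_Ico.1 hy).2⟩)) ?_ ?_ ?_ ?_
  · intro y hy
    rw [List.mem_toFinset, hm, h.adj]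
    exact Or.inl ⟨(Finset.mem_Ico.1 hy).1, rfl⟩
  · intro x hx y hy hxy
    obtain ⟨hx1, hx2⟩ := Finset.mem_Ico.1 hx
    obtain ⟨hy1, hy2⟩ := Finset.mem_Ico.1 hy
    simp only [Sym2.eq_iff, Fin.mk.injEq] at hxy
    rcases hxy with h' | ⟨h1, h2⟩
    · exact h'.1
    · have d1 := h.dep_par x hx1 hx2
      have d2 := h.dep_par y hy1 hy2
      rw [h2] at d1; rw [← h1] at d2
      omega
  · intro e he
    rw [List.mem_toFinset] at he
    induction e using Sym2.ind with
    | _ x y =>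
      rw [hm, h.adj] at he
      rcases he with ⟨h1, h2⟩ | ⟨h1, h2⟩
      · exact ⟨x, Finset.mem_Ico.2 ⟨h1, x.2⟩, by simp [Sym2.eq_iff, Fin.ext_iff, h2]⟩
      · exact ⟨y, Finset.mem_Ico.2 ⟨h1, y.2⟩, by simp [Sym2.eq_iff, Fin.ext_iff, h2]⟩
  · intro y hy
    rfl

theorem length_edges {L : List (Fin q × Fin q)} (hL : (L.map fun e => s(e.1, e.2)).Nodup)
    (hm : ∀ x y, s(x, y) ∈ (L.map fun e => s(e.1, e.2)) ↔ T.Adj x y) : L.length = q - 1 := by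
  have := h.sum_edges hL hm (fun _ _ => 1) fun _ _ => rfl
  simpa using this

/-- As long as a vertex other than the root is left, one of them has no child left. -/
theorem exists_leaf (R : Finset ℕ) (hR : R.card < q - 1) :
    ∃ x, 0 < x ∧ x < q ∧ x ∉ R ∧ ∀ y, 0 < y → y < q → par y = x → y ∈ R := by
  have hne : (Finset.Ico 1 q \ R).Nonempty := by
    rw [← Finset.card_pos]
    have := Finset.le_card_sdiff R (Finset.Ico 1 q)
    rw [Nat.card_Ico] at this
    omega
  obtain ⟨x, hx, hmax⟩ := Finset.exists_max_image _ dep hne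
  rw [Finset.mem_sdiff, Finset.mem_Ico] at hx
  refine ⟨x, hx.1.1, hx.1.2, hx.2, fun y h0 hy hp => ?_⟩
  by_contra hyR
  have h1 := hmax y (Finset.mem_sdiff.2 ⟨Finset.mem_Ico.2 ⟨h0, hy⟩, hyR⟩)
  have h2 := h.dep_par y h0 hy
  rw [hp] at h2
  omega

/-- A connected non-empty set of vertices has exactly one member whose parent is not a member. -/
theorem existsUnique_top {s : Set (Fin q)} (hs : (T.induce s).Connected) :
    ∃! x : Fin q, x ∈ s ∧ ∀ y ∈ s, ¬ (0 < x.val ∧ y.val = par x) := by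
  classical
  obtain ⟨⟨a, ha⟩⟩ := hs.nonempty
  obtain ⟨x, hx, hmin⟩ := Finset.exists_min_image (univ.filter (· ∈ s)) (fun x => dep x.val)
    ⟨a, by simp [ha]⟩
  simp only [mem_filter, mem_univ, true_and] at hx hmin
  have htop : ∀ y ∈ s, ¬ (0 < x.val ∧ y.val = par x) := by
    rintro y hy ⟨h1, h2⟩
    have := hmin y hy
    have := h.dep_par x h1 x.2
    rw [h2] at *
    omega
  refine ⟨x, ⟨hx, htop⟩, ?_⟩
  -- every member of `s` descends from a given top member
  have desc : ∀ t : Fin q, t ∈ s → (∀ y ∈ s, ¬ (0 < t.val ∧ y.val = par t)) → ∀ y ∈ s,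
      Relation.ReflTransGen (fun a b : Fin q => 0 < a.val ∧ b.val = par a) y t := by
    intro t ht htt y hy
    obtain ⟨p⟩ := hs ⟨t, ht⟩ ⟨y, hy⟩
    have : ∀ (u v : s) (p : (T.induce s).Walk u v),
        Relation.ReflTransGen (fun a b : Fin q => 0 < a.val ∧ b.val = par a) u.1 t →
        Relation.ReflTransGen (fun a b : Fin q => 0 < a.val ∧ b.val = par a) v.1 t := by
      intro u v p
      induction p with
      | nil => exact id
      | @cons u v w huv p ih =>
        intro hu
        apply ih
        have huv' : T.Adj u.1 v.1 := huv
        rw [h.adj] at huv'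
        rcases huv' with ⟨h1, h2⟩ | ⟨h1, h2⟩
        · rcases hu.cases_head with h3 | ⟨c, hc, h3⟩
          · exact absurd ⟨h3 ▸ h1, h3 ▸ h2⟩ (htt v.1 v.2)
          · have : c = v.1 := Fin.ext (hc.2.trans h2.symm)
            rwa [this] at h3
        · exact Relation.ReflTransGen.head ⟨h1, h2⟩ hu
    exact this _ _ p Relation.ReflTransGen.refl
  have hdep : ∀ a b : Fin q,
      Relation.ReflTransGen (fun a b : Fin q => 0 < a.val ∧ b.val = par a) a b →
      a = b ∨ dep b < dep a := by
    intro a b hab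
    induction hab with
    | refl => exact Or.inl rfl
    | @tail b c _ hbc ih =>
      right
      have := h.dep_par b hbc.1 b.2
      rw [← hbc.2] at this
      rcases ih with rfl | ih <;> omega
  rintro y ⟨hy, hyt⟩
  rcases hdep _ _ (desc x hx htop y hy) with h1 | h1
  · exact h1
  · rcases hdep _ _ (desc y hy hyt x hx) with h2 | h2
    · exact h2.symm
    · omega

end IsRooting

end

/-! ### Gaussian elimination by row operations -/

section

section Ops

variable {F : Type u} [Field F]

/-- Perform the row operations of a list in order: the triple `(σ, ρ, f)` stands for subtracting
`f` times row `ρ` from row `σ`. -/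
def applyOps (ops : List (ℕ × ℕ × F)) (v : ℕ → F) : ℕ → F :=
  ops.foldl (fun v e => Function.update v e.1 (v e.1 - e.2.2 * v e.2.1)) v

@[simp] theorem applyOps_nil (v : ℕ → F) : applyOps [] v = v := rfl

theorem applyOps_append (l : List (ℕ × ℕ × F)) (e : ℕ × ℕ × F) (v : ℕ → F) :
    applyOps (l ++ [e]) v =
      Function.update (applyOps l v) e.1 (applyOps l v e.1 - e.2.2 * applyOps l v e.2.1) := by
  simp [applyOps]

theorem applyOps_congr {N : ℕ} {ops : List (ℕ × ℕ × F)} (h : ∀ e ∈ ops, e.1 < N ∧ e.2.1 < N)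
    {v v' : ℕ → F} (hv : ∀ s < N, v s = v' s) : ∀ s < N, applyOps ops v s = applyOps ops v' s := by
  induction ops using List.reverseRecOn with
  | nil => exact hv
  | append_singleton l e ih =>
    intro s hs
    have ih' := ih fun e he => h e (List.mem_append_left _ he)
    have he := h e (by simp)
    rw [applyOps_append, applyOps_append, Function.update_apply, Function.update_apply,
      ih' _ he.1, ih' _ he.2, ih' s hs]

theorem applyOps_zero (ops : List (ℕ × ℕ × F)) (s : ℕ) : applyOps ops (fun _ => 0) s = 0 := by
  induction ops using List.reverseRecOn generalizing s with
  | nil => rfl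
  | append_singleton l e ih =>
    rw [applyOps_append, Function.update_apply, ih, ih, ih]
    simp

theorem applyOps_sum {ι : Type*} (ops : List (ℕ × ℕ × F)) (S : Finset ι) (c : ι → F) (v : ℕ → ι → F)
    (s : ℕ) :
    applyOps ops (fun s => ∑ δ ∈ S, v s δ * c δ) s =
      ∑ δ ∈ S, applyOps ops (fun s => v s δ) s * c δ := by
  induction ops using List.reverseRecOn generalizing s with
  | nil => rfl
  | append_singleton l e ih =>
    simp only [applyOps_append, Function.update_apply, ih]
    split_ifs
    · simp only [sub_mul, Finset.sum_sub_distrib, Finset.mul_sum, mul_assoc]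
    · rfl

/-- The row operations are undone by the unit triangular matrix of their coefficients, provided
that no row is changed after it has been used. -/
theorem applyOps_inverse {ops : List (ℕ × ℕ × F)} (h1 : ∀ e ∈ ops, e.2.1 ≠ e.1)
    (h2 : ops.Pairwise fun e e' => e'.1 ≠ e.2.1) (v : ℕ → F) (s : ℕ) :
    v s = applyOps ops v s +
      (ops.map fun e => if e.1 = s then e.2.2 * applyOps ops v e.2.1 else 0).sum := by
  induction ops using List.reverseRecOn generalizing s with
  | nil => simp
  | append_singleton l e ih =>
    rw [List.pairwise_append] at h2
    have ih' := ih (fun e he => h1 e (List.mem_append_left _ he)) h2.1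
    have he := h1 e (by simp)
    have hl : (l.map fun e' => if e'.1 = s then e'.2.2 * applyOps (l ++ [e]) v e'.2.1 else 0) =
        l.map fun e' => if e'.1 = s then e'.2.2 * applyOps l v e'.2.1 else 0 := by
      apply List.map_congr_left
      intro e' he'
      have := h2.2.2 e' he' e (by simp)
      rw [applyOps_append, Function.update_of_ne this.symm]
    rw [List.map_append, List.sum_append, hl, ih' s]
    simp only [List.map_cons, List.map_nil, List.sum_cons, List.sum_nil, add_zero]
    rw [applyOps_append, Function.update_of_ne he]
    by_cases hs : s = e.1
    · subst hs
      rw [Function.update_self, if_pos rfl]; ring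
    · rw [Function.update_of_ne hs, if_neg (Ne.symm hs), add_zero]

end Ops

/-- The nodes of the slots `s` and `t` are equal or adjacent in the forest with parent function
`pn`. -/
def Near (pn nd : ℕ → ℕ) (s t : ℕ) : Prop :=
  nd s = nd t ∨ pn (nd s) = nd t ∨ pn (nd t) = nd s

/-- The state of the elimination of the `N × N` matrix `M'`: the columns `< γ` have been dealt with,
`A` is the current matrix, `piv` lists the pivots found so far, all in columns `< γ'`, and `ops` is
the list of the row operations. The condition `fill` bounds the non-zero entries by the forest. -/
structure IsElim {F : Type u} [Field F] (N : ℕ) (pn nd : ℕ → ℕ) (M' : ℕ → ℕ → F) (γ γ' : ℕ)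
    (A : ℕ → ℕ → F) (piv : List (ℕ × ℕ)) (ops : List (ℕ × ℕ × F)) : Prop where
  eq_apply : ∀ s < N, ∀ t < N, A s t = applyOps ops (fun s => M' s t) s
  ops_lt : ∀ e ∈ ops, e.1 < N ∧ e.2.1 < e.1 ∧ e.2.2 ≠ 0
  ops_cleared : ∀ e ∈ ops, ∃ c, (e.2.1, c) ∈ piv ∧ A e.1 c = 0
  ops_nodup : (ops.map fun e => (e.1, e.2.1)).Nodup
  ops_pairwise : ops.Pairwise fun e e' => e'.1 ≠ e.2.1
  piv_nodup : (piv.map Prod.fst).Nodup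
  piv_sorted : piv.Pairwise fun p p' => p.2 < p'.2
  piv_lt : ∀ p ∈ piv, p.1 < N ∧ p.2 < γ' ∧ p.2 < N
  piv_ne : ∀ p ∈ piv, A p.1 p.2 ≠ 0
  piv_zero : ∀ p ∈ piv, ∀ t < p.2, A p.1 t = 0
  unused : ∀ s < N, s ∉ piv.map Prod.fst → ∀ t < γ, A s t = 0
  fill : ∀ s < N, ∀ t < N, A s t ≠ 0 → Near pn nd s t
  zero_row : ∀ s < N, (∀ t < N, M' s t = 0) → ∀ t < N, A s t = 0

/-- There is no fill-in: if a multiple of the pivot row `r` is subtracted from a later row `s`, then it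
can only change columns `d` near to `s`. Since the only neighbour after a node is its parent, `s` and
`d` belong to the node of `r` or its parent if `nd r = nd g`, and otherwise `nd d = nd g` or
`nd s = nd r`. -/
theorem near_of_near {pn nd : ℕ → ℕ} (hpn : ∀ z, pn z = 0 ∨ z < pn z) {r s g d : ℕ} (h0 : nd d ≠ 0)
    (h0' : nd r ≠ 0) (h0'' : nd s ≠ 0) (h0''' : nd g ≠ 0) (hrs : nd r ≤ nd s) (hgd : nd g ≤ nd d)
    (h1 : Near pn nd r g) (h2 : Near pn nd s g) (h3 : Near pn nd r d) : Near pn nd s d := by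
  unfold Near at *
  have a1 := hpn (nd r)
  have a2 := hpn (nd s)
  have a3 := hpn (nd g)
  have a4 := hpn (nd d)
  grind

/-- The unit lower triangular matrix of the coefficients of a list of row operations. -/
def opsMatrix {F : Type u} [Field F] (N : ℕ) (ops : List (ℕ × ℕ × F)) :
    Matrix (Fin N) (Fin N) F :=
  1 + .of fun i j =>
    (ops.map fun e => if e.1 = (i : ℕ) ∧ e.2.1 = (j : ℕ) then e.2.2 else 0).sum

namespace IsElim

variable {F : Type u} [Field F] {N : ℕ} {pn nd : ℕ → ℕ} {M' : ℕ → ℕ → F} {γ γ' : ℕ}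
  {A : ℕ → ℕ → F} {piv : List (ℕ × ℕ)} {ops : List (ℕ × ℕ × F)}

theorem start (hfill : ∀ s < N, ∀ t < N, M' s t ≠ 0 → Near pn nd s t) :
    IsElim N pn nd M' 0 0 M' [] [] where
  eq_apply _ _ _ _ := rfl
  ops_lt := by simp
  ops_cleared := by simp
  ops_nodup := by simp
  ops_pairwise := by simp
  piv_nodup := by simp
  piv_sorted := by simp
  piv_lt := by simp
  piv_ne := by simp
  piv_zero := by simp
  unused := by simp
  fill := hfill
  zero_row _ _ h := h

theorem congr {A' : ℕ → ℕ → F} (h : IsElim N pn nd M' γ γ A piv ops) (hγ : γ ≤ N)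
    (hA : ∀ s < N, ∀ t < N, A' s t = A s t) : IsElim N pn nd M' γ γ A' piv ops where
  eq_apply s hs t ht := by rw [hA s hs t ht, h.eq_apply s hs t ht]
  ops_lt := h.ops_lt
  ops_cleared e he := by
    obtain ⟨c, hc, hz⟩ := h.ops_cleared e he
    exact ⟨c, hc, by rw [hA _ (h.ops_lt e he).1 _ (h.piv_lt _ hc).2.2, hz]⟩
  ops_nodup := h.ops_nodup
  ops_pairwise := h.ops_pairwise
  piv_nodup := h.piv_nodup
  piv_sorted := h.piv_sorted
  piv_lt := h.piv_lt
  piv_ne p hp := by rw [hA _ (h.piv_lt p hp).1 _ (h.piv_lt p hp).2.2]; exact h.piv_ne p hp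
  piv_zero p hp t ht := by
    have := h.piv_lt p hp
    rw [hA _ this.1 _ (ht.trans this.2.2)]; exact h.piv_zero p hp t ht
  unused s hs hsp t ht := by rw [hA s hs t (by omega)]; exact h.unused s hs hsp t ht
  fill s hs t ht := by rw [hA s hs t ht]; exact h.fill s hs t ht
  zero_row s hs hz t ht := by rw [hA s hs t ht]; exact h.zero_row s hs hz t ht

theorem addPivot (h : IsElim N pn nd M' γ γ A piv ops) {r : ℕ} (hγ : γ < N) (hr : r < N)
    (hrp : r ∉ piv.map Prod.fst) (hA : A r γ ≠ 0) :
    IsElim N pn nd M' γ (γ + 1) A (piv ++ [(r, γ)]) ops where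
  eq_apply := h.eq_apply
  ops_lt := h.ops_lt
  ops_cleared e he := by
    obtain ⟨c, hc, hz⟩ := h.ops_cleared e he
    exact ⟨c, List.mem_append_left _ hc, hz⟩
  ops_nodup := h.ops_nodup
  ops_pairwise := h.ops_pairwise
  piv_nodup := by
    rw [List.map_append, List.map_cons, List.map_nil]
    refine List.Nodup.append h.piv_nodup (by simp) ?_
    rw [List.disjoint_singleton]
    exact hrp
  piv_sorted := by
    rw [List.pairwise_append]
    refine ⟨h.piv_sorted, by simp, fun p hp p' hp' => ?_⟩
    rw [List.mem_singleton] at hp'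
    subst hp'
    exact (h.piv_lt p hp).2.1
  piv_lt p hp := by
    rw [List.mem_append, List.mem_singleton] at hp
    rcases hp with hp | rfl
    · have := h.piv_lt p hp; omega
    · exact ⟨hr, by simp, hγ⟩
  piv_ne p hp := by
    rw [List.mem_append, List.mem_singleton] at hp
    rcases hp with hp | rfl
    · exact h.piv_ne p hp
    · exact hA
  piv_zero p hp := by
    rw [List.mem_append, List.mem_singleton] at hp
    rcases hp with hp | rfl
    · exact h.piv_zero p hp
    · exact h.unused r hr hrp
  unused s hs hsp := h.unused s hs fun hm => hsp (by
    rw [List.map_append]; exact List.mem_append_left _ hm)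
  fill := h.fill
  zero_row := h.zero_row

theorem finish (h : IsElim N pn nd M' γ γ' A piv ops) (hγ : γ' ≤ γ + 1)
    (h0 : ∀ s < N, s ∉ piv.map Prod.fst → A s γ = 0) :
    IsElim N pn nd M' (γ + 1) (γ + 1) A piv ops :=
  { h with
    piv_lt := fun p hp => by have := h.piv_lt p hp; omega
    unused := fun s hs hsp t ht => by
      rcases Nat.lt_succ_iff_lt_or_eq.1 ht with ht | rfl
      · exact h.unused s hs hsp t ht
      · exact h0 s hs hsp }

/-- One row operation, with the pivot row `r`, clears the entry `(s, γ)`. -/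
theorem rowOp (h : IsElim N pn nd M' γ (γ + 1) A piv ops) (hpn : ∀ z, pn z = 0 ∨ z < pn z)
    (hnd : ∀ s < N, nd s ≠ 0) (hmono : ∀ s t, s ≤ t → t < N → nd s ≤ nd t) {r s : ℕ}
    (hrp : (r, γ) ∈ piv) (hs : s < N) (hsp : s ∉ piv.map Prod.fst) (hA : A s γ ≠ 0) (hrs : r < s)
    {A' : ℕ → ℕ → F}
    (hA' : ∀ i < N, ∀ j < N, A' i j = if i = s then A s j - A s γ / A r γ * A r j else A i j) :
    IsElim N pn nd M' γ (γ + 1) A' piv (ops ++ [(s, r, A s γ / A r γ)]) := by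
  have hr := h.piv_lt _ hrp
  have hrγ := h.piv_ne _ hrp
  dsimp only at hr hrγ
  have hmem : ∀ p ∈ piv, p.1 ≠ s := fun p hp hps => hsp (List.mem_map.2 ⟨p, hp, hps⟩)
  have hpiv : ∀ p ∈ piv, ∀ j < N, A' p.1 j = A p.1 j := fun p hp j hj => by
    rw [hA' _ (h.piv_lt p hp).1 _ hj, if_neg (hmem p hp)]
  have hzero : ∀ j < γ, A' s j = 0 := fun j hj => by
    rw [hA' s hs j (by omega), if_pos rfl, h.unused s hs hsp j hj, h.piv_zero _ hrp j hj]; ring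
  have hcl : A' s γ = 0 := by
    rw [hA' s hs γ hr.2.2, if_pos rfl, div_mul_cancel₀ _ hrγ, sub_self]
  refine ⟨?_, ?_, ?_, ?_, ?_, h.piv_nodup, h.piv_sorted, h.piv_lt, ?_, ?_, ?_, ?_, ?_⟩
  · intro i hi j hj
    rw [applyOps_append, hA' i hi j hj, Function.update_apply]
    simp only
    rw [← h.eq_apply s hs j hj, ← h.eq_apply r hr.1 j hj, ← h.eq_apply i hi j hj]
  · intro e he
    rw [List.mem_append, List.mem_singleton] at he
    rcases he with he | rfl
    · exact h.ops_lt e he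
    · exact ⟨hs, hrs, div_ne_zero hA hrγ⟩
  · intro e he
    rw [List.mem_append, List.mem_singleton] at he
    rcases he with he | rfl
    · obtain ⟨c, hc, hz⟩ := h.ops_cleared e he
      have hcl := h.piv_lt _ hc
      refine ⟨c, hc, ?_⟩
      by_cases hes : e.1 = s
      · rcases Nat.lt_succ_iff_lt_or_eq.1 hcl.2.1 with hlt | heq
        · rw [hes]; exact hzero c hlt
        · dsimp only at heq
          rw [hes, heq] at hz; exact absurd hz hA
      · rw [hA' _ (h.ops_lt e he).1 _ hcl.2.2, if_neg hes, hz]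
    · exact ⟨γ, hrp, hcl⟩
  · rw [List.map_append, List.map_cons, List.map_nil]
    refine List.Nodup.append h.ops_nodup (by simp) ?_
    simp only [List.disjoint_singleton, List.mem_map, Prod.mk.injEq, not_exists, not_and]
    intro e he h1 h2
    obtain ⟨c, hc, hz⟩ := h.ops_cleared e he
    have : c = γ := by
      have := List.inj_on_of_nodup_map h.piv_nodup hc hrp h2
      exact congrArg Prod.snd this
    rw [h1, this] at hz
    exact hA hz
  · rw [List.pairwise_append]
    refine ⟨h.ops_pairwise, by simp, fun e he e' he' => ?_⟩
    rw [List.mem_singleton] at he'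
    subst he'
    obtain ⟨c, hc, -⟩ := h.ops_cleared e he
    exact fun h' => hmem _ hc h'.symm
  · intro p hp
    rw [hpiv p hp _ (h.piv_lt p hp).2.2]; exact h.piv_ne p hp
  · intro p hp t ht
    rw [hpiv p hp _ (ht.trans (h.piv_lt p hp).2.2)]; exact h.piv_zero p hp t ht
  · intro i hi hip t ht
    by_cases his : i = s
    · rw [his]; exact hzero t ht
    · rw [hA' i hi t (by omega), if_neg his]; exact h.unused i hi hip t ht
  · intro i hi t ht hne
    by_cases his : i = s
    · subst his
      rcases Nat.lt_or_ge t γ with htγ | htγ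
      · exact absurd (hzero t htγ) hne
      · rw [hA' i hi t ht, if_pos rfl] at hne
        by_cases h1 : A i t = 0
        · have h2 : A r t ≠ 0 := by
            intro h2; rw [h1, h2] at hne; simp at hne
          exact near_of_near hpn (hnd t ht) (hnd r hr.1) (hnd i hi) (hnd γ hr.2.2)
            (hmono _ _ hrs.le hi) (hmono _ _ htγ ht) (h.fill r hr.1 γ hr.2.2 hrγ)
            (h.fill i hi γ hr.2.2 hA) (h.fill r hr.1 t ht h2)
        · exact h.fill i hi t ht h1
    · rw [hA' i hi t ht, if_neg his] at hne
      exact h.fill i hi t ht hne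
  · intro i hi hz t ht
    by_cases his : i = s
    · subst his
      exact absurd (h.zero_row i hi hz γ hr.2.2) hA
    · rw [hA' i hi t ht, if_neg his]; exact h.zero_row i hi hz t ht

section Final

variable (h : IsElim N pn nd M' γ γ' A piv ops)
include h

theorem eq_sum {s t : ℕ} (hs : s < N) (ht : t < N) :
    M' s t = A s t + (ops.map fun e => if e.1 = s then e.2.2 * A e.2.1 t else 0).sum := by
  have := applyOps_inverse (fun e he => (h.ops_lt e he).2.1.ne) h.ops_pairwise (fun s => M' s t) s
  rw [this, h.eq_apply s hs t ht]
  congr 2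
  apply List.map_congr_left
  intro e he
  have := h.ops_lt e he
  rw [h.eq_apply e.2.1 (by omega) t ht]

/-- The row operations do not change the solutions of a linear system. -/
theorem system_iff (b X : ℕ → F) :
    (∀ s < N, ∑ t ∈ range N, M' s t * X t = b s) ↔
      ∀ s < N, ∑ t ∈ range N, A s t * X t = applyOps ops b s := by
  have hlt : ∀ e ∈ ops, e.1 < N ∧ e.2.1 < N := fun e he => by
    have := h.ops_lt e he; omega
  have hsum : ∀ s < N, ∑ t ∈ range N, A s t * X t =
      applyOps ops (fun s => ∑ t ∈ range N, M' s t * X t) s := by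
    intro s hs
    rw [applyOps_sum]
    exact Finset.sum_congr rfl fun t ht => by rw [h.eq_apply s hs t (Finset.mem_range.1 ht)]
  constructor
  · intro hb s hs
    rw [hsum s hs]
    exact applyOps_congr hlt hb s hs
  · intro hb s hs
    have e1 := applyOps_inverse (fun e he => (h.ops_lt e he).2.1.ne) h.ops_pairwise
      (fun s => ∑ t ∈ range N, M' s t * X t) s
    have e2 := applyOps_inverse (fun e he => (h.ops_lt e he).2.1.ne) h.ops_pairwise b s
    rw [e1, e2, ← hsum s hs, hb s hs]
    congr 2
    apply List.map_congr_left
    intro e he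
    rw [← hsum _ (hlt e he).2, hb _ (hlt e he).2]

theorem opsMatrix_mul : opsMatrix N ops * Matrix.of (fun i j : Fin N => A i j) =
    Matrix.of fun i j : Fin N => M' i j := by
  ext s t
  rw [opsMatrix, Matrix.add_mul, Matrix.one_mul, Matrix.add_apply, Matrix.mul_apply]
  simp only [Matrix.of_apply]
  rw [h.eq_sum s.2 t.2]
  congr 1
  have hlt := h.ops_lt
  clear h
  induction ops with
  | nil => simp
  | cons e l ih =>
    have he := hlt e (by simp)
    simp only [List.map_cons, List.sum_cons, add_mul, Finset.sum_add_distrib]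
    rw [ih fun e he => hlt e (List.mem_cons_of_mem _ he)]
    congr 1
    rw [Finset.sum_eq_single (⟨e.2.1, by omega⟩ : Fin N)]
    · by_cases hs : e.1 = s <;> simp [hs]
    · intro j _ hj
      have : ¬ e.2.1 = j := fun h => hj (Fin.ext h.symm)
      simp [this]
    · simp

theorem opsMatrix_apply_of_lt {i j : Fin N} (hij : i < j) : opsMatrix N ops i j = 0 := by
  have : ∀ e ∈ ops, ¬ (e.1 = i ∧ e.2.1 = j) := fun e he ⟨h1, h2⟩ => by
    have h3 := (h.ops_lt e he).2.1
    rw [h1, h2] at h3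
    exact absurd hij (by simpa using h3.le)
  rw [opsMatrix, Matrix.add_apply, Matrix.one_apply_ne hij.ne, zero_add, Matrix.of_apply,
    List.map_congr_left (g := fun _ => (0 : F)) fun e he => if_neg (this e he)]
  simp

theorem opsMatrix_apply_self (i : Fin N) : opsMatrix N ops i i = 1 := by
  have : ∀ e ∈ ops, ¬ (e.1 = i ∧ e.2.1 = i) := fun e he ⟨h1, h2⟩ => by
    have h3 := (h.ops_lt e he).2.1
    omega
  rw [opsMatrix, Matrix.add_apply, Matrix.one_apply_eq, Matrix.of_apply,
    List.map_congr_left (g := fun _ => (0 : F)) fun e he => if_neg (this e he)]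
  simp

theorem det_opsMatrix : (opsMatrix N ops).det = 1 := by
  rw [Matrix.det_of_isLowerTriangular]
  · exact Finset.prod_eq_one fun i _ => h.opsMatrix_apply_self i
  · intro i j hij
    exact h.opsMatrix_apply_of_lt hij

theorem row_eq_zero (hγ : γ = N) {s : ℕ} (hs : s < N) (hsp : s ∉ piv.map Prod.fst) {t : ℕ}
    (ht : t < N) : A s t = 0 := h.unused s hs hsp t (hγ ▸ ht)

theorem piv_fst_lt (i : Fin piv.length) : piv[i].1 < N := (h.piv_lt _ (List.getElem_mem _)).1
theorem piv_snd_lt (i : Fin piv.length) : piv[i].2 < N := (h.piv_lt _ (List.getElem_mem _)).2.2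

theorem piv_fst_inj {i j : Fin piv.length} (hij : piv[i].1 = piv[j].1) : i = j := by
  have := List.inj_on_of_nodup_map h.piv_nodup (List.getElem_mem i.2) (List.getElem_mem j.2) hij
  exact Fin.ext ((List.Nodup.getElem_inj_iff h.piv_nodup.of_map).1 this)

theorem piv_snd_lt_of_lt {i j : Fin piv.length} (hij : i < j) : piv[i].2 < piv[j].2 :=
  List.pairwise_iff_getElem.1 h.piv_sorted i j i.2 j.2 hij

theorem piv_snd_inj {i j : Fin piv.length} (hij : piv[i].2 = piv[j].2) : i = j := by
  rcases lt_trichotomy i j with h1 | h1 | h1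
  · exact absurd hij (h.piv_snd_lt_of_lt h1).ne
  · exact h1
  · exact absurd hij (h.piv_snd_lt_of_lt h1).ne'

theorem rank_eq (hγ : γ = N) : (Matrix.of fun i j : Fin N => M' i j).rank = piv.length := by
  rw [← h.opsMatrix_mul, Matrix.rank_mul_eq_right_of_isUnit_det _ _
    (by rw [h.det_opsMatrix]; exact isUnit_one)]
  set B : Matrix (Fin N) (Fin N) F := Matrix.of fun i j : Fin N => A i j with hB
  set d := piv.length with hd
  let Q : Matrix (Fin N) (Fin d) F := .of fun s i => if s.val = piv[i].1 then 1 else 0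
  let C : Matrix (Fin N) (Fin d) F := .of fun t i => if t.val = piv[i].2 then 1 else 0
  have hW : Q.transpose * B = .of fun i t => A piv[i].1 t := by
    ext i t
    rw [Matrix.mul_apply, Finset.sum_eq_single (⟨piv[i].1, h.piv_fst_lt i⟩ : Fin N)]
    · simp [Q, hB]
    · intro s _ hs
      have : ¬ s.val = piv[i].1 := fun h' => hs (Fin.ext h')
      simp [Q] at this ⊢
      simp [this]
    · simp
  have hT : (Q.transpose * B) * C = .of fun i j => A piv[i].1 piv[j].2 := by
    ext i j
    rw [hW, Matrix.mul_apply, Finset.sum_eq_single (⟨piv[j].2, h.piv_snd_lt j⟩ : Fin N)]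
    · simp [C]
    · intro s _ hs
      have : ¬ s.val = piv[j].2 := fun h' => hs (Fin.ext h')
      simp [C] at this ⊢
      simp [this]
    · simp
  apply le_antisymm
  · have : B = Q * (Q.transpose * B) := by
      ext s t
      rw [hW, Matrix.mul_apply]
      by_cases hs : s.val ∈ piv.map Prod.fst
      · obtain ⟨p, hp, hps⟩ := List.mem_map.1 hs
        obtain ⟨i, hi, rfl⟩ := List.getElem_of_mem hp
        rw [Finset.sum_eq_single (⟨i, hi⟩ : Fin d)]
        · simp [Q, hB, hps]
        · intro j _ hj
          have : ¬ s.val = piv[j].1 := fun h' => hj (h.piv_fst_inj (i := j) (j := ⟨i, hi⟩)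
            (h'.symm.trans hps.symm))
          simp [Q] at this ⊢
          simp [this]
        · simp
      · rw [hB, Matrix.of_apply, h.row_eq_zero hγ s.2 hs t.2]
        symm
        apply Finset.sum_eq_zero
        intro j _
        have : ¬ s.val = piv[j].1 := fun h' => hs
          (List.mem_map.2 ⟨_, List.getElem_mem j.2, h'.symm⟩)
        simp [Q] at this ⊢
        simp [this]
    rw [this]
    exact (Matrix.rank_mul_le_left _ _).trans (by simpa using Matrix.rank_le_card_width Q)
  · have hdet : IsUnit (Q.transpose * B * C) := by
      rw [Matrix.isUnit_iff_isUnit_det, hT, Matrix.det_of_isUpperTriangular]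
      · rw [isUnit_iff_ne_zero, Finset.prod_ne_zero_iff]
        intro i _
        exact h.piv_ne _ (List.getElem_mem _)
      · intro i j hij
        exact h.piv_zero _ (List.getElem_mem _) _ (h.piv_snd_lt_of_lt hij)
    have := Matrix.rank_of_isUnit _ hdet
    rw [Fintype.card_fin] at this
    rw [← this]
    exact (Matrix.rank_mul_le_left _ _).trans (Matrix.rank_mul_le_right _ _)

/-- If all the rows and columns of `M'` but `d` zero rows `sr k` and `d` zero columns `sc k` contain
pivots, then linking these rows and columns yields a matrix whose determinant is, up to the sign of
the permutation that takes rows to columns, the product of the pivots. -/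
theorem exists_perm {d : ℕ} (hd : piv.length + d = N) {sr sc : Fin d → Fin N}
    (hsr : Function.Injective sr) (hsc : Function.Injective sc)
    (hr : ∀ k t, t < N → M' (sr k) t = 0) (hc : ∀ k s, s < N → M' s (sc k) = 0) :
    ∃ e : Equiv.Perm (Fin N), (∀ i : Fin piv.length,
        e ⟨piv[i].1, h.piv_fst_lt i⟩ = ⟨piv[i].2, h.piv_snd_lt i⟩) ∧ (∀ k, e (sr k) = sc k) ∧
      (Matrix.of (fun i j : Fin N => M' i j) +
        Matrix.of fun i j => if ∃ k, i = sr k ∧ j = sc k then 1 else 0).det =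
        (Equiv.Perm.sign e : ℤ) * (piv.map fun p => A p.1 p.2).prod := by
  have hlt : ∀ e ∈ ops, e.1 < N ∧ e.2.1 < N := fun e he => by
    have := h.ops_lt e he; omega
  have hrA : ∀ k t, t < N → A (sr k) t = 0 := fun k t ht =>
    h.zero_row _ (sr k).2 (fun t ht => hr k t ht) t ht
  have hcA : ∀ k s, s < N → A s (sc k) = 0 := fun k s hs => by
    rw [h.eq_apply s hs _ (sc k).2, applyOps_congr hlt (v' := fun _ => 0) (fun s hs => hc k s hs) s hs,
      applyOps_zero]
  have hne : ∀ i : Fin piv.length, A piv[i].1 piv[i].2 ≠ 0 := fun i =>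
    h.piv_ne _ (List.getElem_mem _)
  let f : Fin piv.length ⊕ Fin d → Fin N := Sum.elim (fun i => ⟨piv[i].1, h.piv_fst_lt i⟩) sr
  let g : Fin piv.length ⊕ Fin d → Fin N := Sum.elim (fun i => ⟨piv[i].2, h.piv_snd_lt i⟩) sc
  have hfne : ∀ i k, (⟨piv[i].1, h.piv_fst_lt i⟩ : Fin N) ≠ sr k := fun i k hk => hne i (by
    have := hrA k piv[i].2 (h.piv_snd_lt i)
    rwa [← hk] at this)
  have hgne : ∀ i k, (⟨piv[i].2, h.piv_snd_lt i⟩ : Fin N) ≠ sc k := fun i k hk => hne i (by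
    have := hcA k piv[i].1 (h.piv_fst_lt i)
    rwa [← hk] at this)
  have hf : Function.Injective f := by
    rintro (i | k) (j | l) hij
    · exact congrArg _ (h.piv_fst_inj (congrArg Fin.val hij))
    · exact absurd hij (hfne i l)
    · exact absurd hij.symm (hfne j k)
    · exact congrArg _ (hsr hij)
  have hg : Function.Injective g := by
    rintro (i | k) (j | l) hij
    · exact congrArg _ (h.piv_snd_inj (congrArg Fin.val hij))
    · exact absurd hij (hgne i l)
    · exact absurd hij.symm (hgne j k)
    · exact congrArg _ (hsc hij)
  have hcard : Fintype.card (Fin piv.length ⊕ Fin d) = Fintype.card (Fin N) := by simp [hd]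
  have hf' : Function.Bijective f := (Fintype.bijective_iff_injective_and_card f).2 ⟨hf, hcard⟩
  have hg' : Function.Bijective g := (Fintype.bijective_iff_injective_and_card g).2 ⟨hg, hcard⟩
  let ef := Equiv.ofBijective f hf'
  let eg := Equiv.ofBijective g hg'
  let e : Equiv.Perm (Fin N) := ef.symm.trans eg
  have he : ∀ a, e (f a) = g a := fun a => by
    simp only [e, Equiv.trans_apply]
    have : ef.symm (f a) = a := ef.symm_apply_apply a
    rw [this]; rfl
  refine ⟨e, fun i => he (.inl i), fun k => he (.inr k), ?_⟩
  set Z : Matrix (Fin N) (Fin N) F :=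
    Matrix.of fun i j => if ∃ k, i = sr k ∧ j = sc k then 1 else 0 with hZ
  set B : Matrix (Fin N) (Fin N) F := Matrix.of fun i j : Fin N => A i j with hB
  have hZp : ∀ i j, Z ⟨piv[i].1, h.piv_fst_lt i⟩ j = 0 := fun i j => by
    have : ¬ ∃ k, (⟨piv[i].1, h.piv_fst_lt i⟩ : Fin N) = sr k ∧ j = sc k :=
      fun ⟨k, hk, _⟩ => hfne i k hk
    rw [hZ, Matrix.of_apply, if_neg this]
  have hZs : ∀ k j, Z (sr k) j = if j = sc k then 1 else 0 := fun k j => by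
    rw [hZ, Matrix.of_apply]
    congr 1
    exact propext ⟨fun ⟨l, h1, h2⟩ => by rwa [hsr h1], fun h => ⟨k, rfl, h⟩⟩
  have hLZ : opsMatrix N ops * Z = Z := by
    ext s t
    rw [opsMatrix, Matrix.add_mul, Matrix.one_mul, Matrix.add_apply, Matrix.mul_apply,
      Finset.sum_eq_zero, add_zero]
    intro j _
    obtain ⟨a, rfl⟩ := hf'.2 j
    rcases a with i | k
    · exact mul_eq_zero_of_right _ (hZp i t)
    · rw [Matrix.of_apply, List.map_congr_left (g := fun _ => (0 : F))]
      · simp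
      · intro o ho
        apply if_neg
        rintro ⟨h1, h2⟩
        obtain ⟨c, hc, -⟩ := h.ops_cleared o ho
        have h3 := h.piv_ne _ hc
        apply h3
        rw [h2]
        exact hrA k c (h.piv_lt _ hc).2.2
  have hprod : Matrix.of (fun i j : Fin N => M' i j) + Z = opsMatrix N ops * (B + Z) := by
    rw [Matrix.mul_add, h.opsMatrix_mul, hLZ]
  rw [hprod, Matrix.det_mul, h.det_opsMatrix, one_mul]
  have htri : ((B + Z).submatrix e.symm id).IsUpperTriangular := by
    intro i j hij
    have hij' : j < i := hij
    obtain ⟨a, ha⟩ := hg'.2 i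
    have hei : e.symm i = f a := by rw [Equiv.symm_apply_eq, he, ha]
    rw [Matrix.submatrix_apply, hei, id]
    rcases a with l | k
    · have h1 : B (f (.inl l)) j = 0 :=
        h.piv_zero _ (List.getElem_mem l.2) j (by rw [← ha] at hij'; exact hij')
      rw [Matrix.add_apply, h1, zero_add]
      exact hZp l j
    · have h1 : B (f (.inr k)) j = 0 := hrA k j j.2
      rw [Matrix.add_apply, h1, zero_add]
      have h2 : Z (f (.inr k)) j = if j = sc k then 1 else 0 := hZs k j
      rw [h2, if_neg]
      rw [← ha] at hij'
      exact hij'.ne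
  have hperm := Matrix.det_permute e.symm (B + Z)
  rw [Matrix.det_of_isUpperTriangular htri] at hperm
  have hdiag : ∏ i, (B + Z).submatrix e.symm id i i = (piv.map fun p => A p.1 p.2).prod := by
    rw [← Equiv.prod_comp eg, Fintype.prod_sum_type]
    have h1 : ∀ a, (B + Z).submatrix e.symm id (eg a) (eg a) = (B + Z) (f a) (g a) := by
      intro a
      have : e.symm (eg a) = f a := by rw [Equiv.symm_apply_eq, he]; rfl
      rw [Matrix.submatrix_apply, this]; rfl
    have h2 : ∀ i : Fin piv.length, (B + Z) (f (.inl i)) (g (.inl i)) = A piv[i].1 piv[i].2 :=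
      fun i => by
        rw [Matrix.add_apply]
        have : Z (f (.inl i)) (g (.inl i)) = 0 := hZp i _
        rw [this, add_zero]; rfl
    have h3 : ∀ k, (B + Z) (f (.inr k)) (g (.inr k)) = 1 := fun k => by
      rw [Matrix.add_apply]
      have h4 : Z (f (.inr k)) (g (.inr k)) = 1 := by
        have : Z (f (.inr k)) (g (.inr k)) = if sc k = sc k then 1 else 0 := hZs k _
        rw [this, if_pos rfl]
      have h5 : B (f (.inr k)) (g (.inr k)) = 0 := hrA k _ (sc k).2
      rw [h4, h5, zero_add]
    simp only [h1, h2, h3, Finset.prod_const_one, mul_one]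
    rw [← List.prod_ofFn]
    congr 1
    apply List.ext_getElem
    · simp
    · intro i h1 h2
      simp
  rw [hdiag, Equiv.Perm.sign_symm] at hperm
  rw [hperm, ← mul_assoc, ← Int.cast_mul, ← Units.val_mul, Int.units_mul_self]
  simp

end Final

end IsElim

end

/-! ### Copies of bags arranged along a binary forest -/

section

/-- The layout of the slots (copies of vertices) along a binary forest that refines a rooted tree.
The forest has the nodes `1, …, K - 1` (the number `0` stands for the absent node), and node `z` is a
copy of the bag of the vertex `ob z` of the rooted tree; its slots are the numbers from `bg z` to
`bg (z + 1)`. The slot `s` belongs to the node `nd s` and has the label `lab s`; `up s` is `0`, or it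
is `u + 1` where `u` is the slot with the same label in the parent node. The parent, the children and
the sibling of a node are given by `pn`, `c1`, `c2` and `sb`. The topmost copy of the bag of `x` is
`cur x`, and `done x` says that this copy has been attached to a copy of the parent of `x`. -/
structure IsLayout (q k : ℕ) (bag : ℕ → ℕ → Prop) (par : ℕ → ℕ) (done : ℕ → Prop) (K : ℕ)
    (bg lab nd up pn c1 c2 sb cur ob : ℕ → ℕ) : Prop where
  pos : 1 < K
  bg_zero : bg 0 = 0
  bg_one : bg 1 = 0
  bg_le : ∀ z < K, bg z ≤ bg (z + 1)
  size : ∀ z < K, bg (z + 1) ≤ bg z + k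
  nd_eq : ∀ z < K, ∀ s, bg z ≤ s → s < bg (z + 1) → nd s = z
  lab_inj : ∀ z < K, ∀ s t, bg z ≤ s → s < bg (z + 1) → bg z ≤ t → t < bg (z + 1) →
    lab s = lab t → s = t
  mem : ∀ z, 0 < z → z < K → ∀ v, bag (ob z) v ↔ ∃ s, bg z ≤ s ∧ s < bg (z + 1) ∧ lab s = v
  pn_lt : ∀ z, pn z = 0 ∨ (0 < z ∧ z < pn z ∧ pn z < K)
  eq_child : ∀ x, pn x ≠ 0 → x = c1 (pn x) ∨ x = c2 (pn x)
  pn_c1 : ∀ z, c1 z ≠ 0 → z ≠ 0 ∧ pn (c1 z) = z ∧ c1 z ≠ c2 z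
  pn_c2 : ∀ z, c2 z ≠ 0 → z ≠ 0 ∧ pn (c2 z) = z
  eq_sb : ∀ x y, pn x ≠ 0 → pn x = pn y → x ≠ y → y = sb x
  pn_sb : ∀ x, sb x ≠ 0 → pn (sb x) = pn x ∧ pn x ≠ 0 ∧ sb x ≠ x
  up_some : ∀ s < bg K, ∀ u, up s = u + 1 →
    pn (nd s) ≠ 0 ∧ bg (pn (nd s)) ≤ u ∧ u < bg (pn (nd s) + 1) ∧ lab u = lab s
  up_none : ∀ s < bg K, up s = 0 → pn (nd s) ≠ 0 → ¬ bag (ob (pn (nd s))) (lab s)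
  up_zero : ∀ s, bg K ≤ s → up s = 0
  node : ∀ z, 0 < z → z < K → ob z < q ∧ ((pn z = 0 ∧ z = cur (ob z) ∧ ¬ done (ob z)) ∨
    (pn z ≠ 0 ∧ ob (pn z) = ob z) ∨
    (z = cur (ob z) ∧ pn z ≠ 0 ∧ 0 < ob z ∧ ob (pn z) = par (ob z)))
  cur_spec : ∀ x < q, 0 < cur x ∧ cur x < K ∧ ob (cur x) = x ∧ (¬ done x → pn (cur x) = 0) ∧
    (done x → pn (cur x) ≠ 0 ∧ ob (pn (cur x)) = par x)

/-- The slots of the node `z`. -/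
def nodeSlots (bg : ℕ → ℕ) (z : ℕ) : List ℕ := List.range' (bg z) (bg (z + 1) - bg z)

/-- The slots of the nodes that matter when a column of the node `z` is eliminated: the children,
the node itself, its sibling, its parent and its grandparent. -/
def nearList (bg pn c1 c2 sb : ℕ → ℕ) (z : ℕ) : List ℕ :=
  [c1 z, c2 z, z, sb z, pn z, pn (pn z)].flatMap (nodeSlots bg)

namespace IsLayout

variable {q k : ℕ} {bag : ℕ → ℕ → Prop} {par : ℕ → ℕ} {done : ℕ → Prop} {K : ℕ}
  {bg lab nd up pn c1 c2 sb cur ob : ℕ → ℕ}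
  (h : IsLayout q k bag par done K bg lab nd up pn c1 c2 sb cur ob)
include h

theorem bg_mono {y z : ℕ} (hyz : y ≤ z) (hz : z ≤ K) : bg y ≤ bg z := by
  induction z, hyz using Nat.le_induction with
  | base => exact le_rfl
  | succ z hyz ih => exact (ih (by omega)).trans (h.bg_le z (by omega))

theorem exists_node {s : ℕ} (hs : s < bg K) : 0 < nd s ∧ nd s < K ∧ bg (nd s) ≤ s ∧
    s < bg (nd s + 1) := by
  have key : ∀ z ≤ K, s < bg z → ∃ y < z, bg y ≤ s ∧ s < bg (y + 1) := by
    intro z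
    induction z with
    | zero => intro _ hs; rw [h.bg_zero] at hs; omega
    | succ z ih =>
      intro hz hs
      by_cases hsz : s < bg z
      · obtain ⟨y, hy, hy'⟩ := ih (by omega) hsz
        exact ⟨y, by omega, hy'⟩
      · exact ⟨z, by omega, by omega, hs⟩
  obtain ⟨y, hy, h1, h2⟩ := key K le_rfl hs
  have := h.nd_eq y hy s h1 h2
  rw [this]
  refine ⟨?_, hy, h1, h2⟩
  rcases Nat.eq_zero_or_pos y with rfl | hy
  · rw [zero_add, h.bg_one] at h2; omega
  · exact hy

theorem nd_mono {s t : ℕ} (hst : s ≤ t) (ht : t < bg K) : nd s ≤ nd t := by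
  obtain ⟨-, h1, h2, h3⟩ := h.exists_node ht
  obtain ⟨-, h1', h2', h3'⟩ := h.exists_node (lt_of_le_of_lt hst ht)
  by_contra hlt
  have := h.bg_mono (y := nd t + 1) (z := nd s) (by omega) (by omega)
  omega

theorem card_le : bg K ≤ (K - 1) * k := by
  have key : ∀ z, z + 1 ≤ K → bg (z + 1) ≤ z * k := by
    intro z
    induction z with
    | zero => intro _; rw [zero_add, h.bg_one]; omega
    | succ z ih =>
      intro hz
      have := ih (by omega)
      have := h.size (z + 1) (by omega)
      rw [Nat.succ_mul]
      omega
  have := key (K - 1) (by have := h.pos; omega)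
  rwa [Nat.sub_add_cancel h.pos.le] at this

theorem lt_up {s u : ℕ} (hs : s < bg K) (hu : up s = u + 1) : s < u ∧ u < bg K ∧
    nd u = pn (nd s) ∧ lab u = lab s ∧ pn (nd s) ≠ 0 := by
  obtain ⟨h1, h2, h3, h4⟩ := h.up_some s hs u hu
  obtain ⟨g0, g1, g2, g3⟩ := h.exists_node hs
  have h5 := h.pn_lt (nd s)
  have e1 := h.bg_mono (y := pn (nd s) + 1) (z := K) (by omega) le_rfl
  have e2 := h.bg_mono (y := nd s + 1) (z := pn (nd s)) (by omega) (by omega)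
  exact ⟨by omega, by omega, h.nd_eq _ (by omega) u h2 h3, h4, h1⟩

/-- Attach the topmost copy of the bag of `y` to a new copy of the bag of its parent. -/
theorem merge {y : ℕ} (hy0 : 0 < y) (hy : y < q) (hp : par y < q) (hne : par y ≠ y)
    (hdy : ¬ done y) (hdp : ¬ done (par y)) {a b e N : ℕ}
    (ha : a = cur (par y)) (hb : b = cur y) (he : bg a + e = bg (a + 1)) (hN : N = bg K)
    {lab' nd' up' : ℕ → ℕ}
    (hlab : ∀ s < N, lab' s = lab s) (hlab' : ∀ j < e, lab' (N + j) = lab (bg a + j))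
    (hnd : ∀ s < N, nd' s = nd s) (hnd' : ∀ j < e, nd' (N + j) = K)
    (hupa : ∀ j < e, up' (bg a + j) = N + j + 1)
    (hupb : ∀ t, bg b ≤ t → t < bg (b + 1) → (∃ j < e, lab (bg a + j) = lab t ∧ up' t = N + j + 1) ∨
      ((∀ j < e, lab (bg a + j) ≠ lab t) ∧ up' t = up t))
    (hup : ∀ s, ¬ (bg a ≤ s ∧ s < bg (a + 1)) → ¬ (bg b ≤ s ∧ s < bg (b + 1)) → up' s = up s) :
    IsLayout q k bag par (fun x => done x ∨ x = y) (K + 1)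
      (Function.update bg (K + 1) (N + e)) lab' nd' up'
      (Function.update (Function.update pn a K) b K) (Function.update c1 K a)
      (Function.update c2 K b) (Function.update (Function.update sb a b) b a)
      (Function.update cur (par y) K) (Function.update ob K (par y)) := by
  obtain ⟨ha0, haK, hoa, hpa, -⟩ := h.cur_spec _ hp
  obtain ⟨hb0, hbK, hob, hpb, -⟩ := h.cur_spec _ hy
  rw [← ha] at ha0 haK hoa hpa
  rw [← hb] at hb0 hbK hob hpb
  replace hpa := hpa hdp
  replace hpb := hpb hdy
  have hab : a ≠ b := by rintro rfl; omega
  have hbg : ∀ z ≤ K, Function.update bg (K + 1) (N + e) z = bg z := fun z hz =>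
    Function.update_of_ne (by omega) _ _
  have hbg' : Function.update bg (K + 1) (N + e) (K + 1) = N + e := Function.update_self ..
  have hob' : ∀ z < K, Function.update ob K (par y) z = ob z := fun z hz =>
    Function.update_of_ne (by omega) _ _
  have hobK : Function.update ob K (par y) K = par y := Function.update_self ..
  have hpn : ∀ z, z ≠ a → z ≠ b → Function.update (Function.update pn a K) b K z = pn z :=
    fun z h1 h2 => by rw [Function.update_of_ne h2, Function.update_of_ne h1]
  have hpna : Function.update (Function.update pn a K) b K a = K := by
    rw [Function.update_of_ne hab, Function.update_self]
  have hpnb : Function.update (Function.update pn a K) b K b = K := Function.update_self ..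
  have hpK : pn K = 0 := by have := h.pn_lt K; omega
  have hle : ∀ z < K, bg (z + 1) ≤ N := fun z hz => by
    rw [hN]; exact h.bg_mono (by omega) le_rfl
  have hlaba : ∀ v, bag (par y) v ↔ ∃ j < e, lab (bg a + j) = v := fun v => by
    rw [← hoa, h.mem a ha0 haK]
    constructor
    · rintro ⟨s, h1, h2, h3⟩
      exact ⟨s - bg a, by omega, by rw [Nat.add_sub_cancel' h1, h3]⟩
    · rintro ⟨j, hj, h3⟩
      exact ⟨bg a + j, by omega, by omega, h3⟩
  have hlb := h.lab_inj
  constructor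
  · have := h.pos; omega
  · rw [hbg _ (by omega), h.bg_zero]
  · rw [hbg _ (by omega), h.bg_one]
  · intro z hz
    rcases Nat.lt_succ_iff_lt_or_eq.1 hz with hz | rfl
    · rw [hbg _ (by omega), hbg _ (by omega)]; exact h.bg_le z hz
    · rw [hbg _ (by omega), hbg']; omega
  · intro z hz
    rcases Nat.lt_succ_iff_lt_or_eq.1 hz with hz | rfl
    · rw [hbg _ (by omega), hbg _ (by omega)]; exact h.size z hz
    · rw [hbg', hbg _ le_rfl]
      have := h.size a haK; omega
  · intro z hz s
    rcases Nat.lt_succ_iff_lt_or_eq.1 hz with hz | rfl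
    · rw [hbg _ (by omega), hbg _ (by omega)]
      intro h1 h2
      rw [hnd s (by have := hle z hz; omega)]
      exact h.nd_eq z hz s h1 h2
    · rw [hbg _ (by omega), hbg']
      intro h1 h2
      obtain ⟨j, rfl⟩ := Nat.exists_eq_add_of_le (hN ▸ h1)
      exact hnd' j (by omega)
  · intro z hz s t
    rcases Nat.lt_succ_iff_lt_or_eq.1 hz with hz | rfl
    · rw [hbg _ (by omega), hbg _ (by omega)]
      intro h1 h2 h3 h4
      have := hle z hz
      rw [hlab s (by omega), hlab t (by omega)]
      exact h.lab_inj z hz s t h1 h2 h3 h4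
    · rw [hbg _ (by omega), hbg']
      intro h1 h2 h3 h4
      obtain ⟨i, rfl⟩ := Nat.exists_eq_add_of_le (hN ▸ h1)
      obtain ⟨j, rfl⟩ := Nat.exists_eq_add_of_le (hN ▸ h3)
      rw [hlab' i (by omega), hlab' j (by omega)]
      intro h5
      have := h.lab_inj a haK _ _ (by omega) (by omega) (by omega) (by omega) h5
      omega
  · intro z h0 hz v
    rcases Nat.lt_succ_iff_lt_or_eq.1 hz with hz | rfl
    · rw [hbg _ (by omega), hbg _ (by omega), hob' z hz, h.mem z h0 hz]
      have := hle z hz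
      constructor
      · rintro ⟨s, h1, h2, h3⟩; exact ⟨s, h1, h2, by rw [hlab s (by omega), h3]⟩
      · rintro ⟨s, h1, h2, h3⟩; exact ⟨s, h1, h2, by rw [← hlab s (by omega), h3]⟩
    · rw [hbg _ (by omega), hbg', hobK, hlaba]
      constructor
      · rintro ⟨j, hj, h3⟩
        exact ⟨N + j, by omega, by omega, by rw [hlab' j hj, h3]⟩
      · rintro ⟨s, h1, h2, h3⟩
        obtain ⟨j, rfl⟩ := Nat.exists_eq_add_of_le (hN ▸ h1)
        exact ⟨j, by omega, by rw [← hlab' j (by omega), h3]⟩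
  · intro z
    have := h.pn_lt z
    by_cases hza : z = a
    · subst hza; rw [hpna]; omega
    by_cases hzb : z = b
    · subst hzb; rw [hpnb]; omega
    rw [hpn z hza hzb]; omega
  · intro x
    have := h.eq_child x
    have := h.pn_lt x
    simp only [Function.update_apply]
    grind
  · intro z
    rcases eq_or_ne z K with rfl | hzK
    · have := h.pos; simp [hpna, hpnb, hab]; omega
    · rw [Function.update_of_ne hzK]
      intro h0
      have h1 := h.pn_c1 z h0
      have h2 := h.pn_lt (c1 z)
      rw [hpn _ (by rintro h3; rw [h3] at h1; omega) (by rintro h3; rw [h3] at h1; omega)]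
      rw [Function.update_of_ne hzK]
      exact h1
  · intro z
    rcases eq_or_ne z K with rfl | hzK
    · have := h.pos; simp [hpna, hpnb, hab]; omega
    · rw [Function.update_of_ne hzK]
      intro h0
      have h1 := h.pn_c2 z h0
      have h2 := h.pn_lt (c2 z)
      rw [hpn _ (by rintro h3; rw [h3] at h1; omega) (by rintro h3; rw [h3] at h1; omega)]

      exact h1
  · intro x z
    have := h.eq_sb x z
    have := h.pn_lt x
    have := h.pn_lt z
    simp only [Function.update_apply]
    grind
  · intro x
    have := h.pn_sb x
    simp only [Function.update_apply]
    grind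
  · rw [hbg']
    intro s hs u hu
    by_cases hsa : bg a ≤ s ∧ s < bg (a + 1)
    · obtain ⟨j, rfl⟩ := Nat.exists_eq_add_of_le hsa.1
      have hlt := hle a haK
      rw [hnd _ (by omega), h.nd_eq a haK _ hsa.1 hsa.2, hpna, hbg _ le_rfl, hbg', ← hN]
      have hu' := hupa j (by omega)
      have : u = N + j := by omega
      subst this
      rw [hlab' j (by omega), hlab _ (by omega)]
      exact ⟨by omega, by omega, by omega, rfl⟩
    by_cases hsb : bg b ≤ s ∧ s < bg (b + 1)
    · have hlt := hle b hbK
      have hnds := h.nd_eq b hbK _ hsb.1 hsb.2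
      rw [hnd _ (by omega), hnds, hpnb, hbg _ le_rfl, hbg', ← hN]
      rcases hupb s hsb.1 hsb.2 with ⟨j, hj, hl, hu'⟩ | ⟨-, hu'⟩
      · have : u = N + j := by omega
        subst this
        rw [hlab' j (by omega), hlab _ (by omega), hl]
        exact ⟨by omega, by omega, by omega, rfl⟩
      · have := (h.up_some s (by omega) u (by omega)).1
        rw [hnds] at this
        exact absurd hpb this
    · have hu' := hup s hsa hsb
      have hsN : s < N := by
        by_contra hsN
        have := h.up_zero s (by omega)
        omega
      obtain ⟨g0, g1, g2, g3⟩ := h.exists_node (hN ▸ hsN)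
      obtain ⟨f1, f2, f3, f4⟩ := h.up_some s (hN ▸ hsN) u (by omega)
      have f5 := h.pn_lt (nd s)
      have := hle (pn (nd s)) (by omega)
      rw [hnd s hsN, hpn _ (by grind) (by grind), hbg _ (by omega), hbg _ (by omega),
        hlab s hsN, hlab u (by omega)]
      exact ⟨f1, f2, f3, f4⟩
  · rw [hbg']
    intro s hs hu
    by_cases hsa : bg a ≤ s ∧ s < bg (a + 1)
    · obtain ⟨j, rfl⟩ := Nat.exists_eq_add_of_le hsa.1
      have hu' := hupa j (by omega)
      omega
    by_cases hsb : bg b ≤ s ∧ s < bg (b + 1)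
    · have hlt := hle b hbK
      have hnds := h.nd_eq b hbK _ hsb.1 hsb.2
      rw [hnd _ (by omega), hnds, hpnb, hobK, hlaba, hlab _ (by omega)]
      rintro - ⟨j, hj, hl⟩
      rcases hupb s hsb.1 hsb.2 with ⟨j, hj, hl, hu'⟩ | ⟨hn, -⟩
      · omega
      · exact hn j hj hl
    · have hu' := hup s hsa hsb
      by_cases hsN : s < N
      · obtain ⟨g0, g1, g2, g3⟩ := h.exists_node (hN ▸ hsN)
        have f5 := h.pn_lt (nd s)
        rw [hnd s hsN, hpn _ (by grind) (by grind), hlab s hsN]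
        intro hne
        rw [hob' _ (by omega)]
        exact h.up_none s (hN ▸ hsN) (by omega) hne
      · obtain ⟨j, rfl⟩ := Nat.exists_eq_add_of_le (not_lt.1 hsN)
        rw [hnd' j (by omega), hpn _ (by omega) (by omega)]
        intro hne
        exact absurd hpK hne
  · rw [hbg']
    intro s hs
    rw [hup s (by have := hle a haK; omega) (by have := hle b hbK; omega)]
    exact h.up_zero s (by omega)
  · intro z h0 hz
    rcases Nat.lt_succ_iff_lt_or_eq.1 hz with hz | rfl
    · rw [hob' z hz]
      obtain ⟨h1, h2⟩ := h.node z h0 hz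
      refine ⟨h1, ?_⟩
      have h3 := h.pn_lt z
      by_cases hza : z = a
      · subst hza
        right; left
        rw [hpna, hobK]
        exact ⟨by omega, hoa.symm⟩
      by_cases hzb : z = b
      · subst hzb
        right; right
        rw [hpnb, hobK, hob, Function.update_of_ne hne.symm]
        exact ⟨hb, by omega, hy0, rfl⟩
      rw [hpn z hza hzb]
      rcases h2 with ⟨h2, h4, h5⟩ | ⟨h2, h4⟩ | ⟨h2, h4, h5, h6⟩
      · left
        refine ⟨h2, ?_, ?_⟩
        · rw [Function.update_of_ne (by rintro h6; rw [h6] at h4; omega)]; exact h4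
        · rintro (h6 | h6)
          · exact h5 h6
          · rw [h6] at h4; omega
      · right; left
        rw [hob' _ (by omega)]
        exact ⟨h2, h4⟩
      · right; right
        rw [hob' _ (by omega), Function.update_of_ne (by rintro h6; rw [h6] at h2; omega)]
        exact ⟨h2, h4, h5, h6⟩
    · rw [hobK, hpn z (by omega) (by omega), Function.update_self]
      refine ⟨hp, Or.inl ⟨hpK, rfl, ?_⟩⟩
      rintro (h1 | h1)
      · exact hdp h1
      · exact hne h1
  · intro x hx
    by_cases hxp : x = par y
    · subst hxp
      rw [Function.update_self, hobK, hpn K (by omega) (by omega)]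
      refine ⟨by have := h.pos; omega, by omega, rfl, fun _ => hpK, ?_⟩
      rintro (h1 | h1)
      · exact absurd h1 hdp
      · exact absurd h1 hne
    · rw [Function.update_of_ne hxp]
      obtain ⟨h1, h2, h3, h4, h5⟩ := h.cur_spec x hx
      have hxa : cur x ≠ a := by rintro h6; rw [h6] at h3; omega
      rw [hob' _ h2]
      refine ⟨h1, by omega, h3, ?_⟩
      by_cases hxy : x = y
      · subst hxy
        rw [← hb, hpnb, hobK]
        exact ⟨fun h6 => absurd (Or.inr rfl) h6, fun _ => ⟨by omega, rfl⟩⟩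
      · have hxb : cur x ≠ b := by rintro h6; rw [h6] at h3; omega
        rw [hpn _ hxa hxb]
        have := h.pn_lt (cur x)
        refine ⟨fun h6 => h4 fun h7 => h6 (Or.inl h7), ?_⟩
        rintro (h6 | h6)
        · obtain ⟨h7, h8⟩ := h5 h6
          rw [hob' _ (by omega)]
          exact ⟨h7, h8⟩
        · exact absurd h6 hxy

/-- In a finished layout every label has exactly one slot without a copy above. -/
theorem existsUnique_top (hd0 : ¬ done 0) (hdone : ∀ x, 0 < x → x < q → done x) {v : ℕ}
    (hv : ∃! x, x < q ∧ bag x v ∧ (0 < x → ¬ bag (par x) v)) :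
    ∃! s, s < bg K ∧ lab s = v ∧ up s = 0 := by
  obtain ⟨x, ⟨hx, hxv, htop⟩, huniq⟩ := hv
  have key : ∀ s, s < bg K → lab s = v → up s = 0 → nd s = cur x := by
    intro s hs hl hu
    obtain ⟨g0, g1, g2, g3⟩ := h.exists_node hs
    have hbag : bag (ob (nd s)) v := (h.mem _ g0 g1 v).2 ⟨s, g2, g3, hl⟩
    have hnone := h.up_none s hs hu
    rw [hl] at hnone
    obtain ⟨h1, h2⟩ := h.node _ g0 g1
    rcases h2 with ⟨-, h4, h5⟩ | ⟨h2, h4⟩ | ⟨h2, h4, h5, h6⟩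
    · have h0 : ob (nd s) = 0 := by
        by_contra h0
        exact h5 (hdone _ (by omega) h1)
      rw [h4, huniq (ob (nd s)) ⟨h1, hbag, fun h => by omega⟩]
    · rw [h4] at hnone
      exact absurd hbag (hnone h2)
    · rw [h2, huniq (ob (nd s)) ⟨h1, hbag, fun _ => by rw [← h6]; exact hnone h4⟩]
  obtain ⟨h1, h2, h3, h4, h5⟩ := h.cur_spec x hx
  have hbag := hxv
  rw [← h3, h.mem _ h1 h2] at hbag
  obtain ⟨s, hs1, hs2, hl⟩ := hbag
  have hnd := h.nd_eq _ h2 s hs1 hs2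
  have hsK : s < bg K := lt_of_lt_of_le hs2 (h.bg_mono (by omega) le_rfl)
  refine ⟨s, ⟨hsK, hl, ?_⟩, ?_⟩
  · rcases hu : up s with _ | u
    · rfl
    exfalso
    obtain ⟨f1, f2, f3, f4⟩ := h.up_some s hsK u hu
    rw [hnd] at f1 f2 f3
    have f5 := h.pn_lt (cur x)
    have f6 := (h.mem (pn (cur x)) (by omega) (by omega) v).2 ⟨u, f2, f3, by rw [f4, hl]⟩
    rcases Nat.eq_zero_or_pos x with hx0 | hx0
    · rcases (h.node _ h1 h2).2 with g | g | g
      · exact f1 g.1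
      · exact f1 (h4 (hx0 ▸ hd0))
      · rw [h3] at g; omega
    · have hd := hdone x hx0 hx
      rw [(h5 hd).2] at f6
      exact htop hx0 f6
  · rintro t ⟨ht, htl, htu⟩
    have hndt := key t ht htl htu
    obtain ⟨g0, g1, g2, g3⟩ := h.exists_node ht
    rw [hndt] at g2 g3
    exact h.lab_inj _ h2 _ _ g2 g3 hs1 hs2 (by rw [htl, hl])

theorem mem_nodeSlots {z s : ℕ} (hz : z < K) : s ∈ nodeSlots bg z ↔ s < bg K ∧ nd s = z := by
  rw [nodeSlots, List.mem_range'_1]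
  have h1 := h.bg_le z hz
  have h2 := h.bg_mono (y := z + 1) (z := K) (by omega) le_rfl
  constructor
  · rintro ⟨h3, h4⟩
    exact ⟨by omega, h.nd_eq z hz s h3 (by omega)⟩
  · rintro ⟨h3, rfl⟩
    have := h.exists_node h3
    omega

theorem nearNodes_lt {z : ℕ} (hz : z < K) :
    ∀ x ∈ [c1 z, c2 z, z, sb z, pn z, pn (pn z)], x < K := by
  have hpos := h.pos
  have a1 := h.pn_lt z
  have a2 := h.pn_lt (pn z)
  have a3 := h.pn_lt (c1 z)
  have a4 := h.pn_lt (c2 z)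
  have a5 := h.pn_lt (sb z)
  have b1 := h.pn_c1 z
  have b2 := h.pn_c2 z
  have b3 := h.pn_sb z
  intro x hx
  simp only [List.mem_cons, List.not_mem_nil, or_false] at hx
  omega

theorem mem_nearList {z s : ℕ} (hz : z < K) : s ∈ nearList bg pn c1 c2 sb z ↔
    s < bg K ∧ nd s ∈ [c1 z, c2 z, z, sb z, pn z, pn (pn z)] := by
  rw [nearList, List.mem_flatMap]
  constructor
  · rintro ⟨x, hx, hs⟩
    rw [h.mem_nodeSlots (h.nearNodes_lt hz x hx)] at hs
    exact ⟨hs.1, by rw [hs.2]; exact hx⟩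
  · rintro ⟨h1, h2⟩
    exact ⟨_, h2, (h.mem_nodeSlots (h.nearNodes_lt hz _ h2)).2 ⟨h1, rfl⟩⟩

theorem nearList_nodup {z : ℕ} (h0 : 0 < z) (hz : z < K) :
    (nearList bg pn c1 c2 sb z).Nodup := by
  rw [nearList, List.nodup_flatMap]
  refine ⟨fun x _ => List.nodup_range', ?_⟩
  have hlt := h.nearNodes_lt hz
  have hdis : ∀ x < K, ∀ y < K, (x = y → x = 0) →
      (Function.onFun List.Disjoint (nodeSlots bg)) x y := by
    intro x hx y hy hxy s hs hs'
    rw [h.mem_nodeSlots hx] at hs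
    rw [h.mem_nodeSlots hy] at hs'
    have := hxy (by omega)
    have := (h.exists_node hs.1).1
    omega
  have a1 := h.pn_lt z
  have a2 := h.pn_lt (pn z)
  have a3 := h.pn_lt (c1 z)
  have a4 := h.pn_lt (c2 z)
  have a5 := h.pn_lt (sb z)
  have b1 := h.pn_c1 z
  have b2 := h.pn_c2 z
  have b3 := h.pn_sb z
  have e1 : c1 z = sb z → c1 z = 0 := fun e => by
    have := congrArg pn e; omega
  have e2 : c2 z = sb z → c2 z = 0 := fun e => by
    have := congrArg pn e; omega
  have e3 : sb z = pn z → sb z = 0 := fun e => by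
    have := congrArg pn e; omega
  have e4 : sb z = pn (pn z) → sb z = 0 := fun e => by
    have := congrArg pn e; omega
  simp only [List.pairwise_cons, List.mem_cons, List.not_mem_nil, or_false, forall_eq_or_imp,
    forall_eq, List.Pairwise.nil, and_true, false_imp_iff, implies_true] at hlt ⊢
  obtain ⟨l1, l2, l3, l4, l5, l6⟩ := hlt
  refine ⟨⟨?_, ?_, ?_, ?_, ?_⟩, ⟨?_, ?_, ?_, ?_⟩, ⟨?_, ?_, ?_⟩, ⟨?_, ?_⟩, ?_⟩ <;>
    exact hdis _ (by assumption) _ (by assumption) (by omega)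

theorem length_nearList {z : ℕ} (hz : z < K) : (nearList bg pn c1 c2 sb z).length ≤ 6 * k := by
  have hlt := h.nearNodes_lt hz
  simp only [List.mem_cons, List.not_mem_nil, or_false, forall_eq_or_imp, forall_eq] at hlt
  obtain ⟨l1, l2, l3, l4, l5, l6⟩ := hlt
  have hs : ∀ x < K, (nodeSlots bg x).length ≤ k := fun x hx => by
    have := h.size x hx
    rw [nodeSlots, List.length_range']
    omega
  have := hs _ l1
  have := hs _ l2
  have := hs _ l3
  have := hs _ l4
  have := hs _ l5
  have := hs _ l6
  simp only [nearList, List.flatMap_cons, List.flatMap_nil, List.length_append, List.length_nil]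
  omega

theorem mem_nearList_of_near {s t : ℕ} (hs : s < bg K) (ht : t < bg K) (hst : Near pn nd s t) :
    s ∈ nearList bg pn c1 c2 sb (nd t) := by
  rw [h.mem_nearList (h.exists_node ht).2.1]
  refine ⟨hs, ?_⟩
  have h0 := (h.exists_node ht).1
  have := h.eq_child (nd s)
  simp only [List.mem_cons, List.not_mem_nil, or_false]
  rcases hst with h1 | h1 | h1
  · simp [h1]
  · rw [h1] at this
    have := this (by omega)
    omega
  · simp [h1]

theorem mem_nearList_of_near_of_le {r t d : ℕ} (hd : d < bg K) (ht : t < bg K) (hr : r < bg K)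
    (hrt : Near pn nd r t) (hrd : Near pn nd r d) (htd : t ≤ d) :
    d ∈ nearList bg pn c1 c2 sb (nd t) := by
  rw [h.mem_nearList (h.exists_node ht).2.1]
  refine ⟨hd, ?_⟩
  have h0 := (h.exists_node ht).1
  have h1 := (h.exists_node hd).1
  have h2 := (h.exists_node hr).1
  have a1 := h.pn_lt (nd r)
  have a2 := h.pn_lt (nd t)
  have a3 := h.pn_lt (nd d)
  have h3 := h.nd_mono htd hd
  have h4 := h.eq_sb (nd t) (nd d)
  simp only [List.mem_cons, List.not_mem_nil, or_false]
  unfold Near at *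
  rcases hrt with h5 | h5 | h5
  · rw [h5] at hrd a1
    omega
  · omega
  · rcases hrd with h6 | h6 | h6
    · simp [← h6, h5]
    · simp [← h6, h5]
    · by_cases h7 : nd t = nd d
      · simp [h7]
      · have := h4 (by omega) (by omega) h7
        simp [this]

end IsLayout

end

/-! ### The split matrix with numbers as indices -/

section

/-- The counterpart of `Matrix.IsSplitting` for slots and labels that are natural numbers: row `r`
has the label `r`, column `c` the label `n + c`, and `up s` is `0` if `s` is a root and `u + 1` if
the parent of `s` is `u`. -/
structure IsSplit {F : Type u} [Field F] {n m : ℕ} (M : Fin n → Fin m → F) (N : ℕ) (lab up : ℕ → ℕ)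
    (E : ℕ → ℕ → F) : Prop where
  lab_lt : ∀ s < N, lab s < n + m
  lt_up : ∀ s < N, ∀ u, up s = u + 1 → s < u ∧ u < N ∧ lab u = lab s
  top : ∀ v < n + m, ∃! s, s < N ∧ lab s = v ∧ up s = 0
  supp : ∀ s < N, ∀ t < N, E s t ≠ 0 → lab s < n ∧ n ≤ lab t
  sum : ∀ (r : Fin n) (c : Fin m), ∑ s ∈ range N, ∑ t ∈ range N,
    (if lab s = r ∧ lab t = n + c then E s t else 0) = M r c

/-- The entries of the split matrix. -/
def splitEntry {F : Type u} [Field F] (n : ℕ) (lab up : ℕ → ℕ) (E : ℕ → ℕ → F) (s t : ℕ) : F :=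
  (if s = t ∧ up s ≠ 0 then 1 else 0) + E s t - (if up t = s + 1 ∧ lab t < n then 1 else 0) -
    (if up s = t + 1 ∧ n ≤ lab s then 1 else 0)

/-- The parents of the slots, as an option. -/
def upOption (N : ℕ) (up : ℕ → ℕ) (a : Fin N) : Option (Fin N) :=
  if h : up a ≠ 0 ∧ up a - 1 < N then some ⟨up a - 1, h.2⟩ else none

namespace IsSplit

variable {F : Type u} [Field F] {n m : ℕ} {M : Fin n → Fin m → F} {N : ℕ} {lab up : ℕ → ℕ}
  {E : ℕ → ℕ → F} (h : IsSplit M N lab up E)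
include h

/-- The row or column that a slot is a copy of. -/
def vertex (a : Fin N) : Fin n ⊕ Fin m := finSumFinEquiv.symm ⟨lab a, h.lab_lt a a.2⟩

theorem vertex_eq_inl (a : Fin N) (r : Fin n) : h.vertex a = .inl r ↔ lab a = r := by
  rw [vertex, Equiv.symm_apply_eq, Fin.ext_iff]; simp

theorem vertex_eq_inr (a : Fin N) (c : Fin m) : h.vertex a = .inr c ↔ lab a = n + c := by
  rw [vertex, Equiv.symm_apply_eq, Fin.ext_iff]; simp

theorem isLeft_vertex (a : Fin N) : (h.vertex a).isLeft ↔ lab a < n := by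
  have := a.2
  rcases hv : h.vertex a with r | c
  · rw [h.vertex_eq_inl] at hv; simp [hv]
  · rw [h.vertex_eq_inr] at hv; simp [hv]

theorem isRight_vertex (a : Fin N) : (h.vertex a).isRight ↔ n ≤ lab a := by
  rw [← not_lt, ← h.isLeft_vertex a]
  simp

theorem upOption_eq_none (a : Fin N) : upOption N up a = none ↔ up a = 0 := by
  have h1 : up a ≠ 0 → up a - 1 < N := fun hu => by
    have := h.lt_up a a.2 (up a - 1) (by omega)
    omega
  rw [upOption]
  split_ifs with hu
  · simp [hu.1]
  · simp; tauto

omit [Field F] h in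
theorem upOption_eq_some (a b : Fin N) : upOption N up a = some b ↔ up a = b + 1 := by
  rw [upOption]
  have := b.2
  split_ifs with hu
  · rw [Option.some_inj, Fin.ext_iff]
    simp only; omega
  · simp; omega

theorem isSplitting : Matrix.IsSplitting (Matrix.of M) h.vertex (upOption N up)
    (.of fun s t : Fin N => E s t) where
  lab_up a b hab := by
    rw [upOption_eq_some] at hab
    have := (h.lt_up a a.2 b hab).2.2
    simp [vertex, this]
  lt_up a b hab := by
    rw [upOption_eq_some] at hab
    exact (h.lt_up a a.2 b hab).1
  top v := by
    obtain ⟨s, ⟨h1, h2, h3⟩, h4⟩ := h.top (finSumFinEquiv v) (finSumFinEquiv v).2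
    refine ⟨⟨s, h1⟩, ⟨?_, ?_⟩, ?_⟩
    · simp [vertex, h2]
    · rw [h.upOption_eq_none]; exact h3
    · rintro a ⟨ha, ha'⟩
      refine Fin.ext (h4 a ⟨a.2, ?_, (h.upOption_eq_none a).1 ha'⟩)
      rw [vertex, Equiv.symm_apply_eq] at ha
      rw [← ha]
  supp a b hab := by
    rw [h.isLeft_vertex, h.isRight_vertex]
    exact h.supp a a.2 b b.2 hab
  sum r c := by
    rw [Matrix.of_apply, ← h.sum r c, Finset.sum_range]
    refine Finset.sum_congr rfl fun a _ => ?_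
    rw [Finset.sum_range]
    refine Finset.sum_congr rfl fun b _ => ?_
    simp only [h.vertex_eq_inl, h.vertex_eq_inr, Matrix.of_apply]

theorem split_eq : Matrix.split h.vertex (upOption N up) (.of fun s t : Fin N => E s t) =
    .of fun s t : Fin N => splitEntry n lab up E s t := by
  ext a b
  simp only [Matrix.split, Matrix.nontop, Matrix.rowUp, Matrix.colUp, Matrix.sub_apply,
    Matrix.add_apply, Matrix.of_apply, splitEntry, upOption_eq_some, h.isLeft_vertex,
    h.isRight_vertex, Matrix.diagonal_apply, h.upOption_eq_none]
  congr 3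
  by_cases hab : a = b
  · subst hab
    by_cases hu : up a = 0 <;> simp [hu]
  · simp [hab, Fin.val_ne_of_ne hab]

theorem rank_splitEntry : (Matrix.of fun s t : Fin N => splitEntry n lab up E s t).rank + (n + m) =
    (Matrix.of M).rank + N := by
  rw [← h.split_eq, h.isSplitting.rank_split]

theorem prod_eq : Matrix.of (fun (r : Fin n) (s : Fin N) => if lab s = r then (1 : F) else 0) *
    (Matrix.of fun s t : Fin N => splitEntry n lab up E s t) *
    Matrix.of (fun (s : Fin N) (c : Fin m) => if lab s = n + c then (1 : F) else 0) =
      Matrix.of M := by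
  rw [← h.split_eq, ← h.isSplitting.allRow_mul_split_mul_allCol]
  congr 1
  · congr 1
    ext r s; simp [Matrix.allRow, h.vertex_eq_inl]
  · ext s c; simp [Matrix.allCol, h.vertex_eq_inr]

theorem splitEntry_row {s t : ℕ} (hs : s < N) (ht : t < N) (hl : n ≤ lab s) (hu : up s = 0) :
    splitEntry n lab up E s t = 0 := by
  have hE : E s t = 0 := by
    by_contra hE
    have := h.supp s hs t ht hE
    omega
  have h1 : ¬ (up t = s + 1 ∧ lab t < n) := by
    rintro ⟨h1, h2⟩
    have := h.lt_up t ht s h1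
    omega
  simp [splitEntry, hE, h1, hu]

theorem splitEntry_col {s t : ℕ} (hs : s < N) (ht : t < N) (hl : lab t < n) (hu : up t = 0) :
    splitEntry n lab up E s t = 0 := by
  have hE : E s t = 0 := by
    by_contra hE
    have := h.supp s hs t ht hE
    omega
  have h1 : ¬ (up s = t + 1 ∧ n ≤ lab s) := by
    rintro ⟨h1, h2⟩
    have := h.lt_up s hs t h1
    omega
  have h2 : ¬ (s = t ∧ up s ≠ 0) := by
    rintro ⟨rfl, h2⟩; exact h2 hu
  simp [splitEntry, hE, h1, hu, h2]

variable {ts : ℕ → ℕ} (hts : ∀ v < n + m, ts v < N ∧ lab (ts v) = v ∧ up (ts v) = 0)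
include hts

theorem eq_top_iff {v s : ℕ} (hv : v < n + m) (hs : s < N) :
    s = ts v ↔ lab s = v ∧ up s = 0 := by
  obtain ⟨x, -, hx⟩ := h.top v hv
  constructor
  · rintro rfl; exact (hts v hv).2
  · intro h1
    rw [hx s ⟨hs, h1⟩, hx (ts v) (hts v hv)]

theorem topRow_mulVec {r : Fin n → F} {b : ℕ → F} (hb : ∀ i : Fin n, b (ts i) = r i)
    (hb0 : ∀ s < N, (∀ i < n, s ≠ ts i) → b s = 0) (s : Fin N) :
    ((Matrix.topRow F h.vertex (upOption N up)).transpose.mulVec r) s = b s := by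
  rw [Matrix.mulVec, dotProduct]
  simp only [Matrix.transpose_apply, Matrix.topRow, Matrix.of_apply, h.vertex_eq_inl,
    h.upOption_eq_none, ite_mul, one_mul, zero_mul]
  by_cases hs : ∃ i < n, s.val = ts i
  · obtain ⟨i, hi, hs⟩ := hs
    have h1 := (h.eq_top_iff hts (by omega : i < n + m) s.2).1 hs
    rw [Finset.sum_eq_single ⟨i, hi⟩, if_pos h1, hs, hb ⟨i, hi⟩]
    · intro j _ hj
      rw [if_neg]
      rintro ⟨h2, -⟩
      exact hj (Fin.ext (by simp only; omega))
    · simp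
  · push Not at hs
    rw [hb0 s s.2 hs]
    refine Finset.sum_eq_zero fun i _ => if_neg fun h1 => ?_
    exact hs i i.2 ((h.eq_top_iff hts (by omega) s.2).2 h1)

/-- A solution of the split system gives a solution of the original one. -/
theorem mulVec_eq {r : Fin n → F} {b X : ℕ → F} (hb : ∀ i : Fin n, b (ts i) = r i)
    (hb0 : ∀ s < N, (∀ i < n, s ≠ ts i) → b s = 0)
    (hX : ∀ s < N, ∑ t ∈ range N, splitEntry n lab up E s t * X t = b s) :
    (Matrix.of M).mulVec (fun j => X (ts (n + j))) = r := by
  have key := h.isSplitting.mulVec_of_split (r := r) (X := fun s : Fin N => X s) (by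
    ext s
    rw [h.topRow_mulVec hts hb hb0, ← hX s s.2, Finset.sum_range, h.split_eq]
    rfl)
  rw [← key]
  congr 1
  ext j
  have hj := hts (n + j) (by omega)
  rw [Matrix.mulVec, dotProduct, Finset.sum_eq_single ⟨_, hj.1⟩]
  · simp [Matrix.topCol, h.vertex_eq_inr, h.upOption_eq_none, hj]
  · intro s _ hs
    have h1 : ¬ (lab s = n + j ∧ up s = 0) := fun h1 =>
      hs (Fin.ext ((h.eq_top_iff hts (by omega) s.2).2 h1))
    simp only [Matrix.transpose_apply, Matrix.topCol, Matrix.of_apply, h.vertex_eq_inr,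
      h.upOption_eq_none, h1, if_false, zero_mul]
  · simp

theorem exists_solution {r : Fin n → F} {b : ℕ → F} (hb : ∀ i : Fin n, b (ts i) = r i)
    (hb0 : ∀ s < N, (∀ i < n, s ≠ ts i) → b s = 0) {x : Fin m → F}
    (hx : (Matrix.of M).mulVec x = r) :
    ∃ X : ℕ → F, ∀ s < N, ∑ t ∈ range N, splitEntry n lab up E s t * X t = b s := by
  obtain ⟨X, hX⟩ := h.isSplitting.exists_split_mulVec x
  refine ⟨fun t => if ht : t < N then X ⟨t, ht⟩ else 0, fun s hs => ?_⟩
  have := congrFun hX ⟨s, hs⟩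
  rw [h.split_eq, hx] at this
  rw [Finset.sum_range]
  simp only [Fin.is_lt, dite_true, Fin.eta]
  exact Eq.trans this (h.topRow_mulVec hts hb hb0 ⟨s, hs⟩)

end IsSplit

theorem IsSplit.det_add {F : Type u} [Field F] {n : ℕ} {M : Fin n → Fin n → F} {N : ℕ}
    {lab up : ℕ → ℕ} {E : ℕ → ℕ → F} (h : IsSplit M N lab up E) {ts : ℕ → ℕ}
    (hts : ∀ v < n + n, ts v < N ∧ lab (ts v) = v ∧ up (ts v) = 0) :
    ((Matrix.of fun s t : Fin N => splitEntry n lab up E s t) +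
      Matrix.of fun s t : Fin N => if ∃ k < n, s.val = ts (n + k) ∧ t.val = ts k then 1 else 0).det =
      (-1) ^ n * (Matrix.of M).det := by
  rw [← h.isSplitting.det_split_add, h.split_eq]
  congr 2
  ext s t
  rw [Matrix.mul_apply]
  simp only [Matrix.topCol, Matrix.topRow, Matrix.of_apply, h.vertex_eq_inl, h.vertex_eq_inr,
    h.upOption_eq_none, ← ite_and, mul_ite, mul_one, mul_zero]
  split_ifs with hk
  · obtain ⟨k, hk, h1, h2⟩ := hk
    rw [Finset.sum_eq_single ⟨k, hk⟩]
    · rw [h.eq_top_iff hts (by omega) s.2] at h1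
      rw [h.eq_top_iff hts (by omega) t.2] at h2
      simp [h1, h2]
    · intro j _ hj
      rw [h.eq_top_iff hts (by omega) s.2] at h1
      have : ¬ (lab s = n + j) := fun h3 => hj (Fin.ext (by simp only; omega))
      simp [this]
    · simp
  · symm
    refine Finset.sum_eq_zero fun k _ => ?_
    split_ifs with h1
    · exfalso
      refine hk ⟨k, k.2, ?_⟩
      rw [h.eq_top_iff hts (by omega) s.2, h.eq_top_iff hts (by omega) t.2]
      tauto
    all_goals rfl

end

/-! ### The factors and the determinant -/

section

/-- The `a × b` matrix with an entry `1` in each place `(i, j)` with `p i j`, and `0` elsewhere. -/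
def indicatorMatrix (F : Type u) [Field F] (a b : ℕ) (p : ℕ → ℕ → Prop) [DecidableRel p] :
    Matrix (Fin a) (Fin b) F :=
  .of fun i j => if p i j then 1 else 0

section

variable {F : Type u} [Field F]

theorem exists_perm_of_injOn {N : ℕ} {f : ℕ → ℕ} (hf : ∀ i < N, f i < N)
    (hinj : ∀ i < N, ∀ j < N, f i = f j → i = j) :
    ∃ e : Equiv.Perm (Fin N), ∀ i : Fin N, (e i : ℕ) = f i := by
  let g : Fin N → Fin N := fun i => ⟨f i, hf i i.2⟩
  have hg : Function.Injective g := fun i j hij =>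
    Fin.ext (hinj i i.2 j j.2 (congrArg Fin.val hij))
  exact ⟨Equiv.ofBijective g (Finite.injective_iff_bijective.1 hg), fun i => rfl⟩

theorem isPermutationMatrix_left {N : ℕ} {f : ℕ → ℕ} {e : Equiv.Perm (Fin N)}
    (he : ∀ i : Fin N, (e i : ℕ) = f i) :
    IsPermutationMatrix (indicatorMatrix F N N fun i j => f i = j) :=
  ⟨e, fun i j => by simp [indicatorMatrix, ← he, Fin.ext_iff]⟩

theorem isPermutationMatrix_right {N : ℕ} {f : ℕ → ℕ} {e : Equiv.Perm (Fin N)}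
    (he : ∀ i : Fin N, (e i : ℕ) = f i) :
    IsPermutationMatrix (indicatorMatrix F N N fun i j => f j = i) :=
  ⟨e.symm, fun i j => by
    simp only [indicatorMatrix, Matrix.of_apply, ← he, ← Fin.ext_iff, Equiv.symm_apply_eq]
    simp only [eq_comm]⟩

theorem mul_indicatorMatrix_left {N a : ℕ} {f : ℕ → ℕ} {e : Equiv.Perm (Fin N)}
    (he : ∀ i : Fin N, (e i : ℕ) = f i) (B : Matrix (Fin a) (Fin N) F) (i : Fin a) (s : Fin N) :
    (B * indicatorMatrix F N N fun g s => f g = s) i s = B i (e.symm s) := by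
  rw [Matrix.mul_apply, Finset.sum_eq_single (e.symm s)]
  · simp [indicatorMatrix, ← he]
  · intro g _ hg
    have : ¬ (f g = s) := fun h => hg (by
      rw [Equiv.eq_symm_apply]; exact Fin.ext (by rw [he, h]))
    simp [indicatorMatrix, this]
  · simp

theorem indicatorMatrix_mul_right {N a : ℕ} {f : ℕ → ℕ} {e : Equiv.Perm (Fin N)}
    (he : ∀ i : Fin N, (e i : ℕ) = f i) (B : Matrix (Fin N) (Fin a) F) (s : Fin N) (i : Fin a) :
    ((indicatorMatrix F N N fun s g => f g = s) * B) s i = B (e.symm s) i := by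
  rw [Matrix.mul_apply, Finset.sum_eq_single (e.symm s)]
  · simp [indicatorMatrix, ← he]
  · intro g _ hg
    have : ¬ (f g = s) := fun h => hg (by
      rw [Equiv.eq_symm_apply]; exact Fin.ext (by rw [he, h]))
    simp [indicatorMatrix, this]
  · simp

variable {n m : ℕ} {M : Fin n → Fin m → F} {N : ℕ} {lab up : ℕ → ℕ} {E : ℕ → ℕ → F}
  {pn nd : ℕ → ℕ} {A : ℕ → ℕ → F} {piv : List (ℕ × ℕ)} {ops : List (ℕ × ℕ × F)}

/-- The factors that an elimination yields, where `sl` lists the slots by increasing labels,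
`sv` is the list of these labels, and `ro` lists the pivot rows and then the other rows. -/
def luChain (n m N : ℕ) (A : ℕ → ℕ → F) (ops : List (ℕ × ℕ × F)) (sl sv ro : ℕ → ℕ) :
    MatrixChain F n m :=
  .cons (indicatorMatrix F n N fun r g => sv g = r) <|
  .cons (indicatorMatrix F N N fun g s => sl g = s) <|
  .cons (opsMatrix N ops) <|
  .cons (indicatorMatrix F N N fun s i => ro i = s) <|
  .cons (Matrix.of fun i t : Fin N => A (ro i) t) <|
  .cons (indicatorMatrix F N N fun s g => sl g = s) <|
  .cons (indicatorMatrix F N m fun g c => sv g = n + c) <| .nil m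

theorem isGeneralizedLU_luChain (h : IsSplit M N lab up E)
    (he : IsElim N pn nd (splitEntry n lab up E) N N A piv ops) {sl sv ro : ℕ → ℕ}
    (hsl : ∀ g < N, sl g < N ∧ sv g = lab (sl g)) (hslinj : ∀ i < N, ∀ j < N, sl i = sl j → i = j)
    (hsv : ∀ i j, i ≤ j → j < N → sv i ≤ sv j) (hro : ∀ i < N, ro i < N)
    (hroinj : ∀ i < N, ∀ j < N, ro i = ro j → i = j)
    (hpiv : ∀ i (hi : i < piv.length), ro i = piv[i].1) :
    (luChain n m N A ops sl sv ro).IsGeneralizedLU (Matrix.of M) := by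
  obtain ⟨e, hee⟩ := exists_perm_of_injOn (fun g hg => (hsl g hg).1) hslinj
  obtain ⟨p, hp⟩ := exists_perm_of_injOn hro hroinj
  have hsve : ∀ s : Fin N, sv (e.symm s) = lab s := fun s => by
    rw [(hsl _ (e.symm s).2).2, ← hee, Equiv.apply_symm_apply]
  have hex : ∀ v < n + m, ∃ g : Fin N, sv g = v := fun v hv => by
    obtain ⟨s, ⟨h1, h2, -⟩, -⟩ := h.top v hv
    exact ⟨e.symm ⟨s, h1⟩, by rw [hsve]; exact h2⟩
  have hlt : ∀ i j : Fin N, sv i < sv j → i < j := fun i j hij => by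
    by_contra hji
    have := hsv j i (not_lt.1 hji) i.2
    omega
  have hlen : piv.length ≤ N := by
    have := (he.piv_nodup.subperm (l₂ := List.range N) (by
      intro s hs
      obtain ⟨x, hx, rfl⟩ := List.mem_map.1 hs
      exact List.mem_range.2 (he.piv_lt x hx).1)).length_le
    simpa using this
  have hzero : ∀ i : Fin N, piv.length ≤ i → ∀ t < N, A (ro i) t = 0 := fun i hi t ht => by
    refine he.unused _ (hro i i.2) ?_ t ht
    intro hmem
    obtain ⟨x, hx, hxi⟩ := List.mem_map.1 hmem
    obtain ⟨j, hj, rfl⟩ := List.getElem_of_mem hx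
    rw [← hpiv j hj] at hxi
    have := hroinj j (by omega) i i.2 hxi
    omega
  refine ⟨⟨?_, ?_, ?_, ?_, ?_, ?_, ?_, trivial⟩, ?_⟩
  · right; left
    intro i₁ i₂ hi j₂ hj
    by_contra hne
    obtain ⟨g, hg⟩ := hex i₁ (by omega)
    have h2 : sv j₂ = i₂ := by
      by_contra h2; simp [indicatorMatrix, h2] at hne
    have := hj g (hlt _ _ (by rw [hg, h2]; exact hi))
    simp [indicatorMatrix, hg] at this
  · exact Or.inl (isPermutationMatrix_left hee)
  · right; right
    intro i₁ i₂ hi j₂ hj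
    rw [Matrix.transpose_apply]
    refine he.opsMatrix_apply_of_lt (lt_of_le_of_lt ?_ hi)
    by_contra hlt
    have := hj i₁ (not_le.1 hlt)
    rw [Matrix.transpose_apply, he.opsMatrix_apply_self] at this
    exact one_ne_zero this
  · exact Or.inl (isPermutationMatrix_right hp)
  · right; left
    intro i₁ i₂ hi j₂ hj
    rw [Matrix.of_apply]
    have hi' : (i₁ : ℕ) < i₂ := hi
    by_cases h2 : (i₂ : ℕ) < piv.length
    · have h1 : (i₁ : ℕ) < piv.length := by omega
      rw [hpiv _ h2]
      refine he.piv_zero _ (List.getElem_mem _) _ ?_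
      refine lt_of_le_of_lt ?_ (he.piv_snd_lt_of_lt (i := ⟨i₁, h1⟩) (j := ⟨i₂, h2⟩) hi')
      by_contra hlt
      have h3 := he.piv_lt _ (List.getElem_mem h1)
      have := hj ⟨piv[(i₁ : ℕ)].2, h3.2.2⟩ (not_le.1 hlt)
      rw [Matrix.of_apply, hpiv _ h1] at this
      exact he.piv_ne _ (List.getElem_mem h1) this
    · exact hzero i₂ (not_lt.1 h2) j₂ j₂.2
  · exact Or.inl (isPermutationMatrix_right hee)
  · right; right
    intro i₁ i₂ hi j₂ hj
    rw [Matrix.transpose_apply]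
    by_contra hne
    obtain ⟨g, hg⟩ := hex (n + i₁) (by omega)
    have h2 : sv j₂ = n + i₂ := by
      by_contra h2; simp [indicatorMatrix, h2] at hne
    have := hj g (hlt _ _ (by rw [hg, h2]; exact Nat.add_lt_add_left hi n))
    simp [indicatorMatrix, hg] at this
  · have e1 : (indicatorMatrix F n N fun r g => sv g = r) *
        (indicatorMatrix F N N fun g s => sl g = s) =
        Matrix.of fun (r : Fin n) (s : Fin N) => if lab s = r then (1 : F) else 0 := by
      ext r s
      rw [mul_indicatorMatrix_left hee]
      simp [indicatorMatrix, hsve]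
    have e2 : (indicatorMatrix F N N fun s g => sl g = s) *
        (indicatorMatrix F N m fun g c => sv g = n + c) =
        Matrix.of fun (s : Fin N) (c : Fin m) => if lab s = n + c then (1 : F) else 0 := by
      ext s c
      rw [indicatorMatrix_mul_right hee]
      simp [indicatorMatrix, hsve]
    have e3 : (indicatorMatrix F N N fun s i => ro i = s) *
        (Matrix.of fun i t : Fin N => A (ro i) t) = Matrix.of fun s t : Fin N => A s t := by
      ext s t
      rw [indicatorMatrix_mul_right hp]
      simp [← hp]
    simp only [luChain, MatrixChain.prod, Matrix.mul_one]
    rw [e2, ← Matrix.mul_assoc (indicatorMatrix F N N fun s i => ro i = s), e3,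
      ← Matrix.mul_assoc (opsMatrix N ops), he.opsMatrix_mul, ← Matrix.mul_assoc, e1,
      ← Matrix.mul_assoc]
    exact h.prod_eq

theorem IsSplit.rank_eq (h : IsSplit M N lab up E)
    (he : IsElim N pn nd (splitEntry n lab up E) N N A piv ops) :
    (Matrix.of M).rank = piv.length + (n + m) - N := by
  have h1 := h.rank_splitEntry
  have h2 := he.rank_eq rfl
  omega

end

section

variable {F : Type u} [Field F] {n : ℕ} {M : Fin n → Fin n → F} {N : ℕ} {lab up : ℕ → ℕ}
  {E : ℕ → ℕ → F} {pn nd : ℕ → ℕ} {A : ℕ → ℕ → F} {piv : List (ℕ × ℕ)} {ops : List (ℕ × ℕ × F)}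
  (h : IsSplit M N lab up E) (he : IsElim N pn nd (splitEntry n lab up E) N N A piv ops)
include h he

theorem IsSplit.det_eq_zero (hlen : piv.length + n ≠ N) : (Matrix.of M).det = 0 := by
  have h1 := h.rank_eq he
  have h2 := h.rank_splitEntry
  have h3 := he.rank_eq rfl
  by_contra hdet
  have := Matrix.rank_of_isUnit (Matrix.of M)
    ((Matrix.isUnit_iff_isUnit_det _).2 (isUnit_iff_ne_zero.2 hdet))
  rw [Fintype.card_fin] at this
  omega

theorem IsSplit.exists_perm_det {ts : ℕ → ℕ}
    (hts : ∀ v < n + n, ts v < N ∧ lab (ts v) = v ∧ up (ts v) = 0) (hlen : piv.length + n = N) :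
    ∃ e : Equiv.Perm (Fin N), (∀ i (hi : i < piv.length) s, s.val = piv[i].1 → (e s : ℕ) = piv[i].2) ∧
      (∀ k < n, ∀ s : Fin N, s.val = ts (n + k) → (e s : ℕ) = ts k) ∧
      (Matrix.of M).det = (-1) ^ n * ((Equiv.Perm.sign e : ℤ) * (piv.map fun p => A p.1 p.2).prod) := by
  have hinj : ∀ v < n + n, ∀ v' < n + n, ts v = ts v' → v = v' := fun v hv v' hv' hvv => by
    rw [← (hts v hv).2.1, hvv, (hts v' hv').2.1]
  obtain ⟨e, h1, h2, h3⟩ := he.exists_perm (d := n) hlen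
    (sr := fun k => ⟨ts (n + k), (hts _ (by omega)).1⟩) (sc := fun k => ⟨ts k, (hts _ (by omega)).1⟩)
    (fun k l hkl => Fin.ext (by
      have := hinj _ (by omega) _ (by omega) (congrArg Fin.val hkl); omega))
    (fun k l hkl => Fin.ext (hinj _ (by omega) _ (by omega) (congrArg Fin.val hkl)))
    (fun k t ht => h.splitEntry_row (hts (n + k) (by omega)).1 ht
      (by simp only [(hts (n + k) (by omega)).2.1]; omega) (hts (n + k) (by omega)).2.2)
    (fun k s hs => h.splitEntry_col hs (hts k (by omega)).1
      (by simp only [(hts k (by omega)).2.1]; omega) (hts k (by omega)).2.2)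
  refine ⟨e, ?_, ?_, ?_⟩
  · intro i hi s hs
    have : s = ⟨piv[i].1, he.piv_fst_lt ⟨i, hi⟩⟩ := Fin.ext hs
    rw [this]
    exact congrArg Fin.val (h1 ⟨i, hi⟩)
  · intro k hk s hs
    have : s = ⟨ts (n + k), (hts _ (by omega)).1⟩ := Fin.ext hs
    rw [this]
    exact congrArg Fin.val (h2 ⟨k, hk⟩)
  · have h4 := h.det_add hts
    have h5 : (Matrix.of fun s t : Fin N => if ∃ k < n, s.val = ts (n + k) ∧ t.val = ts k
        then (1 : F) else 0) = Matrix.of fun i j => if ∃ k : Fin n,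
          i = ⟨ts (n + k), (hts _ (by omega)).1⟩ ∧ j = ⟨ts k, (hts _ (by omega)).1⟩ then 1 else 0 := by
      ext s t
      simp only [Matrix.of_apply, Fin.ext_iff]
      congr 1
      rw [eq_iff_iff]
      exact ⟨fun ⟨k, hk, h⟩ => ⟨⟨k, hk⟩, h⟩, fun ⟨k, h⟩ => ⟨k, k.2, h⟩⟩
    rw [h5, h3] at h4
    rw [h4, ← mul_assoc, ← mul_pow]
    simp

end

end

/-! ### Removing the leaves of a tree one by one -/

section

/-- The number of edges at `x` among the edges from a member of `S` to its parent. -/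
def degOf (par : ℕ → ℕ) (S : Finset ℕ) (x : ℕ) : ℕ :=
  ∑ y ∈ S, ((if y = x then 1 else 0) + if par y = x then 1 else 0)

/-- The sum of the other endpoints of these edges. -/
def sumOf (par : ℕ → ℕ) (S : Finset ℕ) (x : ℕ) : ℕ :=
  ∑ y ∈ S, ((if y = x then par y else 0) + if par y = x then y else 0)

/-- The state of the removal of the leaves of a tree on the vertices `0, …, q - 1` with root `0`:
the vertices `Q 0, …, Q (h - 1)` have been removed, those from `Q h` to `Q (t - 1)` are the present
leaves other than the root, and `deg` and `sum` hold the degree and the sum of the neighbours of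
each remaining vertex; for a removed vertex `sum` holds the parent. -/
structure IsPeel (q : ℕ) (par : ℕ → ℕ) (h t : ℕ) (Q deg sum : ℕ → ℕ) : Prop where
  le : h ≤ t
  range : ∀ i < t, 0 < Q i ∧ Q i < q
  inj : ∀ i < t, ∀ j < t, Q i = Q j → i = j
  child : ∀ i < t, ∀ y, 0 < y → y < q → par y = Q i → ∃ j < i, j < h ∧ Q j = y
  leaf : ∀ x, 0 < x → x < q → (∀ y, 0 < y → y < q → par y = x → ∃ j < h, Q j = y) →
    ∃ i < t, Q i = x
  deg_eq : ∀ x < q, (∀ j < h, Q j ≠ x) →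
    deg x = degOf par ((Ico 1 q).filter fun y => ∀ j < h, Q j ≠ y) x
  sum_eq : ∀ x < q, (∀ j < h, Q j ≠ x) →
    sum x = sumOf par ((Ico 1 q).filter fun y => ∀ j < h, Q j ≠ y) x
  par_eq : ∀ j < h, sum (Q j) = par (Q j)

theorem degOf_eq_one_iff {par : ℕ → ℕ} {S : Finset ℕ} {x : ℕ} (hx : x ∈ S) :
    degOf par S x = 1 ↔ ∀ y ∈ S, par y ≠ x := by
  rw [degOf, Finset.sum_add_distrib, Finset.sum_ite_eq', if_pos hx, Nat.add_eq_left,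
    Finset.sum_eq_zero_iff]
  simp

namespace IsPeel

variable {q : ℕ} {T : SimpleGraph (Fin q)} {par dep : ℕ → ℕ} {h t : ℕ} {Q deg sum : ℕ → ℕ}

theorem lt (hT : IsRooting T par dep) (hp : IsPeel q par h t Q deg sum) (hh : h < q - 1) :
    h < t := by
  obtain ⟨x, h0, hx, hxR, hch⟩ := hT.exists_leaf ((Finset.range h).image Q)
    (lt_of_le_of_lt Finset.card_image_le (by simpa using hh))
  obtain ⟨i, hi, hix⟩ := hp.leaf x h0 hx fun y hy0 hy hyx => by
    have := hch y hy0 hy hyx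
    simpa using this
  by_contra hlt
  exact hxR (by simp only [Finset.mem_image, Finset.mem_range]; exact ⟨i, by omega, hix⟩)

theorem mem_remaining (hp : IsPeel q par h t Q deg sum) (hh : h < t) :
    Q h ∈ (Ico 1 q).filter fun y => ∀ j < h, Q j ≠ y := by
  rw [Finset.mem_filter, Finset.mem_Ico]
  have := hp.range h hh
  exact ⟨⟨this.1, this.2⟩, fun j hj hjh => by have := hp.inj j (by omega) h hh hjh; omega⟩

theorem sum_head (hp : IsPeel q par h t Q deg sum) (hh : h < t) :
    sum (Q h) = par (Q h) := by
  have hm := hp.mem_remaining hh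
  have hr := hp.range h hh
  rw [hp.sum_eq _ hr.2 (Finset.mem_filter.1 hm).2, sumOf, Finset.sum_add_distrib,
    Finset.sum_ite_eq', if_pos hm, Nat.add_eq_left, Finset.sum_eq_zero]
  intro y hy
  rw [Finset.mem_filter, Finset.mem_Ico] at hy
  refine if_neg fun hyp => ?_
  obtain ⟨j, hj, hjh, hjy⟩ := hp.child h hh y (by omega) hy.1.2 hyp
  exact hy.2 j hj hjy

theorem par_not_removed (hp : IsPeel q par h t Q deg sum) (hh : h < t) :
    ∀ j < h, Q j ≠ par (Q h) := by
  intro j hj hjp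
  have hr := hp.range h hh
  obtain ⟨i, hi, hih, hiQ⟩ := hp.child j (by omega) (Q h) hr.1 hr.2 hjp.symm
  have := hp.inj i (by omega) h hh hiQ
  omega

/-- Removing the next leaf. -/
theorem pop (hT : IsRooting T par dep) (hp : IsPeel q par h t Q deg sum) (hh : h < t) {p : ℕ}
    (hpar : p = par (Q h)) {Q' : ℕ → ℕ} {t' : ℕ} (hQ : ∀ i < t, Q' i = Q i)
    (ht : (p ≠ 0 ∧ deg p - 1 = 1 ∧ t' = t + 1 ∧ Q' t = p) ∨ (¬ (p ≠ 0 ∧ deg p - 1 = 1) ∧ t' = t)) :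
    IsPeel q par (h + 1) t' Q' (Function.update deg p (deg p - 1))
      (Function.update sum p (sum p - Q h)) := by
  have hm := hp.mem_remaining hh
  have hr := hp.range h hh
  have hpq : p < q := by rw [hpar]; exact hT.par_lt _ hr.1 hr.2
  have hpne : p ≠ Q h := by
    have := hT.dep_par _ hr.1 hr.2
    rw [← hpar] at this
    rintro h1; rw [h1] at this; omega
  have hpn : ∀ j < h, Q j ≠ p := by rw [hpar]; exact hp.par_not_removed hh
  have hpn' : ∀ j < h + 1, Q j ≠ p := fun j hj => by
    rcases Nat.lt_succ_iff_lt_or_eq.1 hj with hj | rfl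
    · exact hpn j hj
    · exact hpne.symm
  have hS : ((Ico 1 q).filter fun y => ∀ j < h, Q j ≠ y) =
      insert (Q h) ((Ico 1 q).filter fun y => ∀ j < h + 1, Q' j ≠ y) := by
    ext y
    simp only [Finset.mem_insert, Finset.mem_filter, Finset.mem_Ico]
    constructor
    · rintro ⟨h1, h2⟩
      by_cases hy : y = Q h
      · exact Or.inl hy
      · refine Or.inr ⟨h1, fun j hj => ?_⟩
        rw [hQ j (by omega)]
        rcases Nat.lt_succ_iff_lt_or_eq.1 hj with hj | rfl
        · exact h2 j hj
        · exact Ne.symm hy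
    · rintro (rfl | ⟨h1, h2⟩)
      · rw [Finset.mem_filter, Finset.mem_Ico] at hm; exact hm
      · refine ⟨h1, fun j hj => ?_⟩
        rw [← hQ j (by omega)]; exact h2 j (by omega)
  have hnot : Q h ∉ ((Ico 1 q).filter fun y => ∀ j < h + 1, Q' j ≠ y) := by
    rw [Finset.mem_filter]
    rintro ⟨-, h1⟩
    exact h1 h (by omega) (hQ h hh)
  set S := (Ico 1 q).filter fun y => ∀ j < h + 1, Q' j ≠ y with hSdef
  have hdeg : ∀ x < q, (∀ j < h + 1, Q j ≠ x) →
      Function.update deg p (deg p - 1) x = degOf par S x := by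
    intro x hx hxn
    have h1 := hp.deg_eq x hx fun j hj => hxn j (by omega)
    rw [hS, degOf, Finset.sum_insert hnot, if_neg (hxn h (by omega)), zero_add] at h1
    by_cases hxp : x = p
    · subst hxp
      rw [Function.update_self, h1, if_pos hpar.symm, degOf]; omega
    · rw [Function.update_of_ne hxp, h1, if_neg (by omega), zero_add, degOf]
  have hsum : ∀ x < q, (∀ j < h + 1, Q j ≠ x) →
      Function.update sum p (sum p - Q h) x = sumOf par S x := by
    intro x hx hxn
    have h1 := hp.sum_eq x hx fun j hj => hxn j (by omega)
    rw [hS, sumOf, Finset.sum_insert hnot, if_neg (hxn h (by omega)), zero_add] at h1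
    by_cases hxp : x = p
    · subst hxp
      rw [Function.update_self, h1, if_pos hpar.symm, sumOf]; omega
    · rw [Function.update_of_ne hxp, h1, if_neg (by omega), zero_add, sumOf]
  -- the parent becomes a leaf exactly if the removed vertex was its last child
  have hlast : p ≠ 0 → (deg p - 1 = 1 ↔
      ∀ y, 0 < y → y < q → par y = p → ∃ j < h + 1, Q j = y) := by
    intro hp0
    have h1 := hdeg p hpq hpn'
    rw [Function.update_self] at h1
    rw [h1, degOf_eq_one_iff]
    · constructor
      · intro h2 y hy0 hy hyp
        by_contra hne
        push Not at hne
        refine h2 y ?_ hyp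
        rw [hSdef, Finset.mem_filter, Finset.mem_Ico]
        exact ⟨⟨hy0, hy⟩, fun j hj => by rw [hQ j (by omega)]; exact hne j hj⟩
      · intro h2 y hy hyp
        rw [hSdef, Finset.mem_filter, Finset.mem_Ico] at hy
        obtain ⟨j, hj, hjy⟩ := h2 y (by omega) hy.1.2 hyp
        exact hy.2 j hj (by rw [hQ j (by omega), hjy])
    · rw [hSdef, Finset.mem_filter, Finset.mem_Ico]
      exact ⟨⟨by omega, hpq⟩, fun j hj => by rw [hQ j (by omega)]; exact hpn' j hj⟩
  have hpt : ∀ i < t, Q i ≠ p := by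
    intro i hi hip
    obtain ⟨j, hj, hjh, hjQ⟩ := hp.child i hi (Q h) hr.1 hr.2 (by rw [← hpar, hip])
    have := hp.inj j (by omega) h hh hjQ
    omega
  have htt : t' = t ∨ t' = t + 1 := by omega
  constructor
  · omega
  · intro i hi
    by_cases hit : i < t
    · rw [hQ i hit]; exact hp.range i hit
    · have : i = t := by omega
      subst this
      rcases ht with ⟨h1, -, -, h2⟩ | ⟨-, h2⟩
      · rw [h2]; omega
      · omega
  · intro i hi j hj hij
    by_cases hit : i < t <;> by_cases hjt : j < t
    · rw [hQ i hit, hQ j hjt] at hij; exact hp.inj i hit j hjt hij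
    · have : j = t := by omega
      subst this
      rw [hQ i hit] at hij
      exact absurd (hij.trans (by omega)) (hpt i hit)
    · have : i = t := by omega
      subst this
      rw [hQ j hjt] at hij
      exact absurd (hij.symm.trans (by omega)) (hpt j hjt)
    · omega
  · intro i hi y hy0 hy hyi
    by_cases hit : i < t
    · rw [hQ i hit] at hyi
      obtain ⟨j, h1, h2, h3⟩ := hp.child i hit y hy0 hy hyi
      exact ⟨j, h1, by omega, by rw [hQ j (by omega), h3]⟩
    · have : i = t := by omega
      subst this
      rcases ht with ⟨h1, h2, h3, h4⟩ | ⟨-, h2⟩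
      · obtain ⟨j, hj, hjy⟩ := (hlast h1).1 h2 y hy0 hy (by rw [hyi, h4])
        exact ⟨j, by omega, hj, by rw [hQ j (by omega), hjy]⟩
      · omega
  · intro x hx0 hx hch
    have hch' : ∀ y, 0 < y → y < q → par y = x → ∃ j < h + 1, Q j = y := fun y hy0 hy hyx => by
      obtain ⟨j, hj, hjy⟩ := hch y hy0 hy hyx
      exact ⟨j, hj, by rw [← hQ j (by omega), hjy]⟩
    by_cases hxp : x = p
    · subst hxp
      have h1 := (hlast (by omega)).2 hch'
      rcases ht with ⟨-, -, h3, h4⟩ | ⟨h2, -⟩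
      · exact ⟨t, by omega, h4⟩
      · exact absurd ⟨by omega, h1⟩ h2
    · obtain ⟨i, hi, hix⟩ := hp.leaf x hx0 hx fun y hy0 hy hyx => by
        obtain ⟨j, hj, hjy⟩ := hch' y hy0 hy hyx
        refine ⟨j, ?_, hjy⟩
        have : j ≠ h := by rintro rfl; rw [← hjy, ← hpar] at hyx; exact hxp hyx.symm
        omega
      exact ⟨i, by omega, by rw [hQ i hi, hix]⟩
  · intro x hx hxn
    exact hdeg x hx fun j hj => by rw [← hQ j (by omega)]; exact hxn j hj
  · intro x hx hxn
    exact hsum x hx fun j hj => by rw [← hQ j (by omega)]; exact hxn j hj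
  · intro j hj
    rw [hQ j (by omega), Function.update_of_ne (hpn' j hj)]
    rcases Nat.lt_succ_iff_lt_or_eq.1 hj with hj | rfl
    · exact hp.par_eq j hj
    · exact hp.sum_head hh

end IsPeel

end

variable {F : Type u} [Field F] {w n m q k N l lo : ℕ} {σ τ : RamState F} {pn nd par dep : ℕ → ℕ}
  {M' : ℕ → ℕ → F} {piv : List (ℕ × ℕ)} {ops : List (ℕ × ℕ × F)} {NL : ℕ → List ℕ}
  {T : SimpleGraph (Fin q)} {B : Fin q → Finset (Fin n ⊕ Fin m)} {M : Matrix (Fin n) (Fin m) F}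

/-! ### Programs: loading the input and ordering the tree

The segments `0` to `11` and the field segments `0` to `4` are those of the input and output formats
(segment `6` is extended behind the given bags). The others are used as follows.

* word `12`: the constants `1` (offset 0) and `0` (offset 1); word `13`: `n + m` (offset 0) and
  `q - 1` (offset 1); field `10`, `11`, `12`: the constants `1`, `-1`, `0`;
* word `16`–`29`: scalar variables, at offset `0`; field `13`–`15`: scalar variables;
* word `30`, `31`, `32`: for the vertices of the tree the degrees, the sums of the neighbours, and
  the queue of leaves;
* field `5`: the matrix as a table with rows of length `m`. -/

/-- The registers that hold constants. -/
structure HoldsConsts (n m q : ℕ) (σ : RamState F) : Prop where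
  one : σ.word 12 0 = 1
  zero : σ.word 12 1 = 0
  rows : σ.word 0 0 = n
  cols : σ.word 0 1 = m
  nodes : σ.word 0 3 = q
  total : σ.word 13 0 = n + m
  edges : σ.word 13 1 = q - 1
  fone : σ.fld 10 0 = 1
  fneg : σ.fld 11 0 = -1
  fzero : σ.fld 12 0 = 0

theorem HoldsConsts.frame {ws fs : List ℕ} (h : HoldsConsts n m q σ) (hF : σ.Frame ws fs τ)
    (h0 : 0 ∉ ws := by decide) (h12 : 12 ∉ ws := by decide) (h13 : 13 ∉ ws := by decide)
    (f10 : 10 ∉ fs := by decide) (f11 : 11 ∉ fs := by decide) (f12 : 12 ∉ fs := by decide) :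
    HoldsConsts n m q τ := by
  obtain ⟨a1, a2, a3, a4, a5, a6, a7, a8, a9, a10⟩ := h
  constructor <;> simpa only [hF.word h0, hF.word h12, hF.word h13, hF.fld f10, hF.fld f11,
    hF.fld f12]

/-- Store the constants. -/
def setup : RamProgram := block [
  .wordConst (reg 12) 1,
  .wordOp .add (reg 13) (.dir 0 0) (.dir 0 1),
  .wordOp .sub (.dir 13 1) (.dir 0 3) (reg 12),
  .fieldOne (reg 10),
  .fieldOp .sub (reg 11) (reg 12) (reg 10)]

theorem setup_spec (hn : σ.word 0 0 = n) (hm : σ.word 0 1 = m) (hq : σ.word 0 3 = q)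
    (h12 : σ.word 12 1 = 0) (hf : σ.fld 12 0 = 0) (hw : n + m + q + 2 < 2 ^ w) :
    WP w setup σ 5 fun τ => σ.Frame [12, 13] [10, 11] τ ∧ HoldsConsts n m q τ := by
  refine WP.block ?_ le_rfl
  simp [hn, hm, hq]
  refine ⟨by rintro rfl; simp at hw, by omega, by omega, ?_⟩
  constructor <;> simp [h12, hf, hn, hm, hq]

/-- Store the matrix as a table. -/
def loadMatrix : RamProgram :=
  forRange 16 zeroAddr (.dir 0 2) (block [
    .wordOp .mul (reg 20) (arr 1 16) (.dir 0 1),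
    .wordOp .add (reg 20) (reg 20) (arr 2 16),
    .fieldMove (arr 5 20) (arr 0 16)])

theorem loadMatrix_spec (M : Fin n → Fin m → F) (L : List (Fin n × Fin m))
    (hL : ∀ i j, (i, j) ∈ L ↔ M i j ≠ 0) (hc : HoldsConsts n m q σ) (hz : σ.word 0 2 = L.length)
    (h1 : σ.word 1 = fun i => (L.map fun e => (e.1 : ℕ)).getD i 0)
    (h2 : σ.word 2 = fun i => (L.map fun e => (e.2 : ℕ)).getD i 0)
    (h3 : σ.fld 0 = fun i => (L.map fun e => M e.1 e.2).getD i 0) (h5 : σ.fld 5 = fun _ => 0)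
    (hw : n * m < 2 ^ w) (hw' : L.length < 2 ^ w) :
    WP w loadMatrix σ (L.length * 5 + 2) fun τ => σ.Frame [16, 20] [5] τ ∧
      ∀ (i : Fin n) (j : Fin m), τ.fld 5 (i * m + j) = M i j := by
  have hm := hc.cols
  have hone := hc.one
  refine WP.forRange 0 L.length 3 (fun e τ => σ.Frame [16, 20] [5] τ ∧ τ.word 16 0 = e ∧
      ∀ (i : Fin n) (j : Fin m), τ.fld 5 (i * m + j) = if (i, j) ∈ L.take e then M i j else 0)
      (by simp [hc.zero]) ?_ ?_ ?_ ?_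
  · simp [h5]
  · rintro i τ ⟨hF, h, -⟩
    simp [h, hF.word, hz]
  · rintro e τ - he ⟨hF, hv, hM⟩
    have hi := (L[e]).1.2
    have hj := (L[e]).2.2
    have hlt : (L[e].1 : ℕ) * m + L[e].2 < n * m := addr_lt hi hj
    refine WP.block ?_
    simp [hF.word, hF.fld, hv, hm, h1, h2, h3, he, hone, hF]
    refine ⟨by omega, by omega, fun i j => ?_⟩
    have hmem : (i, j) ∈ L.take (e + 1) ↔ (i, j) ∈ L.take e ∨ (i, j) = L[e] := by
      rw [List.take_succ_eq_append_getElem he, List.mem_append, List.mem_singleton]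
    simp only [Function.update_apply, addr_inj j.2 hj, hM, hmem]
    by_cases hc : (i, j) = L[e]
    · simp [← hc]
    · have : ¬ ((i : ℕ) = L[e].1 ∧ (j : ℕ) = L[e].2) := fun h =>
        hc (Prod.ext (Fin.ext h.1) (Fin.ext h.2))
      simp [this, hc]
  · rintro τ ⟨hF, hv, hM⟩
    refine ⟨hF, fun i j => ?_⟩
    rw [hM, List.take_length]
    split_ifs with h
    · rfl
    · rw [hL, not_not] at h; exact h.symm

/-- Compute the degrees and the sums of the neighbours. -/
def countNeighbours : RamProgram :=
  forRange 16 zeroAddr (.dir 13 1) (block [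
    .wordMove (reg 20) (arr 3 16),
    .wordMove (reg 21) (arr 4 16),
    .wordOp .add (arr 30 20) (arr 30 20) (reg 12),
    .wordOp .add (arr 30 21) (arr 30 21) (reg 12),
    .wordOp .add (arr 31 20) (arr 31 20) (reg 21),
    .wordOp .add (arr 31 21) (arr 31 21) (reg 20)])

theorem countNeighbours_spec {L : List (Fin q × Fin q)} (hc : HoldsConsts n m q σ)
    (hL : L.length = q - 1) (h3 : σ.word 3 = fun i => (L.map fun e => (e.1 : ℕ)).getD i 0)
    (h4 : σ.word 4 = fun i => (L.map fun e => (e.2 : ℕ)).getD i 0) (h30 : σ.word 30 = fun _ => 0)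
    (h31 : σ.word 31 = fun _ => 0) (hw : 2 * (q + 1) * (q + 1) < 2 ^ w) :
    WP w countNeighbours σ (q * 8 + 2) fun τ => σ.Frame [16, 20, 21, 30, 31] [] τ ∧
      (∀ x, τ.word 30 x = (L.map fun e => (if (e.1 : ℕ) = x then 1 else 0) +
        if (e.2 : ℕ) = x then 1 else 0).sum) ∧
      (∀ x, τ.word 31 x = (L.map fun e => (if (e.1 : ℕ) = x then (e.2 : ℕ) else 0) +
        if (e.2 : ℕ) = x then (e.1 : ℕ) else 0).sum)  ∧
      (∀ x, τ.word 30 x < 2 ^ w) ∧ ∀ x, τ.word 31 x < 2 ^ w := by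
  have hone := hc.one
  have h2q : 2 * q + 2 < 2 ^ w := by nlinarith
  refine WP.forRange 0 L.length 6 (fun e τ => σ.Frame [16, 20, 21, 30, 31] [] τ ∧ τ.word 16 0 = e ∧
      (∀ x, τ.word 30 x ≤ 2 * e) ∧ (∀ x, τ.word 31 x ≤ 2 * e * q) ∧
      (∀ x, τ.word 30 x = ((L.take e).map fun e => (if (e.1 : ℕ) = x then 1 else 0) +
        if (e.2 : ℕ) = x then 1 else 0).sum) ∧
      (∀ x, τ.word 31 x = ((L.take e).map fun e => (if (e.1 : ℕ) = x then (e.2 : ℕ) else 0) +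
        if (e.2 : ℕ) = x then (e.1 : ℕ) else 0).sum))
      (by simp [hc.zero]) ?_ ?_ ?_ ?_ (hT := by rw [hL]; omega)
  · simp [h30, h31]
  · rintro i τ ⟨hF, h, -⟩
    simp [h, hF.word, hc.edges, hL]
  · rintro e τ - he ⟨hF, hv, hb, hb', hd, hs⟩
    have hi := (L[e]).1.2
    have hj := (L[e]).2.2
    have hb1 := hb L[e].1
    have hb2 := hb L[e].2
    have hb3 := hb' L[e].1
    have hb4 := hb' L[e].2
    have hsum : 2 * e * q + 2 * q < 2 ^ w := by
      have : e * q ≤ q * q := Nat.mul_le_mul_right _ (by omega)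
      nlinarith
    have hsum' : 2 * (e + 1) * q = 2 * e * q + 2 * q := by ring
    refine WP.block ?_
    simp [hF.word, hF.fld, hv, h3, h4, he, hone, hF,
      Function.update_apply]
    refine ⟨by omega, by omega, by omega, by clear hd hs hb hb'; split_ifs <;> simp_all <;> omega,
        by omega,
      by clear hd hs hb hb'; split_ifs <;> simp_all <;> omega, fun x => ?_, fun x => ?_, fun x =>
      ?_, fun x => ?_⟩
    · have := hb x
      clear hd hs hb hb'
      split_ifs <;> simp_all <;> omega
    · have := hb' x
      clear hd hs hb hb'
      split_ifs <;> simp_all <;> omega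
    · rw [← List.map_take, ← hd x]
      simp only [eq_comm (b := x)]
      clear hd hs hb hb'
      split_ifs <;> simp_all
    · rw [← List.map_take, ← hs x]
      simp only [eq_comm (b := x)]
      clear hd hs hb hb'
      split_ifs <;> simp_all <;> omega
  · rintro τ ⟨hF, hv, hb, hb', hd, hs⟩
    rw [List.take_length] at hd hs
    have h1 : 2 * L.length * q ≤ 2 * (q + 1) * (q + 1) :=
      Nat.mul_le_mul (by omega) (by omega)
    exact ⟨hF, hd, hs, fun x => lt_of_le_of_lt (hb x) (by omega),
      fun x => lt_of_le_of_lt (hb' x) (by omega)⟩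

/-- Append the content of the scalar variable `x` to the queue. -/
def pushLeaf (x : ℕ) : RamProgram :=
  block [.wordMove (arr 32 29) (reg x), .wordOp .add (reg 29) (reg 29) (reg 12)]

/-- Put the leaves other than the root into the queue. -/
def findLeaves : RamProgram :=
  forRange 16 (reg 12) (.dir 0 3) (.branch (.wordEq (arr 30 16) (reg 12)) (pushLeaf 16) .skip)

theorem findLeaves_spec (hc : HoldsConsts n m q σ) (hq : 0 < q) (h29 : σ.word 29 0 = 0)
    (hw : q + 1 < 2 ^ w) :
    WP w findLeaves σ (q * 5 + 2) fun τ => σ.Frame [16, 29, 32] [] τ ∧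
      (∀ i < τ.word 29 0, 0 < τ.word 32 i ∧ τ.word 32 i < q ∧ σ.word 30 (τ.word 32 i) = 1) ∧
      (∀ i < τ.word 29 0, ∀ j < τ.word 29 0, τ.word 32 i = τ.word 32 j → i = j) ∧
      (∀ x, 0 < x → x < q → σ.word 30 x = 1 → ∃ i < τ.word 29 0, τ.word 32 i = x) ∧
      τ.word 29 0 ≤ q := by
  have hone := hc.one
  refine WP.forRange 1 q 3 (fun v τ => σ.Frame [16, 29, 32] [] τ ∧ τ.word 16 0 = v ∧
      (∀ i < τ.word 29 0, 0 < τ.word 32 i ∧ τ.word 32 i < v ∧ σ.word 30 (τ.word 32 i) = 1) ∧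
      (∀ i < τ.word 29 0, ∀ j < τ.word 29 0, τ.word 32 i = τ.word 32 j → i = j) ∧
      (∀ x, 0 < x → x < v → σ.word 30 x = 1 → ∃ i < τ.word 29 0, τ.word 32 i = x) ∧
      τ.word 29 0 < v)
      (by simp [hone]) ?_ ?_ ?_ ?_
  · simp [h29]
    omega
  · rintro i τ ⟨hF, h, -⟩
    simp [h, hF.word, hc.nodes]
  · rintro v τ hv1 hvq ⟨hF, hv, h1, h2, h3, h4⟩
    refine WP.branch (fun hb => ?_) fun hb => ?_
    · simp [hv, hF.word, hone] at hb
      refine WP.block ?_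
      simp [hF.word, hF.fld, hv, hone, hF, Function.update_apply]
      refine ⟨by omega, by omega, fun i hi => ?_, fun i hi j hj => ?_, fun x hx hxv hx1 => ?_, h4⟩
      · split_ifs with hit
        · exact ⟨by omega, by omega, hb⟩
        · have := h1 i (by omega)
          exact ⟨this.1, by omega, this.2.2⟩
      · split_ifs with hit hjt hjt
        · omega
        · have := h1 j (by omega); omega
        · have := h1 i (by omega); omega
        · exact h2 i (by omega) j (by omega)
      · by_cases hxe : x = v
        · exact ⟨τ.word 29 0, by omega, by simp [hxe]⟩
        · obtain ⟨i, hi, hix⟩ := h3 x hx (by omega) hx1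
          exact ⟨i, by omega, by rw [if_neg (by omega)]; exact hix⟩
    · simp [hv, hF.word, hone] at hb
      refine WP.skip ?_
      simp [hF.word, hv, hone, hF]
      refine ⟨fun i hi => ?_, h2, fun x hx hxv hx1 => ?_, by omega⟩
      · have := h1 i hi
        exact ⟨this.1, by omega, this.2.2⟩
      · have : x ≠ v := by rintro rfl; exact hb hx1
        exact h3 x hx (by omega) hx1
  · rintro τ ⟨hF, hv, h1, h2, h3, h4⟩
    exact ⟨hF, h1, h2, h3, h4.le⟩

/-- Remove the leaves one by one. -/
def peelLeaves : RamProgram :=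
  forRange 16 zeroAddr (.dir 13 1) (
    block [
      .wordMove (reg 20) (arr 32 16),
      .wordMove (reg 21) (arr 31 20),
      .wordOp .sub (arr 31 21) (arr 31 21) (reg 20),
      .wordOp .sub (arr 30 21) (arr 30 21) (reg 12)] ;;
    .branch (.wordEq (reg 21) zeroAddr) .skip
      (.branch (.wordEq (arr 30 21) (reg 12)) (pushLeaf 21) .skip))

theorem peelLeaves_spec (hT : IsRooting T par dep) (hc : HoldsConsts n m q σ)
    (hp : IsPeel q par 0 (σ.word 29 0) (σ.word 32) (σ.word 30) (σ.word 31))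
    (hb30 : ∀ x, σ.word 30 x < 2 ^ w) (hb31 : ∀ x, σ.word 31 x < 2 ^ w) (hw : q + 1 < 2 ^ w) :
    WP w peelLeaves σ (q * 10 + 2) fun τ => σ.Frame [16, 20, 21, 29, 30, 31, 32] [] τ ∧
      IsPeel q par (q - 1) (τ.word 29 0) (τ.word 32) (τ.word 30) (τ.word 31) := by
  have hone := hc.one
  have hzero := hc.zero
  refine WP.forRange 0 (q - 1) 8 (fun h τ => σ.Frame [16, 20, 21, 29, 30, 31, 32] [] τ ∧
      τ.word 16 0 = h ∧ IsPeel q par h (τ.word 29 0) (τ.word 32) (τ.word 30) (τ.word 31) ∧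
      (∀ x, τ.word 30 x < 2 ^ w) ∧ (∀ x, τ.word 31 x < 2 ^ w))
      (by simp [hzero]) ?_ ?_ ?_ ?_ (hT := ?_)
  · simp [hp, hb30, hb31]
  · rintro i τ ⟨hF, h, -⟩
    simp [h, hF.word, hc.edges]
  · rintro h τ - hh ⟨hF, hv, hp, hb30, hb31⟩
    have hlt := hp.lt hT hh
    have hr := hp.range h hlt
    have hs := hp.sum_head hlt
    have hpq := hT.par_lt _ hr.1 hr.2
    have htq : τ.word 29 0 < q := by
      have : ((Finset.range (τ.word 29 0)).image (τ.word 32)).card ≤ (Finset.Ico 1 q).card := by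
        refine Finset.card_le_card fun x hx => ?_
        simp only [Finset.mem_image, Finset.mem_range] at hx
        obtain ⟨i, hi, rfl⟩ := hx
        have := hp.range i hi
        simp; omega
      rw [Finset.card_image_of_injOn, Finset.card_range, Nat.card_Ico] at this
      · omega
      · intro i hi j hj hij
        simp only [Finset.coe_range, Set.mem_Iio] at hi hj
        exact hp.inj i hi j hj hij
    have hb1 := hb30 (par (τ.word 32 h))
    have hb2 := hb31 (par (τ.word 32 h))
    refine WP.block_seq 4 ?_
    simp [hF.word, hF.fld, hv, hs, hone, hF]
    iterate 4 refine ⟨by omega, ?_⟩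
    refine (WP.branch (T := 3) (fun hb => ?_) fun hb => ?_).time (by omega)
    · simp [hF.word, hzero] at hb
      refine WP.skip ?_
      simp [hv, hF.word, hone, hF]
      refine ⟨?_, ?_, ?_⟩
      · exact hp.pop hT hlt rfl (fun _ _ => rfl) (Or.inr ⟨by simp [hb], rfl⟩)
      · intro x; rw [Function.update_apply]; split_ifs; omega; exact hb30 x
      · intro x; rw [Function.update_apply]; split_ifs; omega; exact hb31 x
    · simp [hF.word, hzero] at hb
      refine (WP.branch (T := 2) (fun hb' => ?_) fun hb' => ?_).time (by omega)
      · simp [hF.word, hone] at hb'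
        refine WP.block ?_
        simp [hF.word, hF.fld, hv, hone, hF]
        refine ⟨by omega, by omega, ?_, ?_, ?_⟩
        · exact hp.pop hT hlt rfl (fun i hi => Function.update_of_ne (by omega) _ _)
            (Or.inl ⟨hb, by omega, rfl, by simp⟩)
        · intro x; rw [Function.update_apply]; split_ifs; omega; exact hb30 x
        · intro x; rw [Function.update_apply]; split_ifs; omega; exact hb31 x
      · simp [hF.word, hone] at hb'
        refine WP.skip ?_
        simp [hv, hF.word, hone, hF]
        refine ⟨?_, ?_, ?_⟩
        · exact hp.pop hT hlt rfl (fun _ _ => rfl) (Or.inr ⟨by simp [hb, hb'], rfl⟩)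
        · intro x; rw [Function.update_apply]; split_ifs; omega; exact hb30 x
        · intro x; rw [Function.update_apply]; split_ifs; omega; exact hb31 x
  · rintro τ ⟨hF, hv, hp, -⟩
    exact ⟨hF, hp⟩
  · have : (q - 1 - 0) * (8 + 2) ≤ q * 10 := Nat.mul_le_mul (by omega) (by omega)
    omega

/-! ### Programs: building the layout

Scalars: word `14` is the number of slots, word `15` the number of the next node. Arrays: word `6`
labels of the slots, `33` their nodes, `34` their parents; word `35` first slots of the nodes,
`37` parents, `38`, `39` children, `40` siblings of the nodes; word `41` topmost copies of the
bags. -/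

/-- Create the node `x + 1` from the bag of `x`, for all `x`. -/
def baseNodes : RamProgram :=
  forRange 16 zeroAddr (.dir 0 3) (
    block [
      .wordOp .add (reg 20) (reg 16) (reg 12),
      .wordMove (arr 35 20) (arr 5 16),
      .wordMove (arr 41 16) (reg 20)] ;;
    forRange 17 (arr 5 16) (arr 5 20) (block [.wordMove (arr 33 17) (reg 20)])) ;;
  block [
    .wordOp .add (reg 15) (.dir 0 3) (reg 12),
    .wordMove (arr 35 15) (.ind 5 0 3),
    .wordMove (reg 14) (arr 35 15)]

theorem baseNodes_spec (hc : HoldsConsts n m q σ) (hmono : ∀ x < q, σ.word 5 x ≤ σ.word 5 (x + 1))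
    (hsize : ∀ x < q, σ.word 5 (x + 1) ≤ σ.word 5 x + k) (h35 : σ.word 35 0 = 0)
    (hw : ∀ x ≤ q, σ.word 5 x < 2 ^ w) (hq : q + 1 < 2 ^ w) :
    WP w baseNodes σ (q * (k * 3 + 7) + 5) fun τ =>
      σ.Frame [14, 15, 16, 17, 20, 33, 35, 41] [] τ ∧ τ.word 15 0 = q + 1 ∧
      τ.word 14 0 = σ.word 5 q ∧ τ.word 35 0 = 0 ∧ (∀ x ≤ q, τ.word 35 (x + 1) = σ.word 5 x) ∧
      (∀ x < q, τ.word 41 x = x + 1) ∧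
      ∀ x < q, ∀ s, σ.word 5 x ≤ s → s < σ.word 5 (x + 1) → τ.word 33 s = x + 1 := by
  have hone := hc.one
  have hle : ∀ x y, x ≤ y → y ≤ q → σ.word 5 x ≤ σ.word 5 y := by
    intro x y hxy
    induction y, hxy using Nat.le_induction with
    | base => intro _; exact le_rfl
    | succ y hxy ih => intro hy; exact (ih (by omega)).trans (hmono y (by omega))
  refine (WP.comp (T₁ := q * (k * 3 + 7) + 2) (T₂ := 3) (WP.forRange 0 q (k * 3 + 5) (fun x τ =>
      σ.Frame [14, 15, 16, 17, 20, 33, 35, 41] [] τ ∧ τ.word 16 0 = x ∧ τ.word 35 0 = 0 ∧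
      (∀ y < x, τ.word 35 (y + 1) = σ.word 5 y) ∧ (∀ y < x, τ.word 41 y = y + 1) ∧
      ∀ y < x, ∀ s, σ.word 5 y ≤ s → s < σ.word 5 (y + 1) → τ.word 33 s = y + 1)
      (by simp [hc.zero]) ?_ ?_ ?_ (fun τ hτ => hτ) (hT := by simp)) ?_).time (by omega)
  · simp [h35]
  · rintro i τ ⟨hF, h, -⟩
    simp [h, hF.word, hc.nodes]
  · rintro x τ - hx ⟨hF, hv, h0, h1, h2, h3⟩
    refine WP.block_seq (k * 3 + 2) ?_
    simp [hF.word, hF.fld, hv, hone]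
    refine ⟨by omega, hw x hx.le, by omega, ?_⟩
    set τ₁ : RamState F := ((τ.sw 20 0 (x + 1)).sw 35 (x + 1) (σ.word 5 x)).sw 41 x (x + 1) with hτ₁
    have hF₁ : σ.Frame [14, 15, 16, 17, 20, 33, 35, 41] [] τ₁ := by simp [hτ₁, hF]
    refine WP.forRange (σ.word 5 x) (σ.word 5 (x + 1)) 1 (fun s ρ =>
      τ₁.Frame [17, 33] [] ρ ∧ ρ.word 17 0 = s ∧
      (∀ t, ρ.word 33 t = if σ.word 5 x ≤ t ∧ t < s then x + 1 else τ₁.word 33 t))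
      (by simp [hτ₁, hF.word, hv]) ?_ ?_ ?_ ?_ (hlo := hmono x hx) (hw := hw _ (by omega)) (hT := ?_)
    · simp
    · rintro i ρ ⟨hG, h, -⟩
      simp [h, hG.word, hτ₁, hF.word]
    · rintro s ρ hs1 hs2 ⟨hG, hv', h33⟩
      refine WP.block ?_
      simp [hG.word, hF₁.word, hv', hone, hG]
      simp [hτ₁, Function.update_apply, h33]
      refine ⟨by omega, fun t => ?_⟩
      split_ifs <;> first | rfl | omega
    · rintro ρ ⟨hG, hv', h33⟩
      have e35 : ρ.word 35 = τ₁.word 35 := hG.word (by decide)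
      have e41 : ρ.word 41 = τ₁.word 41 := hG.word (by decide)
      have hGF := hF₁.trans hG (ws' := [17, 33]) (by decide) (by decide)
      have w16 : ρ.word 16 0 = x := by simp [hG.word, hτ₁, hv]
      simp [w16, hGF, hGF.word, hone, e35, e41]
      refine ⟨?_, ?_, ?_, ?_⟩
      · simp [hτ₁, h0]
      · intro y hy
        simp [hτ₁, Function.update_apply]
        split_ifs with hyx
        · rw [hyx]
        · exact h1 y (by omega)
      · intro y hy
        simp [hτ₁, Function.update_apply]
        split_ifs with hyx
        · omega
        · exact h2 y (by omega)
      · intro y hy s hs1 hs2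
        simp [h33, hτ₁]
        by_cases hyx : y = x
        · subst hyx; simp [hs1, hs2]
        · rw [if_neg]
          · exact h3 y (by omega) s hs1 hs2
          · have := hle (y + 1) x (by omega) hx.le; omega
    · have := hsize x hx
      have : (σ.word 5 (x + 1) - σ.word 5 x) * (1 + 2) ≤ k * 3 := Nat.mul_le_mul_right _ (by omega)
      omega
  · rintro τ ⟨hF, hv, h0, h1, h2, h3⟩
    refine WP.block ?_
    simp [hF.word, hF.fld, hv, hone, hc.nodes, hF,
      Function.update_apply, h0]
    refine ⟨hq, hw q le_rfl, fun x hx => ?_, h2, h3⟩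
    split_ifs with hxq
    · rw [hxq]
    · exact h1 x (by omega)

/-- Copy the slots of the node `word 22` to the end of the list of slots, as slots of the new node
`word 15`, and link the copied slots and the slots of the node `word 23` to the copies. -/
def copySlots : RamProgram :=
  forRange 17 (arr 35 22) (arr 35 24) (
    block [
      .wordMove (arr 6 14) (arr 6 17),
      .wordMove (arr 33 14) (reg 15),
      .wordOp .add (reg 26) (reg 14) (reg 12),
      .wordMove (arr 34 17) (reg 26)] ;;
    forRange 18 (arr 35 23) (arr 35 25)
      (.branch (.wordEq (arr 6 18) (arr 6 17)) (block [.wordMove (arr 34 18) (reg 26)]) .skip) ;;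
    block [.wordMove (reg 14) (reg 26)])

theorem copySlots_spec {K a b ga gb gb' e : ℕ} (hone : σ.word 12 0 = 1) (h22 : σ.word 22 0 = a)
    (h24 : σ.word 24 0 = a + 1) (h23 : σ.word 23 0 = b) (h25 : σ.word 25 0 = b + 1)
    (h14 : σ.word 14 0 = N) (h15 : σ.word 15 0 = K) (ha : σ.word 35 a = ga)
    (ha' : σ.word 35 (a + 1) = ga + e) (hb : σ.word 35 b = gb) (hb' : σ.word 35 (b + 1) = gb')
    (hgb : gb ≤ gb') (he : e ≤ k) (hbk : gb' ≤ gb + k) (haN : ga + e ≤ N) (hbN : gb' ≤ N)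
    (hdis : ∀ s, ga ≤ s → s < ga + e → ¬ (gb ≤ s ∧ s < gb')) (hw : N + e < 2 ^ w) (hK : K < 2 ^ w)
    (hlabw : ∀ s < N, σ.word 6 s < 2 ^ w) :
    WP w copySlots σ (k * (k * 4 + 9) + 2) fun τ =>
      σ.Frame [6, 14, 17, 18, 26, 33, 34] [] τ ∧ τ.word 14 0 = N + e ∧
      (∀ s < N, τ.word 6 s = σ.word 6 s) ∧ (∀ j < e, τ.word 6 (N + j) = σ.word 6 (ga + j)) ∧
      (∀ s < N, τ.word 33 s = σ.word 33 s) ∧ (∀ j < e, τ.word 33 (N + j) = K) ∧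
      (∀ j < e, τ.word 34 (ga + j) = N + j + 1) ∧
      (∀ t, gb ≤ t → t < gb' → (∃ j < e, σ.word 6 (ga + j) = σ.word 6 t ∧ τ.word 34 t = N + j + 1) ∨
        ((∀ j < e, σ.word 6 (ga + j) ≠ σ.word 6 t) ∧ τ.word 34 t = σ.word 34 t)) ∧
      ∀ s, ¬ (ga ≤ s ∧ s < ga + e) → ¬ (gb ≤ s ∧ s < gb') → τ.word 34 s = σ.word 34 s := by
  refine WP.forRange ga (ga + e) (k * 4 + 7) (fun s τ => ∃ i, s = ga + i ∧
      σ.Frame [6, 14, 17, 18, 26, 33, 34] [] τ ∧ τ.word 17 0 = ga + i ∧ τ.word 14 0 = N + i ∧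
      (∀ s < N, τ.word 6 s = σ.word 6 s) ∧ (∀ j < i, τ.word 6 (N + j) = σ.word 6 (ga + j)) ∧
      (∀ s < N, τ.word 33 s = σ.word 33 s) ∧ (∀ j < i, τ.word 33 (N + j) = K) ∧
      (∀ j < i, τ.word 34 (ga + j) = N + j + 1) ∧
      (∀ t, gb ≤ t → t < gb' → (∃ j < i, σ.word 6 (ga + j) = σ.word 6 t ∧ τ.word 34 t = N + j + 1) ∨
        ((∀ j < i, σ.word 6 (ga + j) ≠ σ.word 6 t) ∧ τ.word 34 t = σ.word 34 t)) ∧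
      ∀ s, ¬ (ga ≤ s ∧ s < ga + i) → ¬ (gb ≤ s ∧ s < gb') → τ.word 34 s = σ.word 34 s)
      (by simp [h22, ha]) ?_ ?_ ?_ ?_ (hT := ?_)
  · refine ⟨0, by simp, ?_⟩
    simp [h14]
  · rintro s τ ⟨i, rfl, hF, h, -⟩
    simp [h, hF.word, h24, ha']
  · rintro s τ hs1 hs2 ⟨i, rfl, hF, hv, hN, l1, l2, n1, n2, u1, u2, u3⟩
    have hi : i < e := by omega
    have hl := hlabw (ga + i) (by omega)
    have hli := l1 (ga + i) (by omega)
    refine WP.block_seq (k * 4 + 3) ?_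
    simp [hF.word, hF.fld, hv, hone, hN, h15, hli]
    refine ⟨hl, hK, by omega, ?_⟩
    set τ₁ : RamState F := (((τ.sw 6 (N + i) (σ.word 6 (ga + i))).sw 33 (N + i) K).sw 26 0
      (N + i + 1)).sw 34 (ga + i) (N + i + 1) with hτ₁
    have hF₁ : σ.Frame [6, 14, 17, 18, 26, 33, 34] [] τ₁ := by simp [hτ₁, hF]
    have e6 : ∀ s < N, τ₁.word 6 s = σ.word 6 s := fun s hs => by
      simp [hτ₁, Function.update_apply]
      rw [if_neg (by omega), l1 s hs]
    refine (WP.comp (T₁ := k * 4 + 2) (T₂ := 1) (WP.forRange gb gb' 2 (fun t ρ =>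
      τ₁.Frame [18, 34] [] ρ ∧ ρ.word 18 0 = t ∧ ∀ x, ρ.word 34 x =
        if gb ≤ x ∧ x < t ∧ σ.word 6 x = σ.word 6 (ga + i) then N + i + 1 else τ₁.word 34 x)
      (by simp [hF₁.word, h23, hb]) ?_ ?_ ?_ (fun ρ hρ => hρ) (hlo := hgb) (hT := ?_)) ?_).time
      (by omega)
    · simp
      intro t h1 h2; omega
    · rintro t ρ ⟨hG, h, -⟩
      simp [h, hG.word, hF₁.word, h25, hb']
    · rintro t ρ ht1 ht2 ⟨hG, hv', h34⟩
      have ev : τ₁.word 17 0 = ga + i := by simp [hτ₁, hv]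
      refine WP.branch (T := 1) (fun hb => ?_) fun hb => ?_
      · simp [hG.word, hv', ev, e6 t (by omega), e6 (ga + i) (by omega)] at hb
        refine WP.block ?_
        simp [hG.word, hF₁.word, hv', hone, hG]
        simp [hτ₁, Function.update_apply, h34]
        refine ⟨by omega, fun x => ?_⟩
        by_cases hxt : x = t
        · subst hxt; simp [ht1, hb]
        · rw [if_neg hxt]
          congr 1
          rw [eq_iff_iff]
          omega
      · simp [hG.word, hv', ev, e6 t (by omega), e6 (ga + i) (by omega)] at hb
        refine WP.skip ?_
        simp [hG.word, hF₁.word, hv', hone, hG, h34]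
        intro x
        congr 1
        rw [eq_iff_iff]
        constructor
        · rintro ⟨h1, h2, h3⟩; exact ⟨h1, by omega, h3⟩
        · rintro ⟨h1, h2, h3⟩
          have : x ≠ t := by rintro rfl; exact hb h3
          exact ⟨h1, by omega, h3⟩
    · have : (gb' - gb) * (2 + 2) ≤ k * 4 := Nat.mul_le_mul_right _ (by omega)
      omega
    · rintro ρ ⟨hG, hv', h34⟩
      have hGF := hF₁.trans hG (ws' := [18, 34]) (by decide) (by decide)
      refine WP.block ?_
      simp [hG.word, hGF.word, hone, hv, hGF, -exists_eq_left']
      have hb26 : τ₁.word 26 0 = N + i + 1 := by simp [hτ₁]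
      refine ⟨by omega, by simp [hτ₁, hv], by simp [hτ₁, hF.word, hone], i + 1, by omega, by omega,
        fun s hs => e6 s hs, fun j hj => ?_, fun s hs => ?_, fun j hj => ?_, fun j hj => ?_,
        fun t ht1 ht2 => ?_, fun s hs1 hs2 => ?_⟩
      · simp [hτ₁, Function.update_apply]
        split_ifs with hji
        · rw [hji]
        · exact l2 j (by omega)
      · simp [hτ₁, Function.update_apply]
        rw [if_neg (by omega)]; exact n1 s hs
      · simp [hτ₁, Function.update_apply]
        intro hji
        exact n2 j (by omega)
      · rw [h34, if_neg (by have := hdis (ga + j) (by omega) (by omega); omega)]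
        simp [hτ₁, Function.update_apply]
        split_ifs with hji
        · omega
        · exact u1 j (by omega)
      · rw [h34]
        split_ifs with hc
        · exact Or.inl ⟨i, by omega, hc.2.2.symm, rfl⟩
        · have hne : σ.word 6 (ga + i) ≠ σ.word 6 t := fun h => hc ⟨ht1, ht2, h.symm⟩
          have hta : t ≠ ga + i := by rintro rfl; exact hne rfl
          have e34 : τ₁.word 34 t = τ.word 34 t := by simp [hτ₁, hta]
          rw [e34]
          rcases u2 t ht1 ht2 with ⟨j, hj, h1, h2⟩ | ⟨h1, h2⟩
          · exact Or.inl ⟨j, by omega, h1, h2⟩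
          · refine Or.inr ⟨fun j hj => ?_, h2⟩
            rcases Nat.lt_succ_iff_lt_or_eq.1 hj with hj | rfl
            · exact h1 j hj
            · exact hne
      · rw [h34, if_neg (by omega)]
        have hta : s ≠ ga + i := by rintro rfl; omega
        have e34 : τ₁.word 34 s = τ.word 34 s := by simp [hτ₁, hta]
        rw [e34]
        exact u3 s (by omega) (by omega)
  · rintro τ ⟨i, hi, hF, h1, h2⟩
    have : i = e := by omega
    subst this
    exact ⟨hF, h2⟩
  · have : (ga + e - ga) * (k * 4 + 7 + 2) ≤ k * (k * 4 + 9) := Nat.mul_le_mul (by omega) (by omega)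
    omega

/-- Attach the vertices of the tree to their parents, children first. -/
def mergeNodes : RamProgram :=
  forRange 16 zeroAddr (.dir 13 1) (
    block [
      .wordMove (reg 20) (arr 32 16),
      .wordMove (reg 21) (arr 31 20),
      .wordMove (reg 22) (arr 41 21),
      .wordMove (reg 23) (arr 41 20),
      .wordOp .add (reg 24) (reg 22) (reg 12),
      .wordOp .add (reg 25) (reg 23) (reg 12),
      .wordMove (arr 37 22) (reg 15),
      .wordMove (arr 37 23) (reg 15),
      .wordMove (arr 38 15) (reg 22),
      .wordMove (arr 39 15) (reg 23),
      .wordMove (arr 40 22) (reg 23),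
      .wordMove (arr 40 23) (reg 22),
      .wordMove (arr 41 21) (reg 15)] ;;
    copySlots ;;
    block [
      .wordOp .add (reg 15) (reg 15) (reg 12),
      .wordMove (arr 35 15) (reg 14)])

/-- The layout that is stored in a state. -/
def HoldsLayout (q k : ℕ) (bag : ℕ → ℕ → Prop) (par : ℕ → ℕ) (done : ℕ → Prop) (K : ℕ) (ob : ℕ → ℕ)
    (σ : RamState F) : Prop :=
  IsLayout q k bag par done K (σ.word 35) (σ.word 6) (σ.word 33) (σ.word 34) (σ.word 37)
    (σ.word 38) (σ.word 39) (σ.word 40) (σ.word 41) ob ∧ σ.word 14 0 = σ.word 35 K ∧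
    σ.word 15 0 = K

theorem mergeNodes_spec {t : ℕ} {bag : ℕ → ℕ → Prop} {ob : ℕ → ℕ} (hT : IsRooting T par dep)
    (hc : HoldsConsts n m q σ) (hp : IsPeel q par (q - 1) t (σ.word 32) (σ.word 30) (σ.word 31))
    (hq : 0 < q) (hl : HoldsLayout q k bag par (fun _ => False) (q + 1) ob σ)
    (hob : ∀ x < q, ob (x + 1) = x) (hbag : ∀ x < q, ∀ v, bag x v → v < 2 ^ w)
    (hw : 2 * (q + 1) * (k + 1) < 2 ^ w) :
    WP w mergeNodes σ (q * (k * (k * 4 + 9) + 19) + 2) fun τ =>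
      σ.Frame [6, 14, 15, 16, 17, 18, 20, 21, 22, 23, 24, 25, 26, 33, 34, 35, 37, 38, 39, 40, 41]
        [] τ ∧
      ∃ ob, HoldsLayout q k bag par (fun x => 0 < x ∧ x < q) (2 * q) ob τ ∧
        ∀ x < q, ob (x + 1) = x := by
  have hone := hc.one
  have hwq : 2 * q + 2 < 2 ^ w := by nlinarith
  have hle := hp.le
  refine WP.forRange 0 (q - 1) (k * (k * 4 + 9) + 17) (fun i τ =>
      σ.Frame [6, 14, 15, 16, 17, 18, 20, 21, 22, 23, 24, 25, 26, 33, 34, 35, 37, 38, 39, 40, 41]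
        [] τ ∧ τ.word 16 0 = i ∧
      ∃ ob, HoldsLayout q k bag par (fun x => ∃ j < i, σ.word 32 j = x) (q + 1 + i) ob τ ∧
        ∀ x < q, ob (x + 1) = x)
      (by simp [hc.zero]) ?_ ?_ ?_ ?_ (hT := ?_)
  · refine ⟨by simp, by simp, ob, ?_, hob⟩
    simpa [HoldsLayout] using hl
  · rintro i τ ⟨hF, h, -⟩
    simp [h, hF.word, hc.edges]
  · rintro i τ - hi ⟨hF, hv, ob, ⟨hl, h14, h15⟩, hob⟩
    obtain ⟨hy0, hyq⟩ := hp.range i (by omega)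
    have hpar := hp.par_eq i hi
    have hpq := hT.par_lt _ hy0 hyq
    have hne : par (σ.word 32 i) ≠ σ.word 32 i := fun h => by
      have := hT.dep_par _ hy0 hyq
      rw [h] at this
      omega
    have hdy : ¬ ∃ j < i, σ.word 32 j = σ.word 32 i := by
      rintro ⟨j, hj, hji⟩
      have := hp.inj j (by omega) i (by omega) hji
      omega
    have hdp : ¬ ∃ j < i, σ.word 32 j = par (σ.word 32 i) := by
      rintro ⟨j, hj, hji⟩
      obtain ⟨l, hl, -, hli⟩ := hp.child j (by omega) (σ.word 32 i) hy0 hyq hji.symm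
      have := hp.inj l (by omega) i (by omega) hli
      omega
    obtain ⟨ha0, haK, hoa, -⟩ := hl.cur_spec _ hpq
    obtain ⟨hb0, hbK, hob', -⟩ := hl.cur_spec _ hyq
    set y := σ.word 32 i with hy
    set a := τ.word 41 (par y) with ha
    set b := τ.word 41 y with hb
    set K := q + 1 + i with hK
    have hab : a ≠ b := fun h => hne (by rw [← hoa, h, hob'])
    have hN : τ.word 35 K ≤ (2 * q + 1) * k :=
      hl.card_le.trans (Nat.mul_le_mul_right _ (by omega))
    have hw' : (2 * q + 1) * k + k < 2 ^ w := by nlinarith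
    have s1 := hl.bg_le a haK
    have s2 := hl.bg_le b hbK
    have s3 := hl.size a haK
    have s4 := hl.size b hbK
    have s5 := hl.bg_mono (y := a + 1) (z := K) (by omega) le_rfl
    have s6 := hl.bg_mono (y := b + 1) (z := K) (by omega) le_rfl
    obtain ⟨e, he⟩ := Nat.exists_eq_add_of_le s1
    refine WP.block_seq (k * (k * 4 + 9) + 4) ?_
    simp [hF.word, hF.fld, hv, hone, ← hy, hpar, h15, h14,
      ← ha, ← hb, hne, hne.symm, hab, hab.symm]
    iterate 11 refine ⟨by omega, ?_⟩
    set τ₁ : RamState F := ((((((((((((τ.sw 20 0 y).sw 21 0 (par y)).sw 22 0 a).sw 23 0 b).sw 24 0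
      (a + 1)).sw 25 0 (b + 1)).sw 37 a K).sw 37 b K).sw 38 K a).sw 39 K b).sw 40 a b).sw 40 b
      a).sw 41 (par y) K with hτ₁
    have hF₁ : σ.Frame [6, 14, 15, 16, 17, 18, 20, 21, 22, 23, 24, 25, 26, 33, 34, 35, 37, 38, 39,
      40, 41] [] τ₁ := by simp [hτ₁, hF]
    have hcopy := copySlots_spec (w := w) (σ := τ₁) (k := k) (N := τ.word 35 K) (K := K) (a := a)
      (b := b) (ga := τ.word 35 a) (gb := τ.word 35 b) (gb' := τ.word 35 (b + 1)) (e := e)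
      (by simp [hτ₁, hF.word, hone]) (by simp [hτ₁]) (by simp [hτ₁]) (by simp [hτ₁])
      (by simp [hτ₁]) (by simp [hτ₁, h14]) (by simp [hτ₁, h15]) (by simp [hτ₁]) (by simp [hτ₁, he])
      (by simp [hτ₁]) (by simp [hτ₁]) s2 (by omega) s4 (by omega) s6
      (fun s h1 h2 h3 => hab (by
        rw [← hl.nd_eq a haK s h1 (by omega), hl.nd_eq b hbK s h3.1 h3.2]))
      (by omega) (by omega) (fun s hs => by
        have : τ₁.word 6 s = τ.word 6 s := by simp [hτ₁]
        rw [this]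
        obtain ⟨g0, g1, g2, g3⟩ := hl.exists_node hs
        exact hbag _ (hl.node _ g0 g1).1 _ ((hl.mem _ g0 g1 _).2 ⟨s, g2, g3, rfl⟩))
    refine WP.seq (T₁ := k * (k * 4 + 9) + 2) 2 (hcopy.post ?_)
    rintro ρ ⟨hG, r14, r1, r2, r3, r4, r5, r6, r7⟩
    have hGF := hF₁.trans hG
    have r15 : ρ.word 15 0 = K := by simp [hG.word, hτ₁, h15]
    have r16 : ρ.word 16 0 = i := by simp [hG.word, hτ₁, hv]
    have e35 : ρ.word 35 = τ.word 35 := by simp [hG.word, hτ₁]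
    have e37 : ρ.word 37 = Function.update (Function.update (τ.word 37) a K) b K := by
      simp [hG.word, hτ₁]
    have e38 : ρ.word 38 = Function.update (τ.word 38) K a := by simp [hG.word, hτ₁]
    have e39 : ρ.word 39 = Function.update (τ.word 39) K b := by simp [hG.word, hτ₁]
    have e40 : ρ.word 40 = Function.update (Function.update (τ.word 40) a b) b a := by
      simp [hG.word, hτ₁]
    have e41 : ρ.word 41 = Function.update (τ.word 41) (par y) K := by simp [hG.word, hτ₁]
    have f6 : τ₁.word 6 = τ.word 6 := by simp [hτ₁]
    have f33 : τ₁.word 33 = τ.word 33 := by simp [hτ₁]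
    have f34 : τ₁.word 34 = τ.word 34 := by simp [hτ₁]
    rw [f6] at r1 r2 r6
    rw [f33] at r3
    rw [f34] at r6 r7
    have hmerge := hl.merge hy0 hyq hpq hne hdy hdp ha hb he.symm rfl r1 r2 r3 r4 r5 r6
      (by rw [he]; exact r7)
    have hdone : (fun x => (∃ j < i, σ.word 32 j = x) ∨ x = y) =
        fun x => ∃ j ≤ i, σ.word 32 j = x := by
      funext x
      rw [eq_iff_iff]
      constructor
      · rintro (⟨j, hj, hjx⟩ | rfl)
        · exact ⟨j, by omega, hjx⟩
        · exact ⟨i, by omega, rfl⟩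
      · rintro ⟨j, hj, hjx⟩
        rcases hj.lt_or_eq with hj | rfl
        · exact Or.inl ⟨j, hj, hjx⟩
        · exact Or.inr hjx.symm
    rw [hdone] at hmerge
    refine WP.block ?_
    simp [hGF.word, hGF.fld, hone, r15, r14, r16, hGF]
    refine ⟨by omega, by omega, Function.update ob K (par y), ⟨?_, ?_⟩, ?_⟩
    · rw [show q + 1 + (i + 1) = K + 1 by omega]
      simpa [e35, e37, e38, e39, e40, e41] using hmerge
    · rw [show q + 1 + (i + 1) = K + 1 by omega]
      simp [r15, r14]
    · intro x hx
      rw [Function.update_of_ne (by omega)]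
      exact hob x hx
  · rintro τ ⟨hF, hv, ob, hl, hob⟩
    refine ⟨hF, ob, ?_, hob⟩
    have hK : q + 1 + (q - 1) = 2 * q := by omega
    have hdone : (fun x => ∃ j < q - 1, σ.word 32 j = x) = fun x => 0 < x ∧ x < q := by
      funext x
      rw [eq_iff_iff]
      constructor
      · rintro ⟨j, hj, rfl⟩; exact hp.range j (by omega)
      · rintro ⟨h0, hx⟩
        -- an injective sequence of length `q - 1` exhausts the vertices other than the root
        by_contra hne
        push Not at hne
        have hcard : ((Finset.range (q - 1)).image (σ.word 32)).card = q - 1 := by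
          rw [Finset.card_image_of_injOn, Finset.card_range]
          intro i hi j hj hij
          simp only [Finset.coe_range, Set.mem_Iio] at hi hj
          exact hp.inj i (by omega) j (by omega) hij
        have hsub : (Finset.range (q - 1)).image (σ.word 32) ⊆ (Finset.Ico 1 q).erase x := by
          intro y hy
          simp only [Finset.mem_image, Finset.mem_range] at hy
          obtain ⟨j, hj, rfl⟩ := hy
          have := hp.range j (by omega)
          rw [Finset.mem_erase, Finset.mem_Ico]
          exact ⟨hne j hj, by omega⟩
        have := Finset.card_le_card hsub
        rw [hcard, Finset.card_erase_of_mem (by rw [Finset.mem_Ico]; omega), Nat.card_Ico] at this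
        omega
    rwa [hK, hdone] at hl
  · have : (q - 1 - 0) * (k * (k * 4 + 9) + 17 + 2) ≤ q * (k * (k * 4 + 9) + 19) :=
      Nat.mul_le_mul (by omega) (by omega)
    omega

/-! ### Programs: building the split matrix

Field segment `6` is the split matrix, as a table with rows of length `N`. Word segment `45` contains,
for each node `z`, the list of the slots of the nodes around `z`; it begins at the position
`word 43 z` and ends before the position `word 44 z`. -/

/-- The state of the distribution of the entries of `M` over pairs of slots: `g` is what is left of
`M`, the table `f` contains what has been moved to the slots, and the pairs in `P` have been dealt
with. -/
structure IsDistribution (M : Fin n → Fin m → F) (N : ℕ) (lab nd : ℕ → ℕ) (P : ℕ → ℕ → Prop)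
    (g f : ℕ → ℕ → F) : Prop where
  supp : ∀ s < N, ∀ t < N, f s t ≠ 0 → lab s < n ∧ n ≤ lab t ∧ nd s = nd t
  left : ∀ (r : Fin n) (c : Fin m), g r c = 0 ∨ g r c = M r c
  sum : ∀ (r : Fin n) (c : Fin m), g r c + ∑ s ∈ range N, ∑ t ∈ range N,
    (if lab s = r ∧ lab t = n + c then f s t else 0) = M r c
  zero : ∀ s < N, ∀ t < N, P s t → nd s = nd t → ∀ (r : Fin n) (c : Fin m), lab s = r →
    lab t = n + c → g r c = 0

namespace IsDistribution

variable {M : Fin n → Fin m → F} {lab : ℕ → ℕ} {P P' : ℕ → ℕ → Prop}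
  {g f g' f' : ℕ → ℕ → F}

theorem weaken (h : IsDistribution M N lab nd P g f)
    (hP : ∀ s < N, ∀ t < N, P' s t → nd s = nd t → lab s < n → n ≤ lab t → P s t) :
    IsDistribution M N lab nd P' g f :=
  { h with
    zero := fun s hs t ht hst hn r c hr hc => h.zero s hs t ht
      (hP s hs t ht hst hn (by omega) (by omega)) hn r c hr hc }

theorem move (h : IsDistribution M N lab nd P g f) {s t : ℕ} (hs : s < N) (ht : t < N)
    (hst : nd s = nd t) (r : Fin n) (c : Fin m) (hr : lab s = r) (hc : lab t = n + c)
    (hP : ∀ i j, P' i j → P i j ∨ i = s ∧ j = t)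
    (hg : ∀ (i : Fin n) (j : Fin m), g' i j = if i = r ∧ j = c then 0 else g i j)
    (hf : ∀ i < N, ∀ j < N, f' i j = f i j + if i = s ∧ j = t then g r c else 0) :
    IsDistribution M N lab nd P' g' f' where
  supp i hi j hj hij := by
    rw [hf i hi j hj] at hij
    by_cases h1 : i = s ∧ j = t
    · obtain ⟨rfl, rfl⟩ := h1
      exact ⟨by omega, by omega, hst⟩
    · rw [if_neg h1, add_zero] at hij
      exact h.supp i hi j hj hij
  left i j := by
    rw [hg]
    split_ifs
    · exact Or.inl rfl
    · exact h.left i j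
  sum i j := by
    rw [← h.sum i j]
    have h1 : ∑ a ∈ range N, ∑ b ∈ range N, (if lab a = i ∧ lab b = n + j then f' a b else 0) =
        ∑ a ∈ range N, ∑ b ∈ range N, (if lab a = i ∧ lab b = n + j then f a b else 0) +
        ∑ a ∈ range N, ∑ b ∈ range N,
          (if a = s then if b = t then if i = r ∧ j = c then g r c else 0 else 0 else 0) := by
      rw [← Finset.sum_add_distrib]
      refine Finset.sum_congr rfl fun a ha => ?_
      rw [← Finset.sum_add_distrib]
      refine Finset.sum_congr rfl fun b hb => ?_
      rw [hf a (Finset.mem_range.1 ha) b (Finset.mem_range.1 hb)]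
      by_cases h1 : a = s ∧ b = t
      · obtain ⟨rfl, rfl⟩ := h1
        have h2 : (lab a = i ∧ lab b = n + j) ↔ (i = r ∧ j = c) := by
          rw [hr, hc, Fin.ext_iff, Fin.ext_iff]; omega
        simp only [h2]
        split_ifs <;> simp_all
      · have h2 : ¬ (a = s ∧ b = t) := h1
        rw [if_neg h1, add_zero]
        by_cases ha : a = s <;> by_cases hb : b = t <;> simp_all
    rw [h1, hg]
    have h3 : ∀ a ∈ range N, (∑ b ∈ range N, if a = s then if b = t then
        if i = r ∧ j = c then g r c else 0 else 0 else 0) =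
        if a = s then if i = r ∧ j = c then g r c else 0 else 0 := by
      intro a _
      by_cases ha : a = s <;> simp [ha, Finset.sum_ite_eq', ht]
    rw [Finset.sum_congr rfl h3, Finset.sum_ite_eq', if_pos (Finset.mem_range.2 hs)]
    by_cases h4 : i = r ∧ j = c
    · obtain ⟨rfl, rfl⟩ := h4
      simp; ring
    · simp [h4]
  zero i hi j hj hij hn a b ha hb := by
    rw [hg]
    split_ifs with h1
    · rfl
    · rcases hP i j hij with h2 | ⟨rfl, rfl⟩
      · exact h.zero i hi j hj h2 hn a b ha hb
      · exact absurd ⟨Fin.ext (by omega), Fin.ext (by omega)⟩ h1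

end IsDistribution

/-- Move the entries of the matrix to pairs of slots of the first nodes. -/
def distribute : RamProgram :=
  block [.wordOp .add (reg 19) (.dir 0 3) (reg 12)] ;;
  forRange 16 zeroAddr (arr 35 19) (
    .branch (.wordLt (arr 6 16) (.dir 0 0)) (
      block [
        .wordMove (reg 20) (arr 33 16),
        .wordOp .add (reg 21) (reg 20) (reg 12),
        .wordOp .mul (reg 22) (arr 6 16) (.dir 0 1),
        .wordOp .mul (reg 23) (reg 16) (reg 14)] ;;
      forRange 17 (arr 35 20) (arr 35 21) (
        .branch (.wordLt (arr 6 17) (.dir 0 0)) .skip (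
          block [
            .wordOp .sub (reg 24) (arr 6 17) (.dir 0 0),
            .wordOp .add (reg 24) (reg 22) (reg 24),
            .wordOp .add (reg 25) (reg 23) (reg 17),
            .fieldOp .add (arr 6 25) (arr 6 25) (arr 5 24),
            .fieldZero (arr 5 24)])))
      .skip)

theorem distribute_spec {K : ℕ} {bag : ℕ → ℕ → Prop} {done : ℕ → Prop} {ob : ℕ → ℕ}
    {M : Fin n → Fin m → F} (hc : HoldsConsts n m q σ) (hl : HoldsLayout q k bag par done K ob σ)
    (hqK : q < K) (hob : ∀ x < q, ob (x + 1) = x) (hbag : ∀ x < q, ∀ v, bag x v → v < n + m)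
    (hcov : ∀ r c, M r c ≠ 0 → ∃ x < q, bag x r ∧ bag x (n + c))
    (hM : ∀ (i : Fin n) (j : Fin m), σ.fld 5 (i * m + j) = M i j) (hA : σ.fld 6 = fun _ => 0)
    (hwN : σ.word 14 0 * σ.word 14 0 < 2 ^ w) (hwm : n * m < 2 ^ w) (hwn : σ.word 14 0 < 2 ^ w)
    (hwK : K < 2 ^ w) :
    WP w distribute σ (σ.word 14 0 * (k * 8 + 9) + 3) fun τ =>
      σ.Frame [16, 17, 19, 20, 21, 22, 23, 24, 25] [5, 6] τ ∧
      ∃ E : ℕ → ℕ → F,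
        (∀ s < σ.word 14 0, ∀ t < σ.word 14 0, τ.fld 6 (s * σ.word 14 0 + t) = E s t) ∧
        IsDistribution M (σ.word 14 0) (σ.word 6) (σ.word 33) (fun _ _ => True) (fun _ _ => 0) E := by
  have hone := hc.one
  have hzero := hc.zero
  obtain ⟨hl, h14, h15⟩ := hl
  have hbgN : ∀ z < K, σ.word 35 (z + 1) ≤ σ.word 14 0 := fun z hz => by
    rw [h14]; exact hl.bg_mono (by omega) le_rfl
  set N := σ.word 14 0 with hN
  set lab := σ.word 6 with hlab
  set nd := σ.word 33 with hnd
  have hlabw : ∀ s < N, lab s < n + m := fun s hs => by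
    obtain ⟨g0, g1, g2, g3⟩ := hl.exists_node (h14 ▸ hs)
    exact hbag _ (hl.node _ g0 g1).1 _ ((hl.mem _ g0 g1 _).2 ⟨s, g2, g3, rfl⟩)
  refine WP.block_seq (N * (k * 8 + 9) + 2) ?_
  simp [hc.nodes, hone]
  refine ⟨by omega, ?_⟩
  refine WP.forRange 0 (σ.word 35 (q + 1)) (k * 8 + 7) (fun s₀ τ =>
    σ.Frame [16, 17, 19, 20, 21, 22, 23, 24, 25] [5, 6] τ ∧ τ.word 16 0 = s₀ ∧
    τ.word 19 0 = q + 1 ∧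
    IsDistribution M N lab nd (fun s t => s < s₀) (fun r c => τ.fld 5 (r * m + c))
      (fun s t => τ.fld 6 (s * N + t))) (by simp [hzero]) ?_ ?_ ?_ ?_
      (hw := lt_of_le_of_lt (hbgN q hqK) hwn) (hT := ?_)
  · simp
    refine ⟨?_, ?_, ?_, ?_⟩ <;> simp [hA, hM]
  · rintro i τ ⟨hF, h, h19, -⟩
    simp [h, h19, hF.word]
  · rintro s₀ τ - hs₀ ⟨hF, hv, h19, hD⟩
    have hsN : s₀ < N := lt_of_lt_of_le hs₀ (hbgN q hqK)
    obtain ⟨g0, g1, g2, g3⟩ := hl.exists_node (h14 ▸ hsN)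
    have g4 := hlabw s₀ hsN
    have hzN := hbgN _ g1
    refine WP.branch (T := k * 8 + 6) (fun hb => ?_) fun hb => ?_
    · simp [hv, hF.word, hc.rows] at hb
      have hmul : s₀ * N + N ≤ N * N := by
        rw [← Nat.succ_mul]; exact Nat.mul_le_mul_right _ hsN
      have hmulm : lab s₀ * m + m ≤ n * m := by
        rw [← Nat.succ_mul]; exact Nat.mul_le_mul_right _ hb
      refine WP.block_seq (k * 8 + 2) ?_
      simp [hF.word, hF.fld, hv, hone, hc.cols, ← hN, ← hlab,
        ← hnd]
      iterate 4 refine ⟨by omega, ?_⟩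
      set τ₁ : RamState F := (((τ.sw 20 0 (nd s₀)).sw 21 0 (nd s₀ + 1)).sw 22 0
        (lab s₀ * m)).sw 23 0 (s₀ * N) with hτ₁
      have hF₁ : σ.Frame [16, 17, 19, 20, 21, 22, 23, 24, 25] [5, 6] τ₁ := by simp [hτ₁, hF]
      have b16 : τ₁.word 16 0 = s₀ := by simp [hτ₁, hv]
      have b19 : τ₁.word 19 0 = q + 1 := by simp [hτ₁, h19]
      have b20 : τ₁.word 20 0 = nd s₀ := by simp [hτ₁]
      have b21 : τ₁.word 21 0 = nd s₀ + 1 := by simp [hτ₁]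
      have b22 : τ₁.word 22 0 = lab s₀ * m := by simp [hτ₁]
      have b23 : τ₁.word 23 0 = s₀ * N := by simp [hτ₁]
      refine WP.forRange (σ.word 35 (nd s₀)) (σ.word 35 (nd s₀ + 1)) 6 (fun t₀ ρ =>
        τ₁.Frame [17, 24, 25] [5, 6] ρ ∧ ρ.word 17 0 = t₀ ∧
        IsDistribution M N lab nd (fun s t => s < s₀ ∨ s = s₀ ∧ t < t₀)
          (fun r c => ρ.fld 5 (r * m + c)) (fun s t => ρ.fld 6 (s * N + t)))
        (by simp [b20, hF₁.word]) ?_ ?_ ?_ ?_ (hlo := hl.bg_le _ g1) (hT := ?_)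
      · simp
        refine (hD.weaken fun s hs t ht hst hnn _ _ => ?_)
        rcases hst with hst | ⟨rfl, hst⟩
        · exact hst
        · have := hl.exists_node (h14 ▸ ht)
          rw [← hnn] at this
          omega
      · rintro i ρ ⟨hG, h, -⟩
        simp [h, hG.word, hF₁.word, b21]
      · rintro t₀ ρ ht1 ht2 ⟨hG, hv', hD⟩
        have hGF := hF₁.trans hG
        have htN : t₀ < N := by omega
        have hndt : nd t₀ = nd s₀ := hl.nd_eq _ g1 _ ht1 ht2
        refine WP.branch (T := 5) (fun hb' => ?_) fun hb' => ?_
        · simp [hv', hGF.word, hc.rows, ← hlab] at hb'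
          refine WP.skip ?_
          simp [hG.word, hF₁.word, hv', hone, hG]
          refine hD.weaken fun s hs t ht hst hnn _ h2 => ?_
          rcases hst with hst | ⟨rfl, hst⟩
          · exact Or.inl hst
          · refine Or.inr ⟨rfl, ?_⟩
            have : t ≠ t₀ := by rintro rfl; omega
            omega
        · simp [hv', hGF.word, hc.rows, ← hlab] at hb'
          have hlt := hlabw t₀ htN
          obtain ⟨c, hc'⟩ := Nat.exists_eq_add_of_le hb'
          have hcm : c < m := by omega
          have hsub : lab t₀ - n = c := by omega
          refine WP.block ?_
          simp [hGF.word, hG.word, hv', hone, ← hlab, hc.rows,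
            hsub, b22, b23, hG]
          iterate 3 refine ⟨by omega, ?_⟩
          refine hD.move hsN htN hndt.symm ⟨lab s₀, hb⟩ ⟨c, hcm⟩ rfl hc' ?_ ?_ ?_
          · intro i j hij
            omega
          · intro i j
            simp only [Function.update_apply, addr_inj j.2 hcm, Fin.ext_iff]
          · intro i hi j hj
            simp only [Function.update_apply, addr_inj hj htN]
            split_ifs with h1
            · obtain ⟨rfl, rfl⟩ := h1
              rfl
            · rw [add_zero]
      · rintro ρ ⟨hG, hv', hD⟩
        have hGF := hF₁.trans hG
        simp [hGF, hGF.word, hone, hG.word, b16, b19]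
        refine hD.weaken fun s hs t ht hst hnn _ h2 => ?_
        rcases hst.lt_or_eq with hst | rfl
        · exact Or.inl hst
        · refine Or.inr ⟨rfl, ?_⟩
          have := (hl.exists_node (h14 ▸ ht)).2.2.2
          rwa [← hnn] at this
      · have := hl.size _ g1
        have : (σ.word 35 (nd s₀ + 1) - σ.word 35 (nd s₀)) * (6 + 2) ≤ k * 8 :=
          Nat.mul_le_mul_right _ (by omega)
        omega
    · simp [hv, hF.word, hc.rows, ← hlab] at hb
      refine WP.skip ?_
      simp [hF.word, hv, hone, hF, h19]
      refine hD.weaken fun s hs t ht hst _ h1 _ => ?_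
      have : s ≠ s₀ := by rintro rfl; omega
      omega
  · rintro τ ⟨hF, hv, -, hD⟩
    refine ⟨hF, _, fun s hs t ht => rfl, ?_⟩
    have hz : ∀ (r : Fin n) (c : Fin m), τ.fld 5 (r * m + c) = 0 := by
      intro r c
      rcases hD.left r c with h0 | h0
      · exact h0
      · by_cases hrc : M r c = 0
        · exact h0.trans hrc
        obtain ⟨x, hx, hr, hc'⟩ := hcov r c hrc
        rw [← hob x hx, hl.mem (x + 1) (by omega) (by omega)] at hr hc'
        obtain ⟨s, hs1, hs2, hs3⟩ := hr
        obtain ⟨t, ht1, ht2, ht3⟩ := hc'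
        have e1 := hbgN (x + 1) (by omega)
        have e2 := hl.bg_mono (y := x + 1 + 1) (z := q + 1) (by omega) (by omega)
        refine hD.zero s (by omega) t (by omega) (by omega) ?_ r c hs3 ht3
        rw [hl.nd_eq _ (by omega) s hs1 hs2, hl.nd_eq _ (by omega) t ht1 ht2]
    refine ⟨hD.supp, fun _ _ => Or.inl rfl, fun r c => ?_, fun _ _ _ _ _ _ _ _ _ _ => rfl⟩
    rw [← hD.sum r c, hz]
  · rw [Nat.sub_zero]
    have : σ.word 35 (q + 1) * (k * 8 + 7 + 2) ≤ N * (k * 8 + 9) := Nat.mul_le_mul_right _ (hbgN q hqK)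
    omega

/-- Add the entries that link the copies of a row or a column. -/
def linkCopies : RamProgram :=
  forRange 16 zeroAddr (reg 14) (
    .branch (.wordEq (arr 34 16) zeroAddr) .skip (
      block [
        .wordOp .sub (reg 20) (arr 34 16) (reg 12),
        .wordOp .mul (reg 21) (reg 16) (reg 14),
        .wordOp .mul (reg 22) (reg 20) (reg 14),
        .wordOp .add (reg 23) (reg 21) (reg 16),
        .fieldOp .add (arr 6 23) (arr 6 23) (reg 10)] ;;
      .branch (.wordLt (arr 6 16) (.dir 0 0))
        (block [
          .wordOp .add (reg 23) (reg 22) (reg 16),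
          .fieldOp .add (arr 6 23) (arr 6 23) (reg 11)])
        (block [
          .wordOp .add (reg 23) (reg 21) (reg 20),
          .fieldOp .add (arr 6 23) (arr 6 23) (reg 11)])))

theorem linkCopies_spec {E : ℕ → ℕ → F} (hc : HoldsConsts n m q σ) (hN : σ.word 14 0 = N)
    (hup : ∀ s < N, ∀ u, σ.word 34 s = u + 1 → s < u ∧ u < N)
    (hA : ∀ s < N, ∀ t < N, σ.fld 6 (s * N + t) = E s t) (hw : N * N < 2 ^ w) (hwN : N < 2 ^ w) :
    WP w linkCopies σ (N * 12 + 2) fun τ => σ.Frame [16, 20, 21, 22, 23] [6] τ ∧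
      ∀ s < N, ∀ t < N, τ.fld 6 (s * N + t) = splitEntry n (σ.word 6) (σ.word 34) E s t := by
  have hone := hc.one
  have hzero := hc.zero
  have hfone := hc.fone
  have hfneg := hc.fneg
  set lab := σ.word 6 with hlab
  set up := σ.word 34 with hupd
  refine WP.forRange 0 N 9 (fun x τ => σ.Frame [16, 20, 21, 22, 23] [6] τ ∧ τ.word 16 0 = x ∧
    ∀ s < N, ∀ t < N, τ.fld 6 (s * N + t) = E s t + (if s = t ∧ up s ≠ 0 ∧ s < x then 1 else 0) +
      (if up t = s + 1 ∧ lab t < n ∧ t < x then -1 else 0) +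
      (if up s = t + 1 ∧ n ≤ lab s ∧ s < x then -1 else 0))
    (by simp [hzero]) ?_ ?_ ?_ ?_
  · simp
    exact hA
  · rintro i τ ⟨hF, h, -⟩
    simp [h, hF.word, hN]
  · rintro x τ - hx ⟨hF, hv, hf⟩
    refine WP.branch (T := 8) (fun hb => ?_) fun hb => ?_
    · simp [hv, hF.word, hzero, ← hupd] at hb
      refine WP.skip ?_
      simp [hF.word, hv, hone, hF]
      intro s hs t ht
      rw [hf s hs t ht]
      have h1 : ∀ y, y ≤ x → up y ≠ 0 → y < x := fun y hy hu => by
        have : y ≠ x := by rintro rfl; exact hu hb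
        omega
      congr 1
      congr 1
      congr 1
      all_goals
        congr 1
        rw [eq_iff_iff]
        have h2 := h1 s
        have h3 := h1 t
        constructor
        · rintro ⟨a, b, c⟩; exact ⟨a, b, by omega⟩
        · rintro ⟨a, b, c⟩; exact ⟨a, b, by omega⟩
    · simp [hv, hF.word, hzero, ← hupd] at hb
      obtain ⟨u, hu⟩ := Nat.exists_eq_succ_of_ne_zero hb
      obtain ⟨hxu, huN⟩ := hup x hx u hu
      have hus : up x - 1 = u := by omega
      have hm1 : x * N + N ≤ N * N := by
        rw [← Nat.succ_mul]; exact Nat.mul_le_mul_right _ hx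
      have hm2 : u * N + N ≤ N * N := by
        rw [← Nat.succ_mul]; exact Nat.mul_le_mul_right _ huN
      refine WP.block_seq 3 ?_
      simp [hF.word, hF.fld, hv, hone, hN, ← hupd, hus, hfone]
      iterate 4 refine ⟨by omega, ?_⟩
      refine WP.branch (T := 2) (fun hl => ?_) fun hl => ?_
      · simp [hv, hF.word, hc.rows, ← hlab] at hl
        refine WP.block ?_
        simp [hF.word, hF.fld, hv, hone, hN, hfneg, hF]
        refine ⟨by omega, fun s hs t ht => ?_⟩
        simp only [Function.update_apply, addr_inj ht hx, addr_inj hx hx, hf s hs t ht,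
          hf _ hx _ hx, hf _ huN _ hx]
        have e1 : (if s = t ∧ up s ≠ 0 ∧ s ≤ x then (1 : F) else 0) =
            (if s = t ∧ up s ≠ 0 ∧ s < x then 1 else 0) + if s = x ∧ t = x then 1 else 0 := by
          by_cases h1 : s = x ∧ t = x
          · obtain ⟨rfl, rfl⟩ := h1; simp [hb]
          · rw [if_neg h1, add_zero]
            congr 1
            rw [eq_iff_iff]
            constructor <;> rintro ⟨a, b, c⟩ <;> exact ⟨a, b, by omega⟩
        have e2 : (if up t = s + 1 ∧ lab t < n ∧ t ≤ x then (-1 : F) else 0) =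
            (if up t = s + 1 ∧ lab t < n ∧ t < x then -1 else 0) + if s = u ∧ t = x then -1 else 0 := by
          by_cases h1 : s = u ∧ t = x
          · obtain ⟨rfl, rfl⟩ := h1; simp [hl, hu]
          · rw [if_neg h1, add_zero]
            congr 1
            rw [eq_iff_iff]
            constructor <;> rintro ⟨a, b, c⟩ <;> refine ⟨a, b, ?_⟩
            · rcases c.lt_or_eq with c | rfl
              · exact c
              · omega
            · omega
        have e3 : (if up s = t + 1 ∧ n ≤ lab s ∧ s ≤ x then (-1 : F) else 0) =
            (if up s = t + 1 ∧ n ≤ lab s ∧ s < x then -1 else 0) := by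
          congr 1
          rw [eq_iff_iff]
          constructor <;> rintro ⟨a, b, c⟩ <;> refine ⟨a, b, ?_⟩
          · rcases c.lt_or_eq with c | rfl
            · exact c
            · omega
          · omega
        simp only [ne_eq] at e1
        rw [e1, e2, e3]
        by_cases h1 : s = u ∧ t = x
        · obtain ⟨rfl, rfl⟩ := h1
          simp [hxu.ne, hxu.ne']
          ring
        · by_cases h2 : s = x ∧ t = x
          · obtain ⟨rfl, rfl⟩ := h2
            simp [hxu.ne, hxu.ne']
          · simp only [h1, h2, if_false, add_zero]
      · simp [hv, hF.word, hc.rows, ← hlab] at hl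
        refine WP.block ?_
        simp [hF.word, hF.fld, hv, hone, hN, hfneg, hF]
        refine ⟨by omega, fun s hs t ht => ?_⟩
        simp only [Function.update_apply, addr_inj ht huN, addr_inj ht hx, addr_inj huN hx,
          hf s hs t ht, hf _ hx _ hx, hf _ hx _ huN]
        have e1 : (if s = t ∧ up s ≠ 0 ∧ s ≤ x then (1 : F) else 0) =
            (if s = t ∧ up s ≠ 0 ∧ s < x then 1 else 0) + if s = x ∧ t = x then 1 else 0 := by
          by_cases h1 : s = x ∧ t = x
          · obtain ⟨rfl, rfl⟩ := h1; simp [hb]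
          · rw [if_neg h1, add_zero]
            congr 1
            rw [eq_iff_iff]
            constructor <;> rintro ⟨a, b, c⟩ <;> exact ⟨a, b, by omega⟩
        have e2 : (if up s = t + 1 ∧ n ≤ lab s ∧ s ≤ x then (-1 : F) else 0) =
            (if up s = t + 1 ∧ n ≤ lab s ∧ s < x then -1 else 0) + if s = x ∧ t = u then -1 else 0 := by
          by_cases h1 : s = x ∧ t = u
          · obtain ⟨rfl, rfl⟩ := h1; simp [hl, hu]
          · rw [if_neg h1, add_zero]
            congr 1
            rw [eq_iff_iff]
            constructor <;> rintro ⟨a, b, c⟩ <;> refine ⟨a, b, ?_⟩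
            · rcases c.lt_or_eq with c | rfl
              · exact c
              · omega
            · omega
        have e3 : (if up t = s + 1 ∧ lab t < n ∧ t ≤ x then (-1 : F) else 0) =
            (if up t = s + 1 ∧ lab t < n ∧ t < x then -1 else 0) := by
          congr 1
          rw [eq_iff_iff]
          constructor <;> rintro ⟨a, b, c⟩ <;> refine ⟨a, b, ?_⟩
          · rcases c.lt_or_eq with c | rfl
            · exact c
            · omega
          · omega
        simp only [ne_eq] at e1
        rw [e1, e2, e3]
        by_cases h1 : s = x ∧ t = u
        · obtain ⟨rfl, rfl⟩ := h1
          simp [hxu.ne, hxu.ne']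
        · by_cases h2 : s = x ∧ t = x
          · obtain ⟨rfl, rfl⟩ := h2
            simp [hxu.ne, hxu.ne']
          · simp only [h1, h2, if_false, add_zero]
  · rintro τ ⟨hF, hv, hf⟩
    refine ⟨hF, fun s hs t ht => ?_⟩
    rw [hf s hs t ht, splitEntry]
    simp only [hs, ht, and_true]
    split_ifs <;> ring

/-- Append the slots of the node `word 20` to the lists. -/
def appendSlots : RamProgram :=
  block [.wordOp .add (reg 21) (reg 20) (reg 12)] ;;
  forRange 17 (arr 35 20) (arr 35 21)
    (block [.wordMove (arr 45 28) (reg 17), .wordOp .add (reg 28) (reg 28) (reg 12)])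

/-- The members of `l` are the values of `f` from the position `lo` on. -/
def ListAt {α : Type*} (f : ℕ → α) (lo : ℕ) (l : List α) : Prop :=
  ∀ i (hi : i < l.length), f (lo + i) = l[i]

theorem ListAt.append {α : Type*} {f : ℕ → α} {l l' : List α} (h : ListAt f lo l)
    (h' : ListAt f (lo + l.length) l') : ListAt f lo (l ++ l') := by
  intro i hi
  rw [List.getElem_append]
  split_ifs with h1
  · exact h i h1
  · rw [List.length_append] at hi
    have := h' (i - l.length) (by omega)
    rw [← this]
    congr 1
    omega

theorem ListAt.congr {α : Type*} {f f' : ℕ → α} {l : List α} (h : ListAt f lo l)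
    (hf : ∀ i < lo + l.length, f' i = f i) : ListAt f' lo l := fun i hi => by
  rw [hf _ (by omega)]; exact h i hi

theorem appendSlots_spec {z p : ℕ} (hone : σ.word 12 0 = 1) (h20 : σ.word 20 0 = z)
    (h28 : σ.word 28 0 = p) (hle : σ.word 35 z ≤ σ.word 35 (z + 1))
    (hsize : σ.word 35 (z + 1) ≤ σ.word 35 z + k) (hwz : z + 1 < 2 ^ w)
    (hwb : σ.word 35 (z + 1) < 2 ^ w) (hwp : p + k < 2 ^ w) :
    WP w appendSlots σ (k * 4 + 3) fun τ => σ.Frame [17, 21, 28, 45] [] τ ∧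
      τ.word 28 0 = p + (nodeSlots (σ.word 35) z).length ∧
      ListAt (τ.word 45) p (nodeSlots (σ.word 35) z) ∧ ∀ i < p, τ.word 45 i = σ.word 45 i := by
  refine WP.block_seq (k * 4 + 2) ?_
  simp [h20, hone]
  refine ⟨hwz, ?_⟩
  refine WP.forRange (σ.word 35 z) (σ.word 35 (z + 1)) 2 (fun s τ =>
    ∃ i, s = σ.word 35 z + i ∧ σ.Frame [17, 21, 28, 45] [] τ ∧ τ.word 17 0 = s ∧
    τ.word 21 0 = z + 1 ∧ τ.word 28 0 = p + i ∧
    (∀ j < i, τ.word 45 (p + j) = σ.word 35 z + j) ∧ ∀ j < p, τ.word 45 j = σ.word 45 j)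
    (by simp [h20]) ?_ ?_ ?_ ?_ (hlo := hle) (hT := ?_)
  · exact ⟨0, by simp [h28]⟩
  · rintro s τ ⟨i, -, hF, h, h21, -⟩
    simp [h, h21, hF.word]
  · rintro s τ hs1 hs2 ⟨i, rfl, hF, hv, h21, h28, h1, h2⟩
    refine WP.block ?_
    simp [hF.word, hv, hone, h28, hF, h21, Function.update_apply]
    refine ⟨by omega, by omega, i + 1, by omega, by omega, fun j hj => ?_, fun j hj => ?_⟩
    · split_ifs with hji
      · rw [hji]
      · exact h1 j (by omega)
    · rw [if_neg (by omega)]; exact h2 j hj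
  · rintro τ ⟨i, hi, hF, hv, h21, h28, h1, h2⟩
    have hlen : (nodeSlots (σ.word 35) z).length = i := by
      rw [nodeSlots, List.length_range']; omega
    refine ⟨hF, by rw [hlen, h28], fun j hj => ?_, h2⟩
    rw [h1 j (by omega)]
    simp [nodeSlots]
  · have : (σ.word 35 (z + 1) - σ.word 35 z) * (2 + 2) ≤ k * 4 := Nat.mul_le_mul_right _ (by omega)
    omega

/-- Append the slots of several nodes, which are given by addresses, to the lists. -/
def appendAll : List Addr → RamProgram
  | [] => .skip
  | x :: L => block [.wordMove (reg 20) x] ;; appendSlots ;; appendAll L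

theorem appendAll_spec {K : ℕ} {bg : ℕ → ℕ} {L : List Addr} {ys l : List ℕ} (hone : σ.word 12 0 = 1)
    (hbg : σ.word 35 = bg)
    (hL : List.Forall₂ (fun x y => ∀ τ, σ.Frame [17, 20, 21, 28, 45] [] τ → τ.getWord x = y) L ys)
    (hys : ∀ y ∈ ys, y < K) (hle : ∀ z < K, bg z ≤ bg (z + 1))
    (hsize : ∀ z < K, bg (z + 1) ≤ bg z + k) (hwK : K < 2 ^ w) (hwb : ∀ z < K, bg (z + 1) < 2 ^ w)
    (h28 : σ.word 28 0 = lo + l.length) (hl : ListAt (σ.word 45) lo l)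
    (hwp : lo + l.length + ys.length * k < 2 ^ w) :
    WP w (appendAll L) σ (ys.length * (k * 4 + 4)) fun τ =>
      σ.Frame [17, 20, 21, 28, 45] [] τ ∧
      τ.word 28 0 = lo + (l ++ ys.flatMap (nodeSlots bg)).length ∧
      ListAt (τ.word 45) lo (l ++ ys.flatMap (nodeSlots bg)) ∧
      ∀ i < lo, τ.word 45 i = σ.word 45 i := by
  induction L generalizing ys l σ with
  | nil =>
    obtain rfl := List.forall₂_nil_left_iff.1 hL
    exact WP.skip (by simp [h28, hl])
  | cons x L ih =>
    obtain ⟨y, ys, hxy, hL', rfl⟩ := List.forall₂_cons_left_iff.1 hL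
    rw [List.length_cons, Nat.succ_mul] at hwp ⊢
    have hy := hys y (by simp)
    refine WP.block_seq (k * 4 + 3 + ys.length * (k * 4 + 4)) ?_
    simp [hxy σ (RamState.Frame.refl _ _ _)]
    refine ⟨by omega, ?_⟩
    have hlen : (nodeSlots bg y).length ≤ k := by
      have := hsize y hy
      rw [nodeSlots, List.length_range']; omega
    refine WP.seq _ ((appendSlots_spec (k := k) (z := y) (p := lo + l.length) (by simp [hone])
      (by simp) (by simp [h28]) (by simpa [hbg] using hle y hy) (by simpa [hbg] using hsize y hy)
      (by omega) (by simpa [hbg] using hwb y hy) (by omega)).post ?_) le_rfl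
    simp only [RamState.word_sw, if_neg (show ¬ (35 = 20) by decide),
      if_neg (show ¬ (45 = 20) by decide), hbg]
    rintro τ ⟨hG, h28', hl', hk⟩
    have hF : σ.Frame [17, 20, 21, 28, 45] [] τ :=
      (show σ.Frame [17, 20, 21, 28, 45] [] (σ.sw 20 0 y) by simp).trans hG
    refine (ih (l := l ++ nodeSlots bg y) (by simp [hF.word, hone]) (by simp [hF.word, hbg])
      (hL'.imp fun x y h τ' hτ' => h τ' (hF.trans hτ'))
      (fun z hz => hys z (by simp [hz])) (by rw [h28', List.length_append, add_assoc])
      ((hl.congr fun i hi => hk i hi).append hl') (by rw [List.length_append]; omega)).post ?_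
    rintro ρ ⟨hF', h1, h2, h3⟩
    refine ⟨hF.trans hF', ?_, ?_, fun i hi => ?_⟩
    · rw [h1]; simp
    · simpa using h2
    · rw [h3 i hi, hk i (by omega)]

/-- For every node, list the slots of the nodes around it. -/
def buildLists : RamProgram :=
  block [.wordConst (reg 28) 0] ;;
  forRange 16 (reg 12) (reg 15) (
    block [.wordMove (arr 43 16) (reg 28), .wordMove (reg 29) (arr 37 16)] ;;
    appendAll [arr 38 16, arr 39 16, reg 16, arr 40 16, arr 37 16, arr 37 29] ;;
    block [.wordMove (arr 44 16) (reg 28)])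

theorem buildLists_spec {K : ℕ} {bag : ℕ → ℕ → Prop} {done : ℕ → Prop} {ob : ℕ → ℕ}
    (hone : σ.word 12 0 = 1) (hl : HoldsLayout q k bag par done K ob σ) (hwK : K < 2 ^ w)
    (hwN : σ.word 35 K < 2 ^ w) (hw : K * (6 * k) < 2 ^ w) :
    WP w buildLists σ (K * (k * 24 + 29) + 3) fun τ =>
      σ.Frame [16, 17, 20, 21, 28, 29, 43, 44, 45] [] τ ∧ ∀ z, 0 < z → z < K →
        ListAt (τ.word 45) (τ.word 43 z)
          (nearList (σ.word 35) (σ.word 37) (σ.word 38) (σ.word 39) (σ.word 40) z) ∧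
        τ.word 44 z = τ.word 43 z +
          (nearList (σ.word 35) (σ.word 37) (σ.word 38) (σ.word 39) (σ.word 40) z).length ∧
        τ.word 44 z ≤ K * (6 * k) := by
  obtain ⟨hl, h14, h15⟩ := hl
  set NL := nearList (σ.word 35) (σ.word 37) (σ.word 38) (σ.word 39) (σ.word 40) with hNL
  refine WP.block_seq (K * (k * 24 + 29) + 2) ?_
  simp
  refine WP.forRange 1 K (k * 24 + 27) (fun z τ =>
    σ.Frame [16, 17, 20, 21, 28, 29, 43, 44, 45] [] τ ∧ τ.word 16 0 = z ∧
    τ.word 28 0 ≤ z * (6 * k) ∧ ∀ y, 0 < y → y < z → ListAt (τ.word 45) (τ.word 43 y) (NL y) ∧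
      τ.word 44 y = τ.word 43 y + (NL y).length ∧ τ.word 44 y ≤ τ.word 28 0)
    (by simp [hone]) ?_ ?_ ?_ ?_ (hlo := by have := hl.pos; omega) (hT := ?_)
  · simp
    intro y h1 h2; omega
  · rintro i τ ⟨hF, h, -⟩
    simp [h, hF.word, h15]
  · rintro z τ hz0 hzK ⟨hF, hv, h28, hy⟩
    have hzK' : z * (6 * k) + 6 * k ≤ K * (6 * k) := by
      rw [← Nat.succ_mul]; exact Nat.mul_le_mul_right _ hzK
    have hnodes := hl.nearNodes_lt hzK
    have hlen := hl.length_nearList hzK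
    rw [← hNL] at hlen
    have hpnz := hnodes (σ.word 37 z) (by simp)
    refine WP.block_seq (k * 24 + 25) ?_
    simp [hF.word, hv]
    refine ⟨by omega, by omega, ?_⟩
    set p := τ.word 28 0 with hp
    set τ₁ : RamState F := (τ.sw 43 z p).sw 29 0 (σ.word 37 z) with hτ₁
    have hF₁ : σ.Frame [16, 17, 20, 21, 28, 29, 43, 44, 45] [] τ₁ := by simp [hτ₁, hF]
    refine WP.seq 1 ((appendAll_spec (k := k) (K := K) (lo := p) (bg := σ.word 35) (l := [])
      (ys := [σ.word 38 z, σ.word 39 z, z, σ.word 40 z, σ.word 37 z, σ.word 37 (σ.word 37 z)])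
      (by simp [hF₁.word, hone]) (by simp [hF₁.word]) ?_ hnodes hl.bg_le hl.size hwK
      (fun y hy => lt_of_le_of_lt (hl.bg_mono (z := K) (by omega) le_rfl) hwN)
      (by simp [hτ₁, hp]) (fun i hi => by simp at hi) (by simp; omega)).post ?_) (by simp; omega)
    · simp only [List.forall₂_cons, List.forall₂_nil_left_iff, and_true]
      have hz16 : τ₁.word 16 0 = z := by simp [hτ₁, hv]
      have hz29 : τ₁.word 29 0 = σ.word 37 z := by simp [hτ₁]
      refine ⟨?_, ?_, ?_, ?_, ?_, ?_⟩ <;> intro ρ hρ <;>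
        simp [hρ.word, hF₁.word, hz16, hz29]
    · rintro ρ ⟨hG, h28', hl', hk⟩
      rw [List.nil_append] at h28' hl'
      have hGF := hF₁.trans hG
      have b16 : ρ.word 16 0 = z := by rw [hG.word (by decide)]; simp [hτ₁, hv]
      have b43 : ρ.word 43 = Function.update (τ.word 43) z p := by
        rw [hG.word (by decide)]; simp [hτ₁]
      have b44 : ρ.word 44 = τ.word 44 := by rw [hG.word (by decide)]; simp [hτ₁]
      have b45 : ∀ i < p, ρ.word 45 i = τ.word 45 i := fun i hi => by
        rw [hk i hi]; simp [hτ₁]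
      change ρ.word 28 0 = p + (NL z).length at h28'
      change ListAt (ρ.word 45) p (NL z) at hl'
      refine WP.block ?_
      simp [hGF.word, hGF, b16, h28', hone, b43, b44]
      refine ⟨by omega, by rw [Nat.succ_mul]; omega, ?_⟩
      intro y hy0 hyz
      by_cases hyz' : y = z
      · subst hyz'
        simp [hl']
      · have hy1 := hy y hy0 (by omega)
        simp only [Function.update_of_ne hyz']
        exact ⟨hy1.1.congr fun i hi => b45 i (by omega), hy1.2.1, by omega⟩
  · rintro τ ⟨hF, hv, h28, hy⟩
    exact ⟨hF, fun z h1 h2 => ⟨(hy z h1 h2).1, (hy z h1 h2).2.1, (hy z h1 h2).2.2.trans h28⟩⟩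
  · have : (K - 1) * (k * 24 + 27 + 2) ≤ K * (k * 24 + 29) :=
      Nat.mul_le_mul_right _ (by omega)
    omega

/-! ### Programs: Gaussian elimination

Word segment `46` marks the rows that have been used as pivot rows; the rows and the columns of the
pivots are listed in the word segments `47` and `48`, their number is in `word 27 0`. The row
operations are listed in the word segments `50`, `51` and the field segment `7`, their number is in
`word 42 0`. -/

/-- For every slot `t`, the list `NL (nd t)` contains all the rows and all the columns that can be
involved in the elimination of the column `t`. -/
structure IsCover (N l : ℕ) (pn nd : ℕ → ℕ) (NL : ℕ → List ℕ) : Prop where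
  pn_lt : ∀ z, pn z = 0 ∨ z < pn z
  nd_ne : ∀ s < N, nd s ≠ 0
  nd_mono : ∀ s t, s ≤ t → t < N → nd s ≤ nd t
  near : ∀ s < N, ∀ t < N, Near pn nd s t → s ∈ NL (nd t)
  near_le : ∀ r < N, ∀ t < N, ∀ d < N, Near pn nd r t → Near pn nd r d → t ≤ d → d ∈ NL (nd t)
  nodup : ∀ t < N, (NL (nd t)).Nodup
  lt : ∀ t < N, ∀ s ∈ NL (nd t), s < N
  length_le : ∀ t < N, (NL (nd t)).length ≤ l

theorem IsLayout.isCover {bag : ℕ → ℕ → Prop} {done : ℕ → Prop} {K : ℕ}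
    {bg lab up c1 c2 sb cur ob : ℕ → ℕ}
    (h : IsLayout q k bag par done K bg lab nd up pn c1 c2 sb cur ob) :
    IsCover (bg K) (6 * k) pn nd (nearList bg pn c1 c2 sb) where
  pn_lt z := by have := h.pn_lt z; omega
  nd_ne s hs := by have := (h.exists_node hs).1; omega
  nd_mono s t hst ht := h.nd_mono hst ht
  near s hs t ht hst := h.mem_nearList_of_near hs ht hst
  near_le r hr t ht d hd h1 h2 h3 := h.mem_nearList_of_near_of_le hd ht hr h1 h2 h3
  nodup t ht := h.nearList_nodup (h.exists_node ht).1 (h.exists_node ht).2.1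
  lt t ht s hs := ((h.mem_nearList (h.exists_node ht).2.1).1 hs).1
  length_le t ht := h.length_nearList (h.exists_node ht).2.1

/-- The machine knows the lists of a cover. -/
structure HoldsLists (N : ℕ) (nd : ℕ → ℕ) (NL : ℕ → List ℕ) (σ : RamState F) : Prop where
  size : σ.word 14 0 = N
  node : σ.word 33 = nd
  list : ∀ t < N, ListAt (σ.word 45) (σ.word 43 (nd t)) (NL (nd t))
  last : ∀ t < N, σ.word 44 (nd t) = σ.word 43 (nd t) + (NL (nd t)).length

theorem HoldsLists.frame {ws fs : List ℕ} (h : HoldsLists N nd NL σ) (hF : σ.Frame ws fs τ)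
    (hws : ∀ a ∈ [14, 33, 43, 44, 45], a ∉ ws := by decide) : HoldsLists N nd NL τ := by
  have h1 := fun a ha => hF.word_eq a (hws a ha)
  constructor
  · rw [h1 14 (by simp), h.size]
  · rw [h1 33 (by simp), h.node]
  · rw [h1 45 (by simp), h1 43 (by simp)]; exact h.list
  · rw [h1 44 (by simp), h1 43 (by simp)]; exact h.last

/-- The machine holds a state of the elimination. -/
structure HoldsElim (N : ℕ) (pn nd : ℕ → ℕ) (M' : ℕ → ℕ → F) (γ γ' : ℕ) (piv : List (ℕ × ℕ))
    (ops : List (ℕ × ℕ × F)) (σ : RamState F) : Prop where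
  elim : IsElim N pn nd M' γ γ' (fun s t => σ.fld 6 (s * N + t)) piv ops
  used : ∀ s, σ.word 46 s = if s ∈ piv.map Prod.fst then 1 else 0
  npiv : σ.word 27 0 = piv.length
  pivs : ListAt (fun i => (σ.word 47 i, σ.word 48 i)) 0 piv
  nops : σ.word 42 0 = ops.length
  opsl : ListAt (fun i => (σ.word 50 i, σ.word 51 i, σ.fld 7 i)) 0 ops

theorem HoldsElim.piv_getElem {γ γ' : ℕ} (h : HoldsElim N pn nd M' γ γ' piv ops σ) {i : ℕ}
    (hi : i < piv.length) : σ.word 47 i = piv[i].1 ∧ σ.word 48 i = piv[i].2 := by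
  simpa [Prod.ext_iff] using h.pivs i hi

theorem HoldsElim.ops_getElem {γ γ' : ℕ} (h : HoldsElim N pn nd M' γ γ' piv ops σ) {i : ℕ}
    (hi : i < ops.length) :
    σ.word 50 i = ops[i].1 ∧ σ.word 51 i = ops[i].2.1 ∧ σ.fld 7 i = ops[i].2.2 := by
  simpa [Prod.ext_iff] using h.opsl i hi

theorem HoldsElim.frame {γ γ' : ℕ} {ws fs : List ℕ} (h : HoldsElim N pn nd M' γ γ' piv ops σ)
    (hF : σ.Frame ws fs τ) (hws : ∀ a ∈ [27, 42, 46, 47, 48, 50, 51], a ∉ ws := by decide)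
    (hfs : ∀ a ∈ [6, 7], a ∉ fs := by decide) :
    HoldsElim N pn nd M' γ γ' piv ops τ := by
  have h1 := fun a ha => hF.word_eq a (hws a ha)
  have h2 := fun a ha => hF.fld_eq a (hfs a ha)
  constructor
  · rw [h2 6 (by simp)]; exact h.elim
  · rw [h1 46 (by simp)]; exact h.used
  · rw [h1 27 (by simp)]; exact h.npiv
  · rw [h1 47 (by simp), h1 48 (by simp)]; exact h.pivs
  · rw [h1 42 (by simp)]; exact h.nops
  · rw [h1 50 (by simp), h1 51 (by simp), h2 7 (by simp)]; exact h.opsl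

theorem IsElim.length_piv_le {A : ℕ → ℕ → F} {γ γ' : ℕ} (h : IsElim N pn nd M' γ γ' A piv ops) :
    piv.length ≤ N := by
  have h1 : (piv.map Prod.fst).toFinset ⊆ range N := fun s hs => by
    obtain ⟨p, hp, rfl⟩ := List.mem_map.1 (List.mem_toFinset.1 hs)
    exact mem_range.2 (h.piv_lt p hp).1
  have h2 := card_le_card h1
  rwa [List.toFinset_card_of_nodup h.piv_nodup, List.length_map, card_range] at h2

theorem IsElim.length_ops_le {A : ℕ → ℕ → F} {γ γ' : ℕ} (h : IsElim N pn nd M' γ γ' A piv ops) :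
    ops.length ≤ N * N := by
  have h1 : (ops.map fun e => (e.1, e.2.1)).toFinset ⊆ range N ×ˢ range N := fun s hs => by
    obtain ⟨p, hp, rfl⟩ := List.mem_map.1 (List.mem_toFinset.1 hs)
    have := h.ops_lt p hp
    simp only [mem_product, mem_range]
    omega
  have h2 := card_le_card h1
  rwa [List.toFinset_card_of_nodup h.ops_nodup, List.length_map, card_product, card_range] at h2

theorem ListAt.concat {α : Type*} {f f' : ℕ → α} {l : List α} {a : α} (h : ListAt f 0 l)
    (h1 : f' l.length = a) (h2 : ∀ i < l.length, f' i = f i) : ListAt f' 0 (l ++ [a]) :=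
  (h.congr fun i hi => h2 i (by omega)).append fun i hi => by
    rw [List.length_singleton, Nat.lt_one_iff] at hi
    subst hi
    simpa using h1

theorem length_flatMap_le {α β : Type*} {d : ℕ} {f : α → List β} {L : List α}
    (h : ∀ x ∈ L, (f x).length ≤ d) : (L.flatMap f).length ≤ L.length * d := by
  rw [List.length_flatMap]
  simpa using List.sum_le_card_nsmul (L.map fun x => (f x).length) d (by simpa using h)

/-- A loop over the positions of a list. -/
theorem WP.forList {p : RamProgram} {T : ℕ} {Q : RamState F → Prop} {v : ℕ}
    {loA hi : Addr} (lo : ℕ) {α : Type*} (L : List α) (c : ℕ) (I : ℕ → RamState F → Prop)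
    (hloA : σ.getWord loA = lo) (hw : lo + L.length < 2 ^ w) (h0 : I 0 (σ.sw v 0 lo))
    (hI : ∀ i τ, I i τ → τ.word v 0 = lo + i ∧ τ.getWord hi = lo + L.length)
    (hstep : ∀ i τ, i < L.length → I i τ → WP w p τ c fun ρ =>
      ρ.word v 0 = lo + i ∧ ρ.word 12 0 = 1 ∧ I (i + 1) (ρ.sw v 0 (lo + (i + 1))))
    (hT : L.length * (c + 2) + 2 ≤ T) (hQ : ∀ τ, I L.length τ → Q τ) :
    WP w (RamProgram.forRange v loA hi p) σ T Q := by
  refine WP.forRange lo (lo + L.length) c (fun x τ => ∃ i, x = lo + i ∧ I i τ) hloA ⟨0, rfl, h0⟩ ?_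
      ?_ ?_ (hT := by rw [Nat.add_sub_cancel_left]; exact hT)
  · rintro x τ ⟨i, rfl, h⟩
    exact hI i τ h
  · rintro x τ - hx ⟨i, rfl, h⟩
    refine (hstep i τ (by omega) h).post ?_
    rintro ρ ⟨h1, h2, h3⟩
    exact ⟨h1, h2, i + 1, by omega, h3⟩
  · rintro τ ⟨i, hi, h⟩
    obtain rfl : L.length = i := by omega
    exact hQ τ h

/-- Find the first row that can be the pivot row of the column `word 16`. -/
def findPivot : RamProgram :=
  block [.wordMove (reg 22) (reg 14)] ;;
  forRange 17 (reg 20) (reg 21) (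
    block [
      .wordMove (reg 18) (arr 45 17),
      .wordOp .mul (reg 19) (reg 18) (reg 14),
      .wordOp .add (reg 19) (reg 19) (reg 16)] ;;
    .branch (.wordEq (arr 46 18) zeroAddr)
      (.branch (.fieldEq (arr 6 19) (reg 12)) .skip
        (.branch (.wordLt (reg 18) (reg 22)) (block [.wordMove (reg 22) (reg 18)]) .skip))
      .skip)

theorem findPivot_spec {γ : ℕ} {L : List ℕ} {U : ℕ → Prop} (hc : HoldsConsts n m q σ)
    (h14 : σ.word 14 0 = N) (h16 : σ.word 16 0 = γ) (hγ : γ < N) (h20 : σ.word 20 0 = lo)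
    (h21 : σ.word 21 0 = lo + L.length) (hL : ListAt (σ.word 45) lo L) (hLN : ∀ s ∈ L, s < N)
    (hU : ∀ s < N, σ.word 46 s = 0 ↔ ¬ U s) (hw : N * N < 2 ^ w) (hwl : lo + L.length < 2 ^ w)
    (hwN : N < 2 ^ w) :
    WP w findPivot σ (L.length * 9 + 3) fun τ => σ.Frame [17, 18, 19, 22] [] τ ∧
      ∃ r, τ.word 22 0 = r ∧
        (∀ s ∈ L, ¬ U s → σ.fld 6 (s * N + γ) ≠ 0 → r ≤ s) ∧
        (r = N ∨ r ∈ L ∧ r < N ∧ ¬ U r ∧ σ.fld 6 (r * N + γ) ≠ 0) := by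
  have hone := hc.one
  refine WP.block_seq (L.length * 9 + 2) ?_
  simp [h14]
  refine ⟨hwN, ?_⟩
  refine WP.forList lo L 7 (fun i τ => σ.Frame [17, 18, 19, 22] [] τ ∧ τ.word 17 0 = lo + i ∧
    ∃ r, τ.word 22 0 = r ∧
      (∀ s ∈ L.take i, ¬ U s → σ.fld 6 (s * N + γ) ≠ 0 → r ≤ s) ∧
      (r = N ∨ r ∈ L ∧ r < N ∧ ¬ U r ∧ σ.fld 6 (r * N + γ) ≠ 0)) (by simp [h20]) hwl ?_ ?_ ?_ ?_ ?_
  · simp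
  · rintro i τ ⟨hF, h, -⟩
    simp [h, hF.word, h21]
  · rintro i τ hi ⟨hF, hv, r, h22, hr1, hr2⟩
    have hs := hL i hi
    have hsN := hLN _ (List.getElem_mem hi)
    have htake := List.take_succ_eq_append_getElem hi
    have hmem := List.getElem_mem hi
    set s := L[i] with hs'
    have hsN2 : s * N + γ < N * N := addr_lt hsN hγ
    refine WP.block_seq 4 ?_
    simp [hF.word, hv, hs, h14, h16]
    iterate 3 refine ⟨by omega, ?_⟩
    refine WP.branch (T := 3) (fun hb => ?_) fun hb => ?_
    · simp [hF.word, hc.zero, hU s hsN] at hb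
      refine WP.branch (T := 2) (fun hb' => ?_) fun hb' => ?_
      · simp [hF.fld, hc.fzero] at hb'
        refine WP.skip ?_
        simp [hF.word, hF, hone, hv, h22, htake, add_assoc]
        refine ⟨?_, hr2⟩
        rintro x (hx | rfl) h1 h2
        · exact hr1 x hx h1 h2
        · exact absurd hb' h2
      · simp [hF.fld, hc.fzero] at hb'
        refine WP.branch (T := 1) (fun hlt => ?_) fun hlt => ?_
        · simp [h22] at hlt
          refine WP.block ?_
          simp [hF.word, hF, hone, hv, h22, htake, add_assoc]
          refine ⟨by omega, ?_, Or.inr ⟨hmem, hsN, hb, hb'⟩⟩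
          rintro x (hx | rfl) h1 h2
          · exact hlt.le.trans (hr1 x hx h1 h2)
          · exact le_rfl
        · simp [h22] at hlt
          refine WP.skip ?_
          simp [hF.word, hF, hone, hv, h22, htake, add_assoc]
          refine ⟨?_, hr2⟩
          rintro x (hx | rfl) h1 h2
          · exact hr1 x hx h1 h2
          · exact hlt
    · simp [hF.word, hc.zero, hU s hsN] at hb
      refine WP.skip ?_
      simp [hF.word, hF, hone, hv, h22, htake, add_assoc]
      refine ⟨?_, hr2⟩
      rintro x (hx | rfl) h1 h2
      · exact hr1 x hx h1 h2
      · exact absurd hb h1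
  · omega
  · rintro τ ⟨hF, hv, r, h22, hr1, hr2⟩
    rw [List.take_length] at hr1
    subst h22
    exact ⟨hF, by simpa using hr1, by simpa using hr2⟩

/-- Subtract the multiple `fld 13 0` of the row that begins at `word 23` from the row that begins at
`word 19`, in the listed columns. -/
def subtractRow : RamProgram :=
  forRange 26 (reg 20) (reg 21) (
    block [
      .wordMove (reg 28) (arr 45 26),
      .wordOp .add (reg 29) (reg 19) (reg 28),
      .wordOp .add (reg 30) (reg 23) (reg 28),
      .fieldOp .mul (reg 14) (reg 13) (arr 6 30),
      .fieldOp .sub (arr 6 29) (arr 6 29) (reg 14)])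

theorem subtractRow_spec {r s : ℕ} {L : List ℕ} {f : F} (hone : σ.word 12 0 = 1)
    (h19 : σ.word 19 0 = s * N) (h23 : σ.word 23 0 = r * N) (hf : σ.fld 13 0 = f) (hs : s < N)
    (hr : r < N) (hrs : r ≠ s) (h20 : σ.word 20 0 = lo) (h21 : σ.word 21 0 = lo + L.length)
    (hL : ListAt (σ.word 45) lo L) (hLN : ∀ t ∈ L, t < N) (hnodup : L.Nodup) (hw : N * N < 2 ^ w)
    (hwl : lo + L.length < 2 ^ w) :
    WP w subtractRow σ (L.length * 7 + 2) fun τ => σ.Frame [26, 28, 29, 30] [6, 14] τ ∧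
      ∀ i < N, ∀ j < N, τ.fld 6 (i * N + j) = if i = s ∧ j ∈ L then
        σ.fld 6 (s * N + j) - f * σ.fld 6 (r * N + j) else σ.fld 6 (i * N + j) := by
  refine WP.forList lo L 5 (fun p τ => σ.Frame [26, 28, 29, 30] [6, 14] τ ∧ τ.word 26 0 = lo + p ∧
    ∀ i < N, ∀ j < N, τ.fld 6 (i * N + j) = if i = s ∧ j ∈ L.take p then
        σ.fld 6 (s * N + j) - f * σ.fld 6 (r * N + j) else σ.fld 6 (i * N + j))
    (by simp [h20]) hwl ?_ ?_ ?_ ?_ ?_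
  · simp
  · rintro i τ ⟨hF, h, -⟩
    simp [h, hF.word, h21]
  · rintro p τ hp ⟨hF, hv, hA⟩
    have ht := hL p hp
    have htN := hLN _ (List.getElem_mem hp)
    have htake := List.take_succ_eq_append_getElem hp
    have hnot : L[p] ∉ L.take p := fun hm => by
      obtain ⟨j, hj, he⟩ := List.mem_take_iff_getElem.1 hm
      have := (hnodup.getElem_inj_iff (hi := by omega) (hj := hp)).1 he
      omega
    set t := L[p] with ht'
    have h1 : s * N + t < N * N := addr_lt hs htN
    have h2 : r * N + t < N * N := addr_lt hr htN
    refine WP.block ?_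
    simp [hF.word, hF.fld, hv, ht, h19, h23, hf, hF, hone,
      add_assoc]
    refine ⟨by omega, by omega, by omega, fun i hi j hj => ?_⟩
    simp only [Function.update_apply, addr_inj hj htN, hA _ hs _ htN, hA _ hr _ htN, hrs,
      false_and, if_false, hnot, and_false, hA i hi j hj, htake, List.mem_append,
      List.mem_singleton]
    by_cases h3 : i = s ∧ j = t
    · obtain ⟨rfl, rfl⟩ := h3
      simp
    · by_cases h4 : i = s <;> by_cases h5 : j = t <;> simp_all
  · omega
  · rintro τ ⟨hF, hv, hA⟩
    rw [List.take_length] at hA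
    exact ⟨hF, hA⟩

/-- Clear the column `word 16` below the pivot row `word 22`. -/
def clearColumn : RamProgram :=
  forRange 17 (reg 20) (reg 21) (
    block [
      .wordMove (reg 18) (arr 45 17),
      .wordOp .mul (reg 19) (reg 18) (reg 14),
      .wordOp .add (reg 25) (reg 19) (reg 16)] ;;
    .branch (.wordEq (arr 46 18) zeroAddr)
      (.branch (.fieldEq (arr 6 25) (reg 12)) .skip (
        block [
          .fieldOp .div (reg 13) (arr 6 25) (arr 6 24),
          .wordMove (arr 50 42) (reg 18),
          .wordMove (arr 51 42) (reg 22),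
          .fieldMove (arr 7 42) (reg 13),
          .wordOp .add (reg 42) (reg 42) (reg 12)] ;;
        subtractRow))
      .skip)

theorem clearColumn_spec {γ r : ℕ}
    (hc : HoldsConsts n m q σ) (hcov : IsCover N l pn nd NL) (hl : HoldsLists N nd NL σ)
    (he : HoldsElim N pn nd M' γ (γ + 1) piv ops σ) (hγ : γ < N) (hr : (r, γ) ∈ piv)
    (hpos : ∀ s < N, s ∉ piv.map Prod.fst → σ.fld 6 (s * N + γ) ≠ 0 → r < s)
    (h16 : σ.word 16 0 = γ) (h20 : σ.word 20 0 = σ.word 43 (nd γ))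
    (h21 : σ.word 21 0 = σ.word 44 (nd γ)) (h22 : σ.word 22 0 = r) (h23 : σ.word 23 0 = r * N)
    (h24 : σ.word 24 0 = r * N + γ) (hw : N * N + 1 < 2 ^ w)
    (hwl : ∀ t < N, σ.word 44 (nd t) < 2 ^ w) (hwN : N < 2 ^ w) :
    WP w clearColumn σ (l * (l * 7 + 14) + 2) fun τ =>
      σ.Frame [17, 18, 19, 25, 26, 28, 29, 30, 42, 50, 51] [6, 7, 13, 14] τ ∧
      ∃ ops', HoldsElim N pn nd M' (γ + 1) (γ + 1) piv ops' τ ∧ ops'.length ≤ ops.length + l := by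
  have hone := hc.one
  have hlist := hl.list γ hγ
  have hlast := hl.last γ hγ
  have h14 := hl.size
  have hlen := hcov.length_le γ hγ
  have hLN := hcov.lt γ hγ
  have hnodup := hcov.nodup γ hγ
  have hwl := hwl γ hγ
  set L := NL (nd γ) with hL
  set lo := σ.word 43 (nd γ) with hlo
  have hrN := (he.elim.piv_lt _ hr).1
  dsimp only at hrN
  have hrused : r ∈ piv.map Prod.fst := List.mem_map.2 ⟨_, hr, rfl⟩
  refine WP.forList lo L (l * 7 + 12) (fun i τ =>
    σ.Frame [17, 18, 19, 25, 26, 28, 29, 30, 42, 50, 51] [6, 7, 13, 14] τ ∧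
    τ.word 17 0 = lo + i ∧ (∃ ops', HoldsElim N pn nd M' γ (γ + 1) piv ops' τ ∧
      ops'.length ≤ ops.length + i) ∧
    ∀ s < N, s ∉ piv.map Prod.fst → τ.fld 6 (s * N + γ) ≠ 0 → r < s ∧ s ∈ L.drop i)
    (by simp [h20]) (by omega) ?_ ?_ ?_ ?_ ?_
  · refine ⟨by simp, by simp, ⟨ops, he.frame (ws := [17]) (fs := [])
      (by simp) (by decide) (by decide), le_rfl⟩, fun s hs hsp hA => ?_⟩
    rw [RamState.fld_sw] at hA
    exact ⟨hpos s hs hsp hA, hcov.near s hs γ hγ (he.elim.fill s hs γ hγ hA)⟩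
  · rintro i τ ⟨hF, h, -⟩
    simp [h, hF.word, h21, hlast]
  · rintro i τ hi ⟨hF, hv, ⟨ops', he', hol⟩, hA⟩
    have hs := hlist i hi
    have hsN := hLN _ (List.getElem_mem hi)
    have hdrop := List.drop_eq_getElem_cons hi
    set s := L[i] with hs'
    have hsN2 : s * N + γ < N * N := addr_lt hsN hγ
    have hopl := he'.elim.length_ops_le
    -- the invariant in the case that the row `s` need not be changed
    have hkeep : ∀ τ' : RamState F, τ.Frame [17, 18, 19, 25] [] τ' →
        (s ∈ piv.map Prod.fst ∨ τ.fld 6 (s * N + γ) = 0) →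
        (∃ ops', HoldsElim N pn nd M' γ (γ + 1) piv ops' τ' ∧ ops'.length ≤ ops.length + (i + 1)) ∧
        ∀ t < N, t ∉ piv.map Prod.fst →
          τ'.fld 6 (t * N + γ) ≠ 0 → r < t ∧ t ∈ L.drop (i + 1) := by
      intro τ' hG hs0
      refine ⟨⟨ops', he'.frame hG, by omega⟩, fun t ht htp hA' => ?_⟩
      rw [hG.fld (by decide)] at hA'
      have h1 := hA t ht htp hA'
      rw [hdrop, List.mem_cons] at h1
      refine ⟨h1.1, h1.2.resolve_left ?_⟩
      rintro rfl
      exact hs0.elim htp hA'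
    refine WP.block_seq (l * 7 + 9) ?_
    simp [hF.word, hv, hs, h14, h16]
    iterate 3 refine ⟨by omega, ?_⟩
    refine WP.branch (T := l * 7 + 8) (fun hb => ?_) fun hb => ?_
    · have hb1 : s ∉ piv.map Prod.fst := by
        simpa [zeroAddr, hF.word, hc.zero, he'.used] using hb
      refine WP.branch (T := l * 7 + 7) (fun hb' => ?_) fun hb' => ?_
      · simp [hF.fld, hc.fzero] at hb'
        refine WP.skip ?_
        have hk := hkeep ((((τ.sw 18 0 s).sw 19 0 (s * N)).sw 25 0 (s * N + γ)).sw 17 0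
          (lo + (i + 1))) (by simp) (Or.inr hb')
        refine ⟨by simp [hv], by simp [hF.word, hone], by simp [hF], hk.1, by simpa using hk.2⟩
      · simp [hF.fld, hc.fzero] at hb'
        have hrs := (hA s hsN hb1 hb').1
        have hrγ := he'.elim.piv_ne _ hr
        dsimp only at hrγ
        refine WP.block_seq (L.length * 7 + 2) ?_
        simp [hF.word, h24, h22, he'.nops, hone]
        refine ⟨hrγ, by omega, by omega, by omega, ?_⟩
        set f := τ.fld 6 (s * N + γ) / τ.fld 6 (r * N + γ) with hf
        set τ₁ := ((((((((τ.sw 18 0 s).sw 19 0 (s * N)).sw 25 0 (s * N + γ)).sf 13 0 f).sw 50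
          ops'.length s).sw 51 ops'.length r).sf 7 ops'.length f).sw 42 0 (ops'.length + 1)) with hτ₁
        have hF₁ : σ.Frame [17, 18, 19, 25, 26, 28, 29, 30, 42, 50, 51] [6, 7, 13, 14] τ₁ := by
          simp [hτ₁, hF]
        have b17 : τ₁.word 17 0 = lo + i := by simp [hτ₁, hv]
        have b50 : τ₁.word 50 = Function.update (τ.word 50) ops'.length s := by simp [hτ₁]
        have b51 : τ₁.word 51 = Function.update (τ.word 51) ops'.length r := by simp [hτ₁]
        have b7 : τ₁.fld 7 = Function.update (τ.fld 7) ops'.length f := by simp [hτ₁]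
        have b6 : τ₁.fld 6 = τ.fld 6 := by simp [hτ₁]
        have b42 : τ₁.word 42 0 = ops'.length + 1 := by simp [hτ₁]
        have b46 : τ₁.word 46 = τ.word 46 := by simp [hτ₁]
        have b27 : τ₁.word 27 = τ.word 27 := by simp [hτ₁]
        have b47 : τ₁.word 47 = τ.word 47 := by simp [hτ₁]
        have b48 : τ₁.word 48 = τ.word 48 := by simp [hτ₁]
        refine (subtractRow_spec (s := s) (r := r) (N := N) (lo := lo) (L := L) (f := f)
          (by simp [hF₁.word, hone]) (by simp [hτ₁]) (by simp [hF₁.word, h23]) (by simp [hτ₁])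
          hsN hrN hrs.ne (by simp [hF₁.word, h20]) (by simp [hF₁.word, h21, hlast])
          (by simpa [hF₁.word] using hlist) hLN hnodup (by omega) (by omega)).post ?_
        rintro ρ ⟨hG, hA'⟩
        have hGF := hF₁.trans hG
        simp only [b6] at hA'
        have hA'' : ∀ a < N, ∀ b < N, ρ.fld 6 (a * N + b) = if a = s then
            τ.fld 6 (s * N + b) - τ.fld 6 (s * N + γ) / τ.fld 6 (r * N + γ) * τ.fld 6 (r * N + b)
            else τ.fld 6 (a * N + b) := by
          intro a ha b hb
          rw [hA' a ha b hb]
          by_cases h1 : a = s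
          · by_cases h2 : b ∈ L
            · simp [h1, h2, hf]
            · -- the pivot row has no entry in a column outside the list
              have h3 : τ.fld 6 (r * N + b) = 0 := by
                by_contra h3
                refine h2 (hcov.near_le r hrN γ hγ b hb (he'.elim.fill r hrN γ hγ hrγ)
                  (he'.elim.fill r hrN b hb h3) (not_lt.1 fun h4 => h3 ?_))
                exact he'.elim.piv_zero _ hr b h4
              simp [h1, h2, h3]
          · simp [h1]
        have hE := he'.elim.rowOp hcov.pn_lt hcov.nd_ne hcov.nd_mono hr hsN hb1 hb' hrs
          (A' := fun a b => ρ.fld 6 (a * N + b)) hA''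
        refine ⟨?_, ?_, ?_, ⟨ops' ++ [(s, r, f)], ?_, by simp; omega⟩, ?_⟩
        · rw [hG.word (by decide), b17]
        · simp [hGF.word, hone]
        · simp [hGF]
        · refine ⟨hE, ?_, ?_, ?_, ?_, ?_⟩
          · simp [hG.word, b46]
            simpa using he'.used
          · simp [hG.word, b27, he'.npiv]
          · simp only [RamState.word_sw, show ¬ (47 = 17) by decide, show ¬ (48 = 17) by decide,
              if_false, hG.word (a := 47) (by decide), hG.word (a := 48) (by decide), b47, b48]
            exact he'.pivs
          · simp [hG.word, b42]
          · simp only [RamState.word_sw, show ¬ (50 = 17) by decide, show ¬ (51 = 17) by decide,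
              if_false, hG.word (a := 50) (by decide), hG.word (a := 51) (by decide), b50, b51,
              RamState.fld_sw, hG.fld (a := 7) (by decide), b7]
            refine he'.opsl.concat (by simp) fun j hj => ?_
            simp [hj.ne]
        · intro t ht htp hAt
          replace htp : t ∉ piv.map Prod.fst := by simpa using htp
          rw [hA'' t ht γ hγ] at hAt
          by_cases hts : t = s
          · rw [if_pos hts, div_mul_cancel₀ _ hrγ, sub_self] at hAt
            exact absurd rfl hAt
          · rw [if_neg hts] at hAt
            have h1 := hA t ht htp hAt
            rw [hdrop, List.mem_cons] at h1
            exact ⟨h1.1, h1.2.resolve_left hts⟩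
    · have hb1 : s ∈ piv.map Prod.fst := by
        by_contra hb1
        refine hb ?_
        simp [hF.word, hc.zero, he'.used, -List.mem_map, hb1]
      refine WP.skip ?_
      have hk := hkeep ((((τ.sw 18 0 s).sw 19 0 (s * N)).sw 25 0 (s * N + γ)).sw 17 0
        (lo + (i + 1))) (by simp) (Or.inl hb1)
      refine ⟨by simp [hv], by simp [hF.word, hone], by simp [hF], hk.1, by simpa using hk.2⟩
  · have : L.length * (l * 7 + 12 + 2) ≤ l * (l * 7 + 14) := Nat.mul_le_mul_right _ hlen
    omega
  · rintro τ ⟨hF, hv, ⟨ops', he', hol⟩, hA⟩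
    refine ⟨hF, ops', ?_, by omega⟩
    exact { he' with
      elim := he'.elim.finish le_rfl fun s hs hsp => by
        by_contra h0
        have := (hA s hs hsp h0).2
        simp at this }

/-- Gaussian elimination: the columns are dealt with in order. -/
def eliminateColumns : RamProgram :=
  block [.wordConst (reg 27) 0, .wordConst (reg 42) 0] ;;
  forRange 16 zeroAddr (reg 14) (
    block [.wordMove (reg 17) (arr 33 16), .wordMove (reg 20) (arr 43 17),
      .wordMove (reg 21) (arr 44 17)] ;;
    findPivot ;;
    .branch (.wordLt (reg 22) (reg 14)) (
      block [
        .wordMove (arr 46 22) (reg 12),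
        .wordMove (arr 47 27) (reg 22),
        .wordMove (arr 48 27) (reg 16),
        .wordOp .add (reg 27) (reg 27) (reg 12),
        .wordOp .mul (reg 23) (reg 22) (reg 14),
        .wordOp .add (reg 24) (reg 23) (reg 16)] ;;
      clearColumn)
      .skip)

theorem eliminateColumns_spec
    (hc : HoldsConsts n m q σ) (hcov : IsCover N l pn nd NL) (hl : HoldsLists N nd NL σ)
    (hM : ∀ s < N, ∀ t < N, σ.fld 6 (s * N + t) = M' s t)
    (hfill : ∀ s < N, ∀ t < N, M' s t ≠ 0 → Near pn nd s t)
    (hused : σ.word 46 = fun _ => 0) (hw : N * N + 1 < 2 ^ w)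
    (hwl : ∀ t < N, σ.word 44 (nd t) < 2 ^ w) (hwN : N + 1 < 2 ^ w)
    (hwnd : ∀ t < N, nd t < 2 ^ w) :
    WP w eliminateColumns σ (N * (l * (l * 7 + 23) + 17) + 4) fun τ =>
      σ.Frame [16, 17, 18, 19, 20, 21, 22, 23, 24, 25, 26, 27, 28, 29, 30, 42, 46, 47, 48, 50, 51]
        [6, 7, 13, 14] τ ∧
      ∃ piv ops, HoldsElim N pn nd M' N N piv ops τ ∧ ops.length ≤ N * l := by
  have hone := hc.one
  have h14 := hl.size
  have h33 := hl.node
  have hw0 : w ≠ 0 := by rintro rfl; simp at hwN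
  refine WP.block_seq (N * (l * (l * 7 + 23) + 17) + 2) ?_
  simp
  refine WP.forRange 0 N (l * (l * 7 + 23) + 15) (fun γ τ =>
    σ.Frame [16, 17, 18, 19, 20, 21, 22, 23, 24, 25, 26, 27, 28, 29, 30, 42, 46, 47, 48, 50, 51]
        [6, 7, 13, 14] τ ∧ τ.word 16 0 = γ ∧
    ∃ piv ops, HoldsElim N pn nd M' γ γ piv ops τ ∧ ops.length ≤ γ * l)
    (by simp [hc.zero]) ?_ ?_ ?_ ?_ (hT := by rw [Nat.sub_zero])
  · refine ⟨by simp, by simp, [], [], ⟨?_, ?_, ?_, ?_, ?_, ?_⟩, by simp⟩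
    · exact (IsElim.start hfill).congr (Nat.zero_le _) fun s hs t ht => by simpa using hM s hs t ht
    · intro s; simp [hused]
    · simp
    · intro i hi; simp at hi
    · simp
    · intro i hi; simp at hi
  · rintro i τ ⟨hF, h, -⟩
    simp [h, hF.word, h14]
  · rintro γ τ - hγ ⟨hF, hv, piv, ops, he, hol⟩
    have hlist := hl.list γ hγ
    have hlast := hl.last γ hγ
    have hlen := hcov.length_le γ hγ
    have hwlγ := hwl γ hγ
    have hndγ := hwnd γ hγ
    have hpl := he.elim.length_piv_le
    refine WP.block_seq (l * 9 + 3 + (6 + (l * (l * 7 + 14) + 2) + 1)) ?_ (by simp; ring_nf; omega)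
    simp [hF.word, hv, h33]
    refine ⟨hndγ, by omega, hwlγ, ?_⟩
    set τ₁ : RamState F := ((τ.sw 17 0 (nd γ)).sw 20 0 (σ.word 43 (nd γ))).sw 21 0
      (σ.word 44 (nd γ)) with hτ₁
    have hF₁ : σ.Frame [16, 17, 18, 19, 20, 21, 22, 23, 24, 25, 26, 27, 28, 29, 30, 42, 46, 47, 48,
        50, 51] [6, 7, 13, 14] τ₁ := by simp [hτ₁, hF]
    have b16 : τ₁.word 16 0 = γ := by simp [hτ₁, hv]
    have he₁ : HoldsElim N pn nd M' γ γ piv ops τ₁ :=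
      he.frame (ws := [17, 20, 21]) (fs := []) (by simp [hτ₁]) (by decide)
        (by decide)
    refine WP.seq (T₁ := l * 9 + 3) (6 + (l * (l * 7 + 14) + 2) + 1)
        ((findPivot_spec (γ := γ) (L := NL (nd γ))
      (lo := σ.word 43 (nd γ)) (U := fun s => s ∈ piv.map Prod.fst) (hc.frame hF₁)
      (by simp [hF₁.word, h14]) b16 hγ (by simp [hτ₁]) (by simp [hτ₁, hlast])
      (by simpa [hF₁.word] using hlist) (hcov.lt γ hγ) (fun s hs => by simp [he₁.used]) (by omega)
      (by omega) (by omega)).mono (by omega) ?_) le_rfl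
    rintro ρ ⟨hG, r, h22, hr1, hr2⟩
    have hGF := hF₁.trans hG
    have b16' : ρ.word 16 0 = γ := by rw [hG.word (by decide), b16]
    have he₂ : HoldsElim N pn nd M' γ γ piv ops ρ := he₁.frame hG
    have hr1' : ∀ s < N, s ∉ piv.map Prod.fst → τ₁.fld 6 (s * N + γ) ≠ 0 → r ≤ s :=
      fun s hs hsp hA => hr1 s (hcov.near s hs γ hγ (he₁.elim.fill s hs γ hγ hA)) hsp hA
    refine WP.branch (fun hb => ?_) fun hb => ?_
    · simp [h22, hGF.word, h14] at hb
      obtain ⟨hrL, hrN, hrp, hrA⟩ := hr2.resolve_left hb.ne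
      have hrA' : ρ.fld 6 (r * N + γ) ≠ 0 := by rw [hG.fld (by decide)]; exact hrA
      have h1 : r * N + γ < N * N := addr_lt hrN hγ
      refine WP.block_seq (l * (l * 7 + 14) + 2) ?_
      simp [hGF.word, h22, hone, he₂.npiv, b16', h14]
      refine ⟨hw0, by omega, by omega, by omega, by omega, by omega, ?_⟩
      set ρ₁ : RamState F := (((((ρ.sw 46 r 1).sw 47 piv.length r).sw 48 piv.length γ).sw 27 0
        (piv.length + 1)).sw 23 0 (r * N)).sw 24 0 (r * N + γ) with hρ₁
      have hF₂ : σ.Frame [16, 17, 18, 19, 20, 21, 22, 23, 24, 25, 26, 27, 28, 29, 30, 42, 46, 47,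
        48, 50, 51] [6, 7, 13, 14] ρ₁ := by simp [hρ₁, hGF]
      have he₃ : HoldsElim N pn nd M' γ (γ + 1) (piv ++ [(r, γ)]) ops ρ₁ := by
        refine ⟨he₂.elim.addPivot hγ hrN hrp hrA', ?_, ?_, ?_, ?_, ?_⟩
        · intro s
          have := he₂.used s
          by_cases hs : s = r
          · subst hs; simp [hρ₁]
          · have h2 : s ∈ (piv ++ [(r, γ)]).map Prod.fst ↔ s ∈ piv.map Prod.fst := by simp [hs]
            simp only [h2, ← this]
            simp [hρ₁, hs]
        · simp [hρ₁]
        · refine he₂.pivs.concat (by simp [hρ₁]) fun i hi => ?_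
          simp [hρ₁, hi.ne]
        · simp [hρ₁, he₂.nops]
        · simpa [hρ₁] using he₂.opsl
      have b20 : ρ₁.word 20 0 = σ.word 43 (nd γ) := by simp [hρ₁, hG.word, hτ₁]
      have b21 : ρ₁.word 21 0 = σ.word 44 (nd γ) := by simp [hρ₁, hG.word, hτ₁]
      refine (clearColumn_spec (r := r) (hc.frame hF₂) hcov
        (hl.frame hF₂) he₃ hγ (by simp) ?_ (by simp [hρ₁, b16']) ?_ ?_
        (by simp [hρ₁, h22]) (by simp [hρ₁]) (by simp [hρ₁]) hw ?_ (by omega)).post ?_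
      · intro s hs hsp hA
        have h2 : s ≠ r := by rintro rfl; simp at hsp
        have h3 := hr1' s hs (fun h => hsp (by rw [List.map_append]; exact List.mem_append_left _ h))
          (by rw [← hG.fld (a := 6) (by decide)]; simpa [hρ₁] using hA)
        omega
      · rw [b20, hF₂.word (by decide)]
      · rw [b21, hF₂.word (by decide)]
      · rw [hF₂.word (by decide)]; exact hwl
      · rintro τ' ⟨hH, ops', he', hol'⟩
        have hHF := hF₂.trans hH
        refine ⟨?_, ?_, by simp [hHF], _, ops', he'.frame (ws := [16]) (fs := [])
          (by simp) (by decide) (by decide), by rw [Nat.succ_mul]; omega⟩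
        · rw [hH.word (by decide)]; simp [hρ₁, b16']
        · simp [hHF.word, hone]
    · simp [h22, hGF.word, h14] at hb
      refine WP.skip ?_
      have he₃ : HoldsElim N pn nd M' (γ + 1) (γ + 1) piv ops ρ :=
        { he₂ with
          elim := he₂.elim.finish (by omega) fun s hs hsp => by
            by_contra h0
            rw [hG.fld (by decide)] at h0
            have := hr1' s hs hsp h0
            omega }
      exact ⟨b16', by simp [hGF.word, hone], by simp [hGF], piv, ops,
        he₃.frame (ws := [16]) (fs := []) (by simp) (by decide) (by decide),
        by rw [Nat.succ_mul]; omega⟩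
  · rintro τ ⟨hF, hv, he⟩
    exact ⟨hF, he⟩

/-! ### Programs: sorting the slots

Word segment `56` contains the topmost slot of every label, the segments `54` and `55` the slots in
the order of increasing labels and these labels, and segment `57` the pivot rows followed by the other
rows. -/

section

variable (lab : ℕ → ℕ) (N : ℕ)

/-- The position of the slot `s` when the slots below `N` are sorted stably by their labels. -/
def sortPos (s : ℕ) : ℕ :=
  Nat.count (fun t => lab t < lab s) N + Nat.count (fun t => lab t = lab s) s

theorem count_lt_succ (v : ℕ) : Nat.count (fun t => lab t < v + 1) N =
    Nat.count (fun t => lab t < v) N + Nat.count (fun t => lab t = v) N := by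
  induction N with
  | zero => simp
  | succ N ih =>
    rw [Nat.count_succ, Nat.count_succ, Nat.count_succ, ih]
    split_ifs <;> omega

theorem count_lt_mono {u v : ℕ} (h : u ≤ v) :
    Nat.count (fun t => lab t < u) N ≤ Nat.count (fun t => lab t < v) N :=
  Nat.count_mono_left fun _ _ ht => lt_of_lt_of_le ht h

variable {lab N}

theorem sortPos_lt_count {s : ℕ} (hs : s < N) :
    sortPos lab N s < Nat.count (fun t => lab t < lab s + 1) N := by
  rw [sortPos, count_lt_succ]
  exact Nat.add_lt_add_left (Nat.count_strict_mono (p := fun t => lab t = lab s) rfl hs) _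

theorem sortPos_lt {s : ℕ} (hs : s < N) : sortPos lab N s < N :=
  (sortPos_lt_count hs).trans_le (Nat.count_le _)

theorem sortPos_lt_of_lab_lt {s t : ℕ} (hs : s < N) (hst : lab s < lab t) :
    sortPos lab N s < sortPos lab N t :=
  (sortPos_lt_count hs).trans_le ((count_lt_mono lab N hst).trans (Nat.le_add_right _ _))

theorem sortPos_lt_of_lab_eq {s t : ℕ} (hst : s < t) (h : lab s = lab t) :
    sortPos lab N s < sortPos lab N t := by
  rw [sortPos, sortPos, h]
  exact Nat.add_lt_add_left (Nat.count_strict_mono (p := fun x => lab x = lab t) h hst) _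

theorem sortPos_inj {s t : ℕ} (hs : s < N) (ht : t < N) (h : sortPos lab N s = sortPos lab N t) :
    s = t := by
  rcases lt_trichotomy (lab s) (lab t) with h1 | h1 | h1
  · exact absurd h (sortPos_lt_of_lab_lt hs h1).ne
  · rcases lt_trichotomy s t with h2 | h2 | h2
    · exact absurd h (sortPos_lt_of_lab_eq h2 h1).ne
    · exact h2
    · exact absurd h (sortPos_lt_of_lab_eq h2 h1.symm).ne'
  · exact absurd h (sortPos_lt_of_lab_lt ht h1).ne'

/-- `sl` lists the slots below `N` by increasing labels, and `sv` is the list of these labels. -/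
structure IsSorting (N : ℕ) (lab sl sv : ℕ → ℕ) : Prop where
  lt : ∀ g < N, sl g < N ∧ sv g = lab (sl g)
  inj : ∀ i < N, ∀ j < N, sl i = sl j → i = j
  mono : ∀ i j, i ≤ j → j < N → sv i ≤ sv j

theorem isSorting_of_sortPos {sl sv : ℕ → ℕ}
    (h : ∀ s < N, sl (sortPos lab N s) = s ∧ sv (sortPos lab N s) = lab s) :
    IsSorting N lab sl sv := by
  have hex : ∀ g < N, ∃ s < N, sortPos lab N s = g := fun g hg => by
    obtain ⟨e, he⟩ := exists_perm_of_injOn (fun s (hs : s < N) => sortPos_lt (lab := lab) hs)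
      (fun i hi j hj hij => sortPos_inj hi hj hij)
    exact ⟨e.symm ⟨g, hg⟩, (e.symm ⟨g, hg⟩).2, by rw [← he, Equiv.apply_symm_apply]⟩
  refine ⟨fun g hg => ?_, fun i hi j hj hij => ?_, fun i j hij hj => ?_⟩
  · obtain ⟨s, hs, rfl⟩ := hex g hg
    rw [(h s hs).1, (h s hs).2]
    exact ⟨hs, rfl⟩
  · obtain ⟨s, hs, rfl⟩ := hex i hi
    obtain ⟨t, ht, rfl⟩ := hex j hj
    rw [(h s hs).1, (h t ht).1] at hij
    rw [hij]
  · obtain ⟨s, hs, rfl⟩ := hex i (by omega)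
    obtain ⟨t, ht, rfl⟩ := hex j hj
    rw [(h s hs).2, (h t ht).2]
    by_contra hlt
    have := sortPos_lt_of_lab_lt ht (not_le.1 hlt)
    omega

end

/-- Find the topmost slot of every label. -/
def findTops : RamProgram :=
  forRange 16 zeroAddr (reg 14) (
    .branch (.wordEq (arr 34 16) zeroAddr)
      (block [.wordMove (reg 18) (arr 6 16), .wordMove (arr 56 18) (reg 16)])
      .skip)

theorem findTops_spec (hc : HoldsConsts n m q σ) (hN : σ.word 14 0 = N)
    (hlab : ∀ s < N, σ.word 6 s < n + m)
    (htop : ∀ v < n + m, ∃! s, s < N ∧ σ.word 6 s = v ∧ σ.word 34 s = 0) (hwN : N < 2 ^ w)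
    (hwn : n + m < 2 ^ w) :
    WP w findTops σ (N * 5 + 2) fun τ => σ.Frame [16, 18, 56] [] τ ∧
      ∀ v < n + m, τ.word 56 v < N ∧ σ.word 6 (τ.word 56 v) = v ∧ σ.word 34 (τ.word 56 v) = 0 := by
  have hone := hc.one
  refine WP.forRange 0 N 3 (fun x τ => σ.Frame [16, 18, 56] [] τ ∧ τ.word 16 0 = x ∧
    ∀ s < x, σ.word 34 s = 0 → τ.word 56 (σ.word 6 s) = s)
    (by simp [hc.zero]) ?_ ?_ ?_ ?_
  · simp
  · rintro i τ ⟨hF, h, -⟩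
    simp [h, hF.word, hN]
  · rintro x τ - hx ⟨hF, hv, h⟩
    refine WP.branch (T := 2) (fun hb => ?_) fun hb => ?_
    · simp [hv, hF.word, hc.zero] at hb
      refine WP.block ?_
      have hlx := hlab x hx
      simp [hF.word, hv, hF, hone]
      refine ⟨by omega, by omega, fun s hs h0 => ?_⟩
      by_cases hsx : s = x
      · subst hsx; simp
      · rw [Function.update_of_ne, h s (by omega) h0]
        intro he
        exact hsx ((htop _ hlx).unique ⟨by omega, he, h0⟩ ⟨hx, rfl, hb⟩)
    · simp [hv, hF.word, hc.zero] at hb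
      refine WP.skip ?_
      simp [hF.word, hv, hone, hF]
      intro s hs h0
      refine h s ?_ h0
      have : s ≠ x := by rintro rfl; exact hb h0
      omega
  · rintro τ ⟨hF, hv, h⟩
    refine ⟨hF, fun v hv => ?_⟩
    obtain ⟨s, ⟨h1, h2, h3⟩, -⟩ := htop v hv
    have := h s h1 h3
    rw [h2] at this
    rw [this]
    exact ⟨h1, h2, h3⟩

/-- Sort the slots by their labels, by counting. -/
def sortSlots : RamProgram :=
  forRange 16 zeroAddr (reg 14) (block [
    .wordMove (reg 18) (arr 6 16),
    .wordOp .add (arr 52 18) (arr 52 18) (reg 12)]) ;;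
  block [.wordConst (reg 19) 0] ;;
  forRange 16 zeroAddr (reg 13) (block [
    .wordMove (arr 53 16) (reg 19),
    .wordOp .add (reg 19) (reg 19) (arr 52 16)]) ;;
  forRange 16 zeroAddr (reg 14) (block [
    .wordMove (reg 18) (arr 6 16),
    .wordMove (reg 20) (arr 53 18),
    .wordMove (arr 54 20) (reg 16),
    .wordMove (arr 55 20) (reg 18),
    .wordOp .add (arr 53 18) (reg 20) (reg 12)])

theorem sortSlots_spec (hc : HoldsConsts n m q σ) (hN : σ.word 14 0 = N)
    (hlab : ∀ s < N, σ.word 6 s < n + m) (h52 : σ.word 52 = fun _ => 0) (hwN : N + 1 < 2 ^ w)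
    (hwn : n + m < 2 ^ w) :
    WP w sortSlots σ (N * 11 + (n + m) * 4 + 7) fun τ =>
      σ.Frame [16, 18, 19, 20, 52, 53, 54, 55] [] τ ∧
      IsSorting N (σ.word 6) (τ.word 54) (τ.word 55) := by
  have hone := hc.one
  set lab := σ.word 6 with hlabd
  refine WP.seq (T₁ := N * 4 + 2) (1 + ((n + m) * 4 + 2 + (N * 7 + 2)))
    (WP.forRange 0 N 2 (fun x τ => σ.Frame [16, 18, 19, 20, 52, 53, 54, 55] [] τ ∧
      τ.word 16 0 = x ∧ ∀ v < n + m, τ.word 52 v = Nat.count (fun t => lab t = v) x)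
    (by simp [hc.zero]) ?_ ?_ ?_ ?_)
  · simp [h52]
  · rintro i τ ⟨hF, h, -⟩
    simp [h, hF.word, hN]
  · rintro x τ - hx ⟨hF, hv, h⟩
    refine WP.block ?_
    have hlx := hlab x hx
    have hcx := h _ hlx
    have hle : Nat.count (fun t => lab t = lab x) x ≤ x := Nat.count_le _
    simp [hF.word, hv, hF, hone, ← hlabd, hcx]
    refine ⟨by omega, by omega, fun v hvn => ?_⟩
    rw [Nat.count_succ, Function.update_apply, h v hvn]
    by_cases hvx : lab x = v
    · subst hvx; simp
    · rw [if_neg hvx, if_neg (Ne.symm hvx), add_zero]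
  rintro σ₁ ⟨hF₁, -, hcnt⟩
  refine WP.block_seq ((n + m) * 4 + 2 + (N * 7 + 2)) ?_
  simp
  refine WP.seq (T₁ := (n + m) * 4 + 2) (N * 7 + 2) (WP.forRange 0 (n + m) 2 (fun v τ =>
    σ.Frame [16, 18, 19, 20, 52, 53, 54, 55] [] τ ∧ τ.word 16 0 = v ∧
      τ.word 52 = σ₁.word 52 ∧ τ.word 19 0 = Nat.count (fun t => lab t < v) N ∧
      ∀ u < v, τ.word 53 u = Nat.count (fun t => lab t < u) N)
    (by simp [hF₁.word, hc.zero]) ?_ ?_ ?_ ?_) le_rfl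
  · simp [hF₁]
  · rintro i τ ⟨hF, h, -⟩
    simp [h, hF.word, hc.total]
  · rintro v τ - hvn ⟨hF, hv, h52', h19, h⟩
    refine WP.block ?_
    have e1 := count_lt_succ lab N v
    have e2 : Nat.count (fun t => lab t < v) N ≤ N := Nat.count_le _
    have e3 : Nat.count (fun t => lab t < v + 1) N ≤ N := Nat.count_le _
    simp only [Nat.lt_add_one_iff] at e1 e3
    simp [hF.word, hv, hF, hone, h19, h52', hcnt v hvn]
    refine ⟨by omega, by omega, by omega, fun u hu => ?_⟩
    rw [Function.update_apply]
    split_ifs with huv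
    · rw [huv]
    · exact h u (by omega)
  rintro σ₂ ⟨hF₂, -, -, -, hst⟩
  refine WP.forRange 0 N 5 (fun x τ => σ.Frame [16, 18, 19, 20, 52, 53, 54, 55] [] τ ∧
      τ.word 16 0 = x ∧ (∀ v < n + m, τ.word 53 v = Nat.count (fun t => lab t < v) N +
        Nat.count (fun t => lab t = v) x) ∧
      ∀ s < x, τ.word 54 (sortPos lab N s) = s ∧ τ.word 55 (sortPos lab N s) = lab s)
    (by simp [hF₂.word, hc.zero]) ?_ ?_ ?_ ?_
  · simp [hF₂]
    exact hst
  · rintro i τ ⟨hF, h, -⟩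
    simp [h, hF.word, hN]
  · rintro x τ - hx ⟨hF, hv, h, hp⟩
    refine WP.block ?_
    have hlx := hlab x hx
    have hcx : τ.word 53 (lab x) = sortPos lab N x := h _ hlx
    have hpx := sortPos_lt (lab := lab) hx
    simp [hF.word, hv, hF, hone, ← hlabd, hcx]
    refine ⟨by omega, by omega, by omega, by omega, by omega, fun v hvn => ?_, fun s hs => ?_⟩
    · rw [Nat.count_succ, Function.update_apply, h v hvn]
      by_cases hvx : lab x = v
      · subst hvx; simp [sortPos, add_assoc]
      · rw [if_neg hvx, if_neg (Ne.symm hvx), add_zero]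
    · by_cases hsx : s = x
      · subst hsx; simp
      · have : sortPos lab N s ≠ sortPos lab N x := fun he => hsx (sortPos_inj (by omega) hx he)
        rw [Function.update_of_ne this, Function.update_of_ne this]
        exact hp s (by omega)
  · rintro τ ⟨hF, -, -, h⟩
    exact ⟨hF, isSorting_of_sortPos h⟩

/-- List the pivot rows, then the other rows. -/
def listRows : RamProgram :=
  forRange 16 zeroAddr (reg 27) (block [.wordMove (arr 57 16) (arr 47 16)]) ;;
  block [.wordMove (reg 19) (reg 27)] ;;
  forRange 16 zeroAddr (reg 14) (
    .branch (.wordEq (arr 46 16) zeroAddr)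
      (block [.wordMove (arr 57 19) (reg 16), .wordOp .add (reg 19) (reg 19) (reg 12)])
      .skip)

theorem listRows_spec (hc : HoldsConsts n m q σ) (hN : σ.word 14 0 = N)
    (he : HoldsElim N pn nd M' N N piv ops σ) (hwN : N + 1 < 2 ^ w) :
    WP w listRows σ (N * 8 + 5) fun τ => σ.Frame [16, 19, 57] [] τ ∧
      (∀ i < N, τ.word 57 i < N) ∧ (∀ i < N, ∀ j < N, τ.word 57 i = τ.word 57 j → i = j) ∧
      ∀ i (hi : i < piv.length), τ.word 57 i = piv[i].1 := by
  have hone := hc.one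
  have hlen := he.elim.length_piv_le
  refine WP.seq (T₁ := N * 3 + 2) (1 + (N * 5 + 2))
    (WP.forRange 0 piv.length 1 (fun x τ => σ.Frame [16, 19, 57] [] τ ∧
      τ.word 16 0 = x ∧ ∀ i < x, τ.word 57 i = σ.word 47 i)
    (by simp [hc.zero]) ?_ ?_ ?_ ?_)
  · simp
  · rintro i τ ⟨hF, h, -⟩
    simp [h, hF.word, he.npiv]
  · rintro x τ - hx ⟨hF, hv, h⟩
    refine WP.block ?_
    have h1 := (he.elim.piv_lt _ (List.getElem_mem hx)).1
    simp [hF.word, hv, hF, hone, (he.piv_getElem hx).1]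
    refine ⟨by omega, fun i hi => ?_⟩
    rw [Function.update_apply]
    split_ifs with hix
    · subst hix; exact (he.piv_getElem hx).1.symm
    · exact h i (by omega)
  rintro σ₁ ⟨hF₁, -, h1⟩
  refine WP.block_seq (N * 5 + 2) ?_
  simp [hF₁.word, he.npiv]
  refine ⟨by omega, ?_⟩
  -- the number of rows that are not pivot rows
  have hcount : piv.length + Nat.count (fun s => s ∉ piv.map Prod.fst) N = N := by
    have h2 : (piv.map Prod.fst).toFinset = (range N).filter (fun s => s ∈ piv.map Prod.fst) := by
      ext s
      rw [List.mem_toFinset, mem_filter, mem_range]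
      refine ⟨fun h => ⟨?_, h⟩, fun h => h.2⟩
      obtain ⟨p, hp, rfl⟩ := List.mem_map.1 h
      exact (he.elim.piv_lt p hp).1
    have h3 := card_filter_add_card_filter_not (s := range N) (fun s => s ∈ piv.map Prod.fst)
    rw [← h2, List.toFinset_card_of_nodup he.elim.piv_nodup, List.length_map, card_range] at h3
    rw [Nat.count_eq_card_filter_range]
    exact h3
  refine WP.forRange 0 N 3 (fun x τ => σ.Frame [16, 19, 57] [] τ ∧ τ.word 16 0 = x ∧
      τ.word 19 0 = piv.length + Nat.count (fun s => s ∉ piv.map Prod.fst) x ∧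
      (∀ i (hi : i < piv.length), τ.word 57 i = piv[i].1) ∧
      ∀ i < τ.word 19 0, (piv.length ≤ i → τ.word 57 i < x ∧ τ.word 57 i ∉ piv.map Prod.fst) ∧
        ∀ j < τ.word 19 0, τ.word 57 i = τ.word 57 j → i = j)
    (by simp [hF₁.word, hc.zero]) ?_ ?_ ?_ ?_
  · refine ⟨by simp [hF₁], by simp, by simp, fun i hi => ?_, fun i hi => ?_⟩
    · simp [h1 i hi, (he.piv_getElem hi).1]
    · simp at hi
      refine ⟨by omega, fun j hj => ?_⟩
      simp at hj
      simp [h1 i hi, (he.piv_getElem hi).1, h1 j hj, (he.piv_getElem hj).1]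
      intro hij
      exact congrArg Fin.val (he.elim.piv_fst_inj (i := ⟨i, hi⟩) (j := ⟨j, hj⟩) hij)
  · rintro i τ ⟨hF, h, -⟩
    simp [h, hF.word, hN]
  · rintro x τ - hx ⟨hF, hv, h19, hp, h⟩
    have hcle : Nat.count (fun s => s ∉ piv.map Prod.fst) (x + 1) ≤
      Nat.count (fun s => s ∉ piv.map Prod.fst) N := Nat.count_monotone _ hx
    rw [h19] at h
    refine WP.branch (T := 2) (fun hb => ?_) fun hb => ?_
    · have hb1 : x ∉ piv.map Prod.fst := by
        simpa [zeroAddr, hF.word, hv, hc.zero, he.used] using hb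
      have hcs : Nat.count (fun s => s ∉ piv.map Prod.fst) (x + 1) =
          Nat.count (fun s => s ∉ piv.map Prod.fst) x + 1 := by rw [Nat.count_succ, if_pos hb1]
      set c := piv.length + Nat.count (fun s => s ∉ piv.map Prod.fst) x with hcd
      refine WP.block ?_
      simp only [blockPost, Instr.post, WordOp.eval, getWord_reg, loc_arr, loc_reg, h19, hv]
      have hne : ∀ i < c, τ.word 57 i ≠ x := fun i hi hix => by
        rcases Nat.lt_or_ge i piv.length with hil | hil
        · rw [hp i hil] at hix
          exact hb1 (List.mem_map.2 ⟨_, List.getElem_mem hil, hix⟩)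
        · have := ((h i hi).1 hil).1
          omega
      refine ⟨by omega, by simp [h19, hF.word, hone]; omega, by simp [hv],
        by simp [hF.word, hone], by simp [hF], by simp, ?_, ?_, ?_⟩
      · simp [h19, hF.word, hone]
        omega
      · intro i hi
        simp
        rw [Function.update_of_ne (by omega)]
        exact hp i hi
      · simp [h19, hF.word, hone]
        intro i hi
        refine ⟨fun hil => ?_, fun j hj => ?_⟩
        · by_cases hic : i = c
          · subst hic
            simp
            simpa using hb1
          · rw [Function.update_of_ne hic]
            have := (h i (by omega)).1 hil
            exact ⟨by omega, by simpa using this.2⟩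
        · by_cases hic : i = c <;> by_cases hjc : j = c
          · omega
          · subst hic
            simp [hjc]
            intro he
            exact absurd he.symm (hne j (by omega))
          · subst hjc
            simp [hic]
            intro he
            exact absurd he (hne i (by omega))
          · simp [hic, hjc]
            exact (h i (by omega)).2 j (by omega)
    · have hb1 : x ∈ piv.map Prod.fst := by
        by_contra hb1
        refine hb ?_
        simp [hF.word, hv, hc.zero, he.used, -List.mem_map, hb1]
      have hcs : Nat.count (fun s => s ∉ piv.map Prod.fst) (x + 1) =
          Nat.count (fun s => s ∉ piv.map Prod.fst) x := by
        rw [Nat.count_succ, if_neg (not_not.2 hb1), add_zero]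
      refine WP.skip ?_
      refine ⟨hv, by simp [hF.word, hone], by simp [hF], by simp, by simp [h19, hcs], ?_, ?_⟩
      · intro i hi
        simpa using hp i hi
      · intro i hi
        simp [h19] at hi
        refine ⟨fun hil => ?_, fun j hj => ?_⟩
        · have := (h i hi).1 hil
          refine ⟨by simp; omega, by simpa using this.2⟩
        · simp [h19] at hj
          simpa using (h i hi).2 j hj
  · rintro τ ⟨hF, -, h19, hp, h⟩
    rw [h19, hcount] at h
    refine ⟨hF, fun i hi => ?_, fun i hi => (h i hi).2, hp⟩
    rcases Nat.lt_or_ge i piv.length with hil | hil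
    · rw [hp i hil]
      exact (he.elim.piv_lt _ (List.getElem_mem hil)).1
    · exact ((h i hi).1 hil).1

/-! ### Programs: writing the factors -/

/-- The list consists of the non-zero entries of the matrix. -/
structure ListsEntries {a b : ℕ} (A : Matrix (Fin a) (Fin b) F) (L : List (ℕ × ℕ × F)) : Prop where
  nodup : (L.map fun e => (e.1, e.2.1)).Nodup
  sound : ∀ e ∈ L, ∃ (i : Fin a) (j : Fin b), e = (↑i, ↑j, A i j) ∧ A i j ≠ 0
  complete : ∀ i j, A i j ≠ 0 → (↑i, ↑j, A i j) ∈ L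

theorem ListsEntries.holdsMatrix {a b : ℕ} {A : Matrix (Fin a) (Fin b) F} {L : List (ℕ × ℕ × F)}
    (h : ListsEntries A L) (hL : ListAt (fun p => (σ.word 10 p, σ.word 11 p, σ.fld 3 p)) lo L) :
    σ.HoldsMatrix lo (lo + L.length) A := by
  have key : ∀ p ∈ Set.Ico lo (lo + L.length), ∃ (i : ℕ) (hi : i < L.length), p = lo + i ∧
      σ.word 10 p = L[i].1 ∧ σ.word 11 p = L[i].2.1 ∧ σ.fld 3 p = L[i].2.2 := by
    rintro p ⟨h1, h2⟩
    obtain ⟨i, rfl⟩ := Nat.exists_eq_add_of_le h1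
    have hi : i < L.length := by omega
    have := hL i hi
    exact ⟨i, hi, rfl, congrArg Prod.fst this, congrArg (fun e => e.2.1) this,
      congrArg (fun e => e.2.2) this⟩
  refine ⟨?_, ?_, ?_⟩
  · intro p hp p' hp' hpp
    obtain ⟨i, hi, rfl, h1, h2, -⟩ := key p hp
    obtain ⟨j, hj, rfl, h3, h4, -⟩ := key p' hp'
    simp only [h1, h2, h3, h4, Prod.mk.injEq] at hpp
    have := (h.nodup.getElem_inj_iff (i := i) (j := j) (hi := by simpa using hi)
      (hj := by simpa using hj)).1 (by simp [hpp])
    rw [this]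
  · intro p hp
    obtain ⟨i, hi, rfl, h1, h2, h3⟩ := key p hp
    obtain ⟨x, y, hxy, hne⟩ := h.sound _ (List.getElem_mem hi)
    rw [hxy] at h1 h2 h3
    exact ⟨x, y, h1, h2, h3, hne⟩
  · intro x y hxy
    obtain ⟨i, hi, he⟩ := List.getElem_of_mem (h.complete x y hxy)
    refine ⟨lo + i, ⟨by omega, by omega⟩, ?_⟩
    have := hL i hi
    rw [he] at this
    exact ⟨congrArg Prod.fst this, congrArg (fun e => e.2.1) this⟩

theorem flatMap_ite {α β : Type*} (p : α → Prop) [DecidablePred p] (f : α → β) (L : List α) :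
    (L.flatMap fun x => if p x then [f x] else []) = (L.filter p).map f := by
  induction L with
  | nil => rfl
  | cons x L ih =>
    rw [List.flatMap_cons, ih, List.filter_cons]
    by_cases h : p x <;> simp [h]

theorem flatMap_range_getD {β : Type*} (L : List ℕ) (f : ℕ → List β) :
    ((List.range L.length).flatMap fun i => f (L.getD i 0)) = L.flatMap f := by
  have : L = (List.range L.length).map fun i => L.getD i 0 := by
    refine List.ext_getElem (by simp) fun i h1 h2 => ?_
    simp [List.getElem?_eq_getElem h1]
  conv_rhs => rw [this, List.flatMap_map]

theorem flatMap_singleton_getElem {α : Type*} (L : List α) (f : ℕ → List α)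
    (hf : ∀ i (hi : i < L.length), f i = [L[i]]) : (List.range L.length).flatMap f = L := by
  induction L using List.reverseRecOn with
  | nil => rfl
  | append_singleton L x ih =>
    rw [List.length_append, List.length_singleton, List.range_succ, List.flatMap_append, ih]
    · rw [List.flatMap_singleton, hf L.length (by simp)]
      simp
    · intro i hi
      rw [hf i (by simp; omega), List.getElem_append_left hi]

theorem listsEntries_indicatorMatrix {a b h : ℕ} {p : ℕ → Prop} [DecidablePred p] {i j : ℕ → ℕ}
    {P : ℕ → ℕ → Prop} [DecidableRel P] (hp : ∀ g < h, p g → i g < a ∧ j g < b)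
    (hinj : ∀ g < h, ∀ g' < h, p g → p g' → i g = i g' → j g = j g' → g = g')
    (hP : ∀ x < a, ∀ y < b, P x y ↔ ∃ g < h, p g ∧ i g = x ∧ j g = y) :
    ListsEntries (indicatorMatrix F a b P)
      ((List.range h).flatMap fun g => if p g then [(i g, j g, (1 : F))] else []) := by
  rw [flatMap_ite]
  refine ⟨?_, ?_, ?_⟩
  · rw [List.map_map]
    refine List.Nodup.map_on ?_ (List.nodup_range.filter _)
    intro g hg g' hg' he
    simp only [List.mem_filter, List.mem_range, decide_eq_true_eq] at hg hg'
    simp only [Function.comp_apply, Prod.mk.injEq] at he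
    exact hinj g hg.1 g' hg'.1 hg.2 hg'.2 he.1 he.2
  · intro e he
    obtain ⟨g, hg, rfl⟩ := List.mem_map.1 he
    simp only [List.mem_filter, List.mem_range, decide_eq_true_eq] at hg
    obtain ⟨h1, h2⟩ := hp g hg.1 hg.2
    have h3 : P (i g) (j g) := (hP _ h1 _ h2).2 ⟨g, hg.1, hg.2, rfl, rfl⟩
    refine ⟨⟨i g, h1⟩, ⟨j g, h2⟩, ?_, ?_⟩ <;> simp [indicatorMatrix, h3]
  · intro x y hxy
    have h3 : P x y := by
      by_contra h3
      exact hxy (by simp [indicatorMatrix, h3])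
    obtain ⟨g, hg, hpg, h1, h2⟩ := (hP x x.2 y y.2).1 h3
    refine List.mem_map.2 ⟨g, by simp [hg, hpg], ?_⟩
    simp [indicatorMatrix, h1, h2, h3]

theorem IsElim.listsEntries_opsMatrix {A : ℕ → ℕ → F} {γ γ' : ℕ}
    (h : IsElim N pn nd M' γ γ' A piv ops) :
    ListsEntries (opsMatrix N ops) ((List.range N).flatMap (fun i => [(i, i, (1 : F))]) ++ ops) := by
  have hent : ∀ e ∈ ops, ∀ (i j : Fin N), e.1 = i → e.2.1 = j → opsMatrix N ops i j = e.2.2 := by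
    intro e he i j hi hj
    have hne : i ≠ j := by
      rintro rfl
      have := h.ops_lt e he
      omega
    rw [opsMatrix, Matrix.add_apply, Matrix.one_apply_ne hne, zero_add, Matrix.of_apply]
    have : ∀ L : List (ℕ × ℕ × F), (L.map fun e => (e.1, e.2.1)).Nodup → e ∈ L →
        (L.map fun e => if e.1 = (i : ℕ) ∧ e.2.1 = (j : ℕ) then e.2.2 else 0).sum = e.2.2 := by
      intro L hL heL
      induction L with
      | nil => simp at heL
      | cons d L ih =>
        rw [List.map_cons, List.nodup_cons] at hL
        rw [List.map_cons, List.sum_cons]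
        rcases List.mem_cons.1 heL with rfl | heL
        · rw [if_pos ⟨hi, hj⟩, List.sum_eq_zero, add_zero]
          intro x hx
          obtain ⟨d, hd, rfl⟩ := List.mem_map.1 hx
          rw [if_neg]
          rintro ⟨h1, h2⟩
          exact hL.1 (List.mem_map.2 ⟨d, hd, by rw [h1, h2, hi, hj]⟩)
        · rw [ih hL.2 heL, if_neg, zero_add]
          rintro ⟨h1, h2⟩
          exact hL.1 (List.mem_map.2 ⟨e, heL, by rw [h1, h2, hi, hj]⟩)
    exact this ops h.ops_nodup he
  have hdiag : (List.range N).flatMap (fun i => [(i, i, (1 : F))]) =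
      (List.range N).map fun i => (i, i, (1 : F)) := by
    simp [← List.map_eq_flatMap]
  rw [hdiag]
  refine ⟨?_, ?_, ?_⟩
  · rw [List.map_append, List.map_map]
    refine List.Nodup.append (List.nodup_range.map_on (by simp)) h.ops_nodup ?_
    intro x hx hx'
    obtain ⟨i, -, rfl⟩ := List.mem_map.1 hx
    obtain ⟨e, he, hei⟩ := List.mem_map.1 hx'
    have := h.ops_lt e he
    simp only [Function.comp_apply, Prod.mk.injEq] at hei
    omega
  · intro e he
    rcases List.mem_append.1 he with he | he
    · obtain ⟨i, hi, rfl⟩ := List.mem_map.1 he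
      have := h.opsMatrix_apply_self ⟨i, List.mem_range.1 hi⟩
      exact ⟨⟨i, List.mem_range.1 hi⟩, ⟨i, List.mem_range.1 hi⟩, by rw [this], by
        rw [this]; exact one_ne_zero⟩
    · have h1 := h.ops_lt e he
      have := hent e he ⟨e.1, h1.1⟩ ⟨e.2.1, by omega⟩ rfl rfl
      exact ⟨⟨e.1, h1.1⟩, ⟨e.2.1, by omega⟩, by rw [this], by rw [this]; exact h1.2.2⟩
  · intro i j hij
    rw [List.mem_append]
    by_cases hij' : i = j
    · subst hij'
      left
      rw [h.opsMatrix_apply_self]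
      exact List.mem_map.2 ⟨i, by simp, rfl⟩
    · right
      have : ∃ e ∈ ops, e.1 = i ∧ e.2.1 = j := by
        by_contra hne
        push Not at hne
        apply hij
        rw [opsMatrix, Matrix.add_apply, Matrix.one_apply_ne hij', zero_add, Matrix.of_apply]
        apply List.sum_eq_zero
        intro x hx
        obtain ⟨e, he, rfl⟩ := List.mem_map.1 hx
        rw [if_neg]
        rintro ⟨h1, h2⟩
        exact hne e he h1 h2
      obtain ⟨e, he, h1, h2⟩ := this
      rw [hent e he i j h1 h2, ← h1, ← h2]
      exact he

/-- What has been written to the output so far. -/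
structure Emitted (out : List (ℕ × ℕ × F)) (σ : RamState F) : Prop where
  len : σ.word 61 0 = out.length
  list : ListAt (fun p => (σ.word 10 p, σ.word 11 p, σ.fld 3 p)) 0 out

theorem Emitted.frame {out : List (ℕ × ℕ × F)} {ws fs : List ℕ} (h : Emitted out σ)
    (hF : σ.Frame ws fs τ) (hws : ∀ a ∈ [10, 11, 61], a ∉ ws := by decide)
    (hfs : 3 ∉ fs := by decide) : Emitted out τ := by
  have h1 := fun a ha => hF.word_eq a (hws a ha)
  refine ⟨by rw [h1 61 (by simp)]; exact h.len, ?_⟩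
  rw [h1 10 (by simp), h1 11 (by simp), hF.fld_eq 3 hfs]
  exact h.list

/-- Write one entry. -/
def emit (r c v : Addr) : RamProgram := block [
  .wordMove (arr 10 61) r,
  .wordMove (arr 11 61) c,
  .fieldMove (arr 3 61) v,
  .wordOp .add (reg 61) (reg 61) (reg 12)]

/-- The addresses whose words are not affected by `emit`. -/
def Addr.IsFree : Addr → Prop
  | .dir a _ => a ∉ [10, 11, 61]
  | .ind a b _ => a ∉ [10, 11, 61] ∧ b ∉ [10, 11, 61]

/-- The addresses whose field elements are not affected by `emit`. -/
def Addr.IsFreeField : Addr → Prop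
  | .dir a _ => a ≠ 3
  | .ind a b _ => a ≠ 3 ∧ b ∉ [10, 11, 61]

theorem emit_spec {r c v : Addr} {out : List (ℕ × ℕ × F)} (i j : ℕ) (x : F)
    (hi : σ.getWord r = i) (hj : σ.getWord c = j) (hx : σ.getField v = x)
    (h : Emitted out σ) (hone : σ.word 12 0 = 1) (hw : out.length + 1 < 2 ^ w) (hiw : i < 2 ^ w)
    (hjw : j < 2 ^ w) (hc : c.IsFree := by simp [Addr.IsFree, arr, reg])
    (hv : v.IsFreeField := by simp [Addr.IsFreeField, arr, reg]) :
    WP w (emit r c v) σ 4 fun τ => σ.Frame [10, 11, 61] [3] τ ∧ Emitted (out ++ [(i, j, x)]) τ := by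
  have hword : ∀ (τ : RamState F) (y : Addr), y.IsFree → σ.Frame [10, 11, 61] [3] τ →
      τ.getWord y = σ.getWord y := by
    intro τ y hy hF
    cases y <;> simp [Addr.IsFree] at hy <;> simp [hF.word, hy]
  have hfld : ∀ (τ : RamState F) (y : Addr), y.IsFreeField → σ.Frame [10, 11, 61] [3] τ →
      τ.getField y = σ.getField y := by
    intro τ y hy hF
    cases y with
    | dir a i =>
      simp only [Addr.IsFreeField, List.mem_cons, not_or] at hy
      simp [hF.fld, hy]
    | ind a b i =>
      simp only [Addr.IsFreeField, List.mem_cons, not_or] at hy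
      change τ.fld a (τ.word b i) = σ.fld a (σ.word b i)
      rw [hF.word (by simp [hy]), hF.fld (by simp [hy])]
  refine WP.block ?_
  simp only [blockPost, Instr.post, WordOp.eval, loc_arr, loc_reg, h.len, getWord_reg, hi,
    RamState.word_sw, show ¬ (61 = 10) by decide, show ¬ (61 = 11) by decide, if_false]
  rw [hword _ c hc (by simp), hj,
    hfld _ v hv (by simp), hx]
  refine ⟨hiw, hjw, ?_, ?_, ?_, ?_⟩
  · simp [h.len, hone]; exact hw
  · simp
  · simp [h.len, hone]
  · refine h.list.concat (by simp) fun p hp => ?_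
    simp [hp.ne]

/-- A loop whose passes write entries. -/
theorem WP.forEmit {p : RamProgram} {T : ℕ} {Q : RamState F → Prop}
    {v : ℕ} {hi : Addr} {out : List (ℕ × ℕ × F)} (h c d : ℕ) (e : ℕ → List (ℕ × ℕ × F))
    (ws : List ℕ) (hv : v ∉ 12 :: ws) (hv' : v ∉ [10, 11, 61]) (h12 : 12 ∉ ws)
    (hc : HoldsConsts n m q σ)
    (hhi : ∀ τ, σ.Frame (v :: ws) [3] τ → τ.getWord hi = h)
    (hout : Emitted out σ) (hd : ∀ x < h, (e x).length ≤ d) (hw : out.length + h * d + h < 2 ^ w)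
    (hstep : ∀ x τ out', x < h → σ.Frame (v :: ws) [3] τ → τ.word v 0 = x →
      Emitted out' τ → out'.length ≤ out.length + x * d → WP w p τ c fun ρ =>
        τ.Frame ws [3] ρ ∧ Emitted (out' ++ e x) ρ)
    (hT : h * (c + 2) + 2 ≤ T)
    (hQ : ∀ τ, σ.Frame (v :: ws) [3] τ → Emitted (out ++ (List.range h).flatMap e) τ → Q τ) :
    WP w (RamProgram.forRange v zeroAddr hi p) σ T Q := by
  have hlen : ∀ x ≤ h, ((List.range x).flatMap e).length ≤ x * d := fun x hx => by
    simpa using length_flatMap_le fun y (hy : y ∈ List.range x) => hd y (by simp at hy; omega)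
  have hsw : ∀ (τ : RamState F) x, τ.Frame [v] [] (τ.sw v 0 x) := fun τ x => by
    simp
  have hfr : ∀ a ∈ [10, 11, 61], a ∉ [v] := by
    intro a ha hav
    rw [List.mem_singleton] at hav
    exact hv' (hav ▸ ha)
  refine WP.forRange 0 h c (fun x τ => σ.Frame (v :: ws) [3] τ ∧ τ.word v 0 = x ∧
    Emitted (out ++ (List.range x).flatMap e) τ) (by simp [hc.zero]) ?_ ?_ ?_ ?_
    (hT := by rw [Nat.sub_zero]; exact hT)
  · refine ⟨(hsw σ 0).mono (by simp) (by simp), by simp, ?_⟩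
    simpa using hout.frame (hsw σ 0) hfr (by simp)
  · rintro x τ ⟨hF, h1, -⟩
    exact ⟨h1, hhi τ hF⟩
  · rintro x τ - hx ⟨hF, h1, h2⟩
    have h3 := hlen x hx.le
    refine (hstep x τ _ hx hF h1 h2 (by rw [List.length_append]; omega)).post ?_
    rintro ρ ⟨hG, hE⟩
    have hGF : σ.Frame (v :: ws) [3] ρ := hF.trans hG (by simp) (by simp)
    refine ⟨?_, ?_, hGF.trans (hsw ρ _) (by simp) (by simp), by simp, ?_⟩
    · rw [hG.word (fun h => hv (List.mem_cons_of_mem _ h)), h1]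
    · rw [hGF.word (fun h => by
        rcases List.mem_cons.1 h with h | h
        · exact hv (by simp [h])
        · exact h12 h), hc.one]
    · rw [List.range_succ, List.flatMap_append, List.flatMap_singleton, ← List.append_assoc]
      exact hE.frame (hsw ρ _) hfr (by simp)
  · rintro τ ⟨hF, -, h2⟩
    exact hQ τ hF h2

/-- A loop each pass of which writes one entry. -/
theorem WP.forEmitOne {hi r c v : Addr} {out : List (ℕ × ℕ × F)} {T : ℕ}
    {Q : RamState F → Prop} (h : ℕ) (i j : ℕ → ℕ) (x : ℕ → F)
    (hc : HoldsConsts n m q σ)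
    (hhi : ∀ τ, σ.Frame [16, 10, 11, 61] [3] τ → τ.getWord hi = h)
    (hget : ∀ y < h, ∀ τ, σ.Frame [16, 10, 11, 61] [3] τ → τ.word 16 0 = y → τ.getWord r = i y ∧
      τ.getWord c = j y ∧ τ.getField v = x y)
    (hlt : ∀ y < h, i y < 2 ^ w ∧ j y < 2 ^ w)
    (hout : Emitted out σ) (hw : out.length + 2 * h < 2 ^ w) (hT : h * 6 + 2 ≤ T)
    (hQ : ∀ τ, σ.Frame [16, 10, 11, 61] [3] τ →
      Emitted (out ++ (List.range h).flatMap fun y => [(i y, j y, x y)]) τ → Q τ)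
    (hr : c.IsFree := by simp [Addr.IsFree, arr, reg])
    (hv : v.IsFreeField := by simp [Addr.IsFreeField, arr, reg]) :
    WP w (RamProgram.forRange 16 zeroAddr hi (emit r c v)) σ T Q := by
  refine WP.forEmit h 4 1 (fun y => [(i y, j y, x y)]) [10, 11, 61] (by decide) (by decide)
    (by decide) hc hhi hout (by simp) (by omega) ?_ hT hQ
  intro y τ out' hy hF h16 hE hw'
  obtain ⟨h1, h2, h3⟩ := hget y hy τ hF h16
  exact emit_spec (i y) (j y) (x y) h1 h2 h3 hE (by rw [hF.word (by decide), hc.one]) (by omega)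
    (hlt y hy).1 (hlt y hy).2 hr hv

/-- The entries of several factors have been written, and at most `B` entries for each of them. -/
structure Written (B : ℕ) (Ls : List (List (ℕ × ℕ × F))) (σ : RamState F) : Prop where
  emitted : Emitted Ls.flatten σ
  start : ∀ t ≤ Ls.length, σ.word 9 t = (Ls.take t).flatten.length
  le : Ls.flatten.length ≤ Ls.length * B

theorem Written.holdsMatrix {B : ℕ} {Ls : List (List (ℕ × ℕ × F))} (h : Written B Ls σ) {a b : ℕ}
    {A : Matrix (Fin a) (Fin b) F} {L : List (ℕ × ℕ × F)} (t : ℕ) (ht : Ls[t]? = some L)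
    (hA : ListsEntries A L) :
    σ.HoldsMatrix (σ.word 9 t) (σ.word 9 (t + 1)) A := by
  obtain ⟨htl, rfl⟩ := List.getElem?_eq_some_iff.1 ht
  have h1 := List.take_succ_eq_append_getElem htl
  have h2 := h.start (t + 1) htl
  rw [h1, List.flatten_append, List.length_append, ← h.start t htl.le] at h2
  rw [h2]
  simp only [List.flatten_cons, List.flatten_nil, List.append_nil]
  refine hA.holdsMatrix fun i hi => ?_
  have h3 : Ls.flatten = (Ls.take t).flatten ++ (Ls[t] ++ (Ls.drop (t + 1)).flatten) := by
    rw [← List.flatten_cons, ← List.drop_eq_getElem_cons htl, ← List.flatten_append,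
      List.take_append_drop]
  have h4 := h.start t htl.le
  have h5 : Ls.flatten[σ.word 9 t + i]? = some (Ls[t][i]) := by
    rw [h3, h4, List.getElem?_append_right (by omega), Nat.add_sub_cancel_left,
      List.getElem?_append_left hi, List.getElem?_eq_getElem hi]
  obtain ⟨h6, h7⟩ := List.getElem?_eq_some_iff.1 h5
  rw [← h7]
  simpa using h.emitted.list _ h6

theorem Written.frame {B : ℕ} {Ls : List (List (ℕ × ℕ × F))} {ws fs : List ℕ} (h : Written B Ls σ)
    (hF : σ.Frame ws fs τ) (hws : ∀ a ∈ [9, 10, 11, 61], a ∉ ws := by decide)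
    (hfs : 3 ∉ fs := by decide) : Written B Ls τ :=
  ⟨h.emitted.frame hF (fun a ha => hws a (List.mem_cons_of_mem _ ha)) hfs, fun t ht => by
    rw [hF.word (hws 9 (by simp))]; exact h.start t ht, h.le⟩

/-- Write the entries of the factor number `t` and the position after them. -/
def writeFactor (t : ℕ) (p : RamProgram) : RamProgram :=
  p ;; block [.wordMove (.dir 9 (t + 1)) (reg 61)]

theorem writeFactor_spec {B t T : ℕ} {p : RamProgram}
    {Ls : List (List (ℕ × ℕ × F))} {L : List (ℕ × ℕ × F)} (ht : Ls.length = t)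
    (hF : σ.Frame [9, 10, 11, 16, 17, 18, 19, 20, 21, 22, 23, 61] [3] τ) (hW : Written B Ls τ)
    (hB : L.length ≤ B) (hw : (t + 1) * B < 2 ^ w)
    (hp : WP w p τ T fun ρ => τ.Frame [10, 11, 16, 17, 18, 19, 20, 21, 22, 23, 61] [3] ρ ∧
      Emitted (Ls.flatten ++ L) ρ) :
    WP w (writeFactor t p) τ (T + 1) fun ρ =>
      σ.Frame [9, 10, 11, 16, 17, 18, 19, 20, 21, 22, 23, 61] [3] ρ ∧
      Written B (Ls ++ [L]) ρ := by
  refine WP.seq 1 (hp.post ?_) le_rfl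
  rintro ρ ⟨hG, hE⟩
  have hGF := hF.trans hG (ws := [9, 10, 11, 16, 17, 18, 19, 20, 21, 22, 23, 61]) (fs := [3])
    (by decide) (by decide)
  have hle := hW.le
  rw [ht] at hle
  have hE' := hE.len
  rw [List.length_append] at hE'
  rw [Nat.succ_mul] at hw
  refine WP.block ?_
  simp only [blockPost, Instr.post, getWord_reg, loc_dir, hE']
  refine ⟨by omega, by simp [hGF], ?_, ?_, ?_⟩
  · have : ρ.Frame [9] [] (ρ.sw 9 (t + 1) (Ls.flatten.length + L.length)) := by
      simp
    simpa using hE.frame this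
  · intro u hu
    simp only [List.length_append, List.length_singleton] at hu
    by_cases hut : u = t + 1
    · subst hut
      rw [List.take_of_length_le (by simp; omega)]
      simp
    · rw [List.take_append_of_le_length (by omega)]
      simp [hut, hG.word, hW.start u (by omega)]
  · rw [List.flatten_append, List.length_append, List.length_append, ht, List.length_singleton,
      Nat.succ_mul, List.flatten_cons, List.flatten_nil, List.append_nil]
    omega

/-- Write the entries of the pivot rows. -/
def writePivotRows : RamProgram :=
  forRange 16 zeroAddr (reg 27) (
    block [
      .wordMove (reg 20) (arr 48 16),
      .wordMove (reg 20) (arr 33 20),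
      .wordMove (reg 21) (arr 43 20),
      .wordMove (reg 22) (arr 44 20),
      .wordOp .sub (reg 22) (reg 22) (reg 21),
      .wordMove (reg 23) (arr 47 16),
      .wordOp .mul (reg 23) (reg 23) (reg 14)] ;;
    forRange 17 zeroAddr (reg 22) (
      block [
        .wordOp .add (reg 18) (reg 21) (reg 17),
        .wordMove (reg 18) (arr 45 18),
        .wordOp .add (reg 19) (reg 23) (reg 18)] ;;
      .branch (.fieldEq (arr 6 19) (reg 12)) .skip (emit (reg 16) (reg 18) (arr 6 19))))

open Classical in
/-- The list of the entries of the row number `i` of the eliminated matrix, where the pivot rows come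
first. -/
noncomputable def pivotRowEntries (nd : ℕ → ℕ) (NL : ℕ → List ℕ) (A : ℕ → ℕ → F) (piv : List (ℕ × ℕ))
    (i : ℕ) : List (ℕ × ℕ × F) :=
  (NL (nd (piv.getD i (0, 0)).2)).flatMap fun t =>
    if A (piv.getD i (0, 0)).1 t ≠ 0 then [(i, t, A (piv.getD i (0, 0)).1 t)] else []

theorem writePivotRows_spec {out : List (ℕ × ℕ × F)} (hc : HoldsConsts n m q σ)
    (hcov : IsCover N l pn nd NL) (hl : HoldsLists N nd NL σ)
    (he : HoldsElim N pn nd M' N N piv ops σ) (hout : Emitted out σ) (hw : N * N < 2 ^ w)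
    (hwl : ∀ t < N, σ.word 44 (nd t) < 2 ^ w) (hwnd : ∀ t < N, nd t < 2 ^ w)
    (hwo : out.length + N * (2 * l + 2) < 2 ^ w) :
    WP w writePivotRows σ (N * (l * 10 + 11) + 2) fun τ =>
      σ.Frame [10, 11, 16, 17, 18, 19, 20, 21, 22, 23, 61] [3] τ ∧
      Emitted (out ++ (List.range piv.length).flatMap
        (pivotRowEntries nd NL (fun s t => σ.fld 6 (s * N + t)) piv)) τ := by
  classical
  have hlen := he.elim.length_piv_le
  set A : ℕ → ℕ → F := fun s t => σ.fld 6 (s * N + t) with hA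
  have hone : ∀ i t, (if A (piv.getD i (0, 0)).1 t ≠ 0 then
      [(i, t, A (piv.getD i (0, 0)).1 t)] else []).length ≤ 1 := fun i t => by
    split_ifs <;> simp
  have hmul : piv.length * l + piv.length ≤ N * (2 * l + 2) := by
    have h1 : piv.length * (l + 1) ≤ N * (l + 1) := Nat.mul_le_mul_right _ hlen
    have h2 : N * (2 * l + 2) = N * (l + 1) + N * (l + 1) := by ring
    rw [Nat.mul_succ] at h1
    omega
  refine WP.forEmit piv.length (l * 10 + 9) l (pivotRowEntries nd NL A piv)
    [10, 11, 17, 18, 19, 20, 21, 22, 23, 61] (by decide) (by decide) (by decide) hc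
    (fun τ hF => by simp [hF.word, he.npiv]) hout ?_ (by omega) ?_ ?_
    (fun τ hF hE => ⟨hF.mono, hE⟩)
  · intro i hi
    refine (length_flatMap_le fun t _ => hone i t).trans ?_
    rw [List.getD_eq_getElem _ _ hi, mul_one]
    exact hcov.length_le _ (he.elim.piv_lt _ (List.getElem_mem hi)).2.2
  · intro i τ out' hi hF h16 hE hw'
    have hp := he.elim.piv_lt _ (List.getElem_mem hi)
    obtain ⟨h47, h48⟩ := he.piv_getElem hi
    have hlist := hl.list _ hp.2.2
    have hlast := hl.last _ hp.2.2
    have hwl' := hwl _ hp.2.2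
    have hwnd' := hwnd _ hp.2.2
    have hle := hcov.length_le _ hp.2.2
    have hLN := hcov.lt _ hp.2.2
    have hrow : pivotRowEntries nd NL A piv i = (NL (nd piv[i].2)).flatMap fun t =>
        if A piv[i].1 t ≠ 0 then [(i, t, A piv[i].1 t)] else [] := by
      rw [pivotRowEntries, List.getD_eq_getElem _ _ hi]
    rw [hrow]
    have hrowN : piv[i].1 * N + N ≤ N * N := by
      rw [← Nat.succ_mul]; exact Nat.mul_le_mul_right _ hp.1
    set r := piv[i].1 with hr
    set γ := piv[i].2 with hγ
    set L := NL (nd γ) with hL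
    refine WP.block_seq (l * 10 + 2) ?_
    simp [hF.word, h16, h47, h48, hl.node, hl.size, hlast]
    iterate 7 refine ⟨by omega, ?_⟩
    set τ₁ : RamState F := ((((((τ.sw 20 0 γ).sw 20 0 (nd γ)).sw 21 0 (σ.word 43 (nd γ))).sw 22 0
      (σ.word 43 (nd γ) + L.length)).sw 22 0 L.length).sw 23 0 r).sw 23 0 (r * N) with hτ₁
    have hF₁ : σ.Frame [16, 10, 11, 17, 18, 19, 20, 21, 22, 23, 61] [3] τ₁ := by simp [hτ₁, hF]
    have hE₁ : Emitted out' τ₁ := hE.frame (ws := [20, 21, 22, 23]) (fs := [])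
      (by simp [hτ₁]) (by decide) (by decide)
    have b16 : τ₁.word 16 0 = i := by simp [hτ₁, h16]
    have b21 : τ₁.word 21 0 = σ.word 43 (nd γ) := by simp [hτ₁]
    have b22 : τ₁.word 22 0 = L.length := by simp [hτ₁]
    have b23 : τ₁.word 23 0 = r * N := by simp [hτ₁]
    have hrng := flatMap_range_getD L fun t => if A r t ≠ 0 then [(i, t, A r t)] else []
    refine WP.forEmit L.length 8 1 (fun j => if A r (L.getD j 0) ≠ 0 then
        [(i, L.getD j 0, A r (L.getD j 0))] else []) [10, 11, 18, 19, 61] (by decide) (by decide)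
      (by decide) (hc.frame hF₁)
      (fun ρ hG => by simp [hG.word, b22]) hE₁ (fun j _ => by split_ifs <;> simp) ?_ ?_ (by omega) ?_
    · have h1 : i * l + l ≤ N * l := by
        rw [← Nat.succ_mul]; exact Nat.mul_le_mul_right _ (by omega)
      have h2 : N * (2 * l + 2) = N * l + N * l + 2 * N := by ring
      omega
    · intro j ρ out'' hj hG h17 hE₂ hw''
      have hGF := hF₁.trans (ws := [16, 10, 11, 17, 18, 19, 20, 21, 22, 23, 61]) (fs := [3]) hG
        (by decide) (by decide)
      have ht := hlist j hj
      have htN := hLN _ (List.getElem_mem hj)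
      rw [List.getD_eq_getElem _ _ hj]
      set t := L[j] with ht'
      refine WP.block_seq 5 ?_
      simp [hGF.word, hG.word, b21, h17, b23, ht]
      iterate 3 refine ⟨by omega, ?_⟩
      set ρ₁ : RamState F := (((ρ.sw 18 0 (σ.word 43 (nd γ) + j)).sw 18 0 t).sw 19 0 (r * N + t))
        with hρ₁
      have hF₂ : ρ.Frame [18, 19] [] ρ₁ := by simp [hρ₁]
      have h6 : ρ₁.fld 6 = σ.fld 6 := by rw [hF₂.fld (by decide), hGF.fld (by decide)]
      have c16 : ρ₁.word 16 0 = i := by rw [hF₂.word (by decide), hG.word (by decide), b16]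
      have c18 : ρ₁.word 18 0 = t := by simp [hρ₁]
      have c19 : ρ₁.word 19 0 = r * N + t := by simp [hρ₁]
      have c12 : ρ₁.word 12 0 = 1 := by rw [hF₂.word (by decide), hGF.word (by decide), hc.one]
      have hfz : ρ₁.fld 12 0 = 0 := by rw [hF₂.fld (by decide), hGF.fld (by decide), hc.fzero]
      have hE₃ := hE₂.frame hF₂
      refine WP.branch (T := 4) (fun hb => ?_) fun hb => ?_
      · simp [h6, c19, hfz] at hb
        refine WP.skip ?_
        have : A r t = 0 := hb
        simp only [this, if_true, List.append_nil]
        exact ⟨hF₂.mono, by simpa using hE₃⟩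
      · simp [h6, c19, hfz] at hb
        have hAt : A r t ≠ 0 := hb
        refine (emit_spec i t (A r t) (by simp [c16]) (by simp [c18]) (by simp [c19, h6, hA]) hE₃
          c12 ?_ (by omega) (by omega)).post ?_
        · have h1 : i * l + l ≤ N * l := by
            rw [← Nat.succ_mul]; exact Nat.mul_le_mul_right _ (by omega)
          have h2 : N * (2 * l + 2) = N * l + N * l + 2 * N := by ring
          omega
        rintro ρ' ⟨hH, hE₄⟩
        refine ⟨(hF₂.mono).trans hH, ?_⟩
        simp only [hAt, if_false]
        exact hE₄
    · intro ρ hG hE₂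
      have hG' := (show τ.Frame [10, 11, 17, 18, 19, 20, 21, 22, 23, 61] [3] τ₁ by
        simp [hτ₁]).trans hG
      simp only [ne_eq] at hrng hE₂
      rw [hrng] at hE₂
      exact ⟨hG', by simpa only [ite_not] using hE₂⟩
  · have : piv.length * (l * 10 + 9 + 2) ≤ N * (l * 10 + 11) := Nat.mul_le_mul_right _ hlen
    omega

theorem listsEntries_pivotRows {A : ℕ → ℕ → F} {ro : ℕ → ℕ} (hcov : IsCover N l pn nd NL)
    (he : IsElim N pn nd M' N N A piv ops) (hro : ∀ i < N, ro i < N)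
    (hroinj : ∀ i < N, ∀ j < N, ro i = ro j → i = j)
    (hpiv : ∀ i (hi : i < piv.length), ro i = piv[i].1) :
    ListsEntries (Matrix.of fun i t : Fin N => A (ro i) t)
      ((List.range piv.length).flatMap (pivotRowEntries nd NL A piv)) := by
  classical
  have hlen := he.length_piv_le
  have hmem : ∀ e i, i < piv.length → (e ∈ pivotRowEntries nd NL A piv i ↔
      ∃ t < N, A (ro i) t ≠ 0 ∧ e = (i, t, A (ro i) t)) := by
    intro e i hi
    have hp := he.piv_lt _ (List.getElem_mem hi)
    have hne := he.piv_ne _ (List.getElem_mem hi)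
    rw [pivotRowEntries, List.mem_flatMap, List.getD_eq_getElem _ _ hi, ← hpiv i hi]
    rw [← hpiv i hi] at hne hp
    constructor
    · rintro ⟨t, ht, h⟩
      split_ifs at h with h1
      · exact ⟨t, hcov.lt _ hp.2.2 t ht, h1, List.mem_singleton.1 h⟩
      · simp at h
    · rintro ⟨t, ht, h1, rfl⟩
      refine ⟨t, hcov.near_le _ hp.1 _ hp.2.2 t ht (he.fill _ hp.1 _ hp.2.2 hne)
        (he.fill _ hp.1 t ht h1) (not_lt.1 fun h2 => h1 ?_), by rw [if_pos h1]; simp⟩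
      rw [hpiv i hi]
      exact he.piv_zero _ (List.getElem_mem hi) t h2
  refine ⟨?_, ?_, ?_⟩
  · rw [List.map_flatMap, List.nodup_flatMap]
    constructor
    · intro i hi
      rw [List.mem_range] at hi
      rw [pivotRowEntries, flatMap_ite, List.map_map]
      refine List.Nodup.map_on (by simp) (List.Nodup.filter _ ?_)
      rw [List.getD_eq_getElem _ _ hi]
      exact hcov.nodup _ (he.piv_lt _ (List.getElem_mem hi)).2.2
    · refine List.nodup_range.pairwise_of_forall_ne fun i hi j hj hij => ?_
      rw [List.mem_range] at hi hj
      intro x hx hx'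
      obtain ⟨e, he1, rfl⟩ := List.mem_map.1 hx
      obtain ⟨e', he2, he3⟩ := List.mem_map.1 hx'
      obtain ⟨t, -, -, rfl⟩ := (hmem e i hi).1 he1
      obtain ⟨t', -, -, rfl⟩ := (hmem e' j hj).1 he2
      exact hij (congrArg Prod.fst he3).symm
  · intro e h
    obtain ⟨i, hi, h⟩ := List.mem_flatMap.1 h
    rw [List.mem_range] at hi
    obtain ⟨t, ht, h1, rfl⟩ := (hmem e i hi).1 h
    exact ⟨⟨i, by omega⟩, ⟨t, ht⟩, rfl, h1⟩
  · intro i t hit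
    rw [Matrix.of_apply] at hit ⊢
    have hi : (i : ℕ) < piv.length := by
      by_contra hi
      refine hit (he.unused _ (hro i i.2) (fun hm => ?_) t t.2)
      obtain ⟨p, hp, hpi⟩ := List.mem_map.1 hm
      obtain ⟨j, hj, rfl⟩ := List.getElem_of_mem hp
      rw [← hpiv j hj] at hpi
      have := hroinj j (by omega) i i.2 hpi
      omega
    exact List.mem_flatMap.2 ⟨i, List.mem_range.2 hi, (hmem _ _ hi).2 ⟨t, t.2, hit, rfl⟩⟩

/-- Write the factors. -/
def writeFactors : RamProgram :=
  block [.wordConst (reg 61) 0, .wordConst (.dir 9 0) 0] ;;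
  writeFactor 0 (forRange 16 zeroAddr (reg 14)
    (.branch (.wordLt (arr 55 16) (.dir 0 0)) (emit (arr 55 16) (reg 16) (reg 10)) .skip)) ;;
  writeFactor 1 (forRange 16 zeroAddr (reg 14) (emit (reg 16) (arr 54 16) (reg 10))) ;;
  writeFactor 2 (forRange 16 zeroAddr (reg 14) (emit (reg 16) (reg 16) (reg 10)) ;;
    forRange 16 zeroAddr (reg 42) (emit (arr 50 16) (arr 51 16) (arr 7 16))) ;;
  writeFactor 3 (forRange 16 zeroAddr (reg 14) (emit (arr 57 16) (reg 16) (reg 10))) ;;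
  writeFactor 4 writePivotRows ;;
  writeFactor 5 (forRange 16 zeroAddr (reg 14) (emit (arr 54 16) (reg 16) (reg 10))) ;;
  writeFactor 6 (forRange 16 zeroAddr (reg 14)
    (.branch (.wordLt (arr 55 16) (.dir 0 0)) .skip (
      block [.wordOp .sub (reg 18) (arr 55 16) (.dir 0 0)] ;;
      emit (reg 16) (reg 18) (reg 10)))) ;;
  block [
    .wordConst (.dir 7 1) 7,
    .wordMove (.dir 8 0) (.dir 0 0),
    .wordMove (.dir 8 1) (reg 14),
    .wordMove (.dir 8 2) (reg 14),
    .wordMove (.dir 8 3) (reg 14),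
    .wordMove (.dir 8 4) (reg 14),
    .wordMove (.dir 8 5) (reg 14),
    .wordMove (.dir 8 6) (reg 14),
    .wordMove (.dir 8 7) (.dir 0 1)]

theorem writeFactors_spec {lab : ℕ → ℕ}
    (hc : HoldsConsts n m q σ) (hcov : IsCover N l pn nd NL) (hl : HoldsLists N nd NL σ)
    (he : HoldsElim N pn nd M' N N piv ops σ) (hol : ops.length ≤ N * l)
    (hs : IsSorting N lab (σ.word 54) (σ.word 55)) (hlab : ∀ s < N, lab s < n + m)
    (hro : ∀ i < N, σ.word 57 i < N)
    (hroinj : ∀ i < N, ∀ j < N, σ.word 57 i = σ.word 57 j → i = j)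
    (hpiv : ∀ i (hi : i < piv.length), σ.word 57 i = piv[i].1) (hw : N * N < 2 ^ w)
    (hwl : ∀ t < N, σ.word 44 (nd t) < 2 ^ w) (hwN : N < 2 ^ w) (hw8 : 8 ≤ 2 ^ w)
    (hwn : n + m < 2 ^ w)
    (hwnd : ∀ t < N, nd t < 2 ^ w) (hwo : 7 * (N * (2 * l + 2)) < 2 ^ w) :
    WP w writeFactors σ (N * (l * 16 + 52) + 36) fun τ =>
      σ.Frame [7, 8, 9, 10, 11, 16, 17, 18, 19, 20, 21, 22, 23, 61] [3] τ ∧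
      τ.HoldsChainFrom (luChain n m N (fun s t => σ.fld 6 (s * N + t)) ops (σ.word 54) (σ.word 55)
        (σ.word 57)) 0 := by
  set B := N * (2 * l + 2) with hB
  have hB2 : B = 2 * N + N * l + N * l := by rw [hB]; ring
  have hlen := he.elim.length_piv_le
  set sl := σ.word 54 with hsl
  set sv := σ.word 55 with hsv
  set ro := σ.word 57 with hrod
  set A : ℕ → ℕ → F := fun s t => σ.fld 6 (s * N + t) with hA
  have hsvlt : ∀ g < N, sv g < n + m := fun g hg => by
    rw [(hs.lt g hg).2]; exact hlab _ (hs.lt g hg).1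
  have hflen : ∀ (h : ℕ) (e : ℕ → List (ℕ × ℕ × F)), (∀ x, (e x).length ≤ 1) →
      ((List.range h).flatMap e).length ≤ h := fun h e he => by
    simpa using length_flatMap_le fun x (_ : x ∈ List.range h) => he x
  refine WP.block_seq (N * (l * 16 + 52) + 34) ?_
  simp only [blockPost, Instr.post, loc_reg, loc_dir]
  refine ⟨by omega, by omega, ?_⟩
  have hW₀ : Written B [] ((σ.sw 61 0 0).sw 9 0 0) := by
    refine ⟨⟨by simp, fun i hi => by simp at hi⟩, ?_, by simp⟩
    intro t ht
    simp at ht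
    simp [ht]
  have hF₀ : σ.Frame [9, 10, 11, 16, 17, 18, 19, 20, 21, 22, 23, 61] [3]
      ((σ.sw 61 0 0).sw 9 0 0) := by simp
  generalize (σ.sw 61 0 0).sw 9 0 0 = σ₀ at hW₀ hF₀ ⊢
  have hWle : ∀ {Ls : List (List (ℕ × ℕ × F))} {τ : RamState F}, Written B Ls τ →
      Ls.length ≤ 6 → Ls.flatten.length ≤ 6 * B := fun h h6 =>
    h.le.trans (Nat.mul_le_mul_right _ h6)
  have hwB : ∀ t ≤ 6, (t + 1) * B < 2 ^ w := fun t ht =>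
    lt_of_le_of_lt (Nat.mul_le_mul_right _ (by omega)) hwo
  have hpermW : ∀ {Ls : List (List (ℕ × ℕ × F))} {τ : RamState F} (t : ℕ) (r c : Addr) (i j : ℕ → ℕ),
      Ls.length = t → t ≤ 6 → σ.Frame [9, 10, 11, 16, 17, 18, 19, 20, 21, 22, 23, 61] [3] τ →
      Written B Ls τ → c.IsFree → (∀ g < N, i g < N ∧ j g < N) →
      (∀ g < N, ∀ ρ, τ.Frame [16, 10, 11, 61] [3] ρ → ρ.word 16 0 = g →
        ρ.getWord r = i g ∧ ρ.getWord c = j g) →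
      WP w (writeFactor t (forRange 16 zeroAddr (reg 14) (emit r c (reg 10)))) τ (N * 6 + 2 + 1)
        fun ρ => σ.Frame [9, 10, 11, 16, 17, 18, 19, 20, 21, 22, 23, 61] [3] ρ ∧
          Written B (Ls ++ [(List.range N).flatMap fun g => [(i g, j g, (1 : F))]]) ρ := by
    intro Ls τ t r c i j ht ht6 hF hW hr hlt hget
    have := hWle hW (by omega)
    refine writeFactor_spec ht hF hW ((hflen _ _ fun x => by simp).trans (by omega)) (hwB t ht6)
      (WP.forEmitOne N i j (fun _ => 1) (hc.frame hF) (fun ρ hG => by simp [hG.word, hF.word, hl.size])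
        (fun g hg ρ hG h16 => ⟨(hget g hg ρ hG h16).1, (hget g hg ρ hG h16).2, ?_⟩)
        (fun g hg => ?_) hW.emitted (by omega) le_rfl (fun ρ hG hE => ⟨hG.mono, hE⟩) hr)
    · simp [hG.fld, hF.fld, hc.fone]
    · have := hlt g hg
      omega
  -- the rows
  refine WP.seq (T₁ := N * 7 + 2 + 1) (N * (l * 16 + 45) + 31) ((writeFactor_spec (t := 0) (B := B)
    (T := N * 7 + 2) (L := (List.range N).flatMap fun g => if sv g < n then [(sv g, g, (1 : F))]
    else [])
    rfl hF₀ hW₀ ((hflen _ _ fun x => by split_ifs <;> simp).trans (by omega)) (hwB 0 (by omega))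
    ?_).post ?_) (by ring_nf; omega)
  · refine WP.forEmit N 5 1 _ [10, 11, 61] (by decide) (by decide) (by decide)
      (hc.frame hF₀)
      (fun τ hF => by simp [hF.word, hF₀.word, hl.size]) hW₀.emitted
      (fun x _ => by split_ifs <;> simp) (by simp; omega) ?_ (by omega)
      fun τ hF hE => ⟨hF.mono, hE⟩
    intro g τ out hg hF h16 hE hlen'
    have hFF := hF₀.trans hF
    have h55 : τ.word 55 = sv := hFF.word (by decide)
    simp only [List.flatten_nil, List.length_nil] at hlen'
    refine WP.branch (fun hb => ?_) fun hb => ?_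
    · simp [h16, h55, hFF.word, hc.rows] at hb
      simp only [hb, if_true]
      exact emit_spec _ _ _
        (by simp [h16, h55]) (by simp [h16]) (by simp [hFF.fld, hc.fone]) hE
        (by rw [hFF.word (by decide), hc.one]) (by omega) (by omega) (by omega)
    · simp [h16, h55, hFF.word, hc.rows] at hb
      simp only [not_lt.2 hb, if_false, List.append_nil]
      exact WP.skip ⟨RamState.Frame.refl _ _ _, hE⟩
  rintro σ₁ ⟨hF₁, hW₁⟩
  have hle₁ := hWle hW₁ (by simp)
  -- the sorting permutation
  refine WP.seq (N * (l * 16 + 39) + 28) ((hpermW 1 _ _ (fun g => g) sl (by simp) (by omega) hF₁ hW₁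
    (by simp [Addr.IsFree, arr]) (fun g hg => ⟨hg, (hs.lt g hg).1⟩) fun g hg τ hF h16 => by
      simp [h16, hF.word, hF₁.word, hsl]).post ?_) (by ring_nf; omega)
  rintro σ₂ ⟨hF₂, hW₂⟩
  have hle₂ := hWle hW₂ (by simp)
  -- the row operations
  refine WP.seq (T₁ := N * 6 + 2 + (N * l * 6 + 2) + 1) (N * (l * 10 + 33) + 23)
    ((writeFactor_spec (t := 2) (B := B) (T := N * 6 + 2 + (N * l * 6 + 2))
    (L := ((List.range N).flatMap fun i => [(i, i, (1 : F))]) ++ ops)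
    (by simp) hF₂ hW₂ ?_ (hwB 2 (by omega)) ?_).post ?_) (by ring_nf; omega)
  · have := hflen N (fun i => [(i, i, (1 : F))]) fun x => by simp
    rw [List.length_append]
    omega
  · refine WP.seq (T₁ := N * 6 + 2) (N * l * 6 + 2) (WP.forEmitOne N (fun g => g) (fun g => g)
      (fun _ => 1) (hc.frame hF₂) (fun τ hF => by simp [hF.word, hF₂.word, hl.size])
      (fun g hg τ hF h16 => ?_) (fun g hg => by omega) hW₂.emitted (by omega) le_rfl
      fun τ hF hE => ?_) le_rfl
    · simp [h16, hF.word, hF₂.word, hF.fld, hF₂.fld, hc.fone]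
    · have hFF := hF₂.trans hF
      have h5 := hflen N (fun i => [(i, i, (1 : F))]) fun x => by simp
      have h6 := flatMap_singleton_getElem ops (fun i => [(σ.word 50 i, σ.word 51 i, σ.fld 7 i)])
        fun i hi => by rw [(he.ops_getElem hi).1, (he.ops_getElem hi).2.1, (he.ops_getElem hi).2.2]
      refine WP.forEmitOne ops.length (σ.word 50) (σ.word 51) (σ.fld 7) (hc.frame hFF)
          (fun ρ hG => by simp [hG.word, hFF.word, he.nops])
        (fun g hg ρ hG h16 => ?_) (fun i hi => ?_) hE (by rw [List.length_append]; omega) (by omega)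
        fun ρ hG hE' => ⟨?_, ?_⟩
      · simp [h16, hG.word, hFF.word, hG.fld, hFF.fld]
      · rw [(he.ops_getElem hi).1, (he.ops_getElem hi).2.1]
        have := he.elim.ops_lt _ (List.getElem_mem hi)
        omega
      · exact (hF.mono).trans hG
      · rw [h6, List.append_assoc] at hE'
        exact hE'
  rintro σ₃ ⟨hF₃, hW₃⟩
  have hle₃ := hWle hW₃ (by simp)
  -- the permutation of the rows
  refine WP.seq (N * (l * 10 + 27) + 20) ((hpermW 3 _ _ ro (fun g => g) (by simp) (by omega) hF₃ hW₃
    (by simp [Addr.IsFree, reg]) (fun g hg => ⟨hro g hg, hg⟩) fun g hg τ hF h16 => by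
      simp [h16, hF.word, hF₃.word, hrod]).post ?_) (by ring_nf; omega)
  rintro σ₄ ⟨hF₄, hW₄⟩
  have hle₄ := hWle hW₄ (by simp)
  have h6₄ : σ₄.fld 6 = σ.fld 6 := hF₄.fld (by decide)
  -- the pivot rows
  refine WP.seq (T₁ := N * (l * 10 + 11) + 2 + 1) (N * 16 + 17) ((writeFactor_spec (t := 4) (B := B)
    (T := N * (l * 10 + 11) + 2)
    (L := (List.range piv.length).flatMap (pivotRowEntries nd NL A piv))
    (by simp) hF₄ hW₄ ?_ (hwB 4 (by omega)) ?_).post ?_) (by ring_nf; omega)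
  · have h1 := length_flatMap_le (f := pivotRowEntries nd NL A piv) (L := List.range piv.length)
      (d := l) fun i hi => by
        rw [pivotRowEntries, flatMap_ite, List.length_map,
          List.getD_eq_getElem _ _ (List.mem_range.1 hi)]
        exact (List.length_filter_le _ _).trans
          (hcov.length_le _ (he.elim.piv_lt _ (List.getElem_mem _)).2.2)
    rw [List.length_range] at h1
    have h2 : piv.length * l ≤ N * l := Nat.mul_le_mul_right _ hlen
    omega
  · have := writePivotRows_spec (w := w) (hc.frame hF₄) hcov (hl.frame hF₄)
      (he.frame hF₄) hW₄.emitted hw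
      (by rw [hF₄.word (by decide)]; exact hwl) hwnd (by rw [← hB]; omega)
    rw [h6₄] at this
    exact this
  rintro σ₅ ⟨hF₅, hW₅⟩
  have hle₅ := hWle hW₅ (by simp)
  refine WP.seq (N * 10 + 14) ((hpermW 5 _ _ sl (fun g => g) (by simp) (by omega) hF₅ hW₅
    (by simp [Addr.IsFree, reg]) (fun g hg => ⟨(hs.lt g hg).1, hg⟩) fun g hg τ hF h16 => by
      simp [h16, hF.word, hF₅.word, hsl]).post ?_)
  rintro σ₆ ⟨hF₆, hW₆⟩
  have hle₆ := hWle hW₆ (by simp)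
  -- the columns
  refine WP.seq (T₁ := N * 8 + 2 + 1) 9 ((writeFactor_spec (t := 6) (B := B)
    (T := N * 8 + 2) (L := (List.range N).flatMap fun g =>
      if n ≤ sv g then [(g, sv g - n, (1 : F))] else [])
    (by simp) hF₆ hW₆ ((hflen _ _ fun x => by split_ifs <;> simp).trans (by omega))
    (hwB 6 (by omega)) ?_).post ?_)
  · refine WP.forEmit N 6 1 _ [10, 11, 18, 61] (by decide) (by decide) (by decide)
      (hc.frame hF₆)
      (fun τ hF => by simp [hF.word, hF₆.word, hl.size]) hW₆.emitted
      (fun x _ => by split_ifs <;> simp) (by omega) ?_ (by omega)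
      fun τ hF hE => ⟨hF.mono, hE⟩
    intro g τ out hg hF h16 hE hlen'
    have hFF := hF₆.trans hF
    have h55 : τ.word 55 = sv := hFF.word (by decide)
    have hsvg := hsvlt g hg
    refine WP.branch (fun hb => ?_) fun hb => ?_
    · simp [h16, h55, hFF.word, hc.rows] at hb
      simp only [not_le.2 hb, if_false, List.append_nil]
      exact WP.skip ⟨RamState.Frame.refl _ _ _, hE⟩
    · simp [h16, h55, hFF.word, hc.rows] at hb
      simp only [hb, if_true]
      refine WP.block_seq 4 ?_
      simp only [blockPost, Instr.post, WordOp.eval, loc_reg, getWord_arr, getWord_dir, h16, h55,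
        hFF.word (show 0 ∉ _ by decide), hc.rows]
      refine ⟨by omega, ?_⟩
      have hsw : τ.Frame [18] [] (τ.sw 18 0 (sv g - n)) := by simp
      refine (emit_spec g (sv g - n) 1 (by simp [h16]) (by simp) (by simp [hFF.fld, hc.fone])
        (hE.frame hsw)
        (by simp [hFF.word, hc.one]) (by omega) (by omega) (by omega)).post ?_
      rintro ρ ⟨hG, hE'⟩
      exact ⟨(hsw.mono).trans hG, hE'⟩
  rintro τ ⟨hF, hW⟩
  have hperm : ∀ f : ℕ → ℕ, (∀ g < N, f g < N) →
      ListsEntries (indicatorMatrix F N N fun s i => f i = s)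
        ((List.range N).flatMap fun g => [(f g, g, (1 : F))]) := fun f hf => by
    simpa using listsEntries_indicatorMatrix (F := F) (a := N) (b := N) (h := N) (p := fun _ => True)
      (i := f) (j := fun g => g) (P := fun s i => f i = s) (fun g hg _ => ⟨hf g hg, hg⟩)
      (fun g _ g' _ _ _ _ h => h) fun x _ y hy => ⟨fun h => ⟨y, hy, trivial, h, rfl⟩, by
        rintro ⟨g, _, _, rfl, rfl⟩; rfl⟩
  have hfin : ∀ τ' : RamState F, τ.Frame [7, 8] [] τ' → τ'.word 7 1 = 7 →
      (τ'.word 8 0 = n ∧ τ'.word 8 1 = N ∧ τ'.word 8 2 = N ∧ τ'.word 8 3 = N ∧ τ'.word 8 4 = N ∧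
        τ'.word 8 5 = N ∧ τ'.word 8 6 = N ∧ τ'.word 8 7 = m) →
      τ'.HoldsChainFrom (luChain n m N A ops sl sv ro) 0 := by
    rintro τ' hG h7 ⟨g0, g1, g2, g3, g4, g5, g6, g7⟩
    have hW' := hW.frame hG
    refine ⟨g0, hW'.holdsMatrix 0 rfl ?_, g1, hW'.holdsMatrix 1 rfl ?_, g2,
      hW'.holdsMatrix 2 rfl he.elim.listsEntries_opsMatrix, g3, hW'.holdsMatrix 3 rfl ?_, g4,
      hW'.holdsMatrix 4 rfl (listsEntries_pivotRows hcov he.elim hro hroinj hpiv), g5,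
      hW'.holdsMatrix 5 rfl ?_, g6, hW'.holdsMatrix 6 rfl ?_, h7, g7⟩
    · refine listsEntries_indicatorMatrix (p := fun g => sv g < n) (i := sv) (j := fun g => g)
        (fun g hg h => ⟨h, hg⟩) (fun g _ g' _ _ _ _ h => h) fun x hx y hy => ?_
      constructor
      · rintro rfl
        exact ⟨y, hy, hx, rfl, rfl⟩
      · rintro ⟨g, _, _, rfl, rfl⟩
        rfl
    · simpa using listsEntries_indicatorMatrix (F := F) (a := N) (b := N) (h := N) (p := fun _ => True)
        (i := fun g => g) (j := sl) (P := fun g s => sl g = s) (fun g hg _ => ⟨hg, (hs.lt g hg).1⟩)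
        (fun g _ g' _ _ _ h _ => h) fun x hx y _ =>
        ⟨fun h => ⟨x, hx, trivial, rfl, h⟩, by rintro ⟨g, _, _, rfl, rfl⟩; rfl⟩
    · exact hperm ro hro
    · exact hperm sl fun g hg => (hs.lt g hg).1
    · refine listsEntries_indicatorMatrix (p := fun g => n ≤ sv g) (i := fun g => g)
        (j := fun g => sv g - n) (fun g hg h => ⟨hg, by have := hsvlt g hg; omega⟩)
        (fun g _ g' _ _ _ h _ => h) fun x hx y hy => ?_
      constructor
      · intro h
        exact ⟨x, hx, by omega, rfl, by omega⟩
      · rintro ⟨g, _, _, rfl, rfl⟩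
        omega
  have hF' : σ.Frame [7, 8, 9, 10, 11, 16, 17, 18, 19, 20, 21, 22, 23, 61] [3] τ :=
    hF.mono
  refine WP.block ?_
  have e1 : n < 2 ^ w := by omega
  have e2 : m < 2 ^ w := by omega
  have e3 : 7 < 2 ^ w := by omega
  simp [hF.word, hc.rows, hc.cols, hl.size, e1, e2, e3, hwN, hF']
  exact hfin _ (by simp) (by simp) (by simp)

/-! ### Programs: the rank and the determinant -/

/-- Compute the sign of the permutation in segment `58` into `fld 15 0`, by sorting it with
transpositions; segment `59` holds its inverse. -/
def permSign : RamProgram :=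
  block [.fieldMove (reg 15) (reg 10)] ;;
  forRange 16 zeroAddr (reg 14) (
    block [.wordMove (reg 18) (arr 58 16), .wordMove (arr 59 18) (reg 16)]) ;;
  forRange 16 zeroAddr (reg 14) (
    .branch (.wordEq (arr 58 16) (reg 16)) .skip (block [
      .wordMove (reg 18) (arr 58 16),
      .wordMove (reg 19) (arr 59 16),
      .wordMove (arr 58 19) (reg 18),
      .wordMove (arr 58 16) (reg 16),
      .wordMove (arr 59 18) (reg 19),
      .wordMove (arr 59 16) (reg 16),
      .fieldOp .mul (reg 15) (reg 15) (reg 11)]))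

theorem permSign_spec (hc : HoldsConsts n m q σ) (hN : σ.word 14 0 = N) (hwN : N < 2 ^ w)
    (e : Equiv.Perm (Fin N)) (he : ∀ s : Fin N, σ.word 58 s = e s) :
    WP w permSign σ (N * 14 + 5) fun τ => σ.Frame [16, 18, 19, 58, 59] [15] τ ∧
      τ.fld 15 0 = ((Equiv.Perm.sign e : ℤ) : F) := by
  have hone := hc.one
  refine WP.block_seq (N * 14 + 4) ?_
  simp [hc.fone]
  refine WP.seq (T₁ := N * 4 + 2) (N * 10 + 2) (WP.forRange 0 N 2 (fun x τ =>
    σ.Frame [16, 18, 59] [15] τ ∧ τ.word 16 0 = x ∧ τ.fld 15 0 = 1 ∧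
      ∀ s : Fin N, (s : ℕ) < x → τ.word 59 (e s) = s)
    (by simp [hc.zero]) ?_ ?_ ?_ ?_)
  · simp
  · rintro i τ ⟨hF, h, -⟩
    simp [h, hF.word, hN]
  · rintro x τ - hx ⟨hF, hv, h15, h⟩
    have hex := he ⟨x, hx⟩
    have hlt := (e ⟨x, hx⟩).2
    dsimp only at hex
    refine WP.block ?_
    simp [hF.word, hv, hF, hone, hex, h15]
    refine ⟨by omega, by omega, fun s hs => ?_⟩
    by_cases hsx : s = ⟨x, hx⟩
    · subst hsx; simp
    · have h1 : (e s : ℕ) ≠ e ⟨x, hx⟩ := fun h' => hsx (e.injective (Fin.ext h'))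
      rw [Function.update_of_ne h1]
      refine h s ?_
      have : (s : ℕ) ≠ x := fun h' => hsx (Fin.ext h')
      omega
  rintro σ₁ ⟨hF₁, -, h15, h59⟩
  refine WP.forRange 0 N 8 (fun x τ =>
    σ.Frame [16, 18, 19, 58, 59] [15] τ ∧ τ.word 16 0 = x ∧ ∃ e' : Equiv.Perm (Fin N),
      (∀ s : Fin N, τ.word 58 s = e' s) ∧ (∀ s : Fin N, τ.word 59 (e' s) = s) ∧
      (∀ s : Fin N, (s : ℕ) < x → e' s = s) ∧
      τ.fld 15 0 = ((Equiv.Perm.sign e : ℤ) : F) * ((Equiv.Perm.sign e' : ℤ) : F))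
    (by simp [hF₁.word, hc.zero]) ?_ ?_ ?_ ?_
  · refine ⟨by simp; exact hF₁.mono, by simp, e, fun s => ?_, fun s => ?_,
      by simp, ?_⟩
    · simp [hF₁.word, he]
    · simp [h59]
    · simp only [RamState.fld_sw, h15]
      rcases Int.units_eq_one_or (Equiv.Perm.sign e) with h | h <;> simp [h]
  · rintro i τ ⟨hF, h, -⟩
    simp [h, hF.word, hN]
  · rintro x τ - hx ⟨hF, hv, e', h58, h59, hfix, hsgn⟩
    have hx58 := h58 ⟨x, hx⟩
    have hx59 := h59 (e'.symm ⟨x, hx⟩)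
    dsimp only at hx58
    rw [Equiv.apply_symm_apply] at hx59
    dsimp only at hx59
    refine WP.branch (T := 7) (fun hb => ?_) fun hb => ?_
    · simp [hv, hx58] at hb
      refine WP.skip ?_
      refine ⟨hv, by simp [hF.word, hone], by simp [hF], by simp, e', by simpa using h58,
        by simpa using h59, fun s hs => ?_, by simpa using hsgn⟩
      by_cases hsx : s = ⟨x, hx⟩
      · subst hsx; exact Fin.ext hb
      · refine hfix s ?_
        have : (s : ℕ) ≠ x := fun h' => hsx (Fin.ext h')
        omega
    · simp [hv, hx58] at hb
      set a : Fin N := ⟨x, hx⟩ with ha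
      set t := e'.symm a with ht
      have het : e' t = a := by rw [ht, Equiv.apply_symm_apply]
      have hta : t ≠ a := by
        intro h
        rw [h] at het
        exact hb (by rw [het])
      have hea : e' a ≠ a := fun h => hb (by rw [h])
      have h1 := (e' a).2
      refine WP.block ?_
      simp [hF.word, hF.fld, hv, hF, hone, hx58, hx59, hc.fneg]
      have htx : (t : ℕ) ≠ x := fun h => hta (Fin.ext h)
      have hex : x ≠ (e' a : ℕ) := fun h => hea (Fin.ext h.symm)
      refine ⟨by omega, by omega, by omega, by omega, by omega, by omega, e' * Equiv.swap a t, fun s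
          => ?_, fun s => ?_,
        fun s hs => ?_, ?_⟩
      · by_cases hsa : s = a
        · subst hsa
          simp [het, ha]
        · have hsx : (s : ℕ) ≠ x := fun h => hsa (Fin.ext h)
          by_cases hst : s = t
          · subst hst
            simp [Function.update_of_ne hsx]
          · have hst' : (s : ℕ) ≠ t := fun h => hst (Fin.ext h)
            simp [Function.update_of_ne hsx, Function.update_of_ne hst',
              Equiv.swap_apply_of_ne_of_ne hsa hst, h58]
      · by_cases hsa : s = a
        · subst hsa
          simp [het, ha]
        · have hsx : (s : ℕ) ≠ x := fun h => hsa (Fin.ext h)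
          by_cases hst : s = t
          · subst hst
            have : (e' a : ℕ) ≠ x := hex.symm
            simp [Function.update_of_ne this]
          · have h2 : (e' s : ℕ) ≠ x := fun h => hst (by
              rw [ht, Equiv.eq_symm_apply]; exact Fin.ext h)
            have h3 : (e' s : ℕ) ≠ e' a := fun h => hsa (e'.injective (Fin.ext h))
            simp [Equiv.swap_apply_of_ne_of_ne hsa hst, Function.update_of_ne h2,
              Function.update_of_ne h3, h59]
      · by_cases hsa : s = a
        · subst hsa
          simp [het]
        · have hsx : (s : ℕ) ≠ x := fun h => hsa (Fin.ext h)
          have hst : s ≠ t := by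
            rintro rfl
            have := hfix t (by omega)
            exact hta (this.symm.trans het)
          simp [Equiv.swap_apply_of_ne_of_ne hsa hst]
          exact hfix s (by omega)
      · rw [Equiv.Perm.sign_mul, Equiv.Perm.sign_swap hta.symm, hsgn]
        push_cast
        ring
  · rintro τ ⟨hF, -, e', -, -, hfix, hsgn⟩
    have : e' = 1 := Equiv.ext fun s => hfix s s.2
    rw [this] at hsgn
    exact ⟨hF, by simpa using hsgn⟩

/-- Compute the rank. -/
def writeRank : RamProgram := block [
  .wordOp .add (reg 20) (reg 27) (reg 13),
  .wordOp .sub (.dir 7 0) (reg 20) (reg 14)]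

theorem writeRank_spec {r : ℕ} (hc : HoldsConsts n m q σ) (hN : σ.word 14 0 = N)
    (hr : σ.word 27 0 = r) (hw : r + (n + m) < 2 ^ w) :
    WP w writeRank σ 2 fun τ => σ.Frame [7, 20] [] τ ∧ τ.word 7 0 = r + (n + m) - N ∧
      τ.word 7 1 = σ.word 7 1 := by
  refine WP.block ?_ (by simp [writeRank])
  simp [hc.total, hN, hr]
  omega

/-- Compute the determinant. -/
def writeDet : RamProgram :=
  .branch (.wordEq (.dir 0 0) (.dir 0 1)) (
    block [.wordOp .add (reg 20) (reg 27) (.dir 0 0)] ;;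
    .branch (.wordEq (reg 20) (reg 14)) (
      forRange 16 zeroAddr (reg 27) (block [
        .wordMove (reg 18) (arr 47 16),
        .wordMove (arr 58 18) (arr 48 16)]) ;;
      forRange 16 zeroAddr (.dir 0 0) (block [
        .wordOp .add (reg 18) (.dir 0 0) (reg 16),
        .wordMove (reg 18) (arr 56 18),
        .wordMove (arr 58 18) (arr 56 16)]) ;;
      permSign ;;
      forRange 16 zeroAddr (reg 27) (block [
        .wordOp .mul (reg 18) (arr 47 16) (reg 14),
        .wordOp .add (reg 18) (reg 18) (arr 48 16),
        .fieldOp .mul (reg 15) (reg 15) (arr 6 18)]) ;;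
      forRange 16 zeroAddr (.dir 0 0) (block [.fieldOp .mul (reg 15) (reg 15) (reg 11)]) ;;
      block [.fieldMove (.dir 2 0) (reg 15)])
    (block [.fieldZero (.dir 2 0)]))
  .skip

theorem writeDet_spec {lab up : ℕ → ℕ} {E : ℕ → ℕ → F} (hc : HoldsConsts n m q σ)
    (hN : σ.word 14 0 = N) (h : IsSplit (fun i j => M i j) N lab up E)
    (he : HoldsElim N pn nd (splitEntry n lab up E) N N piv ops σ)
    (hts : ∀ v < n + m, σ.word 56 v < N ∧ lab (σ.word 56 v) = v ∧ up (σ.word 56 v) = 0)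
    (hw : N * N < 2 ^ w) (hwN : N < 2 ^ w) (hwn : N + n + m < 2 ^ w) :
    WP w writeDet σ (N * 23 + n * 8 + 20) fun τ => σ.Frame [16, 18, 19, 20, 58, 59] [2, 15] τ ∧
      ∀ hnm : n = m, τ.fld 2 0 = (M.submatrix id (Fin.cast hnm)).det := by
  have hone := hc.one
  have hlen := he.elim.length_piv_le
  refine WP.branch (T := N * 23 + n * 8 + 19) (fun hb => ?_) fun hb => ?_
  swap
  · simp [hc.rows, hc.cols] at hb
    exact WP.skip ⟨RamState.Frame.refl _ _ _, fun hnm => absurd hnm hb⟩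
  simp [hc.rows, hc.cols] at hb
  subst hb
  have hdet : (M.submatrix id (Fin.cast rfl)).det = (Matrix.of fun i j => M i j).det := rfl
  refine WP.block_seq (N * 23 + n * 8 + 18) ?_
  simp [hc.rows, he.npiv]
  refine ⟨by omega, ?_⟩
  have hF₀ : σ.Frame [16, 18, 19, 20, 58, 59] [2, 15] (σ.sw 20 0 (piv.length + n)) := by
    simp
  have h20 : (σ.sw 20 0 (piv.length + n)).word 20 0 = piv.length + n := by simp
  generalize σ.sw 20 0 (piv.length + n) = σ₀ at hF₀ h20 ⊢
  refine WP.branch (T := N * 23 + n * 8 + 17) (fun hb => ?_) fun hb => ?_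
  swap
  · simp [h20, hF₀.word, hN] at hb
    refine WP.block ?_
    simp [hF₀]
    exact (h.det_eq_zero he.elim hb).symm
  simp [h20, hF₀.word, hN] at hb
  obtain ⟨e, he1, he2, he3⟩ := h.exists_perm_det he.elim hts hb
  have hcov : ∀ s : Fin N, (∃ i, ∃ hi : i < piv.length, (s : ℕ) = piv[i].1) ∨
      ∃ k < n, (s : ℕ) = σ.word 56 (n + k) := by
    have hnp : ∀ i (hi : i < piv.length), ∀ k < n, piv[i].1 ≠ σ.word 56 (n + k) := by
      intro i hi k hk hik
      have h1 := he.elim.piv_lt _ (List.getElem_mem hi)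
      obtain ⟨t1, t2, t3⟩ := hts (n + k) (by omega)
      refine he.elim.piv_ne _ (List.getElem_mem hi) (he.elim.zero_row _ h1.1 (fun t ht => ?_) _ h1.2.2)
      rw [hik]
      exact h.splitEntry_row t1 ht (by omega) t3
    let f : Fin piv.length ⊕ Fin n → Fin N := Sum.elim
      (fun i => ⟨piv[i].1, (he.elim.piv_lt _ (List.getElem_mem i.2)).1⟩)
      (fun k => ⟨σ.word 56 (n + k), (hts (n + k) (by omega)).1⟩)
    have hf : Function.Injective f := by
      rintro (i | i) (j | j) hij
      · exact congrArg Sum.inl (he.elim.piv_fst_inj (congrArg Fin.val hij))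
      · exact absurd (congrArg Fin.val hij) (hnp i i.2 j j.2)
      · exact absurd (congrArg Fin.val hij).symm (hnp j j.2 i i.2)
      · have h1 : σ.word 56 (n + i) = σ.word 56 (n + j) := congrArg Fin.val hij
        have h2 := (hts (n + i) (by omega)).2.1
        rw [h1, (hts (n + j) (by omega)).2.1] at h2
        exact congrArg Sum.inr (Fin.ext (by omega))
    have hbij := (Fintype.bijective_iff_injective_and_card f).2 ⟨hf, by simp [hb]⟩
    intro s
    obtain ⟨x, hx⟩ := hbij.2 s
    rcases x with i | k
    · exact Or.inl ⟨i, i.2, by rw [← hx]; rfl⟩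
    · exact Or.inr ⟨k, k.2, by rw [← hx]; rfl⟩
  have hn : n ≤ N := by omega
  refine WP.seq (T₁ := N * 4 + 2) (N * 19 + n * 8 + 15) (WP.forRange 0 piv.length 2 (fun x τ =>
    σ.Frame [16, 18, 19, 20, 58, 59] [2, 15] τ ∧ τ.word 16 0 = x ∧
      ∀ s : Fin N, (∃ i, ∃ hi : i < piv.length, i < x ∧ (s : ℕ) = piv[i].1) → τ.word 58 s = e s)
    (by simp [hF₀.word, hc.zero]) ?_ ?_ ?_ ?_)
  · simp [hF₀]
  · rintro i τ ⟨hF, h, -⟩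
    simp [h, hF.word, he.npiv]
  · rintro x τ - hx ⟨hF, hv, h58⟩
    have hp := he.elim.piv_lt _ (List.getElem_mem hx)
    refine WP.block ?_
    simp only [blockPost, Instr.post, loc_reg, loc_arr, getWord_arr, hv, hF.word
        (show 47 ∉ _ by decide),
      (he.piv_getElem hx).1]
    refine ⟨by omega, ?_⟩
    simp [hF.word, hv, hF, hone, (he.piv_getElem hx).2]
    refine ⟨by omega, fun s i hix hi hs => ?_⟩
    by_cases hxx : i = x
    · subst hxx
      rw [hs, Function.update_self, he1 i hi s hs]
    · have h1 : (s : ℕ) ≠ piv[x].1 := fun h' => hxx (congrArg Fin.val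
        (he.elim.piv_fst_inj (i := ⟨i, hi⟩) (j := ⟨x, hx⟩) (hs.symm.trans h')))
      rw [Function.update_of_ne h1]
      exact h58 s ⟨i, hi, by omega, hs⟩
  rintro σ₁ ⟨hF₁, -, h58₁⟩
  refine WP.seq (T₁ := n * 5 + 2) (N * 19 + n * 3 + 13) (WP.forRange 0 n 3 (fun x τ =>
    σ.Frame [16, 18, 19, 20, 58, 59] [2, 15] τ ∧ τ.word 16 0 = x ∧
      ∀ s : Fin N, ((∃ i, ∃ hi : i < piv.length, (s : ℕ) = piv[i].1) ∨
        ∃ k < x, (s : ℕ) = σ.word 56 (n + k)) → τ.word 58 s = e s)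
    (by simp [hF₁.word, hc.zero]) ?_ ?_ ?_ ?_)
  · simp [hF₁]
    intro s i hi hs
    exact h58₁ s ⟨i, hi, hi, hs⟩
  · rintro i τ ⟨hF, h, -⟩
    simp [h, hF.word, hc.rows]
  · rintro x τ - hx ⟨hF, hv, h58⟩
    have t1 := (hts (n + x) (by omega)).1
    have t2 := (hts x (by omega)).1
    refine WP.block ?_
    simp [hF.word, hv, hF, hone, hc.rows]
    refine ⟨by omega, by omega, by omega, fun s hs => ?_⟩
    by_cases hsx : (s : ℕ) = σ.word 56 (n + x)
    · rw [hsx, Function.update_self, he2 x hx s hsx]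
    · rw [Function.update_of_ne hsx]
      refine h58 s (hs.imp id ?_)
      rintro ⟨k, hk, hks⟩
      refine ⟨k, ?_, hks⟩
      have : k ≠ x := by rintro rfl; exact hsx hks
      omega
  rintro σ₂ ⟨hF₂, -, h58₂⟩
  refine WP.seq (T₁ := N * 14 + 5) (N * 5 + n * 3 + 8) ((permSign_spec (hc.frame hF₂)
    (by rw [hF₂.word (by decide), hN]) hwN e fun s => h58₂ s (hcov s)).post ?_)
  rintro σ₃ ⟨hG, h15⟩
  have hF₃ := hF₂.trans hG
  refine WP.seq (T₁ := N * 5 + 2) (n * 3 + 6) (WP.forRange 0 piv.length 3 (fun x τ =>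
    σ.Frame [16, 18, 19, 20, 58, 59] [2, 15] τ ∧ τ.word 16 0 = x ∧
      τ.fld 15 0 = ((Equiv.Perm.sign e : ℤ) : F) *
        ((piv.take x).map fun p => σ.fld 6 (p.1 * N + p.2)).prod)
    (by simp [hF₃.word, hc.zero]) ?_ ?_ ?_ ?_)
  · simp [hF₃, h15]
  · rintro i τ ⟨hF, h, -⟩
    simp [h, hF.word, he.npiv]
  · rintro x τ - hx ⟨hF, hv, h15⟩
    have hp := he.elim.piv_lt _ (List.getElem_mem hx)
    have h1 : piv[x].1 * N + piv[x].2 < N * N := addr_lt hp.1 hp.2.2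
    refine WP.block ?_
    simp [hF.word, hF.fld, hv, hF, hone, he.piv_getElem hx, hN, h15]
    refine ⟨by omega, by omega, ?_⟩
    rw [List.take_succ_eq_append_getElem (by simpa using hx), List.prod_append]
    simp [mul_assoc]
  rintro σ₄ ⟨hF₄, -, h15₄⟩
  rw [List.take_length] at h15₄
  refine WP.seq (T₁ := n * 3 + 2) 1 (WP.forRange 0 n 1 (fun x τ =>
    σ.Frame [16, 18, 19, 20, 58, 59] [2, 15] τ ∧ τ.word 16 0 = x ∧
      τ.fld 15 0 = (-1) ^ x * (((Equiv.Perm.sign e : ℤ) : F) *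
        (piv.map fun p => σ.fld 6 (p.1 * N + p.2)).prod))
    (by simp [hF₄.word, hc.zero]) ?_ ?_ ?_ ?_)
  · simp [hF₄, h15₄]
  · rintro i τ ⟨hF, h, -⟩
    simp [h, hF.word, hc.rows]
  · rintro x τ - hx ⟨hF, hv, h15⟩
    refine WP.block ?_
    simp [hF.word, hF.fld, hv, hF, hone, hc.fneg, h15]
    ring
  rintro τ ⟨hF, -, h15⟩
  refine WP.block ?_
  simp [hF, h15]
  exact he3.symm

/-! ### Programs: solving a linear system

Field segment `8` holds the right-hand side of the split system and field segment `9` a solution. -/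

/-- Copy the right-hand side to the top rows of the split system. -/
def loadRhs : RamProgram :=
  forRange 16 zeroAddr (reg 14) (block [.fieldZero (arr 8 16), .fieldZero (arr 9 16)]) ;;
  forRange 16 zeroAddr (.dir 0 0) (block [
    .wordMove (reg 18) (arr 56 16),
    .fieldMove (arr 8 18) (arr 1 16)])

theorem loadRhs_spec {lab : ℕ → ℕ} (hc : HoldsConsts n m q σ) (hN : σ.word 14 0 = N)
    (hts : ∀ i < n, σ.word 56 i < N ∧ lab (σ.word 56 i) = i) (hwN : N < 2 ^ w) (hwn : n < 2 ^ w) :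
    WP w loadRhs σ (N * 4 + n * 4 + 4) fun τ => σ.Frame [16, 18] [8, 9] τ ∧
      (∀ s < N, τ.fld 9 s = 0) ∧ (∀ i < n, τ.fld 8 (σ.word 56 i) = σ.fld 1 i) ∧
      ∀ s < N, (∀ i < n, s ≠ σ.word 56 i) → τ.fld 8 s = 0 := by
  have hone := hc.one
  refine WP.seq (T₁ := N * 4 + 2) (n * 4 + 2) (WP.forRange 0 N 2 (fun x τ =>
    σ.Frame [16, 18] [8, 9] τ ∧ τ.word 16 0 = x ∧ (∀ s < x, τ.fld 8 s = 0) ∧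
      ∀ s < x, τ.fld 9 s = 0)
    (by simp [hc.zero]) ?_ ?_ ?_ ?_)
  · simp
  · rintro i τ ⟨hF, h, -⟩
    simp [h, hF.word, hN]
  · rintro x τ - hx ⟨hF, hv, h8, h9⟩
    refine WP.block ?_
    simp [hF.word, hv, hF, hone]
    constructor <;> intro s hs <;> rw [Function.update_apply] <;> split_ifs with hsx
    · rfl
    · exact h8 s (by omega)
    · rfl
    · exact h9 s (by omega)
  rintro σ₁ ⟨hF₁, -, h8, h9⟩
  refine WP.forRange 0 n 2 (fun x τ => σ.Frame [16, 18] [8, 9] τ ∧ τ.word 16 0 = x ∧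
      (∀ s < N, τ.fld 9 s = 0) ∧ (∀ i < x, τ.fld 8 (σ.word 56 i) = σ.fld 1 i) ∧
      ∀ s < N, (∀ i < x, s ≠ σ.word 56 i) → τ.fld 8 s = 0)
    (by simp [hF₁.word, hc.zero]) ?_ ?_ ?_ ?_
  · simp [hF₁]
    exact ⟨h9, h8⟩
  · rintro i τ ⟨hF, h, -⟩
    simp [h, hF.word, hc.rows]
  · rintro x τ - hx ⟨hF, hv, h9, hi, h0⟩
    have h1 := hts x hx
    refine WP.block ?_
    simp [hF.word, hF.fld, hv, hF, hone]
    refine ⟨by omega, h9, fun i hix => ?_, fun s hs hsi => ?_⟩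
    · by_cases hxx : i = x
      · subst hxx; simp
      · have : σ.word 56 i ≠ σ.word 56 x := fun h => hxx (by
          rw [← (hts i (by omega)).2, h, h1.2])
        rw [Function.update_of_ne this, hi i (by omega)]
    · rw [Function.update_of_ne (hsi x le_rfl)]
      exact h0 s hs fun i hi => hsi i (by omega)
  · rintro τ ⟨hF, -, h⟩
    exact ⟨hF, h⟩

/-- Apply the row operations of the elimination to the right-hand side. -/
def replayOps : RamProgram :=
  forRange 16 zeroAddr (reg 42) (block [
    .wordMove (reg 18) (arr 50 16),
    .wordMove (reg 19) (arr 51 16),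
    .fieldOp .mul (reg 13) (arr 7 16) (arr 8 19),
    .fieldOp .sub (arr 8 18) (arr 8 18) (reg 13)])

theorem replayOps_spec (hc : HoldsConsts n m q σ) (hn : σ.word 42 0 = ops.length)
    (hl : ListAt (fun i => (σ.word 50 i, σ.word 51 i, σ.fld 7 i)) 0 ops)
    (hN : ∀ e ∈ ops, e.1 < N ∧ e.2.1 < N) (hwN : N < 2 ^ w) (hwo : ops.length < 2 ^ w) :
    WP w replayOps σ (ops.length * 6 + 2) fun τ => σ.Frame [16, 18, 19] [8, 13] τ ∧
      τ.fld 8 = applyOps ops (σ.fld 8) := by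
  have hone := hc.one
  refine WP.forRange 0 ops.length 4 (fun x τ => σ.Frame [16, 18, 19] [8, 13] τ ∧
      τ.word 16 0 = x ∧ τ.fld 8 = applyOps (ops.take x) (σ.fld 8))
    (by simp [hc.zero]) ?_ ?_ ?_ ?_
  · simp
  · rintro i τ ⟨hF, h, -⟩
    simp [h, hF.word, hn]
  · rintro x τ - hx ⟨hF, hv, h8⟩
    have h1 := hl x hx
    simp only [zero_add] at h1
    have h50 : σ.word 50 x = ops[x].1 := congrArg Prod.fst h1
    have h51 : σ.word 51 x = ops[x].2.1 := congrArg (fun p => p.2.1) h1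
    have h7 : σ.fld 7 x = ops[x].2.2 := congrArg (fun p => p.2.2) h1
    have h2 := hN _ (List.getElem_mem hx)
    refine WP.block ?_
    simp [hF.word, hF.fld, hv, hF, hone, h50, h51, h7]
    refine ⟨by omega, by omega, ?_⟩
    rw [List.take_succ_eq_append_getElem hx, applyOps_append, h8]
  · rintro τ ⟨hF, -, h⟩
    rw [List.take_length] at h
    exact ⟨hF, h⟩

/-- Set the solvability bit: the rows without a pivot are zero. -/
def checkSolvable : RamProgram :=
  block [.wordMove (.dir 7 2) (reg 12)] ;;
  forRange 16 zeroAddr (reg 14) (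
    .branch (.wordEq (arr 46 16) zeroAddr)
      (.branch (.fieldEq (arr 8 16) (reg 12)) .skip (block [.wordMove (.dir 7 2) zeroAddr]))
      .skip)

theorem checkSolvable_spec (hc : HoldsConsts n m q σ) (hN : σ.word 14 0 = N) (hwN : N + 1 < 2 ^ w) :
    WP w checkSolvable σ (N * 5 + 3) fun τ => σ.Frame [7, 16] [] τ ∧
      ((τ.word 7 2 = 1 ∧ ∀ s < N, σ.word 46 s = 0 → σ.fld 8 s = 0) ∨
        (τ.word 7 2 = 0 ∧ ∃ s < N, σ.word 46 s = 0 ∧ σ.fld 8 s ≠ 0)) := by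
  have hone := hc.one
  refine WP.block_seq (N * 5 + 2) ?_
  simp only [blockPost, Instr.post, loc_dir, getWord_reg, hone]
  refine ⟨by omega, ?_⟩
  refine WP.forRange 0 N 3 (fun x τ => σ.Frame [7, 16] [] τ ∧ τ.word 16 0 = x ∧
      ((τ.word 7 2 = 1 ∧ ∀ s < x, σ.word 46 s = 0 → σ.fld 8 s = 0) ∨
        (τ.word 7 2 = 0 ∧ ∃ s < N, σ.word 46 s = 0 ∧ σ.fld 8 s ≠ 0)))
    (by simp [hc.zero]) ?_ ?_ ?_ ?_
  · simp
  · rintro i τ ⟨hF, h, -⟩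
    simp [h, hF.word, hN]
  · rintro x τ - hx ⟨hF, hv, h⟩
    -- the invariant in the case that the bit does not change
    have keep : (σ.word 46 x = 0 → σ.fld 8 x = 0) →
        ((τ.sw 16 0 (x + 1)).word 7 2 = 1 ∧ ∀ s < x + 1, σ.word 46 s = 0 → σ.fld 8 s = 0) ∨
        ((τ.sw 16 0 (x + 1)).word 7 2 = 0 ∧ ∃ s < N, σ.word 46 s = 0 ∧ σ.fld 8 s ≠ 0) := by
      intro h0
      refine h.imp (fun ⟨h1, h2⟩ => ⟨by simpa using h1, fun s hs hs0 => ?_⟩)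
        fun ⟨h1, h2⟩ => ⟨by simpa using h1, h2⟩
      obtain rfl | hsx := eq_or_ne s x
      · exact h0 hs0
      · exact h2 s (by omega) hs0
    refine WP.branch (T := 2) (fun hb => WP.branch (T := 1) (fun hb' => ?_) fun hb' => ?_)
      fun hb => ?_
    · simp [hF.word, hF.fld, hv, hc.fzero] at hb'
      refine WP.skip ⟨hv, by simp [hF.word, hone], by simp [hF], by simp, ?_⟩
      exact keep fun _ => hb'
    · simp [hF.word, hv, hc.zero] at hb
      simp [hF.word, hF.fld, hv, hc.fzero] at hb'
      refine WP.block ?_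
      simp [hF.word, hv, hF, hone, hc.zero]
      exact ⟨x, hx, hb, hb'⟩
    · simp [hF.word, hv, hc.zero] at hb
      refine WP.skip ⟨hv, by simp [hF.word, hone], by simp [hF], by simp, ?_⟩
      exact keep fun h => absurd h hb
  · rintro τ ⟨hF, -, h⟩
    exact ⟨hF, h⟩

/-- Solve the eliminated system from the last pivot to the first. -/
def backSubstitute : RamProgram :=
  forRange 16 zeroAddr (reg 27) (
    block [
      .wordOp .sub (reg 17) (reg 27) (reg 16),
      .wordOp .sub (reg 17) (reg 17) (reg 12),
      .wordMove (reg 18) (arr 47 17),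
      .wordMove (reg 19) (arr 48 17),
      .wordOp .mul (reg 21) (reg 18) (reg 14),
      .wordMove (reg 20) (arr 33 19),
      .wordMove (reg 22) (arr 43 20),
      .wordMove (reg 23) (arr 44 20),
      .fieldMove (reg 13) (arr 8 18)] ;;
    forRange 24 (reg 22) (reg 23) (block [
      .wordMove (reg 25) (arr 45 24),
      .wordOp .add (reg 26) (reg 21) (reg 25),
      .fieldOp .mul (reg 14) (arr 6 26) (arr 9 25),
      .fieldOp .sub (reg 13) (reg 13) (reg 14)]) ;;
    block [
      .wordOp .add (reg 26) (reg 21) (reg 19),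
      .fieldOp .div (arr 9 19) (reg 13) (arr 6 26)])

theorem backSubstitute_spec
    (hc : HoldsConsts n m q σ) (hcov : IsCover N l pn nd NL) (hl : HoldsLists N nd NL σ)
    (he : HoldsElim N pn nd M' N N piv ops σ) (h9 : ∀ s < N, σ.fld 9 s = 0)
    (hw : N * N < 2 ^ w) (hwl : ∀ t < N, σ.word 44 (nd t) < 2 ^ w) (hwN : N < 2 ^ w)
    (hwnd : ∀ t < N, nd t < 2 ^ w) :
    WP w backSubstitute σ (N * (l * 6 + 15) + 2) fun τ =>
      σ.Frame [16, 17, 18, 19, 20, 21, 22, 23, 24, 25, 26] [9, 13, 14] τ ∧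
      ∀ p ∈ piv, ∑ t ∈ range N, σ.fld 6 (p.1 * N + t) * τ.fld 9 t = σ.fld 8 p.1 := by
  have hone := hc.one
  have hlen := he.elim.length_piv_le
  have h14 := hl.size
  refine WP.forRange 0 piv.length (l * 6 + 13) (fun x τ =>
    σ.Frame [16, 17, 18, 19, 20, 21, 22, 23, 24, 25, 26] [9, 13, 14] τ ∧ τ.word 16 0 = x ∧
    (∀ i (hi : i < piv.length), piv.length - x ≤ i →
      ∑ t ∈ range N, σ.fld 6 (piv[i].1 * N + t) * τ.fld 9 t = σ.fld 8 piv[i].1) ∧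
    ∀ t < N, τ.fld 9 t ≠ 0 → ∃ i, ∃ hi : i < piv.length, piv.length - x ≤ i ∧ t = piv[i].2)
    (by simp [hc.zero]) ?_ ?_ ?_ ?_ (hT := ?_)
  · refine ⟨by simp, by simp, fun i hi hi' => by omega, fun t ht h => ?_⟩
    exact absurd (h9 t ht) h
  · rintro i τ ⟨hF, h, -⟩
    simp [h, hF.word, he.npiv]
  · rintro x τ - hx ⟨hF, hv, hsum, hsupp⟩
    set i := piv.length - x - 1 with hi
    have hil : i < piv.length := by omega
    obtain ⟨h47, h48⟩ := he.piv_getElem hil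
    have hmem := List.getElem_mem hil
    have hplt := he.elim.piv_lt _ hmem
    have hpne := he.elim.piv_ne _ hmem
    have hpz := he.elim.piv_zero _ hmem
    have hsort : ∀ j (hj : j < piv.length), i < j → piv[i].2 < piv[j].2 := fun j hj hij =>
      List.pairwise_iff_getElem.1 he.elim.piv_sorted _ _ hil hj hij
    generalize hpr : piv[i].1 = r at h47 hplt hpne hpz
    generalize hpc : piv[i].2 = c at h48 hplt hpne hpz hsort
    obtain ⟨hr, -, hcN⟩ := hplt
    have hrc : r * N + c < N * N := addr_lt hr hcN
    have hr0 : r * N < N * N := lt_of_le_of_lt (Nat.le_add_right _ _) hrc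
    have hnear : ∀ t < N, σ.fld 6 (r * N + t) ≠ 0 → t ∈ NL (nd c) := fun t ht h => by
      refine hcov.near_le r hr c hcN t ht (he.elim.fill r hr c hcN hpne)
        (he.elim.fill r hr t ht h) ?_
      by_contra hlt
      exact h (hpz t (by omega))
    have hlast := hl.last c hcN
    have hlist := hl.list c hcN
    have hLl := hcov.length_le c hcN
    have hLN := hcov.lt c hcN
    have hLnd := hcov.nodup c hcN
    have hwlc := hwl c hcN
    have hwndc := hwnd c hcN
    generalize NL (nd c) = L at *
    refine WP.block_seq (l * 6 + 4) ?_
    have hi' : piv.length - x - 1 = i := rfl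
    simp [hF.word, hF.fld, hv, he.npiv, hone, hi', h47, h48, h14,
      hl.node, hlast]
    iterate 8 refine ⟨by omega, ?_⟩
    set τ₁ := ((((((((((τ.sw 17 0 (piv.length - x)).sw 17 0 i).sw 18 0 r).sw 19 0 c).sw 21 0
      (r * N)).sw 20 0 (nd c)).sw 22 0 (σ.word 43 (nd c))).sw 23 0
      (σ.word 43 (nd c) + L.length)).sf 13 0 (σ.fld 8 r))) with hτ₁
    have hF₁ : σ.Frame [16, 17, 18, 19, 20, 21, 22, 23, 24, 25, 26] [9, 13, 14] τ₁ := by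
      simp [hτ₁, hF]
    have b9 : τ₁.fld 9 = τ.fld 9 := by simp [hτ₁]
    have b16 : τ₁.word 16 0 = x := by simp [hτ₁, hv]
    have b13 : τ₁.fld 13 0 = σ.fld 8 r := by simp [hτ₁]
    have b19 : τ₁.word 19 0 = c := by simp [hτ₁]
    have b21 : τ₁.word 21 0 = r * N := by simp [hτ₁]
    have b22 : τ₁.word 22 0 = σ.word 43 (nd c) := by simp [hτ₁]
    have b23 : τ₁.word 23 0 = σ.word 43 (nd c) + L.length := by simp [hτ₁]
    clear_value τ₁
    refine WP.seq (T₁ := l * 6 + 2) 2 (WP.forList (σ.word 43 (nd c)) L 4 (fun j ρ =>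
      τ₁.Frame [24, 25, 26] [13, 14] ρ ∧ ρ.word 24 0 = σ.word 43 (nd c) + j ∧
      ρ.fld 13 0 = σ.fld 8 r - ((L.take j).map fun t => σ.fld 6 (r * N + t) * τ.fld 9 t).sum)
      (by simp [b22]) (by omega) ?_ ?_ ?_ (by have := Nat.mul_le_mul_right 6 hLl; omega) ?_)
      (by omega)
    · simp [b13]
    · rintro j ρ ⟨hG, h, -⟩
      simp [h, hG.word, b23]
    · rintro j ρ hj ⟨hG, h24, h13⟩
      have ht := hlist j hj
      have htN := hLN _ (List.getElem_mem hj)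
      have hrt : r * N + L[j] < N * N := addr_lt hr htN
      refine WP.block ?_
      simp [hG.word, hG.fld, hF₁.word, hF₁.fld, h24, h13, ht,
        b21, b9, hG, hone, add_assoc]
      refine ⟨by omega, by omega, ?_⟩
      rw [List.take_succ_eq_append_getElem (by simpa using hj), List.sum_append]
      simp [sub_sub]
    rintro σ₂ ⟨hG, -, h13⟩
    rw [List.take_length] at h13
    have hL : (L.map fun t => σ.fld 6 (r * N + t) * τ.fld 9 t).sum =
        ∑ t ∈ range N, σ.fld 6 (r * N + t) * τ.fld 9 t := by
      rw [← List.sum_toFinset _ hLnd]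
      refine Finset.sum_subset (fun t ht => by simpa using hLN t (by simpa using ht))
        fun t ht ht' => ?_
      by_cases h0 : σ.fld 6 (r * N + t) = 0
      · rw [h0, zero_mul]
      · exact absurd (hnear t (by simpa using ht) h0) (by simpa using ht')
    have h9c : τ.fld 9 c = 0 := by
      by_contra h
      obtain ⟨j, hj, hij, hcj⟩ := hsupp c hcN h
      have := hsort j hj (by omega)
      omega
    rw [hL] at h13
    refine WP.block ?_
    simp [hG.word, hG.fld, hF₁.word, hF₁.fld, b21, b19, b9, b16,
      h13, hone, hpne]
    refine ⟨by omega, hF₁.trans hG, fun j hj hij => ?_, fun t ht h => ?_⟩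
    · have hupd : ∀ (a : ℕ → F) (v : F), ∑ t ∈ range N, a t * Function.update (τ.fld 9) c v t =
          ∑ t ∈ range N, a t * τ.fld 9 t + a c * v := by
        intro a v
        have : Function.update (τ.fld 9) c v = fun t => τ.fld 9 t + if t = c then v else 0 := by
          funext t
          rw [Function.update_apply]
          split_ifs with htc
          · rw [htc, h9c, zero_add]
          · rw [add_zero]
        simp [this, mul_add, Finset.sum_add_distrib, hcN]
      rw [hupd]
      obtain rfl | hji := eq_or_ne j i
      · rw [hpr, mul_div_cancel₀ _ hpne]
        ring
      · rw [hsum j hj (by omega), he.elim.piv_zero _ (List.getElem_mem hj) c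
          (hsort j hj (by omega)), zero_mul, add_zero]
    · obtain rfl | htc := eq_or_ne t c
      · exact ⟨i, by omega, hil, hpc.symm⟩
      · rw [Function.update_of_ne htc] at h
        obtain ⟨j, hj, hij, htj⟩ := hsupp t ht h
        exact ⟨j, by omega, hj, htj⟩
  · rintro τ ⟨hF, -, h, -⟩
    refine ⟨hF, fun p hp => ?_⟩
    obtain ⟨i, hi, rfl⟩ := List.getElem_of_mem hp
    exact h i hi (by omega)
  · exact Nat.add_le_add_right (Nat.mul_le_mul_right _ (by omega)) 2

/-- Read the solution off the top columns of the split system. -/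
def writeSolution : RamProgram :=
  forRange 16 zeroAddr (.dir 0 1) (block [
    .wordOp .add (reg 18) (.dir 0 0) (reg 16),
    .wordMove (reg 18) (arr 56 18),
    .fieldMove (arr 4 16) (arr 9 18)])

theorem writeSolution_spec (hc : HoldsConsts n m q σ) (hts : ∀ j < m, σ.word 56 (n + j) < N)
    (hwN : N < 2 ^ w) (hwn : n + m < 2 ^ w) :
    WP w writeSolution σ (m * 5 + 2) fun τ => σ.Frame [16, 18] [4] τ ∧
      ∀ j < m, τ.fld 4 j = σ.fld 9 (σ.word 56 (n + j)) := by
  have hone := hc.one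
  refine WP.forRange 0 m 3 (fun x τ => σ.Frame [16, 18] [4] τ ∧ τ.word 16 0 = x ∧
      ∀ j < x, τ.fld 4 j = σ.fld 9 (σ.word 56 (n + j)))
    (by simp [hc.zero]) ?_ ?_ ?_ ?_
  · simp
  · rintro i τ ⟨hF, h, -⟩
    simp [h, hF.word, hc.cols]
  · rintro x τ - hx ⟨hF, hv, h4⟩
    have h1 := hts x hx
    refine WP.block ?_
    simp [hF.word, hF.fld, hv, hF, hone, hc.rows]
    refine ⟨by omega, by omega, fun j hj => ?_⟩
    rw [Function.update_apply]
    split_ifs with hjx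
    · rw [hjx]
    · exact h4 j (by omega)
  · rintro τ ⟨hF, -, h⟩
    exact ⟨hF, h⟩

/-- Solve the linear system with the right-hand side in field segment `1`. -/
def solveSystem : RamProgram :=
  loadRhs ;; replayOps ;; checkSolvable ;; backSubstitute ;; writeSolution

theorem solveSystem_spec {lab up : ℕ → ℕ} {E : ℕ → ℕ → F} {r : Fin n → F} (hc : HoldsConsts n m q σ)
    (hcov : IsCover N l pn nd NL) (hl : HoldsLists N nd NL σ)
    (h : IsSplit (fun i j => M i j) N lab up E)
    (he : HoldsElim N pn nd (splitEntry n lab up E) N N piv ops σ) (hol : ops.length ≤ N * l)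
    (hts : ∀ v < n + m, σ.word 56 v < N ∧ lab (σ.word 56 v) = v ∧ up (σ.word 56 v) = 0)
    (hr : ∀ i : Fin n, σ.fld 1 i = r i) (hw : N * N < 2 ^ w)
    (hwl : ∀ t < N, σ.word 44 (nd t) < 2 ^ w) (hwN : N + 1 < 2 ^ w) (hwnd : ∀ t < N, nd t < 2 ^ w)
    (hwo : N * l < 2 ^ w) (hwn : n + m < 2 ^ w) :
    WP w solveSystem σ (N * (l * 12 + 24) + (n + m) * 5 + 13) fun τ => τ.HoldsSolution M r := by
  have hops : ∀ e ∈ ops, e.1 < N ∧ e.2.1 < N := fun e he' => by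
    have := he.elim.ops_lt e he'; omega
  refine WP.seq (T₁ := N * 4 + n * 4 + 4) (N * (l * 12 + 20) + m * 5 + 9) ((loadRhs_spec (lab := lab)
    hc hl.size (fun i hi => ⟨(hts i (by omega)).1, (hts i (by omega)).2.1⟩) (by omega)
    (by omega)).post ?_) (by rw [Nat.mul_add, Nat.mul_add]; omega)
  rintro σ₁ ⟨hF₁, h9, hb, hb0⟩
  have hc₁ := hc.frame hF₁
  refine WP.seq (T₁ := ops.length * 6 + 2) (N * (l * 6 + 20) + m * 5 + 7) ((replayOps_spec hc₁
    (by rw [hF₁.word (by decide), he.nops]) (by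
      rw [hF₁.word (a := 50) (by decide), hF₁.word (a := 51) (by decide),
        hF₁.fld (a := 7) (by decide)]
      exact he.opsl) hops (by omega) (by omega)).post ?_)
    (by simp only [Nat.mul_add, ← Nat.mul_assoc]; omega)
  rintro σ₂ ⟨hG₂, h8⟩
  have hF₂ : σ.Frame [16, 18, 19] [8, 9, 13] σ₂ :=
    (hF₁.mono).trans hG₂
  have hc₂ := hc.frame hF₂
  refine WP.seq (T₁ := N * 5 + 3) (N * (l * 6 + 15) + m * 5 + 4) ((checkSolvable_spec hc₂
    (by rw [hF₂.word (by decide), hl.size]) hwN).post ?_)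
    (by simp only [Nat.mul_add, ← Nat.mul_assoc]; omega)
  rintro σ₃ ⟨hG₃, hbit⟩
  have hF₃ : σ.Frame [7, 16, 18, 19] [8, 9, 13] σ₃ :=
    (hF₂.mono).trans hG₃
  have hc₃ := hc.frame hF₃
  refine WP.seq (T₁ := N * (l * 6 + 15) + 2) (m * 5 + 2) ((backSubstitute_spec hc₃ hcov
    (hl.frame hF₃) (he.frame hF₃) (fun s hs => by
      rw [hG₃.fld (by decide), hG₂.fld (by decide), h9 s hs]) hw
    (by rw [hF₃.word (by decide)]; exact hwl) (by omega) hwnd).post ?_)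
  rintro σ₄ ⟨hG₄, hX⟩
  have hF₄ : σ.Frame [7, 16, 17, 18, 19, 20, 21, 22, 23, 24, 25, 26] [8, 9, 13, 14] σ₄ :=
    (hF₃.mono).trans hG₄
  refine (writeSolution_spec (N := N) (hc.frame hF₄) (fun j hj => by
    rw [hF₄.word (by decide)]; exact (hts (n + j) (by omega)).1) (by omega) hwn).post ?_
  rintro τ ⟨hG, h4⟩
  have h8₃ : σ₃.fld 8 = applyOps ops (σ₁.fld 8) := by rw [hG₃.fld (by decide), h8]
  have hbr : ∀ i : Fin n, σ₁.fld 8 (σ.word 56 i) = r i := fun i => by rw [hb i i.2, hr]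
  rw [hF₃.fld (by decide)] at hX
  rw [hF₂.word (by decide), h8] at hbit
  have hzero : ∀ s < N, s ∉ piv.map Prod.fst → ∀ t < N, σ.fld 6 (s * N + t) = 0 := he.elim.unused
  rcases hbit with ⟨hbit, h0⟩ | ⟨hbit, s, hs, hs46, hs8⟩
  · refine Or.inl ⟨by rw [hG.word (by decide), hG₄.word (by decide), hbit], ?_⟩
    have key := h.mulVec_eq hts (X := σ₄.fld 9) hbr hb0 ((he.elim.system_iff _ _).2 fun s hs => ?_)
    · rw [← key]
      congr 1
      ext j
      rw [h4 j j.2, hF₄.word (by decide)]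
    · by_cases hsp : s ∈ piv.map Prod.fst
      · obtain ⟨p, hp, rfl⟩ := List.mem_map.1 hsp
        rw [hX p hp, h8₃]
      · rw [h0 s hs (by rw [he.used, if_neg hsp])]
        exact Finset.sum_eq_zero fun t ht => by
          rw [hzero s hs hsp t (Finset.mem_range.1 ht), zero_mul]
  · refine Or.inr ⟨by rw [hG.word (by decide), hG₄.word (by decide), hbit], ?_⟩
    rintro ⟨x, hx⟩
    obtain ⟨X, hX⟩ := h.exists_solution hts hbr hb0 hx
    have hsp : s ∉ piv.map Prod.fst := fun h' => by
      rw [he.used, if_pos h'] at hs46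
      exact one_ne_zero hs46
    refine hs8 ?_
    rw [← (he.elim.system_iff _ _).1 hX s hs]
    exact Finset.sum_eq_zero fun t ht => by
      rw [hzero s hs hsp t (Finset.mem_range.1 ht), zero_mul]

/-! ### The input -/

theorem IsPeel.start {t : ℕ} {Q deg sum : ℕ → ℕ}
    (hdeg : ∀ x, deg x = degOf par (Ico 1 q) x) (hsum : ∀ x, sum x = sumOf par (Ico 1 q) x)
    (hQ : ∀ i < t, 0 < Q i ∧ Q i < q ∧ deg (Q i) = 1) (hinj : ∀ i < t, ∀ j < t, Q i = Q j → i = j)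
    (hex : ∀ x, 0 < x → x < q → deg x = 1 → ∃ i < t, Q i = x) : IsPeel q par 0 t Q deg sum where
  le := Nat.zero_le _
  range i hi := ⟨(hQ i hi).1, (hQ i hi).2.1⟩
  inj := hinj
  child i hi y hy0 hy hyi := by
    obtain ⟨h0, hq, h1⟩ := hQ i hi
    rw [hdeg, degOf_eq_one_iff (Finset.mem_Ico.2 ⟨h0, hq⟩)] at h1
    exact absurd hyi (h1 y (Finset.mem_Ico.2 ⟨hy0, hy⟩))
  leaf x hx0 hx h := by
    refine hex x hx0 hx ?_
    rw [hdeg, degOf_eq_one_iff (Finset.mem_Ico.2 ⟨hx0, hx⟩)]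
    intro y hy hyx
    rw [Finset.mem_Ico] at hy
    obtain ⟨j, hj, -⟩ := h y hy.1 hy.2 hyx
    omega
  deg_eq x _ _ := by simp [hdeg]
  sum_eq x _ _ := by simp [hsum]
  par_eq j hj := by omega

namespace InputLists

variable (I : InputLists n m q)

/-- The number of vertices in the bags at the nodes `< x`. -/
def start (x : ℕ) : ℕ := (((List.finRange q).take x).map fun y => (I.bags y).length).sum

/-- The vertex with the code `v` belongs to the bag at `x`. -/
def InBag (x v : ℕ) : Prop := ∃ hx : x < q, v ∈ (I.bags ⟨x, hx⟩).map vertexCode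

theorem take_succ_finRange {x : ℕ} (hx : x < q) :
    (List.finRange q).take (x + 1) = (List.finRange q).take x ++ [⟨x, hx⟩] := by
  rw [List.take_succ_eq_append_getElem (by simpa using hx)]
  simp

theorem start_succ {x : ℕ} (hx : x < q) :
    I.start (x + 1) = I.start x + (I.bags ⟨x, hx⟩).length := by
  rw [start, take_succ_finRange hx, List.map_append, List.sum_append]
  simp [start]

theorem start_zero : I.start 0 = 0 := by simp [start]

theorem bagContents_getD {x : ℕ} (hx : x < q) {i : ℕ} (hi : i < (I.bags ⟨x, hx⟩).length) :
    I.bagContents.getD (I.start x + i) 0 = vertexCode (I.bags ⟨x, hx⟩)[i] := by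
  have h1 : I.bagContents = ((List.finRange q).take x).flatMap (fun y => (I.bags y).map vertexCode) ++
      ((I.bags ⟨x, hx⟩).map vertexCode ++
        ((List.finRange q).drop (x + 1)).flatMap fun y => (I.bags y).map vertexCode) := by
    rw [bagContents]
    conv_lhs => rw [← List.take_append_drop (x + 1) (List.finRange q)]
    rw [List.flatMap_append, take_succ_finRange hx, List.flatMap_append]
    simp
  have h2 : (((List.finRange q).take x).flatMap fun y => (I.bags y).map vertexCode).length =
      I.start x := by
    rw [List.length_flatMap, start]
    simp
  rw [h1, List.getD_append_right _ _ _ _ (by omega), h2, Nat.add_sub_cancel_left,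
    List.getD_append _ _ _ _ (by simpa using hi), List.getD_eq_getElem _ _ (by simpa using hi)]
  simp

theorem vertexCode_injective : Function.Injective (vertexCode (n := n) (m := m)) := by
  rintro (i | i) (j | j) h <;> simp only [vertexCode] at h
  · exact congrArg _ (Fin.ext h)
  · omega
  · omega
  · exact congrArg _ (Fin.ext (by omega))

theorem vertexCode_lt (v : Fin n ⊕ Fin m) : vertexCode v < n + m := by
  rcases v with i | j <;> simp only [vertexCode] <;> omega

theorem exists_vertexCode {v : ℕ} (hv : v < n + m) : ∃ u : Fin n ⊕ Fin m, vertexCode u = v := by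
  by_cases h : v < n
  · exact ⟨Sum.inl ⟨v, h⟩, rfl⟩
  · exact ⟨Sum.inr ⟨v - n, by omega⟩, by simp only [vertexCode]; omega⟩

theorem InBag.lt {x v : ℕ} (h : I.InBag x v) : v < n + m := by
  obtain ⟨hx, h⟩ := h
  obtain ⟨u, -, rfl⟩ := List.mem_map.1 h
  exact vertexCode_lt u

theorem inBag_iff (hI : I.Describes M T B) (x : Fin q) (u : Fin n ⊕ Fin m) :
    I.InBag x (vertexCode u) ↔ u ∈ B x := by
  rw [← hI.mem_bags, InBag]
  simp [List.mem_map, vertexCode_injective.eq_iff, x.2]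

theorem length_bags_le (hI : I.Describes M T B) (hB : ∀ x, (B x).card ≤ k + 1) (x : Fin q) :
    (I.bags x).length ≤ min (k + 1) (n + m) := by
  have h1 : (I.bags x).toFinset = B x := by ext v; simp [hI.mem_bags]
  have h2 := List.toFinset_card_of_nodup (hI.bags_nodup x)
  rw [h1] at h2
  have h3 := Finset.card_le_univ (B x)
  rw [Fintype.card_sum, Fintype.card_fin, Fintype.card_fin] at h3
  have := hB x
  omega

/-- The non-zero entries are few: each lies in a bag. -/
theorem length_entries_le (hT : IsTreeDecomposition (matrixGraph M) T B) (hI : I.Describes M T B)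
    (hk : ∀ x, (I.bags x).length ≤ k) : I.entries.length ≤ q * (k * k) := by
  classical
  have h2 := List.toFinset_card_of_nodup hI.entries_nodup
  rw [← h2]
  have hBk : ∀ x, (B x).card ≤ k := fun x => by
    have h1 : (I.bags x).toFinset = B x := by ext v; simp [hI.mem_bags]
    rw [← h1]
    exact (List.toFinset_card_le _).trans (hk x)
  calc I.entries.toFinset.card
      = (I.entries.toFinset.image fun e => ((Sum.inl e.1, Sum.inr e.2) :
          (Fin n ⊕ Fin m) × (Fin n ⊕ Fin m))).card := by
        refine (Finset.card_image_of_injective _ fun a b h => ?_).symm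
        simpa [Prod.ext_iff] using h
    _ ≤ (Finset.univ.biUnion fun x : Fin q => B x ×ˢ B x).card := by
        refine Finset.card_le_card fun p hp => ?_
        obtain ⟨e, he, rfl⟩ := Finset.mem_image.1 hp
        have hne := (hI.mem_entries e.1 e.2).1 (List.mem_toFinset.1 he)
        obtain ⟨x, h1, h2⟩ := hT.edge_covered (Sum.inl e.1) (Sum.inr e.2) hne
        exact Finset.mem_biUnion.2 ⟨x, Finset.mem_univ _, Finset.mem_product.2 ⟨h1, h2⟩⟩
    _ ≤ ∑ x : Fin q, (B x ×ˢ B x).card := Finset.card_biUnion_le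
    _ ≤ ∑ _x : Fin q, k * k := Finset.sum_le_sum fun x _ => by
        rw [Finset.card_product]
        exact Nat.mul_le_mul (hBk x) (hBk x)
    _ = q * (k * k) := by simp

theorem length_entries_le_mul (hI : I.Describes M T B) : I.entries.length ≤ n * m := by
  have h := List.Nodup.length_le_card hI.entries_nodup
  simpa using h

theorem exists_inBag (hT : IsTreeDecomposition (matrixGraph M) T B) (hI : I.Describes M T B)
    (r : Fin n) (c : Fin m) (h : M r c ≠ 0) : ∃ x < q, I.InBag x r ∧ I.InBag x (n + c) := by
  obtain ⟨x, h1, h2⟩ := hT.edge_covered (Sum.inl r) (Sum.inr c) h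
  exact ⟨x, x.2, (I.inBag_iff hI x (Sum.inl r)).2 h1, (I.inBag_iff hI x (Sum.inr c)).2 h2⟩

theorem existsUnique_inBag (hR : IsRooting T par dep) (hT : IsTreeDecomposition (matrixGraph M) T B)
    (hI : I.Describes M T B) {v : ℕ} (hv : v < n + m) :
    ∃! x, x < q ∧ I.InBag x v ∧ (0 < x → ¬ I.InBag (par x) v) := by
  obtain ⟨u, rfl⟩ := exists_vertexCode hv
  obtain ⟨x, ⟨hx, htop⟩, huniq⟩ := hR.existsUnique_top (hT.connected u)
  refine ⟨x, ⟨x.2, (I.inBag_iff hI x u).2 hx, fun h0 hpar => ?_⟩, ?_⟩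
  · obtain ⟨hp, -⟩ := id hpar
    exact htop ⟨par x, hp⟩ ((I.inBag_iff hI ⟨par x, hp⟩ u).1 hpar) ⟨h0, rfl⟩
  · rintro y ⟨hy, hyu, hytop⟩
    have := huniq ⟨y, hy⟩ ⟨(I.inBag_iff hI ⟨y, hy⟩ u).1 hyu, fun z hz hzp => ?_⟩
    · exact congrArg Fin.val this
    · refine hytop hzp.1 ?_
      have h1 := (I.inBag_iff hI z u).2 hz
      rwa [hzp.2] at h1

/-- The bags as they are given form a layout without any edges. -/
theorem isLayout {bg lab cur : ℕ → ℕ} (par : ℕ → ℕ) (hq : 0 < q) (hI : I.Describes M T B)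
    (hk : ∀ x, (I.bags x).length ≤ k) (hbg0 : bg 0 = 0) (hbg : ∀ x ≤ q, bg (x + 1) = I.start x)
    (hlab : lab = fun i => I.bagContents.getD i 0)
    (hnd : ∀ x < q, ∀ s, I.start x ≤ s → s < I.start (x + 1) → nd s = x + 1)
    (hcur : ∀ x < q, cur x = x + 1) :
    IsLayout q k I.InBag par (fun _ => False) (q + 1) bg lab nd (fun _ => 0) (fun _ => 0)
      (fun _ => 0) (fun _ => 0) (fun _ => 0) cur (fun z => z - 1) := by
  have hbg1 : bg 1 = 0 := by rw [hbg 0 (Nat.zero_le _), start_zero]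
  have hlabel : ∀ x (hx : x < q) i (hi : i < (I.bags ⟨x, hx⟩).length),
      lab (I.start x + i) = vertexCode (I.bags ⟨x, hx⟩)[i] := fun x hx i hi => by
    rw [hlab]; exact I.bagContents_getD hx hi
  refine ⟨by omega, hbg0, hbg1, ?_, ?_, ?_, ?_, ?_, by simp, by simp, by simp, by simp, by simp,
    by simp, by simp, by simp, by simp, ?_, ?_⟩
  · rintro (_ | x) hx
    · simp [hbg0]
    · rw [hbg x (by omega), hbg (x + 1) (by omega), I.start_succ (by omega)]
      omega
  · rintro (_ | x) hx
    · simp [hbg1]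
    · rw [hbg x (by omega), hbg (x + 1) (by omega), I.start_succ (by omega)]
      exact Nat.add_le_add_left (hk _) _
  · rintro (_ | x) hx s h1 h2
    · simp only [zero_add, hbg1] at h2; omega
    · rw [hbg x (by omega)] at h1
      rw [hbg (x + 1) (by omega)] at h2
      exact hnd x (by omega) s h1 h2
  · rintro (_ | x) hx s t h1 h2 h3 h4 hst
    · simp only [zero_add, hbg1] at h2; omega
    · rw [hbg x (by omega)] at h1 h3
      rw [hbg (x + 1) (by omega), I.start_succ (by omega)] at h2 h4
      obtain ⟨i, rfl⟩ := Nat.exists_eq_add_of_le h1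
      obtain ⟨j, rfl⟩ := Nat.exists_eq_add_of_le h3
      rw [hlabel x (by omega) i (by omega), hlabel x (by omega) j (by omega)] at hst
      rw [(hI.bags_nodup _).getElem_inj_iff.1 (vertexCode_injective hst)]
  · rintro (_ | x) h0 hx v
    · omega
    · rw [hbg x (by omega), hbg (x + 1) (by omega), I.start_succ (by omega), Nat.add_sub_cancel]
      constructor
      · rintro ⟨hxq, hv⟩
        obtain ⟨u, hu, rfl⟩ := List.mem_map.1 hv
        obtain ⟨i, hi, rfl⟩ := List.getElem_of_mem hu
        exact ⟨I.start x + i, by omega, by omega, hlabel x hxq i hi⟩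
      · rintro ⟨s, h1, h2, rfl⟩
        obtain ⟨i, rfl⟩ := Nat.exists_eq_add_of_le h1
        rw [hlabel x (by omega) i (by omega)]
        exact ⟨by omega, List.mem_map.2 ⟨_, List.getElem_mem _, rfl⟩⟩
  · intro z h0 hz
    refine ⟨by omega, Or.inl ⟨rfl, ?_, id⟩⟩
    rw [hcur _ (by omega)]; omega
  · intro x hx
    simp [hcur x hx, hx]

end InputLists

/-! ### Programs: the split matrix of the input -/

/-- The numbers that occur during the computation fit into a word. -/
theorem word_bounds {S W : ℕ} (hS : n + m + q + 2 = S) (hk : k ≤ n + m) (hN : N ≤ 2 * q * k)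
    (hW : 256 * S ^ 4 ≤ W) :
    4 * S < W ∧ 2 * (q + 1) * (q + 1) < W ∧ n * m < W ∧ 2 * (q + 1) * (k + 1) < W ∧ q * k < W ∧
      N * N + 1 < W ∧ N + n + m + 1 < W ∧ 2 * q * (6 * k) < W ∧ N * (6 * k) < W ∧
      7 * (N * (2 * (6 * k) + 2)) < W := by
  have hS2 : 2 ≤ S := by omega
  have p1 : S ≤ S ^ 2 := Nat.le_self_pow (by norm_num) S
  have p2 : S ^ 2 ≤ S ^ 3 := Nat.pow_le_pow_right (by omega) (by norm_num)
  have p3 : S ^ 3 ≤ S ^ 4 := Nat.pow_le_pow_right (by omega) (by norm_num)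
  have a1 : (q + 1) * (q + 1) ≤ S ^ 2 := by rw [pow_two]; exact Nat.mul_le_mul (by omega) (by omega)
  have a2 : n * m ≤ S ^ 2 := by rw [pow_two]; exact Nat.mul_le_mul (by omega) (by omega)
  have a3 : (q + 1) * (k + 1) ≤ S ^ 2 := by rw [pow_two]; exact Nat.mul_le_mul (by omega) (by omega)
  have a4 : q * k ≤ S ^ 2 := by rw [pow_two]; exact Nat.mul_le_mul (by omega) (by omega)
  have hN' : N ≤ 2 * S ^ 2 := by rw [mul_assoc] at hN; omega
  have a5 : N * N ≤ 4 * S ^ 4 := by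
    calc N * N ≤ (2 * S ^ 2) * (2 * S ^ 2) := Nat.mul_le_mul hN' hN'
      _ = 4 * S ^ 4 := by ring
  have a6 : N * k ≤ 2 * S ^ 3 := by
    calc N * k ≤ (2 * S ^ 2) * S := Nat.mul_le_mul hN' (by omega)
      _ = 2 * S ^ 3 := by ring
  have e1 : 2 * (q + 1) * (q + 1) = 2 * ((q + 1) * (q + 1)) := by ring
  have e2 : 2 * (q + 1) * (k + 1) = 2 * ((q + 1) * (k + 1)) := by ring
  have e3 : 2 * q * (6 * k) = 12 * (q * k) := by ring
  have e4 : N * (6 * k) = 6 * (N * k) := by ring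
  have e5 : 7 * (N * (2 * (6 * k) + 2)) = 84 * (N * k) + 14 * N := by ring
  rw [e1, e2, e3, e4, e5]
  omega

/-- Read the matrix and order the tree. -/
def readInput : RamProgram := setup ;; loadMatrix ;; countNeighbours ;; findLeaves ;; peelLeaves

theorem readInput_spec (I : InputLists n m q)
    (hR : IsRooting T par dep) (hq : 0 < q) (hI : I.Describes M T B)
    (hw : 4 * (n + m + q + 2) < 2 ^ w) (hwq : 2 * (q + 1) * (q + 1) < 2 ^ w) (hwM : n * m < 2 ^ w) :
    WP w readInput (I.initialState M) (I.entries.length * 5 + q * 23 + 13) fun τ =>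
      (I.initialState M).Frame [12, 13, 16, 20, 21, 29, 30, 31, 32] [5, 10, 11] τ ∧
      HoldsConsts n m q τ ∧ (∀ (i : Fin n) (j : Fin m), τ.fld 5 (i * m + j) = M i j) ∧
      ∃ t, IsPeel q par (q - 1) t (τ.word 32) (τ.word 30) (τ.word 31) := by
  set σ := I.initialState M with hσ
  refine WP.seq (T₁ := 5) (I.entries.length * 5 + q * 23 + 8) ((setup_spec (σ := σ) (n := n) (m := m)
    (q := q) rfl rfl rfl rfl rfl (by omega)).post ?_)
  rintro σ₁ ⟨hF₁, hc₁⟩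
  refine WP.seq (T₁ := I.entries.length * 5 + 2) (q * 23 + 6) ((loadMatrix_spec M I.entries
    hI.mem_entries hc₁ (by rw [hF₁.word (by decide)]; rfl) (by rw [hF₁.word (by decide)]; rfl)
    (by rw [hF₁.word (by decide)]; rfl) (by rw [hF₁.fld (by decide)]; rfl)
    (by rw [hF₁.fld (by decide)]; rfl) hwM
    (lt_of_le_of_lt (I.length_entries_le_mul hI) hwM)).post ?_)
  rintro σ₂ ⟨hG₂, hM⟩
  have hF₂ : σ.Frame [12, 13, 16, 20] [5, 10, 11] σ₂ :=
    (hF₁.mono).trans hG₂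
  have hc₂ := hc₁.frame hG₂
  refine WP.seq (T₁ := q * 8 + 2) (q * 15 + 4) ((countNeighbours_spec hc₂
    (hR.length_edges hI.edges_nodup hI.mem_edges) (by rw [hF₂.word (by decide)]; rfl)
    (by rw [hF₂.word (by decide)]; rfl) (by rw [hF₂.word (by decide)]; rfl)
    (by rw [hF₂.word (by decide)]; rfl) hwq).post ?_)
  rintro σ₃ ⟨hG₃, hdeg, hsum, hb30, hb31⟩
  have hF₃ : σ.Frame [12, 13, 16, 20, 21, 30, 31] [5, 10, 11] σ₃ :=
    (hF₂.mono).trans hG₃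
  have hc₃ := hc₂.frame hG₃
  refine WP.seq (T₁ := q * 5 + 2) (q * 10 + 2) ((findLeaves_spec hc₃ hq
    (by rw [hF₃.word (by decide)]; rfl) (by omega)).post ?_)
  rintro σ₄ ⟨hG₄, hQ, hinj, hex, -⟩
  have hF₄ : σ.Frame [12, 13, 16, 20, 21, 29, 30, 31, 32] [5, 10, 11] σ₄ :=
    (hF₃.mono).trans hG₄
  have hc₄ := hc₃.frame hG₄
  have b30 : σ₄.word 30 = σ₃.word 30 := hG₄.word (by decide)
  have b31 : σ₄.word 31 = σ₃.word 31 := hG₄.word (by decide)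
  rw [← b30] at hdeg hb30 hQ hex
  rw [← b31] at hsum hb31
  refine (peelLeaves_spec hR hc₄ (IsPeel.start (fun x => ?_) (fun x => ?_) hQ hinj hex) hb30 hb31
    (by omega)).post ?_
  · rw [hdeg, degOf]
    exact hR.sum_edges hI.edges_nodup hI.mem_edges
      (fun a b => (if a = x then 1 else 0) + if b = x then 1 else 0) fun a b => add_comm _ _
  · rw [hsum, sumOf]
    exact hR.sum_edges hI.edges_nodup hI.mem_edges
      (fun a b => (if a = x then b else 0) + if b = x then a else 0) fun a b => add_comm _ _
  rintro τ ⟨hG, hp⟩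
  refine ⟨hF₄.trans hG, hc₄.frame hG, fun i j => ?_, _, hp⟩
  rw [hG.fld (by decide), hG₄.fld (by decide), hG₃.fld (by decide)]
  exact hM i j

/-- Copy the bags along a binary forest and join the copies to a tree. -/
def buildLayout : RamProgram := baseNodes ;; mergeNodes

theorem buildLayout_spec {t : ℕ} (I : InputLists n m q)
    (hR : IsRooting T par dep) (hq : 0 < q) (hI : I.Describes M T B)
    (hk : ∀ x, (I.bags x).length ≤ k)
    (hF : (I.initialState M).Frame [12, 13, 16, 20, 21, 29, 30, 31, 32] [5, 10, 11] σ)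
    (hc : HoldsConsts n m q σ)
    (hp : IsPeel q par (q - 1) t (σ.word 32) (σ.word 30) (σ.word 31))
    (hw : 4 * (n + m + q + 2) < 2 ^ w) (hwk : 2 * (q + 1) * (k + 1) < 2 ^ w) (hwqk : q * k < 2 ^ w) :
    WP w buildLayout σ (q * (k * (k * 4 + 12) + 26) + 7) fun τ =>
      σ.Frame [6, 14, 15, 16, 17, 18, 20, 21, 22, 23, 24, 25, 26, 33, 34, 35, 37, 38, 39, 40, 41]
        [] τ ∧
      ∃ ob, HoldsLayout q k I.InBag par (fun x => 0 < x ∧ x < q) (2 * q) ob τ ∧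
        ∀ x < q, ob (x + 1) = x := by
  have h5 : ∀ x ≤ q, σ.word 5 x = I.start x := fun x hx => by
    rw [hF.word (by decide)]
    change I.bagStarts.getD x 0 = _
    rw [InputLists.bagStarts, List.getD_eq_getElem _ _ (by simp; omega)]
    simp [InputLists.start]
  have hstart : ∀ x ≤ q, I.start x ≤ x * k := by
    intro x
    induction x with
    | zero => simp [I.start_zero]
    | succ x ih =>
      intro hx
      rw [I.start_succ (by omega), Nat.succ_mul]
      exact Nat.add_le_add (ih (by omega)) (hk _)
  refine WP.seq (T₁ := q * (k * 3 + 7) + 5) (q * (k * (k * 4 + 9) + 19) + 2) ((baseNodes_spec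
    (k := k) hc (fun x hx => ?_) (fun x hx => ?_) (by rw [hF.word (by decide)]; rfl) (fun x hx => ?_)
    (by omega)).post ?_) (le_of_eq (by ring))
  · rw [h5 x hx.le, h5 (x + 1) hx, I.start_succ hx]; omega
  · rw [h5 x hx.le, h5 (x + 1) hx, I.start_succ hx]; exact Nat.add_le_add_left (hk _) _
  · rw [h5 x hx]
    exact lt_of_le_of_lt ((hstart x hx).trans (Nat.mul_le_mul_right _ hx)) hwqk
  rintro σ₁ ⟨hG, h15, h14, h35, h35', h41, h33⟩
  have hG' := hF.mono (ws := [12, 13, 14, 15, 16, 17, 20, 21, 29, 30, 31, 32, 33, 35, 41])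
    (fs := [5, 10, 11]) (by decide) (by decide)
  have hF₁ := hG'.trans hG
  have hl : HoldsLayout q k I.InBag par (fun _ => False) (q + 1) (fun z => z - 1) σ₁ := by
    refine ⟨?_, by rw [h14, h35' q le_rfl], h15⟩
    rw [hF₁.word (a := 34) (by decide), hF₁.word (a := 37) (by decide),
      hF₁.word (a := 38) (by decide), hF₁.word (a := 39) (by decide), hF₁.word (a := 40) (by decide)]
    refine I.isLayout par hq hI hk h35 (fun x hx => by rw [h35' x hx, h5 x hx])
      (by rw [hF₁.word (by decide)]; rfl) (fun x hx s h1 h2 => h33 x hx s ?_ ?_) h41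
    · rw [h5 x hx.le]; exact h1
    · rw [h5 (x + 1) hx]; exact h2
  refine (mergeNodes_spec (t := t) hR (hc.frame hG) ?_ hq hl (fun x _ => rfl)
    (fun x hx v hv => ?_) hwk).post ?_
  · rw [hG.word (by decide), hG.word (by decide), hG.word (by decide)]; exact hp
  · have := InputLists.InBag.lt I hv
    omega
  · rintro τ ⟨hG', h⟩
    exact ⟨(hG.mono).trans hG', h⟩

/-- Set up the elimination. -/
def prepare : RamProgram := readInput ;; buildLayout ;; distribute ;; linkCopies ;; buildLists

theorem prepare_spec (I : InputLists n m q)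
    (hT : IsTreeDecomposition (matrixGraph M) T B) (hI : I.Describes M T B)
    (hk : ∀ x, (I.bags x).length ≤ k) (hkn : k ≤ n + m)
    (hw : 256 * (n + m + q + 2) ^ 4 ≤ 2 ^ w) :
    WP w prepare (I.initialState M) (q * (k * (k * 25 + 102) + 107) + 28) fun τ =>
      ∃ N lab up pn nd NL E, HoldsConsts n m q τ ∧ IsCover N (6 * k) pn nd NL ∧
        HoldsLists N nd NL τ ∧ IsSplit (fun i j => M i j) N lab up E ∧ τ.word 6 = lab ∧
        τ.word 34 = up ∧
        (∀ s < N, ∀ t < N, τ.fld 6 (s * N + t) = splitEntry n lab up E s t) ∧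
        (∀ s < N, ∀ t < N, splitEntry n lab up E s t ≠ 0 → Near pn nd s t) ∧
        τ.word 46 = (fun _ => 0) ∧ τ.word 52 = (fun _ => 0) ∧ N ≤ 2 * q * k ∧
        (∀ t < N, nd t < 2 ^ w) ∧ ∀ t < N, τ.word 44 (nd t) < 2 ^ w := by
  obtain ⟨par, dep, hR⟩ := hT.isTree.exists_isRooting
  have hq : 0 < q := by
    obtain ⟨z⟩ := hT.isTree.connected.nonempty
    exact z.pos
  obtain ⟨b1, b2, b3, b4, b5, -, -, b8, -, -⟩ := word_bounds (N := 0) rfl hkn (Nat.zero_le _) hw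
  have hent := I.length_entries_le hT hI hk
  refine WP.seq (T₁ := I.entries.length * 5 + q * 23 + 13) (q * (k * (k * 20 + 102) + 84) + 15)
    ((readInput_spec I hR hq hI b1 b2 b3).post ?_) (by nlinarith)
  rintro σ₁ ⟨hF₁, hc₁, hM, t, hp⟩
  refine WP.seq (T₁ := q * (k * (k * 4 + 12) + 26) + 7) (q * (k * (k * 16 + 90) + 58) + 8)
    ((buildLayout_spec I hR hq hI hk hF₁ hc₁ hp b1 b4 b5).post ?_) (le_of_eq (by ring))
  rintro σ₂ ⟨hG₂, ob, hl, hob⟩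
  have hF₂ : (I.initialState M).Frame [6, 12, 13, 14, 15, 16, 17, 18, 20, 21, 22, 23, 24, 25, 26, 29,
      30, 31, 32, 33, 34, 35, 37, 38, 39, 40, 41] [5, 10, 11] σ₂ :=
    (hF₁.mono).trans hG₂
  have hc₂ := hc₁.frame hG₂
  obtain ⟨hl', h14, h15⟩ := id hl
  have hN : σ₂.word 14 0 ≤ 2 * q * k := by
    rw [h14]; exact hl'.card_le.trans (Nat.mul_le_mul_right _ (by omega))
  obtain ⟨-, -, -, -, -, b6, b7, -, -, -⟩ := word_bounds (N := σ₂.word 14 0) rfl hkn hN hw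
  set N := σ₂.word 14 0 with hNd
  have hNk := Nat.mul_le_mul_right (k * 8 + 9) hN
  refine WP.seq (T₁ := N * (k * 8 + 9) + 3) (N * 12 + q * (k * 48 + 58) + 5) ((distribute_spec
    (M := fun i j => M i j) hc₂ hl (by omega) hob (fun x _ v hv => InputLists.InBag.lt I hv)
    (I.exists_inBag hT hI) (fun i j => by rw [hG₂.fld (by decide)]; exact hM i j)
    (by rw [hF₂.fld (by decide)]; rfl) (lt_of_le_of_lt (Nat.le_succ _) b6) b3 (by omega)
    (by omega)).post ?_) (by nlinarith)
  rintro σ₃ ⟨hG₃, E, hE, hdist⟩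
  have hc₃ := hc₂.frame hG₃
  have hF₃ : (I.initialState M).Frame [6, 12, 13, 14, 15, 16, 17, 18, 19, 20, 21, 22, 23, 24, 25, 26,
      29, 30, 31, 32, 33, 34, 35, 37, 38, 39, 40, 41] [5, 6, 10, 11] σ₃ :=
    (hF₂.mono).trans hG₃
  have b34 : σ₃.word 34 = σ₂.word 34 := hG₃.word (by decide)
  have b33 : σ₃.word 33 = σ₂.word 33 := hG₃.word (by decide)
  have c6 : σ₃.word 6 = σ₂.word 6 := hG₃.word (by decide)
  refine WP.seq (T₁ := N * 12 + 2) (q * (k * 48 + 58) + 3) ((linkCopies_spec (N := N) (E := E) hc₃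
    (by rw [hG₃.word (by decide)]) (fun s hs u hu => ?_) hE (lt_of_le_of_lt (Nat.le_succ _) b6)
    (by omega)).post ?_)
  · have := hl'.lt_up (by omega) (b34 ▸ hu)
    omega
  rintro σ₄ ⟨hG₄, hA⟩
  have hF₄ : (I.initialState M).Frame [6, 12, 13, 14, 15, 16, 17, 18, 19, 20, 21, 22, 23, 24, 25, 26,
      29, 30, 31, 32, 33, 34, 35, 37, 38, 39, 40, 41] [5, 6, 10, 11] σ₄ :=
    hF₃.trans hG₄
  have hG₂₄ : σ₂.Frame [16, 17, 19, 20, 21, 22, 23, 24, 25] [5, 6] σ₄ :=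
    hG₃.trans hG₄
  have hl₄ : HoldsLayout q k I.InBag par (fun x => 0 < x ∧ x < q) (2 * q) ob σ₄ := by
    unfold HoldsLayout
    rw [hG₂₄.word (a := 35) (by decide), hG₂₄.word (a := 6) (by decide),
      hG₂₄.word (a := 33) (by decide), hG₂₄.word (a := 34) (by decide),
      hG₂₄.word (a := 37) (by decide), hG₂₄.word (a := 38) (by decide),
      hG₂₄.word (a := 39) (by decide), hG₂₄.word (a := 40) (by decide),
      hG₂₄.word (a := 41) (by decide), hG₂₄.word (a := 14) (by decide),
      hG₂₄.word (a := 15) (by decide)]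
    exact hl
  have hN₄ : N = σ₄.word 35 (2 * q) := by rw [h14, hG₂₄.word (by decide)]
  refine (buildLists_spec (hc₃.frame hG₄).one hl₄ (by omega) (by omega) b8).mono
    (le_of_eq (by ring)) ?_
  rintro τ ⟨hG, hlist⟩
  have hF := (hF₄.mono (ws := [6, 12, 13, 14, 15, 16, 17, 18, 19, 20, 21, 22, 23, 24, 25, 26, 28, 29,
    30, 31, 32, 33, 34, 35, 37, 38, 39, 40, 41, 43, 44, 45]) (by decide) (List.Subset.refl _)).trans hG
  have hl₅ := hl₄.1
  have hnode : ∀ s < N, 0 < σ₄.word 33 s ∧ σ₄.word 33 s < 2 * q := fun s hs =>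
    ⟨(hl₅.exists_node (hN₄ ▸ hs)).1, (hl₅.exists_node (hN₄ ▸ hs)).2.1⟩
  have hlab : ∀ s < N, σ₄.word 6 s < n + m := fun s hs => by
    obtain ⟨g0, g1, g2, g3⟩ := hl₅.exists_node (hN₄ ▸ hs)
    exact InputLists.InBag.lt I ((hl₅.mem _ g0 g1 _).2 ⟨s, g2, g3, rfl⟩)
  refine ⟨N, σ₄.word 6, σ₄.word 34, σ₄.word 37, σ₄.word 33, _, E, (hc₃.frame hG₄).frame hG,
    hN₄ ▸ hl₅.isCover, ⟨by rw [hG.word (by decide), hG₂₄.word (by decide)],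
      hG.word (by decide), fun t ht => (hlist _ (hnode t ht).1 (hnode t ht).2).1,
      fun t ht => (hlist _ (hnode t ht).1 (hnode t ht).2).2.1⟩, ⟨hlab, fun s hs u hu => ?_,
      fun v hv => ?_, fun s hs t ht h => ?_, fun r c => ?_⟩, hG.word (by decide),
    hG.word (by decide), fun s hs t ht => ?_, fun s hs t ht h => ?_,
    by rw [hF.word (by decide)]; rfl, by rw [hF.word (by decide)]; rfl, hN,
    fun t ht => by have := (hnode t ht).2; omega,
    fun t ht => lt_of_le_of_lt (hlist _ (hnode t ht).1 (hnode t ht).2).2.2 b8⟩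
  · have := hl₅.lt_up (hN₄ ▸ hs) hu
    exact ⟨this.1, by omega, this.2.2.2.1⟩
  · rw [hN₄]
    exact hl₅.existsUnique_top (fun h => by simp at h) (fun x h0 hx => ⟨h0, hx⟩)
      (I.existsUnique_inBag hR hT hI hv)
  · rw [hG₂₄.word (by decide)]
    have := hdist.supp s hs t ht h
    exact ⟨this.1, this.2.1⟩
  · have := hdist.sum r c
    rw [zero_add] at this
    rw [hG₂₄.word (by decide)]
    exact this
  · rw [hG.fld (by decide), hA s hs t ht, hG₄.word (a := 6) (by decide),
      hG₄.word (a := 34) (by decide)]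
  · -- a non-zero entry lies inside one node, or it belongs to a link from a node to its parent
    have hlink : ∀ {s t : ℕ}, s < N → σ₄.word 34 s = t + 1 →
        σ₄.word 37 (σ₄.word 33 s) = σ₄.word 33 t := fun hs hu =>
      (hl₅.lt_up (hN₄ ▸ hs) hu).2.2.1.symm
    by_cases h1 : s = t
    · rw [h1]; exact Or.inl rfl
    by_cases h2 : σ₄.word 34 t = s + 1
    · exact Or.inr (Or.inr (hlink ht h2))
    by_cases h3 : σ₄.word 34 s = t + 1
    · exact Or.inr (Or.inl (hlink hs h3))
    simp only [splitEntry, h1, h2, h3, false_and, if_false, zero_add, sub_zero] at h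
    rw [hG₂₄.word (a := 33) (by decide)]
    exact Or.inl (hdist.supp s hs t ht h).2.2

/-! ### The algorithm -/

theorem RamState.HoldsChainFrom.congr (h7 : τ.word 7 1 = σ.word 7 1) (h8 : τ.word 8 = σ.word 8)
    (h9 : τ.word 9 = σ.word 9) (h10 : τ.word 10 = σ.word 10) (h11 : τ.word 11 = σ.word 11)
    (h3 : τ.fld 3 = σ.fld 3) {t : ℕ} {c : MatrixChain F n m} (h : σ.HoldsChainFrom c t) :
    τ.HoldsChainFrom c t := by
  induction c generalizing t with
  | nil n =>
    rw [RamState.HoldsChainFrom, h7, h8]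
    exact h
  | cons A rest ih =>
    rw [RamState.HoldsChainFrom, RamState.HoldsMatrix, h8, h9, h10, h11, h3]
    exact ⟨h.1, h.2.1, ih h.2.2⟩

/-- Compute the rank, the determinant and a generalized LU-factorization. -/
def eliminateSystem : RamProgram :=
  prepare ;; eliminateColumns ;; findTops ;; sortSlots ;; listRows ;; writeFactors ;; writeRank ;;
    writeDet

theorem eliminateSystem_spec (I : InputLists n m q)
    (hT : IsTreeDecomposition (matrixGraph M) T B) (hI : I.Describes M T B)
    (hk : ∀ x, (I.bags x).length ≤ k) (hkn : k ≤ n + m)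
    (hw : 256 * (n + m + q + 2) ^ 4 ≤ 2 ^ w) :
    WP w eliminateSystem (I.initialState M)
      (q * (k * (k * (k * 504 + 493) + 334) + 107) + (n + m) * 12 + 104) fun τ =>
      τ.HoldsElimination M ∧ ∀ r : Fin n → F,
        WP w solveSystem (τ.withRhs r) (q * (k * (k * 144 + 48)) + (n + m) * 5 + 13) fun ρ =>
          ρ.HoldsSolution M r := by
  refine WP.seq (T₁ := q * (k * (k * 25 + 102) + 107) + 28)
    (q * (k * (k * (k * 504 + 468) + 232)) + (n + m) * 12 + 76)
    ((prepare_spec I hT hI hk hkn hw).post ?_) (le_of_eq (by ring))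
  rintro σ₁ ⟨N, lab, up, pn, nd, NL, E, hc₁, hcov, hl₁, hs, h6, h34, hM, hfill, h46, h52, hN, hwnd,
    hwl⟩
  obtain ⟨b1, -, -, -, -, b6, b7, -, b9, b10⟩ := word_bounds rfl hkn hN hw
  have hw8 : 8 ≤ 2 ^ w := by
    have : 2 ^ 4 ≤ (n + m + q + 2) ^ 4 := Nat.pow_le_pow_left (by omega) 4
    omega
  have hNN : N * N < 2 ^ w := lt_of_le_of_lt (Nat.le_succ _) b6
  have htime : N * (6 * k * (6 * k * 7 + 39) + 116) ≤
      2 * q * k * (6 * k * (6 * k * 7 + 39) + 116) := Nat.mul_le_mul_right _ hN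
  have htime' : N * (6 * k * 12 + 24) ≤ 2 * q * k * (6 * k * 12 + 24) := Nat.mul_le_mul_right _ hN
  refine WP.seq (T₁ := N * (6 * k * (6 * k * 7 + 23) + 17) + 4)
    (N * (6 * k * 16 + 99) + (n + m) * 12 + 72)
    ((eliminateColumns_spec hc₁ hcov hl₁ hM hfill h46 b6 hwl (by omega) hwnd).post ?_)
    (by nlinarith only [htime])
  rintro σ₂ ⟨hG₂, piv, ops, he₂, hol⟩
  have hc₂ := hc₁.frame hG₂
  have hl₂ := hl₁.frame hG₂
  have g6 : σ₂.word 6 = lab := by rw [hG₂.word (by decide), h6]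
  have g34 : σ₂.word 34 = up := by rw [hG₂.word (by decide), h34]
  refine WP.seq (T₁ := N * 5 + 2) (N * (6 * k * 16 + 94) + (n + m) * 12 + 70)
    ((findTops_spec hc₂ hl₂.size (by rw [g6]; exact hs.lab_lt) (by rw [g6, g34]; exact hs.top)
    (by omega) (by omega)).post ?_) (by simp only [Nat.mul_add]; omega)
  rintro σ₃ ⟨hG₃, hts⟩
  rw [g6, g34] at hts
  have hc₃ := hc₂.frame hG₃
  have hl₃ := hl₂.frame hG₃
  have he₃ := he₂.frame hG₃
  have k6 : σ₃.word 6 = lab := by rw [hG₃.word (by decide), g6]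
  refine WP.seq (T₁ := N * 11 + (n + m) * 4 + 7) (N * (6 * k * 16 + 83) + (n + m) * 8 + 63)
    ((sortSlots_spec hc₃ hl₃.size (by rw [k6]; exact hs.lab_lt)
    (by rw [hG₃.word (by decide), hG₂.word (by decide), h52]) (by omega) (by omega)).post ?_)
    (by simp only [Nat.mul_add]; omega)
  rintro σ₄ ⟨hG₄, hsort⟩
  rw [k6] at hsort
  have hc₄ := hc₃.frame hG₄
  have hl₄ := hl₃.frame hG₄
  have he₄ := he₃.frame hG₄
  refine WP.seq (T₁ := N * 8 + 5) (N * (6 * k * 16 + 75) + (n + m) * 8 + 58)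
    ((listRows_spec hc₄ hl₄.size he₄ (by omega)).post ?_) (by simp only [Nat.mul_add]; omega)
  rintro σ₅ ⟨hG₅, hro, hroinj, hpiv⟩
  have hc₅ := hc₄.frame hG₅
  have hl₅ := hl₄.frame hG₅
  have he₅ := he₄.frame hG₅
  have hsort₅ : IsSorting N lab (σ₅.word 54) (σ₅.word 55) := by
    rw [hG₅.word (by decide), hG₅.word (by decide)]; exact hsort
  refine WP.seq (T₁ := N * (6 * k * 16 + 52) + 36) (N * 23 + (n + m) * 8 + 22)
    ((writeFactors_spec hc₅ hcov hl₅ he₅ hol hsort₅ hs.lab_lt hro hroinj hpiv hNN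
    (by rw [hG₅.word (by decide), hG₄.word (by decide), hG₃.word (by decide),
      hG₂.word (by decide)]; exact hwl) (by omega) hw8 (by omega) hwnd b10).post ?_)
    (by simp only [Nat.mul_add]; omega)
  rintro σ₆ ⟨hG₆, hchain⟩
  have hc₆ := hc₅.frame hG₆
  have hl₆ := hl₅.frame hG₆
  have he₆ := he₅.frame hG₆
  have hlen := he₆.elim.length_piv_le
  refine WP.seq (T₁ := 2) (N * 23 + (n + m) * 8 + 20)
    ((writeRank_spec hc₆ hl₆.size he₆.npiv (by omega)).post ?_)
  rintro σ₇ ⟨hG₇, hrank, h71⟩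
  have hc₇ := hc₆.frame hG₇
  have hl₇ := hl₆.frame hG₇
  have he₇ := he₆.frame hG₇
  have m56 : σ₇.word 56 = σ₃.word 56 := by
    rw [hG₇.word (by decide), hG₆.word (by decide), hG₅.word (by decide), hG₄.word (by decide)]
  have m44 : σ₇.word 44 = σ₁.word 44 := by
    rw [hG₇.word (by decide), hG₆.word (by decide), hG₅.word (by decide), hG₄.word (by decide),
      hG₃.word (by decide), hG₂.word (by decide)]
  rw [← m56] at hts
  refine (writeDet_spec hc₇ hl₇.size hs he₇ hts hNN (by omega) (by omega)).mono (by omega) ?_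
  rintro τ ⟨hG, hdet⟩
  refine ⟨⟨?_, hdet, _, isGeneralizedLU_luChain hs he₅.elim hsort₅.lt hsort₅.inj hsort₅.mono hro
    hroinj hpiv, hchain.congr ?_ ?_ ?_ ?_ ?_ ?_⟩, fun r => ?_⟩
  · rw [hG.word (by decide), hrank]
    exact (hs.rank_eq he₆.elim).symm
  · rw [hG.word (by decide), h71]
  · rw [hG.word (by decide), hG₇.word (by decide)]
  · rw [hG.word (by decide), hG₇.word (by decide)]
  · rw [hG.word (by decide), hG₇.word (by decide)]
  · rw [hG.word (by decide), hG₇.word (by decide)]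
  · rw [hG.fld (by decide), hG₇.fld (by decide)]
  · have hR : τ.Frame [] [1] (τ.withRhs r) := by
      refine ⟨fun _ _ => rfl, fun a ha => funext fun i => dif_neg fun h => ha ?_⟩
      rw [h.1]; simp
    have hH := (hG.mono (fs := [1, 2, 15]) (List.Subset.refl _) (by decide)).trans hR
    refine (solveSystem_spec (hc₇.frame hH) hcov (hl₇.frame hH) hs
      (he₇.frame hH) hol (by rw [hH.word (by decide)]; exact hts)
      (fun i => ?_) hNN (by rw [hH.word (by decide), m44]; exact hwl) (by omega) hwnd (by omega)
      (by omega)).time ?_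
    · simp [RamState.withRhs]
    · nlinarith only [htime']

theorem theorem3 :
    ∃ (eliminate solve : RamProgram) (c : ℕ), ∀ D : ℕ, ∃ C : ℕ,
      ∀ (F : Type u) [Field F] (n m q k w : ℕ) (M : Matrix (Fin n) (Fin m) F)
        (T : SimpleGraph (Fin q)) (B : Fin q → Finset (Fin n ⊕ Fin m)) (I : InputLists n m q),
        0 < n + m →
        1 ≤ k →
        IsTreeDecomposition (matrixGraph M) T B →
        (∀ x, (B x).card ≤ k + 1) →
        q ≤ D * (n + m) →
        I.Describes M T B →
        (n + m + q + 2) ^ c ≤ 2 ^ w →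
        ∃ (σ : RamState F) (t : ℕ),
          Runs w eliminate (I.initialState M) σ t ∧
          t ≤ C * (k ^ 3 * (n + m)) ∧
          σ.HoldsElimination M ∧
          ∀ r : Fin n → F, ∃ (τ : RamState F) (t' : ℕ),
            Runs w solve (σ.withRhs r) τ t' ∧
            t' ≤ C * (k ^ 2 * (n + m)) ∧
            τ.HoldsSolution M r := by
  refine ⟨eliminateSystem, solveSystem, 8, fun D => ⟨7000 * D + 200, ?_⟩⟩
  intro F _ n m q k w M T B I hV hk hT hB hq hI hw
  have hq0 : 0 < q := by
    obtain ⟨z⟩ := hT.isTree.connected.nonempty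
    exact z.pos
  -- a table of the split matrix has `N ^ 2` cells, where `N` is at most quadratic in the input
  have hw' : 256 * (n + m + q + 2) ^ 4 ≤ 2 ^ w := by
    have h4 : 4 ^ 4 ≤ (n + m + q + 2) ^ 4 := Nat.pow_le_pow_left (by omega) 4
    calc 256 * (n + m + q + 2) ^ 4 ≤ (n + m + q + 2) ^ 4 * (n + m + q + 2) ^ 4 :=
          Nat.mul_le_mul_right _ (by omega)
      _ = (n + m + q + 2) ^ 8 := by ring
      _ ≤ 2 ^ w := hw
  -- the size of a bag is bounded by the width and by the number of vertices
  have hlen := I.length_bags_le hI hB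
  set b := min (k + 1) (n + m) with hb
  have hb2 : b ≤ 2 * k := by omega
  have hkk : k ≤ k ^ 2 := Nat.le_self_pow (by norm_num) k
  have hkkk : k ^ 2 ≤ k ^ 3 := Nat.pow_le_pow_right hk (by norm_num)
  have hbb : b ^ 2 ≤ 4 * k ^ 2 := by
    calc b ^ 2 ≤ (2 * k) ^ 2 := Nat.pow_le_pow_left hb2 2
      _ = 4 * k ^ 2 := by ring
  have hbbb : b ^ 3 ≤ 8 * k ^ 3 := by
    calc b ^ 3 ≤ (2 * k) ^ 3 := Nat.pow_le_pow_left hb2 3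
      _ = 8 * k ^ 3 := by ring
  obtain ⟨σ, t, hrun, ht, helim, hsolve⟩ := eliminateSystem_spec I hT hI hlen (min_le_right _ _) hw'
  refine ⟨σ, t, hrun, ht.trans ?_, helim, fun r => ?_⟩
  · calc q * (b * (b * (b * 504 + 493) + 334) + 107) + (n + m) * 12 + 104
        = q * (504 * b ^ 3 + 493 * b ^ 2 + 334 * b + 107) + (n + m) * 12 + 104 := by ring
      _ ≤ D * (n + m) * (7000 * k ^ 3) + (n + m) * (200 * k ^ 3) := by
        rw [add_assoc]
        refine Nat.add_le_add (Nat.mul_le_mul hq (by omega)) ?_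
        have : (n + m) * 200 ≤ (n + m) * (200 * k ^ 3) := Nat.mul_le_mul_left _ (by omega)
        omega
      _ = (7000 * D + 200) * (k ^ 3 * (n + m)) := by ring
  · obtain ⟨τ, t', hrun', ht', hsol⟩ := hsolve r
    refine ⟨τ, t', hrun', ht'.trans ?_, hsol⟩
    calc q * (b * (b * 144 + 48)) + (n + m) * 5 + 13
        = q * (144 * b ^ 2 + 48 * b) + (n + m) * 5 + 13 := by ring
      _ ≤ D * (n + m) * (7000 * k ^ 2) + (n + m) * (200 * k ^ 2) := by
        rw [add_assoc]
        refine Nat.add_le_add (Nat.mul_le_mul hq (by omega)) ?_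
        have : (n + m) * 200 ≤ (n + m) * (200 * k ^ 2) := Nat.mul_le_mul_left _ (by omega)
        omega
      _ = (7000 * D + 200) * (k ^ 2 * (n + m)) := by ring
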